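/- **Setting.** Let $m,k\ge 0$, let $M$ be a connected smooth $m$-manifold (Hausdorff, second countable, without boundary) and $p\in M$. Put $P=\mathrm{diag}(I_m,-I_{k+1})$, $Q=\mathrm{diag}(I_{m+1},-I_k)$, $\mathbb C^*=\mathbb C\setminus\{0\}$. For $J=I_{m+k+1}$ or $J=\mathrm{diag}(I_m,-1,I_k)$ let $SO(J,\mathbb C)=\{X\in SL(m+k+1,\mathbb C): X^tJX=J\}$. Consider the group $\mathcal H$ of holomorphic loops $X:\mathbb C^*\to SO(J,\mathbb C)$ with $$X(\lambda)=P\,X(-\lambda)\,P,\qquad X(\lambda)=Q\,X(1/\lambda)\,Q,$$ and satisfying one of the reality conditions $(\rho_1)\ X(\lambda)=\overline{X(-\bar\lambda)}$, $(\rho_2)\ X(\lambda)=\overline{X(\bar\lambda)}$, $(\rho_3)\ X(\lambda)=\overline{X(1/\bar\lambda)}$: in Cases 1, 2, 3, $J=I$ and the condition is $\rho_1,\rho_2,\rho_3$ respectively; in Case 4, $J=\mathrm{diag}(I_m,-1,I_k)$ and the condition is $\rho_2$. Let $\mathcal H^0=SO(m)\times\{1\}\times SO(k)$ be the subgroup of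 constant loops $\mathrm{diag}(A,1,B)$ with $A,B$ real. A *loop group map* is a map $F:M\to\mathcal H/\mathcal H^0$ with $F(p)=[I]$ which near every point is represented by a map into $\mathcal H$, again written $F$, smooth jointly in the point and in $\lambda$, such that $F_\lambda^{-1}dF_\lambda=A_{-1}\lambda^{-1}+A_0+A_1\lambda$ for matrix-valued 1-forms $A_{-1},A_0,A_1$ independent of $\lambda$. For an invertible diagonal matrix $T$ the $(m+1)$-st column of $TF_\lambda T^{-1}$ is a well-defined map $M\to\mathbb C^{m+k+1}$. Call $F$ *immersive* if for every $\lambda\in\mathbb C^*\setminus\{\pm i\}$ the $(m+1)$-st column of $F_\lambda$ has injective differential everywhere. On $\mathbb R^{m+k+1}$ let $\langle x,x\rangle=x^t\hat Jx$ with $\hat J=\mathrm{diag}(I_m,\varepsilon,\delta I_k)$. The target spaces are $\{\langle x,x\rangle=\varepsilon\}$, of constant curvature $\varepsilon$, with $(\varepsilon,\delta)=(1,1)$ for $S^{m+k}$, $(-1,1)$ for $H^{m+k}$ (the sheet $x_{m+1}>0$), $(1,-1)$ for $S^{m+k}_k$ and $(-1,-1)$ for $H^{m+k}_k$. For each case and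 each parameter range the following table gives $T=\mathrm{diag}(aI_m,b,cI_k)$, written $(a,b,c)$, the target space $N$ and an interval $\mathcal I$. | Case | $\lambda\in i\mathbb R^*\setminus\{\pm i\}$ | $\lambda\in\mathbb R^*$ | $\lambda\in S^1\setminus\{\pm i\}$ | |---|---|---|---| | 1 | $(1,1,1)$, $S^{m+k}$, $(-\infty,0)$ | $(i,1,1)$, $H^{m+k}_k$, $[-1,0)$ | $(i,1,i)$, $H^{m+k}$, $(-\infty,-1]$ | | 2 | $(i,1,1)$, $H^{m+k}_k$, $(0,\infty)$ | $(1,1,1)$, $S^{m+k}$, $(0,1]$ | $(i,i,1)$, $S^{m+k}_k$, $[1,\infty)$ | | 3 | $(i,1,i)$, $H^{m+k}$, $(0,\infty)$ | $(i,i,1)$, $S^{m+k}_k$, $(0,1]$ | $(1,1,1)$, $S^{m+k}$, $[1,\infty)$ | | 4 | $(1,i,i)$, $S^{m+k}_k$, $(-\infty,0)$ | $(1,1,1)$, $H^{m+k}$, $[-1,0)$ | $(1,1,i)$, $H^{m+k}_k$, $(-\infty,-1]$ | Put $c_\lambda=\dfrac{4\varepsilon}{(\lambda+\lambda^{-1})^2}$.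 **Theorem.** For each of the twelve entries of the table: 1. $c_\lambda$ takes exactly the values in $\mathcal I$ as $\lambda$ runs through the parameter range. 2. If $F$ is an immersive loop group map of the given case, then for every $\lambda$ in the parameter range the $(m+1)$-st column of $TF_\lambda T^{-1}$ is real and is a smooth immersion $M\to N$ with flat normal bundle, whose induced metric is positive definite and has constant sectional curvature $c_\lambda$. 3. Conversely, let $M$ be simply connected and let $f:M\to N$ be a smooth immersion with flat normal bundle whose induced metric is positive definite and has constant sectional curvature $c\in\mathcal I$, $c\ne\varepsilon$. Then, up to an ambient isometry, $f$ belongs to the family: there are a real matrix $S$ with $S^t\hat JS=\hat J$, an immersive loop group map $F$ of the given case, and a $\lambda$ in the parameter range with $c_\lambda=c$, such that $Sf$ is the $(m+1)$-st column of $TF_\lambda T^{-1}$. -/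

import Mathlib

open scoped Manifold ContDiff

noncomputable section

namespace FerusPedit

/-! ### Block indices: `m` tangent directions, the position vector, `k` normal directions -/

/-- The index type of the `(m+k+1)`-dimensional coordinate space. -/
abbrev Idx (m k : ℕ) : Type := Fin m ⊕ (Unit ⊕ Fin k)

/-- The index of the `(m+1)`-st column. -/
def mid (m k : ℕ) : Idx m k := Sum.inr (Sum.inl ())

/-- The diagonal of `diag(a I_m, b, c I_k)`. -/
def diag3 {R : Type} (m k : ℕ) (a b c : R) : Idx m k → R :=
  Sum.elim (fun _ => a) (Sum.elim (fun _ => b) (fun _ => c))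

/-! ### The twelve situations: four cases, three ranges of the parameter -/

/-- The four cases: `SO(m+k+1, ℂ)` with one of three reality conditions, and `SO(m+k,1,ℂ)`. -/
inductive FPCase
  | one | two | three | four

/-- The parameter ranges `iℝ* \ {±i}`, `ℝ*` and `S¹ \ {±i}`. -/
inductive Axis
  | imag | real | circle

/-- The target spaces `S^{m+k}`, `H^{m+k}`, `S^{m+k}_k`, `H^{m+k}_k`. -/
inductive Target
  | sphere | hyperbolic | pseudoSphere | pseudoHyperbolic

/-- The subset of `ℂ* = ℂˣ` over which the parameter runs. -/
def Axis.range : Axis → Set ℂˣ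
  | .imag => {z | (z : ℂ).re = 0 ∧ (z : ℂ) ≠ Complex.I ∧ (z : ℂ) ≠ -Complex.I}
  | .real => {z | (z : ℂ).im = 0}
  | .circle => {z | ‖(z : ℂ)‖ = 1 ∧ (z : ℂ) ≠ Complex.I ∧ (z : ℂ) ≠ -Complex.I}

/-- The middle entry of the form `J = diag(I_m, ±1, I_k)` preserved by the complex group:
`SO(m+k+1, ℂ)` in the first three cases, `SO(m+k,1,ℂ)` in the fourth. -/
def FPCase.eps : FPCase → ℂ
  | .one => 1
  | .two => 1
  | .three => 1
  | .four => -1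

/-- The antiholomorphic involution of `ℂ*` in the reality condition
`X(λ) = conj X(-λ̄)` (`ρ₁`), `conj X(λ̄)` (`ρ₂`), `conj X(1/λ̄)` (`ρ₃`), respectively. -/
def FPCase.refl : FPCase → ℂˣ → ℂˣ
  | .one, z => -star z
  | .two, z => star z
  | .three, z => (star z)⁻¹
  | .four, z => star z

/-- The diagonal of the matrix `T` by which the loop group map is conjugated. -/
def conjDiag (m k : ℕ) : FPCase → Axis → Idx m k → ℂ
  | .one, .imag => diag3 m k 1 1 1
  | .one, .real => diag3 m k Complex.I 1 1
  | .one, .circle => diag3 m k Complex.I 1 Complex.I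
  | .two, .imag => diag3 m k Complex.I 1 1
  | .two, .real => diag3 m k 1 1 1
  | .two, .circle => diag3 m k Complex.I Complex.I 1
  | .three, .imag => diag3 m k Complex.I 1 Complex.I
  | .three, .real => diag3 m k Complex.I Complex.I 1
  | .three, .circle => diag3 m k 1 1 1
  | .four, .imag => diag3 m k 1 Complex.I Complex.I
  | .four, .real => diag3 m k 1 1 1
  | .four, .circle => diag3 m k 1 1 Complex.I

/-- The target space belonging to a case and a parameter range. -/
def target : FPCase → Axis → Target
  | .one, .imag => .sphere
  | .one, .real => .pseudoHyperbolic
  | .one, .circle => .hyperbolic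
  | .two, .imag => .pseudoHyperbolic
  | .two, .real => .sphere
  | .two, .circle => .pseudoSphere
  | .three, .imag => .hyperbolic
  | .three, .real => .pseudoSphere
  | .three, .circle => .sphere
  | .four, .imag => .pseudoSphere
  | .four, .real => .hyperbolic
  | .four, .circle => .pseudoHyperbolic

/-- The range of the induced curvature belonging to a case and a parameter range. -/
def curvRange : FPCase → Axis → Set ℝ
  | .one, .imag => Set.Iio 0
  | .one, .real => Set.Ico (-1) 0
  | .one, .circle => Set.Iic (-1)
  | .two, .imag => Set.Ioi 0
  | .two, .real => Set.Ioc 0 1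
  | .two, .circle => Set.Ici 1
  | .three, .imag => Set.Ioi 0
  | .three, .real => Set.Ioc 0 1
  | .three, .circle => Set.Ici 1
  | .four, .imag => Set.Iio 0
  | .four, .real => Set.Ico (-1) 0
  | .four, .circle => Set.Iic (-1)

/-! ### Target spaces -/

/-- The constant curvature `±1` of the target; also the middle entry of its ambient form. -/
def Target.curv : Target → ℝ
  | .sphere => 1
  | .hyperbolic => -1
  | .pseudoSphere => 1
  | .pseudoHyperbolic => -1

/-- The sign of the ambient form on the last `k` coordinates. -/
def Target.normalSign : Target → ℝ
  | .sphere => 1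
  | .hyperbolic => 1
  | .pseudoSphere => -1
  | .pseudoHyperbolic => -1

/-- The diagonal of the ambient form `Ĵ = diag(I_m, ±1, ±I_k)`. -/
def Target.signs (N : Target) (m k : ℕ) : Idx m k → ℝ := diag3 m k 1 N.curv N.normalSign

/-- The ambient pseudo-Euclidean scalar product `⟨v, w⟩ = vᵗ Ĵ w`. -/
def Target.form (N : Target) {m k : ℕ} (v w : Idx m k → ℝ) : ℝ :=
  ∑ i, N.signs m k i * v i * w i

/-- The target as a subset of the ambient space; `H^{m+k}` is the sheet containing the
`(m+1)`-st unit vector. -/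
def Target.space (N : Target) (m k : ℕ) : Set (Idx m k → ℝ) :=
  match N with
  | .sphere => {v | Target.sphere.form v v = 1}
  | .hyperbolic => {v | Target.hyperbolic.form v v = -1 ∧ 0 < v (mid m k)}
  | .pseudoSphere => {v | Target.pseudoSphere.form v v = 1}
  | .pseudoHyperbolic => {v | Target.pseudoHyperbolic.form v v = -1}

/-- The curvature `c_λ = ±4/(λ + λ⁻¹)²`, the sign being that of the target curvature. It is used
only where `λ ≠ ±i` and `(λ + λ⁻¹)²` is real. -/
def curvAt (N : Target) (z : ℂˣ) : ℝ := (N.curv * 4 / ((z : ℂ) + (z : ℂ)⁻¹) ^ 2).re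

/-! ### Loop groups -/

section Loops

section Auxiliary

theorem mdifferentiable_finset_sum {ι : Type} (s : Finset ι) (f : ι → ℂˣ → ℂ)
    (hf : ∀ i, MDifferentiable 𝓘(ℂ, ℂ) 𝓘(ℂ, ℂ) (f i)) :
    MDifferentiable 𝓘(ℂ, ℂ) 𝓘(ℂ, ℂ) (fun z => ∑ i ∈ s, f i z) := by
  classical
  induction s using Finset.induction_on with
  | empty => simpa using mdifferentiable_const
  | insert a s ha ih =>
    simp only [Finset.sum_insert ha]
    exact (hf a).add ih

theorem diag3_mul_self (m k : ℕ) {b c : ℂ} (i : Idx m k) (hb : b * b = 1) (hc : c * c = 1) :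
    diag3 m k 1 b c i * diag3 m k 1 b c i = 1 := by
  rcases i with i | i | i <;> simp [diag3, hb, hc]

variable {ι : Type} [Fintype ι] [DecidableEq ι]

theorem diagonal_mul_self {d : ι → ℂ} (hd : ∀ i, d i * d i = 1) :
    Matrix.diagonal d * Matrix.diagonal d = 1 := by
  simp [hd]

theorem diagonal_conj_mul (d : ι → ℂ) (hd : ∀ i, d i * d i = 1) {X Y X' Y' : Matrix ι ι ℂ}
    (hX : Matrix.diagonal d * X * Matrix.diagonal d = X')
    (hY : Matrix.diagonal d * Y * Matrix.diagonal d = Y') :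
    Matrix.diagonal d * (X * Y) * Matrix.diagonal d = X' * Y' := by
  have h := diagonal_mul_self hd
  rw [← hX, ← hY]
  calc Matrix.diagonal d * (X * Y) * Matrix.diagonal d
      = Matrix.diagonal d * X * 1 * Y * Matrix.diagonal d := by noncomm_ring
    _ = _ := by rw [← h]; noncomm_ring

theorem coe_mul_inv (X : Matrix.SpecialLinearGroup ι ℂ) : X.1 * (X⁻¹).1 = 1 :=
  congrArg Subtype.val (mul_inv_cancel X)

theorem eq_coe_inv (X : Matrix.SpecialLinearGroup ι ℂ) {Y : Matrix ι ι ℂ} (h : X.1 * Y = 1) :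
    Y = (X⁻¹).1 := by
  have h' : (X⁻¹).1 * X.1 = 1 := congrArg Subtype.val (inv_mul_cancel X)
  rw [← Matrix.one_mul Y, ← h', Matrix.mul_assoc, h, Matrix.mul_one]

theorem coe_inv_eq (X : Matrix.SpecialLinearGroup ι ℂ) {d : ι → ℂ} (hd : ∀ i, d i * d i = 1)
    (h : X.1.transpose * Matrix.diagonal d * X.1 = Matrix.diagonal d) :
    (X⁻¹).1 = Matrix.diagonal d * X.1.transpose * Matrix.diagonal d := by
  have h1 : (Matrix.diagonal d * X.1.transpose * Matrix.diagonal d) * X.1 = 1 := by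
    rw [Matrix.mul_assoc, Matrix.mul_assoc, ← Matrix.mul_assoc X.1.transpose, h,
      diagonal_mul_self hd]
  rw [← Matrix.one_mul (X⁻¹).1, ← h1, Matrix.mul_assoc, coe_mul_inv, Matrix.mul_one]

theorem inv_eq_of_conj (d : ι → ℂ) (hd : ∀ i, d i * d i = 1)
    {X Y : Matrix.SpecialLinearGroup ι ℂ}
    (h : Matrix.diagonal d * Y.1 * Matrix.diagonal d = X.1) :
    Matrix.diagonal d * (Y⁻¹).1 * Matrix.diagonal d = (X⁻¹).1 := by
  refine eq_coe_inv X ?_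
  rw [← diagonal_conj_mul d hd h rfl, coe_mul_inv, Matrix.mul_one, diagonal_mul_self hd]

end Auxiliary

variable (m k : ℕ)

/-- The loops `X : ℂ* → SL(m+k+1, ℂ)`, holomorphic, with values in the group that preserves
`J = diag(I_m, ±1, I_k)`, and fixed by `σ`, `μ` and the reality condition of the case. -/
def loopGroup (C : FPCase) :
    Subgroup (ℂˣ → Matrix.SpecialLinearGroup (Idx m k) ℂ) where
  carrier := {X |
    (∀ i j, MDifferentiable 𝓘(ℂ, ℂ) 𝓘(ℂ, ℂ) (fun z : ℂˣ => (X z).1 i j)) ∧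
    (∀ z, (X z).1.transpose * Matrix.diagonal (diag3 m k 1 C.eps 1) * (X z).1 =
      Matrix.diagonal (diag3 m k 1 C.eps 1)) ∧
    (∀ z, Matrix.diagonal (diag3 m k 1 (-1) (-1)) * (X (-z)).1 *
      Matrix.diagonal (diag3 m k 1 (-1) (-1)) = (X z).1) ∧
    (∀ z, Matrix.diagonal (diag3 m k 1 1 (-1)) * (X z⁻¹).1 *
      Matrix.diagonal (diag3 m k 1 1 (-1)) = (X z).1) ∧
    (∀ z, (X (C.refl z)).1.map (starRingEnd ℂ) = (X z).1)}
  mul_mem' := by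
    rintro X Y ⟨hX, hX1, hX2, hX3, hX4⟩ ⟨hY, hY1, hY2, hY3, hY4⟩
    refine ⟨fun i j => ?_, fun z => ?_, fun z => ?_, fun z => ?_, fun z => ?_⟩
    · have h := mdifferentiable_finset_sum Finset.univ
        (fun l : Idx m k => fun z : ℂˣ => (X z).1 i l * (Y z).1 l j)
        (fun l => (hX i l).mul (hY l j))
      simpa [Matrix.mul_apply] using h
    · change ((X z).1 * (Y z).1).transpose * _ * ((X z).1 * (Y z).1) = _
      rw [Matrix.transpose_mul]
      conv_rhs => rw [← hY1 z, ← hX1 z]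
      simp only [Matrix.mul_assoc]
    · exact diagonal_conj_mul _ (fun i => diag3_mul_self m k i (by norm_num) (by norm_num))
        (hX2 z) (hY2 z)
    · exact diagonal_conj_mul _ (fun i => diag3_mul_self m k i (by norm_num) (by norm_num))
        (hX3 z) (hY3 z)
    · change ((X (C.refl z)).1 * (Y (C.refl z)).1).map _ = (X z).1 * (Y z).1
      rw [Matrix.map_mul, hX4, hY4]
  one_mem' := by
    refine ⟨fun i j => mdifferentiable_const, fun z => ?_, fun z => ?_, fun z => ?_, fun z => ?_⟩
    · simp
    · have h : ∀ i, diag3 m k (1 : ℂ) (-1) (-1) i * diag3 m k (1 : ℂ) (-1) (-1) i = 1 :=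
        fun i => diag3_mul_self m k i (by norm_num) (by norm_num)
      simp [h]
    · have h : ∀ i, diag3 m k (1 : ℂ) 1 (-1) i * diag3 m k (1 : ℂ) 1 (-1) i = 1 :=
        fun i => diag3_mul_self m k i (by norm_num) (by norm_num)
      simp [h]
    · simp
  inv_mem' := by
    rintro X ⟨hX, hX1, hX2, hX3, hX4⟩
    have hC : C.eps * C.eps = 1 := by cases C <;> simp [FPCase.eps]
    have hJ := fun i => diag3_mul_self m k i hC (show (1 : ℂ) * 1 = 1 by norm_num)
    have key : ∀ z, ((X z)⁻¹).1 = Matrix.diagonal (diag3 m k 1 C.eps 1) * (X z).1.transpose *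
        Matrix.diagonal (diag3 m k 1 C.eps 1) := fun z => coe_inv_eq (X z) hJ (hX1 z)
    refine ⟨fun i j => ?_, fun z => ?_, fun z => ?_, fun z => ?_, fun z => ?_⟩
    · have h : (fun z : ℂˣ => ((X⁻¹) z).1 i j) = fun z : ℂˣ =>
          (diag3 m k 1 C.eps 1 i * diag3 m k 1 C.eps 1 j) • (X z).1 j i := by
        funext z
        rw [Pi.inv_apply, key z, Matrix.mul_diagonal, Matrix.diagonal_mul, Matrix.transpose_apply,
          smul_eq_mul]
        ring
      rw [h]
      exact (hX j i).const_smul _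
    · have h1 : (X z).1 * ((X z)⁻¹).1 = 1 := coe_mul_inv (X z)
      have h2 : ((X z)⁻¹).1.transpose * (X z).1.transpose = 1 := by
        rw [← Matrix.transpose_mul, h1, Matrix.transpose_one]
      rw [Pi.inv_apply]
      conv_lhs => rw [← hX1 z]
      rw [← Matrix.mul_assoc, ← Matrix.mul_assoc, h2, Matrix.one_mul, Matrix.mul_assoc, h1,
        Matrix.mul_one]
    · exact inv_eq_of_conj _ (fun i => diag3_mul_self m k i (by norm_num) (by norm_num)) (hX2 z)
    · exact inv_eq_of_conj _ (fun i => diag3_mul_self m k i (by norm_num) (by norm_num)) (hX3 z)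
    · refine eq_coe_inv (X z) ?_
      have h := congrArg (fun Z => Matrix.map Z (starRingEnd ℂ)) (coe_mul_inv (X (C.refl z)))
      simp only [Matrix.map_mul, hX4] at h
      simpa using h

/-- The block matrix `diag(A, 1, B)` with real entries, as a complex matrix. -/
def blockMat (A : Matrix (Fin m) (Fin m) ℝ) (B : Matrix (Fin k) (Fin k) ℝ) :
    Matrix (Idx m k) (Idx m k) ℂ :=
  (Matrix.fromBlocks A 0 0 (Matrix.fromBlocks 1 0 0 B)).map (fun x : ℝ => (x : ℂ))

theorem blockMat_mul (A A' : Matrix (Fin m) (Fin m) ℝ) (B B' : Matrix (Fin k) (Fin k) ℝ) :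
    blockMat m k (A * A') (B * B') = blockMat m k A B * blockMat m k A' B' := by
  have h : Matrix.fromBlocks (A * A') 0 0 (Matrix.fromBlocks (1 : Matrix Unit Unit ℝ) 0 0
      (B * B')) = Matrix.fromBlocks A 0 0 (Matrix.fromBlocks 1 0 0 B) *
        Matrix.fromBlocks A' 0 0 (Matrix.fromBlocks 1 0 0 B') := by
    simp [Matrix.fromBlocks_multiply]
  unfold blockMat
  rw [h]
  exact Matrix.map_mul (f := Complex.ofRealHom)

theorem blockMat_one : blockMat m k 1 1 = 1 := by
  simp [blockMat, Matrix.fromBlocks_one]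

/-- The subgroup `SO(m) × {1} × SO(k)` of constant loops. -/
def constLoops (C : FPCase) : Subgroup (loopGroup m k C) where
  carrier := {X | ∃ A ∈ Matrix.specialOrthogonalGroup (Fin m) ℝ,
    ∃ B ∈ Matrix.specialOrthogonalGroup (Fin k) ℝ, ∀ z, (X.1 z).1 = blockMat m k A B}
  mul_mem' := by
    rintro X Y ⟨A, hA, B, hB, h⟩ ⟨A', hA', B', hB', h'⟩
    refine ⟨A * A', mul_mem hA hA', B * B', mul_mem hB hB', fun z => ?_⟩
    change (X.1 z).1 * (Y.1 z).1 = _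
    rw [h z, h' z, blockMat_mul]
  one_mem' := ⟨1, one_mem _, 1, one_mem _, fun z => by
    rw [blockMat_one]
    rfl⟩
  inv_mem' := by
    rintro X ⟨A, hA, B, hB, h⟩
    refine ⟨star A, (star (⟨A, hA⟩ : Matrix.specialOrthogonalGroup (Fin m) ℝ)).2, star B,
      (star (⟨B, hB⟩ : Matrix.specialOrthogonalGroup (Fin k) ℝ)).2, fun z => ?_⟩
    refine (eq_coe_inv (X.1 z) ?_).symm
    rw [h z, ← blockMat_mul, Matrix.mem_unitaryGroup_iff.1
      (Matrix.mem_specialUnitaryGroup_iff.1 hA).1, Matrix.mem_unitaryGroup_iff.1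
      (Matrix.mem_specialUnitaryGroup_iff.1 hB).1, blockMat_one]

/-- The quotient in which loop group maps take their values; the constant loops act on the
right. -/
abbrev LoopQuot (C : FPCase) : Type := loopGroup m k C ⧸ constLoops m k C

variable {m k}

/-- The `(m+1)`-st column of `T X(λ) T⁻¹`, for the diagonal matrix `T` with entries `t`, depends
only on the class of the loop `X`. -/
def column {C : FPCase} (t : Idx m k → ℂ) (q : LoopQuot m k C) (z : ℂˣ) : Idx m k → ℂ :=
  Quotient.liftOn' q
    (fun X => fun i =>
      (Matrix.diagonal t * (X.1 z).1 * Matrix.diagonal (fun j => (t j)⁻¹)) i (mid m k))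
    (by
      intro X Y hXY
      obtain ⟨A, -, B, -, h⟩ := QuotientGroup.leftRel_apply.1 hXY
      have hY : (Y.1 z).1 = (X.1 z).1 * blockMat m k A B := by
        rw [← h z]
        change _ = ((X.1 z) * ((X.1 z)⁻¹ * (Y.1 z))).1
        rw [mul_inv_cancel_left]
      funext i
      have e : ((X.1 z).1 * blockMat m k A B) i (mid m k) = (X.1 z).1 i (mid m k) := by
        simp [Matrix.mul_apply, blockMat, mid, Matrix.map_apply]
      simp only [Matrix.mul_diagonal, Matrix.diagonal_mul, hY, e])

/-- The conjugation by `T = 1`. -/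
def noConj (m k : ℕ) : Idx m k → ℂ := diag3 m k 1 1 1

end Loops

/-! ### Loop group maps on a manifold -/

section Maps

variable {m k : ℕ} {M : Type*} [TopologicalSpace M] [ChartedSpace (EuclideanSpace ℝ (Fin m)) M]

/-- The (entrywise) derivative at `x` along `v` of the map `y ↦ F_y(λ)`. -/
def loopDeriv {C : FPCase} (F : M → loopGroup m k C) (z : ℂˣ) (x : M)
    (v : TangentSpace (𝓡 m) x) : Matrix (Idx m k) (Idx m k) ℂ :=
  Matrix.of fun i j =>
    (mfderiv (𝓡 m) 𝓘(ℝ, ℂ) (fun y => ((F y).1 z).1 i j) x v : ℂ)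

/-- `F` is, on the open set `U`, a smooth map into the loop group (jointly smooth in the point and
the parameter), of connection order `(-1, 1)`: the Maurer–Cartan form `F⁻¹ dF` is a Laurent
polynomial in `λ` with exponents `-1, 0, 1`. -/
def IsExtendedFrameOn {C : FPCase} (F : M → loopGroup m k C) (U : Set M) : Prop :=
  (∀ i j, ContMDiffOn ((𝓡 m).prod 𝓘(ℝ, ℂ)) 𝓘(ℝ, ℂ) ∞
    (fun q : M × ℂˣ => ((F q.1).1 q.2).1 i j) (U ×ˢ Set.univ)) ∧
  ∀ x ∈ U, ∃ Bm B0 Bp : TangentSpace (𝓡 m) x →ₗ[ℝ] Matrix (Idx m k) (Idx m k) ℂ,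
    ∀ (z : ℂˣ) (v : TangentSpace (𝓡 m) x),
      (((F x).1 z)⁻¹).1 * loopDeriv F z x v =
        (z : ℂ)⁻¹ • Bm v + B0 v + (z : ℂ) • Bp v

/-- Connection order `(-1, 1)` maps from `M` into the quotient of the loop group by the constant
loops, normalised to the identity at `p`: near each point such a map is represented by an
extended frame. -/
def IsLoopMap {C : FPCase} (p : M) (Φ : M → LoopQuot m k C) : Prop :=
  Φ p = QuotientGroup.mk 1 ∧
  ∀ x : M, ∃ U : Set M, IsOpen U ∧ x ∈ U ∧ ∃ F : M → loopGroup m k C,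
    (∀ y ∈ U, Φ y = QuotientGroup.mk (F y)) ∧ IsExtendedFrameOn F U

/-- The `(m+1)`-st column `f^λ : M → ℂ^{m+k+1}` of the loop group map is an immersion for all
`λ ∈ ℂ* \ {±i}`. -/
def IsImmersive {C : FPCase} (Φ : M → LoopQuot m k C) : Prop :=
  ∀ z : ℂˣ, (z : ℂ) ≠ Complex.I → (z : ℂ) ≠ -Complex.I → ∀ x : M,
    Function.Injective
      (mfderiv (𝓡 m) 𝓘(ℝ, Idx m k → ℂ) (fun y => column (noConj m k) (Φ y) z) x)

end Maps

/-! ### Riemannian geometry in coordinates -/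

section Coordinates

variable {m : ℕ}

/-- The `i`-th partial derivative. -/
def pd {W : Type*} [NormedAddCommGroup W] [NormedSpace ℝ W] (i : Fin m)
    (h : EuclideanSpace ℝ (Fin m) → W) (u : EuclideanSpace ℝ (Fin m)) : W :=
  fderiv ℝ h u (EuclideanSpace.single i 1)

/-- The Christoffel symbols `Γ^l_{ij}` of a metric `g`. -/
def christoffel (g : EuclideanSpace ℝ (Fin m) → Matrix (Fin m) (Fin m) ℝ) (l i j : Fin m)
    (u : EuclideanSpace ℝ (Fin m)) : ℝ :=
  (1 / 2) * ∑ s, (g u)⁻¹ l s *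
    (pd i (fun w => g w j s) u + pd j (fun w => g w i s) u - pd s (fun w => g w i j) u)

/-- The component `R^l` of the curvature `R(∂_i, ∂_j)∂_k = ∇_i ∇_j ∂_k - ∇_j ∇_i ∂_k`. -/
def riemann (g : EuclideanSpace ℝ (Fin m) → Matrix (Fin m) (Fin m) ℝ) (l i j k : Fin m)
    (u : EuclideanSpace ℝ (Fin m)) : ℝ :=
  pd i (christoffel g l j k) u - pd j (christoffel g l i k) u +
    ∑ s, (christoffel g l i s u * christoffel g s j k u -
      christoffel g l j s u * christoffel g s i k u)

/-- At `u` every sectional curvature of `g` equals `c`: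
`⟨R(X,Y)Y, X⟩ = c (|X|²|Y|² - ⟨X,Y⟩²)` for all vectors `X, Y`. -/
def SectionalCurvatureEq (g : EuclideanSpace ℝ (Fin m) → Matrix (Fin m) (Fin m) ℝ) (c : ℝ)
    (u : EuclideanSpace ℝ (Fin m)) : Prop :=
  ∀ X Y : Fin m → ℝ,
    (∑ i, ∑ j, ∑ k, ∑ l, ∑ s, X i * Y j * Y k * riemann g l i j k u * g u l s * X s) =
      c * ((X ⬝ᵥ (g u).mulVec X) * (Y ⬝ᵥ (g u).mulVec Y) - (X ⬝ᵥ (g u).mulVec Y) ^ 2)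

variable {k : ℕ}

/-- The metric coefficients `⟨∂_i h, ∂_j h⟩` induced by a parametrisation `h`. -/
def inducedMetric (N : Target) (h : EuclideanSpace ℝ (Fin m) → Idx m k → ℝ)
    (u : EuclideanSpace ℝ (Fin m)) : Matrix (Fin m) (Fin m) ℝ :=
  Matrix.of fun i j => N.form (pd i h u) (pd j h u)

/-- The projection of an ambient vector `v` to the normal space, in the target, of the
parametrised submanifold `h` at `h u`: remove from `v` the components along `h u` and along the
tangent space. -/
def normalProj (N : Target) (h : EuclideanSpace ℝ (Fin m) → Idx m k → ℝ)
    (u : EuclideanSpace ℝ (Fin m)) (v : Idx m k → ℝ) : Idx m k → ℝ :=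
  v - (N.curv * N.form v (h u)) • h u -
    ∑ i, ∑ j, ((inducedMetric N h u)⁻¹ i j * N.form v (pd i h u)) • pd j h u

/-- The normal connection `∇^⊥_{∂_i} ξ`. -/
def normalDeriv (N : Target) (h : EuclideanSpace ℝ (Fin m) → Idx m k → ℝ) (i : Fin m)
    (ξ : EuclideanSpace ℝ (Fin m) → Idx m k → ℝ) (u : EuclideanSpace ℝ (Fin m)) : Idx m k → ℝ :=
  normalProj N h u (pd i ξ u)

/-- Over `D` the curvature of the normal connection of `h` vanishes on all local smooth sections
of the normal bundle. -/
def NormalFlatOn (N : Target) (h : EuclideanSpace ℝ (Fin m) → Idx m k → ℝ)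
    (D : Set (EuclideanSpace ℝ (Fin m))) : Prop :=
  ∀ O ⊆ D, IsOpen O → ∀ ξ : EuclideanSpace ℝ (Fin m) → Idx m k → ℝ,
    ContDiffOn ℝ ∞ ξ O →
    (∀ u ∈ O, N.form (ξ u) (h u) = 0 ∧ ∀ i, N.form (ξ u) (pd i h u) = 0) →
    ∀ u ∈ O, ∀ i j,
      normalDeriv N h i (normalDeriv N h j ξ) u = normalDeriv N h j (normalDeriv N h i ξ) u

end Coordinates

/-! ### Immersions of constant curvature with flat normal bundle -/

section Immersions

variable {m k : ℕ} {M : Type*} [TopologicalSpace M] [ChartedSpace (EuclideanSpace ℝ (Fin m)) M]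

/-- The map `f` in the chart around `x₀`. -/
def inChart (f : M → Idx m k → ℝ) (x₀ : M) : EuclideanSpace ℝ (Fin m) → Idx m k → ℝ :=
  fun u => f ((chartAt (EuclideanSpace ℝ (Fin m)) x₀).symm u)

/-- `f` is a smooth immersion of `M` into the target, the induced metric is positive definite and
of constant sectional curvature `c`, and the normal bundle is flat. -/
structure IsFlatNormalImmersion (N : Target) (c : ℝ) (f : M → Idx m k → ℝ) : Prop where
  smooth : ContMDiff (𝓡 m) 𝓘(ℝ, Idx m k → ℝ) ∞ f
  mem : ∀ x, f x ∈ N.space m k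
  immersion : ∀ x, Function.Injective (mfderiv (𝓡 m) 𝓘(ℝ, Idx m k → ℝ) f x)
  posDef : ∀ (x : M) (v : TangentSpace (𝓡 m) x), v ≠ 0 →
    0 < N.form (mfderiv (𝓡 m) 𝓘(ℝ, Idx m k → ℝ) f x v : Idx m k → ℝ)
      (mfderiv (𝓡 m) 𝓘(ℝ, Idx m k → ℝ) f x v : Idx m k → ℝ)
  curvature : ∀ x₀ : M, ∀ u ∈ (chartAt (EuclideanSpace ℝ (Fin m)) x₀).target,
    SectionalCurvatureEq (inducedMetric N (inChart f x₀)) c u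
  flatNormal : ∀ x₀ : M,
    NormalFlatOn N (inChart f x₀) (chartAt (EuclideanSpace ℝ (Fin m)) x₀).target

end Immersions

end FerusPedit

end

/-!
An immersion into one of the targets, together with an adapted frame `S` (tangent vectors, position
vector, normal vectors), is encoded in the Maurer–Cartan form `S⁻¹ dS`, and the equations of Gauss,
Codazzi and Ricci are the blocks of its structure equation. The involutions of the loop group force
the Maurer–Cartan form of a loop group map to depend on `λ` only through scalar factors, the
`weight`s: `1` on the diagonal blocks, `λ + λ⁻¹` between the tangent directions and the position
vector, `λ⁻¹ - λ` between the tangent and the normal directions. The theorem rests on the identity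
`(λ + λ⁻¹)² - (λ⁻¹ - λ)² = 4` (`sq_sub_sq_weight`).

*From loops to immersions.* In the tangential block of the structure equation, only the products
through the position vector and those through the normal directions depend on `λ`, with the squares
of the two weights. So flatness for all `λ` says that these products cancel up to the weights, and
that the shape operators commute (`IsLoopFrame.tangent_relation`, `IsLoopFrame.normal_relation`). On
the parameter range the conjugation by `T` makes the frame real (`ofReal_realForm`), and the two
relations become the Gauss equation for the curvature `c_λ` and the Ricci equation of a flat normal
bundle (`IsLoopFrame.shapeComm_realFrame`, `IsLoopFrame.normalComm_realFrame`). In the algebraic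
form used here these equations are equivalent to constant sectional curvature and to a flat normal
bundle (`IsAdaptedFrame.sectionalCurvatureEq_of_shapeComm`,
`IsAdaptedFrame.shapeComm_of_sectionalCurvatureEq`, `IsAdaptedFrame.normalComm_eq_zero`,
`normalFlatOn_of_normalComm`). The result is `isFlatNormalImmersion_of_isLoopMap`.

*From immersions to loops.* Given an immersion of curvature `c = c_{λ₀} ≠ ε`, the weights of `λ₀` do
not vanish, and the Maurer–Cartan form of an adapted frame (`exists_adaptedFrame`) can be multiplied
by the quotients of the weights at `λ` and at `λ₀`. The same computation, read backwards, shows that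
the deformed form is flat for every `λ` (`IsDeformable.flat`). It integrates on convex sets to a
frame which is jointly smooth and holomorphic in `λ` (`exists_parallel_family`): parallel transport
along rays is the inverse of a Volterra operator, hence a smooth function of the path of
coefficients, and flatness makes it a solution in all directions. Uniqueness of parallel frames
gives the symmetries of the loop group (`IsDeformable.exists_isLoopFrame`).

Two adapted frames along the same immersion differ by a matrix in `O(m) × {1} × O(k)`, and after
this gauge transformation the two deformations differ by a constant loop on the left
(`IsDeformable.transition_const`). So the obstructions to a global construction are locally constant
cocycles, which are trivial on a simply connected manifold
(`exists_locally_constant_coboundary`). This is used twice: with values in the signs, to orient the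
tangent and the normal spaces consistently (`IsFlatNormalImmersion.exists_oriented_frames`), and
with values in the loop group, to glue the local deformations
(`IsFlatNormalImmersion.exists_isLoopMap`). The matrix `S` of the theorem is the inverse of the
adapted frame at the base point.
-/

noncomputable section

namespace FerusPedit

set_option linter.unusedSectionVars false

/-! ### Parallel transport along a path -/

section Transport

open scoped unitInterval

-- The algebra `𝔸` carries separate real and complex structures, so the real structures derived from
-- the complex one would compete with the given ones.
attribute [-instance] NormedSpace.complexToReal Module.complexToReal NormedAlgebra.complexToReal

/-- The geometric series of `x` converges as soon as some power of `x` has norm less than one. -/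
theorem isUnit_one_sub_of_norm_pow_lt_one {R : Type*} [NormedRing R] [HasSummableGeomSeries R]
    {x : R} {n : ℕ} (h : ‖x ^ n‖ < 1) : IsUnit (1 - x) := by
  have hu := isUnit_one_sub_of_norm_lt_one h
  rw [← mul_neg_geom_sum] at hu
  refine ((Commute.isUnit_mul_iff ?_).1 hu).1
  exact ((Commute.one_left _).sub_left
    (Commute.sum_right _ _ _ fun i _ => (Commute.refl x).pow_right i))

variable {𝔸 : Type*} [NormedRing 𝔸] [NormedAlgebra ℝ 𝔸] [NormedAlgebra ℂ 𝔸]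
  [IsScalarTower ℝ ℂ 𝔸] [CompleteSpace 𝔸]

/-- The continuous extension of a path on the unit interval to the real line, constant outside. -/
def extendPath {W : Type*} [TopologicalSpace W] (y : C(I, W)) (s : ℝ) : W :=
  y (Set.projIcc 0 1 zero_le_one s)

theorem continuous_extendPath {W : Type*} [TopologicalSpace W] (y : C(I, W)) :
    Continuous (extendPath y) :=
  y.continuous.comp continuous_projIcc

theorem extendPath_coe {W : Type*} [TopologicalSpace W] (y : C(I, W)) (t : I) :
    extendPath y t = y t := by
  simp [extendPath]

theorem norm_extendPath_le {W : Type*} [NormedAddCommGroup W] (y : C(I, W)) (s : ℝ) :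
    ‖extendPath y s‖ ≤ ‖y‖ := y.norm_coe_le_norm _

theorem hasDerivAt_integral_extendPath (y : C(I, 𝔸)) (s : ℝ) :
    HasDerivAt (fun u => ∫ x in (0 : ℝ)..u, extendPath y x) (extendPath y s) s :=
  intervalIntegral.integral_hasDerivAt_right ((continuous_extendPath y).intervalIntegrable _ _)
    (continuous_extendPath y).stronglyMeasurable.stronglyMeasurableAtFilter
    (continuous_extendPath y).continuousAt

variable (𝔸) in
/-- The primitive vanishing at `0`, as a bounded operator on paths. -/
def primitive : C(I, 𝔸) →L[ℂ] C(I, 𝔸) :=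
  LinearMap.mkContinuous
    { toFun := fun y => ⟨fun t => ∫ x in (0 : ℝ)..t, extendPath y x, by
        have h : Continuous fun u : ℝ => ∫ x in (0 : ℝ)..u, extendPath y x :=
          continuous_iff_continuousAt.2 fun s => (hasDerivAt_integral_extendPath y s).continuousAt
        exact h.comp continuous_subtype_val⟩
      map_add' := fun y w => by
        ext t
        exact intervalIntegral.integral_add ((continuous_extendPath y).intervalIntegrable _ _)
          ((continuous_extendPath w).intervalIntegrable _ _)
      map_smul' := fun c y => by
        ext t
        exact intervalIntegral.integral_smul c (extendPath y) } 1 (fun y => by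
    rw [ContinuousMap.norm_le _ (by positivity)]
    intro t
    refine (intervalIntegral.norm_integral_le_of_norm_le_const
      (fun x _ => norm_extendPath_le y x)).trans ?_
    have h0 : (0 : ℝ) ≤ t := t.2.1
    have h1 : (t : ℝ) ≤ 1 := t.2.2
    rw [sub_zero, abs_of_nonneg h0, one_mul]
    exact mul_le_of_le_one_right (norm_nonneg _) h1)

theorem primitive_apply (y : C(I, 𝔸)) (t : I) :
    primitive 𝔸 y t = ∫ x in (0 : ℝ)..t, extendPath y x := rfl

/-- The Volterra operator `y ↦ ∫ y ℓ`, linear in `ℓ`. -/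
def volterra : C(I, 𝔸) →L[ℂ] C(I, 𝔸) →L[ℂ] C(I, 𝔸) :=
  (ContinuousLinearMap.compL ℂ C(I, 𝔸) C(I, 𝔸) C(I, 𝔸) (primitive 𝔸)).comp
    (ContinuousLinearMap.mul ℂ C(I, 𝔸)).flip

theorem volterra_apply (l y : C(I, 𝔸)) : volterra l y = primitive 𝔸 (y * l) := rfl

/-- The iterated integrals are bounded by the terms of the exponential series. -/
theorem norm_volterra_pow_apply_le (l y : C(I, 𝔸)) (n : ℕ) (t : I) :
    ‖((volterra l) ^ n) y t‖ ≤ ‖l‖ ^ n * (t : ℝ) ^ n / n.factorial * ‖y‖ := by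
  induction n generalizing t with
  | zero => simpa using y.norm_coe_le_norm t
  | succ n ih =>
    rw [pow_succ', mul_apply_eq_comp, volterra_apply, primitive_apply]
    set w := ((volterra l) ^ n) y with hw
    have h0 : (0 : ℝ) ≤ t := t.2.1
    have hint : ∫ x in (0 : ℝ)..t, ‖l‖ ^ (n + 1) * x ^ n / n.factorial * ‖y‖ =
        ‖l‖ ^ (n + 1) * (t : ℝ) ^ (n + 1) / (n + 1).factorial * ‖y‖ := by
      have : (fun x : ℝ => ‖l‖ ^ (n + 1) * x ^ n / n.factorial * ‖y‖) =
          fun x : ℝ => (‖l‖ ^ (n + 1) / n.factorial * ‖y‖) * x ^ n := by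
        funext x; ring
      rw [this, intervalIntegral.integral_const_mul, integral_pow, Nat.factorial_succ]
      push_cast
      field_simp
      simp
    rw [← hint]
    refine intervalIntegral.norm_integral_le_of_norm_le h0 ?_
      (Continuous.intervalIntegrable (by fun_prop) _ _)
    refine Filter.Eventually.of_forall fun x hx => ?_
    have hx1 : x ∈ Set.Icc (0 : ℝ) 1 := ⟨hx.1.le, hx.2.trans t.2.2⟩
    have e : extendPath (w * l) x = w ⟨x, hx1⟩ * l ⟨x, hx1⟩ := by
      simp [extendPath, Set.projIcc_of_mem _ hx1]
    rw [e]
    refine (norm_mul_le _ _).trans ?_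
    have h2 := ih ⟨x, hx1⟩
    have h3 := l.norm_coe_le_norm ⟨x, hx1⟩
    calc ‖w ⟨x, hx1⟩‖ * ‖l ⟨x, hx1⟩‖ ≤ (‖l‖ ^ n * x ^ n / n.factorial * ‖y‖) * ‖l‖ := by
          refine mul_le_mul h2 h3 (norm_nonneg _) ((norm_nonneg _).trans h2)
      _ = _ := by ring

/-- The Volterra operator is quasi-nilpotent, so `1 - volterra l` is invertible. -/
theorem isUnit_one_sub_volterra (l : C(I, 𝔸)) : IsUnit (1 - volterra l) := by
  have hlim := FloorSemiring.tendsto_pow_div_factorial_atTop ‖l‖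
  obtain ⟨n, hn⟩ := (hlim.eventually (gt_mem_nhds (show (0 : ℝ) < 1 / 2 by norm_num))).exists
  have hnorm : ‖(volterra l) ^ n‖ < 1 := by
    refine lt_of_le_of_lt (ContinuousLinearMap.opNorm_le_bound _ (by positivity)
      (fun y => ?_)) (hn.trans (by norm_num))
    rw [ContinuousMap.norm_le _ (by positivity)]
    intro t
    refine (norm_volterra_pow_apply_le l y n t).trans ?_
    have h0 : (0 : ℝ) ≤ t := t.2.1
    have h1 : (t : ℝ) ^ n ≤ 1 := pow_le_one₀ h0 t.2.2
    gcongr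
    exact mul_le_of_le_one_right (by positivity) h1
  exact isUnit_one_sub_of_norm_pow_lt_one (R := C(I, 𝔸) →L[ℂ] C(I, 𝔸)) hnorm

theorem eq_zero_of_volterra_eq {l y : C(I, 𝔸)} (h : y = volterra l y) : y = 0 := by
  obtain ⟨u, hu⟩ := isUnit_one_sub_volterra l
  have h1 : (u : C(I, 𝔸) →L[ℂ] C(I, 𝔸)) y = 0 := by
    rw [hu, sub_apply, one_apply_eq_self, ← h, sub_self]
  have h2 := congrArg ((u⁻¹ : (C(I, 𝔸) →L[ℂ] C(I, 𝔸))ˣ) : C(I, 𝔸) →L[ℂ] C(I, 𝔸)) h1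
  rwa [← mul_apply_eq_comp, Units.inv_mul, one_apply_eq_self,
    map_zero] at h2

/-- The solution `y` of `y' = y l`, `y 0 = 1` on the unit interval. -/
def transport (l : C(I, 𝔸)) : C(I, 𝔸) := Ring.inverse (1 - volterra l) 1

/-- The integral equation of parallel transport. -/
theorem transport_eq (l : C(I, 𝔸)) : transport l = 1 + volterra l (transport l) := by
  have h := Ring.mul_inverse_cancel _ (isUnit_one_sub_volterra l)
  have h1 := congrArg (fun u : C(I, 𝔸) →L[ℂ] C(I, 𝔸) => u 1) h
  simp only [mul_apply_eq_comp, sub_apply,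
    one_apply_eq_self] at h1
  rw [← h1]
  simp [transport]

theorem transport_zero : transport (0 : C(I, 𝔸)) = 1 := by
  have h := transport_eq (0 : C(I, 𝔸))
  rw [h, map_zero]
  simp

/-- Parallel transport depends smoothly on the path `l`, because inversion in a Banach algebra is
smooth. Over `ℂ` this gives the holomorphic dependence on parameters as well. -/
theorem contDiff_transport : ContDiff ℂ ∞ (transport : C(I, 𝔸) → C(I, 𝔸)) := by
  rw [contDiff_iff_contDiffAt]
  intro l
  obtain ⟨u, hu⟩ := isUnit_one_sub_volterra l
  have h1 : ContDiffAt ℂ ∞ (Ring.inverse : (C(I, 𝔸) →L[ℂ] C(I, 𝔸)) → _) (1 - volterra l) := by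
    rw [← hu]; exact contDiffAt_ringInverse ℂ (R := C(I, 𝔸) →L[ℂ] C(I, 𝔸)) u
  have h2 : ContDiffAt ℂ ∞ (fun l : C(I, 𝔸) => 1 - volterra l) l :=
    contDiffAt_const.sub (ContinuousLinearMap.contDiff (𝕜 := ℂ) (E := C(I, 𝔸))
      (F := C(I, 𝔸) →L[ℂ] C(I, 𝔸)) volterra).contDiffAt
  exact (h1.comp l h2).clm_apply contDiffAt_const

end Transport

/-! ### Paths depending smoothly on a parameter -/

section Curry

open scoped unitInterval

universe u

variable {P W : Type u} [NormedAddCommGroup P] [NormedSpace ℝ P] [NormedAddCommGroup W]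
  [NormedSpace ℝ W]

/-- A function of a parameter and of time, as a function of the parameter with values in the
paths; the junk value `0` where the path is not continuous. -/
def curryPath (f : P × ℝ → W) (p : P) : C(I, W) :=
  ContinuousMap.mkD (fun t : I => f (p, t)) 0

theorem curryPath_apply {f : P × ℝ → W} {p : P} (hf : ∀ t : I, ContinuousAt f (p, (t : ℝ)))
    (t : I) : curryPath f p t = f (p, t) := by
  have h : Continuous fun t : I => f (p, (t : ℝ)) := continuous_iff_continuousAt.2 fun t =>
    ContinuousAt.comp (f := fun t : I => (p, (t : ℝ))) (hf t) (by fun_prop)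
  rw [curryPath, ContinuousMap.mkD_of_continuous h]
  rfl

theorem continuousOn_curryPath {f : P × ℝ → W} {U : Set P}
    (hf : ∀ p ∈ U, ∀ t : I, ContinuousAt f (p, (t : ℝ))) : ContinuousOn (curryPath f) U := by
  rw [continuousOn_iff_continuous_domRestrict]
  refine ContinuousMap.continuous_of_continuous_uncurry _ ?_
  have e : (Function.uncurry fun (x : U) (y : I) => (U.domRestrict (curryPath f) x) y) =
      fun q : U × I => f (q.1, (q.2 : ℝ)) := by
    funext q
    exact curryPath_apply (hf q.1 q.1.2) q.2
  rw [e, continuous_iff_continuousAt]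
  intro q
  exact ContinuousAt.comp (f := fun q : U × I => ((q.1 : P), (q.2 : ℝ))) (hf q.1 q.1.2 q.2)
    (by fun_prop)

variable (P W) in
/-- A path of operators as an operator with values in paths. -/
def pathFlip : C(I, P →L[ℝ] W) →L[ℝ] P →L[ℝ] C(I, W) :=
  LinearMap.mkContinuous₂ (LinearMap.mk₂ ℝ
    (fun (y : C(I, P →L[ℝ] W)) (v : P) =>
      (⟨fun t => y t v, y.continuous.clm_apply continuous_const⟩ : C(I, W)))
    (fun y w v => by ext t; rfl) (fun c y v => by ext t; rfl)
    (fun y v w => by ext t; exact (y t).map_add v w)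
    (fun c y v => by ext t; exact (y t).map_smul c v)) 1 (fun y v => by
    refine (ContinuousMap.norm_le _ (by positivity)).2 fun t => ?_
    refine ((y t).le_opNorm v).trans ?_
    rw [one_mul]
    gcongr
    exact y.norm_coe_le_norm t)

theorem pathFlip_apply (y : C(I, P →L[ℝ] W)) (v : P) (t : I) : pathFlip P W y v t = y t v := rfl

/-- The partial derivative in the parameter. -/
def paramDeriv (f : P × ℝ → W) (q : P × ℝ) : P →L[ℝ] W :=
  (fderiv ℝ f q).comp (ContinuousLinearMap.inl ℝ P ℝ)

theorem contDiffAt_paramDeriv {f : P × ℝ → W} {q : P × ℝ} (hf : ContDiffAt ℝ ∞ f q) :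
    ContDiffAt ℝ ∞ (paramDeriv f) q :=
  (hf.fderiv_right (m := ∞) (by simp)).clm_comp contDiffAt_const

theorem hasFDerivAt_paramDeriv {f : P × ℝ → W} {p : P} {t : ℝ} (hf : ContDiffAt ℝ ∞ f (p, t)) :
    HasFDerivAt (fun q => f (q, t)) (paramDeriv f (p, t)) p := by
  have h1 := (hf.differentiableAt (by simp)).hasFDerivAt
  exact HasFDerivAt.comp (f := fun q : P => (q, t)) p h1 (hasFDerivAt_prodMk_left p t)

/-- Differentiation under the sup norm: by the mean value inequality the remainder at each time is
controlled by the continuity of the partial derivative, uniformly in time. -/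
theorem hasFDerivAt_curryPath {f : P × ℝ → W} {U : Set P} (hU : IsOpen U)
    (hf : ∀ p ∈ U, ∀ t : I, ContDiffAt ℝ ∞ f (p, (t : ℝ))) {p : P} (hp : p ∈ U) :
    HasFDerivAt (curryPath f) (pathFlip P W (curryPath (paramDeriv f) p)) p := by
  have hg : ∀ p ∈ U, ∀ t : I, ContinuousAt (paramDeriv f) (p, (t : ℝ)) := fun p hp t =>
    (contDiffAt_paramDeriv (hf p hp t)).continuousAt
  have hfc : ∀ p ∈ U, ∀ t : I, ContinuousAt f (p, (t : ℝ)) := fun p hp t =>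
    (hf p hp t).continuousAt
  have hc : ContinuousAt (curryPath (paramDeriv f)) p :=
    (continuousOn_curryPath hg).continuousAt (hU.mem_nhds hp)
  rw [hasFDerivAt_iff_isLittleO, Asymptotics.isLittleO_iff]
  intro ε hε
  have h1 := Metric.continuousAt_iff.1 hc ε hε
  obtain ⟨δ, hδ, h1⟩ := h1
  obtain ⟨δ', hδ', h2⟩ := Metric.isOpen_iff.1 hU p hp
  have hball : Metric.ball p (min δ δ') ∈ nhds p := Metric.ball_mem_nhds p (lt_min hδ hδ')
  filter_upwards [hball] with q hq
  rw [ContinuousMap.norm_le _ (by positivity)]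
  intro t
  have hsub : ∀ w ∈ Metric.ball p (min δ δ'), w ∈ U := fun w hw =>
    h2 (Metric.ball_subset_ball (min_le_right _ _) hw)
  have hqU := hsub q hq
  rw [ContinuousMap.sub_apply, ContinuousMap.sub_apply, pathFlip_apply,
    curryPath_apply (hfc q hqU), curryPath_apply (hfc p hp), curryPath_apply (hg p hp)]
  refine Convex.norm_image_sub_le_of_norm_hasFDerivWithin_le' (f := fun w => f (w, (t : ℝ)))
    (f' := fun w => paramDeriv f (w, (t : ℝ))) (s := Metric.ball p (min δ δ'))
    (fun w hw => (hasFDerivAt_paramDeriv (hf w (hsub w hw) t)).hasFDerivWithinAt)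
    (fun w hw => ?_) (convex_ball _ _) (Metric.mem_ball_self (lt_min hδ hδ')) hq
  have h3 := h1 (Metric.ball_subset_ball (min_le_left _ _) hw)
  rw [dist_eq_norm] at h3
  have h4 := (ContinuousMap.norm_coe_le_norm
    (curryPath (paramDeriv f) w - curryPath (paramDeriv f) p) t).trans h3.le
  rwa [ContinuousMap.sub_apply, curryPath_apply (hg w (hsub w hw)),
    curryPath_apply (hg p hp)] at h4

theorem contDiffOn_curryPath_nat (n : ℕ) : ∀ {W : Type u} [NormedAddCommGroup W] [NormedSpace ℝ W]
    {f : P × ℝ → W} {U : Set P} (_ : IsOpen U)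
    (_ : ∀ p ∈ U, ∀ t : I, ContDiffAt ℝ ∞ f (p, (t : ℝ))), ContDiffOn ℝ n (curryPath f) U := by
  induction n with
  | zero =>
    intro W _ _ f U hU hf
    rw [Nat.cast_zero, contDiffOn_zero]
    exact continuousOn_curryPath fun p hp t => (hf p hp t).continuousAt
  | succ n ih =>
    intro W _ _ f U hU hf
    rw [Nat.cast_add, Nat.cast_one, contDiffOn_succ_iff_fderiv_of_isOpen hU]
    refine ⟨fun p hp => (hasFDerivAt_curryPath hU hf hp).differentiableAt.differentiableWithinAt,
      fun h => absurd h (by simp), ?_⟩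
    have h1 := ih hU (fun p hp t => contDiffAt_paramDeriv (hf p hp t))
    refine ((ContinuousLinearMap.contDiff (𝕜 := ℝ) (E := C(I, P →L[ℝ] W))
      (F := P →L[ℝ] C(I, W)) (pathFlip P W)).comp_contDiffOn h1).congr fun p hp => ?_
    exact (hasFDerivAt_curryPath hU hf hp).fderiv

/-- A smooth function of a parameter and of time is a smooth function of the parameter with values in
the Banach space of paths. -/
theorem contDiffOn_curryPath {f : P × ℝ → W} {U : Set P} (hU : IsOpen U)
    (hf : ∀ p ∈ U, ∀ t : I, ContDiffAt ℝ ∞ f (p, (t : ℝ))) : ContDiffOn ℝ ∞ (curryPath f) U :=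
  contDiffOn_infty.2 fun n => contDiffOn_curryPath_nat n hU hf

end Curry

/-! ### Integration of flat connection forms -/

section Frobenius

open scoped unitInterval

attribute [-instance] NormedSpace.complexToReal Module.complexToReal NormedAlgebra.complexToReal

variable {E 𝔸 : Type} [NormedAddCommGroup E] [NormedSpace ℝ E] [NormedRing 𝔸] [NormedAlgebra ℝ 𝔸]
  [NormedAlgebra ℂ 𝔸] [IsScalarTower ℝ ℂ 𝔸] [CompleteSpace 𝔸]

/-- The coefficient at time `t` of the parallel transport equation of the connection form `A`
along the segment from `u₀` to `x`. -/
def radialCoeff (A : E → E →L[ℝ] 𝔸) (u₀ : E) (q : E × ℝ) : 𝔸 :=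
  A (u₀ + q.2 • (q.1 - u₀)) (q.1 - u₀)

/-- Parallel transport of the connection form `A` along the segment from `u₀` to `x`. -/
def radialTransport (A : E → E →L[ℝ] 𝔸) (u₀ x : E) : C(I, 𝔸) :=
  transport (curryPath (radialCoeff A u₀) x)

theorem segment_mem {B : Set E} (hB : Convex ℝ B) {u₀ x : E} (h₀ : u₀ ∈ B) (hx : x ∈ B) {t : ℝ}
    (ht : t ∈ Set.Icc (0 : ℝ) 1) : u₀ + t • (x - u₀) ∈ B :=
  hB.add_smul_sub_mem h₀ hx ht

theorem contDiffAt_radialCoeff {A : E → E →L[ℝ] 𝔸} {B : Set E} (hBo : IsOpen B)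
    (hB : Convex ℝ B) {u₀ : E} (h₀ : u₀ ∈ B) (hA : ContDiffOn ℝ ∞ A B) {x : E} (hx : x ∈ B)
    (t : I) : ContDiffAt ℝ ∞ (radialCoeff A u₀) (x, (t : ℝ)) := by
  have h1 : ContDiffAt ℝ ∞ A (u₀ + (t : ℝ) • (x - u₀)) :=
    hA.contDiffAt (hBo.mem_nhds (segment_mem hB h₀ hx t.2))
  have h2 : ContDiffAt ℝ ∞ (fun q : E × ℝ => u₀ + q.2 • (q.1 - u₀)) (x, (t : ℝ)) :=
    ContDiff.contDiffAt (by fun_prop)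
  have h3 : ContDiffAt ℝ ∞ (fun q : E × ℝ => q.1 - u₀) (x, (t : ℝ)) :=
    ContDiff.contDiffAt (by fun_prop)
  exact ContDiffAt.clm_apply (ContDiffAt.comp (x, (t : ℝ)) h1 h2) h3

theorem volterra_real_apply (l y : C(I, 𝔸)) (t : I) :
    volterra l y t = ∫ s in (0 : ℝ)..t, extendPath y s * extendPath l s := rfl

/-- If the connection form `A` is flat, then its radial parallel transport `Y` solves `dY = Y A`: in
the direction `v`, both `dY` and the path `t ↦ Y t * (t • A v)` solve the linearised transport
equation, whose solution is unique. -/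
theorem hasFDerivAt_radialTransport {A : E → E →L[ℝ] 𝔸} {B : Set E} (hBo : IsOpen B)
    (hB : Convex ℝ B) {u₀ : E} (h₀ : u₀ ∈ B) (hA : ContDiffOn ℝ ∞ A B)
    (hflat : ∀ u ∈ B, ∀ v w, fderiv ℝ A u v w - fderiv ℝ A u w v + A u v * A u w -
      A u w * A u v = 0) {x : E} (hx : x ∈ B) :
    HasFDerivAt (fun x => radialTransport A u₀ x 1)
      ((ContinuousLinearMap.mul ℝ 𝔸 (radialTransport A u₀ x 1)).comp (A x)) x := by
  set f := radialCoeff A u₀ with hf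
  have hfs : ∀ p ∈ B, ∀ t : I, ContDiffAt ℝ ∞ f (p, (t : ℝ)) := fun p hp t =>
    contDiffAt_radialCoeff hBo hB h₀ hA hp t
  have hl := hasFDerivAt_curryPath hBo hfs hx
  set l := curryPath f x with hldef
  set Y := transport l with hY
  have hT : HasFDerivAt (transport : C(I, 𝔸) → C(I, 𝔸)) (fderiv ℝ transport l) l :=
    ((contDiff_transport (𝔸 := 𝔸)).restrict_scalars ℝ).contDiffAt.differentiableAt
      (by simp) |>.hasFDerivAt
  have hYd : HasFDerivAt (radialTransport A u₀) _ x := hT.comp x hl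
  set D : E →L[ℝ] C(I, 𝔸) := (fderiv ℝ transport l).comp
    (pathFlip E 𝔸 (curryPath (paramDeriv f) x)) with hD
  have hev : HasFDerivAt (fun x => radialTransport A u₀ x 1)
      ((ContinuousMap.evalCLM ℝ (1 : I)).comp D) x :=
    HasFDerivAt.comp (g := fun y : C(I, 𝔸) => y 1) x
      (ContinuousMap.evalCLM ℝ (1 : I) : C(I, 𝔸) →L[ℝ] 𝔸).hasFDerivAt hYd
  refine hev.congr_fderiv ?_
  ext v
  set dl : C(I, 𝔸) := pathFlip E 𝔸 (curryPath (paramDeriv f) x) v with hdl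
  set dY : C(I, 𝔸) := D v with hdY
  -- the variational equation
  have hvar : dY = volterra l dY + volterra dl Y := by
    have h1 : HasFDerivAt (fun x => (1 : C(I, 𝔸)) +
        primitive 𝔸 (radialTransport A u₀ x * curryPath f x)) _ x :=
      ((((primitive 𝔸).restrictScalars ℝ).hasFDerivAt (x := radialTransport A u₀ x *
        curryPath f x)).comp x (hYd.fun_mul' hl)).const_add 1
    have h2 : (fun x => (1 : C(I, 𝔸)) + primitive 𝔸 (radialTransport A u₀ x * curryPath f x)) =
        radialTransport A u₀ := by
      funext y
      exact (transport_eq _).symm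
    rw [h2] at h1
    have h3 := congrArg (fun L : E →L[ℝ] C(I, 𝔸) => L v) (hYd.unique h1)
    refine h3.trans ?_
    change primitive 𝔸 (Y * dl + dY * l) = primitive 𝔸 (dY * l) + primitive 𝔸 (Y * dl)
    rw [map_add, add_comm]
  -- the path `Q t = Y t * (t • A v)`, which ends in `Y * A v`, solves the same equation by flatness
  set c : ℝ → E := fun t => u₀ + t • (x - u₀) with hc
  have hcB : ∀ t ∈ Set.Icc (0 : ℝ) 1, c t ∈ B := fun t ht => segment_mem hB h₀ hx ht
  have hcd : ∀ t, HasDerivAt c (x - u₀) t := fun t =>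
    (((hasDerivAt_id t).smul_const (x - u₀)).const_add u₀).congr_deriv (one_smul ℝ _)
  have hAc : Continuous fun t : I => A (c t) := continuous_iff_continuousAt.2 fun t =>
    ContinuousAt.comp (f := fun t : I => c t)
      (hA.contDiffAt (hBo.mem_nhds (hcB t t.2))).continuousAt
      (((hcd t).continuousAt).comp continuous_subtype_val.continuousAt)
  set Q : C(I, 𝔸) := ⟨fun t => Y t * ((t : ℝ) • A (c t) v), Y.continuous.mul
    (continuous_subtype_val.smul (hAc.clm_apply continuous_const))⟩ with hQ
  have hlt : ∀ t : I, l t = A (c t) (x - u₀) := fun t =>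
    curryPath_apply (fun t => (hfs x hx t).continuousAt) t
  have hdlt : ∀ t : I, dl t = (t : ℝ) • fderiv ℝ A (c t) v (x - u₀) + A (c t) v := by
    intro t
    have e1 : dl t = paramDeriv f (x, (t : ℝ)) v := by
      rw [hdl, pathFlip_apply, curryPath_apply
        (fun t => (contDiffAt_paramDeriv (hfs x hx t)).continuousAt)]
    rw [e1]
    have h1 := hasFDerivAt_paramDeriv (hfs x hx t)
    have h2 : HasFDerivAt (fun q : E => A (u₀ + (t : ℝ) • (q - u₀))) ((fderiv ℝ A (c t)).comp
        ((t : ℝ) • ContinuousLinearMap.id ℝ E)) x := by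
      refine HasFDerivAt.comp (g := A) (f := fun q : E => u₀ + (t : ℝ) • (q - u₀)) x ?_ ?_
      · exact ((hA.contDiffAt (hBo.mem_nhds (hcB t t.2))).differentiableAt
          (by simp)).hasFDerivAt
      · exact HasFDerivAt.const_add u₀ (((hasFDerivAt_id x).sub_const u₀).const_smul (t : ℝ))
    have h3 := h2.clm_apply ((hasFDerivAt_id x).sub_const u₀)
    have h4 := congrArg (fun L : E →L[ℝ] 𝔸 => L v) (h1.unique h3)
    refine h4.trans ?_
    change A (c t) v + fderiv ℝ A (c t) ((t : ℝ) • v) (x - u₀) = _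
    rw [map_smul, add_comm]
    rfl
  have hvarQ : Q = volterra l Q + volterra dl Y := by
    ext t
    rw [ContinuousMap.add_apply, volterra_real_apply, volterra_real_apply,
      ← intervalIntegral.integral_add (f := fun s => extendPath Q s * extendPath l s)
        (g := fun s => extendPath Y s * extendPath dl s)
        (((continuous_extendPath _).mul (continuous_extendPath _)).intervalIntegrable _ _)
        (((continuous_extendPath _).mul (continuous_extendPath _)).intervalIntegrable _ _)]
    set Ye : ℝ → 𝔸 := fun s => 1 + ∫ r in (0 : ℝ)..s, extendPath (Y * l) r with hYe
    have hYe' : ∀ s : I, Ye s = Y s := fun s => by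
      have h := congrArg (fun y : C(I, 𝔸) => y s) (transport_eq l)
      exact h.symm
    have hYed : ∀ s, HasDerivAt Ye (extendPath (Y * l) s) s := fun s =>
      (hasDerivAt_integral_extendPath (Y * l) s).const_add 1
    set q : ℝ → 𝔸 := fun s => Ye s * (s • A (c s) v) with hq
    have hqt : Q t = q t - q 0 := by
      simp [hQ, hq, hYe']
    rw [hqt]
    symm
    refine intervalIntegral.integral_eq_sub_of_hasDerivAt (fun s hs => ?_)
      ((((continuous_extendPath _).mul (continuous_extendPath _)).add
        ((continuous_extendPath _).mul (continuous_extendPath _))).intervalIntegrable _ _)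
    rw [Set.uIcc_of_le t.2.1] at hs
    have hs1 : s ∈ Set.Icc (0 : ℝ) 1 := ⟨hs.1, hs.2.trans t.2.2⟩
    have hext : ∀ y : C(I, 𝔸), extendPath y s = y ⟨s, hs1⟩ := fun y =>
      extendPath_coe y ⟨s, hs1⟩
    have hAd : HasDerivAt (fun s => A (c s) v) (fderiv ℝ A (c s) (x - u₀) v) s := by
      have h1 : HasFDerivAt A (fderiv ℝ A (c s)) (c s) :=
        ((hA.contDiffAt (hBo.mem_nhds (hcB s hs1))).differentiableAt (by simp)).hasFDerivAt
      have h2 : HasDerivAt (fun s => A (c s)) (fderiv ℝ A (c s) (x - u₀)) s :=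
        h1.comp_hasDerivAt s (hcd s)
      exact h2.clm_apply (hasDerivAt_const s v) |>.congr_deriv (by simp)
    have hder := (hYed s).fun_mul ((hasDerivAt_id s).fun_smul hAd)
    refine hder.congr_deriv ?_
    rw [hext, hext, hext, hext, hext, hdlt, ContinuousMap.mul_apply, hlt]
    have hYs : Ye s = Y ⟨s, hs1⟩ := hYe' ⟨s, hs1⟩
    rw [hYs]
    have hfl := hflat (c s) (hcB s hs1) (x - u₀) v
    have hfl' : fderiv ℝ A (c s) (x - u₀) v = fderiv ℝ A (c s) v (x - u₀) -
        A (c s) (x - u₀) * A (c s) v + A (c s) v * A (c s) (x - u₀) := by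
      rw [← sub_eq_zero, ← hfl]; abel
    simp only [hQ, ContinuousMap.coe_mk, hfl', id_eq, smul_add, smul_sub, one_smul, mul_add,
      mul_sub, mul_smul_comm, smul_mul_assoc, mul_assoc]
    abel
  have hz : dY - Q = 0 := by
    refine eq_zero_of_volterra_eq (l := l) ?_
    rw [map_sub]
    conv_lhs => rw [hvar, hvarQ]
    abel
  have hfin : dY = Q := sub_eq_zero.1 hz
  change dY 1 = Y 1 * A x v
  rw [hfin, hQ]
  change Y 1 * ((1 : ℝ) • A (u₀ + (1 : ℝ) • (x - u₀)) v) = _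
  rw [one_smul, one_smul, add_sub_cancel]

variable {κ : Type} [Fintype κ]

/-- Integration of a family of flat connection forms `∑ j, c j z • A j` that depends on a complex
parameter `z`, on a convex open set. The path along which the form is transported depends linearly
on the coefficients, so that the solution is jointly smooth, and holomorphic in `z`. -/
theorem exists_parallel_family {B : Set E} (hBo : IsOpen B)
    (hB : Convex ℝ B) {u₀ : E} (h₀ : u₀ ∈ B) (Z : Set ℂ) (hZ : IsOpen Z)
    (c : κ → ℂ → ℂ) (hc : ∀ j, DifferentiableOn ℂ (c j) Z)
    (A : κ → E → E →L[ℝ] 𝔸) (hA : ∀ j, ContDiffOn ℝ ∞ (A j) B)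
    (hflat : ∀ z ∈ Z, ∀ u ∈ B, ∀ v w,
      ∑ j, c j z • (fderiv ℝ (A j) u v w - fderiv ℝ (A j) u w v) +
      (∑ j, c j z • A j u v) * (∑ j, c j z • A j u w) -
      (∑ j, c j z • A j u w) * (∑ j, c j z • A j u v) = 0) :
    ∃ F : E → ℂ → 𝔸,
      ContDiffOn ℝ ∞ (fun q : E × ℂ => F q.1 q.2) (B ×ˢ Z) ∧
      (∀ x ∈ B, DifferentiableOn ℂ (F x) Z) ∧
      (∀ z, F u₀ z = 1) ∧
      (∀ z ∈ Z, ∀ x ∈ B, HasFDerivAt (fun x => F x z)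
        ((ContinuousLinearMap.mul ℝ 𝔸 (F x z)).comp (∑ j, c j z • A j x)) x) := by
  set L : κ → E → C(I, 𝔸) := fun j => curryPath (radialCoeff (A j) u₀) with hL
  have hLs : ∀ j, ContDiffOn ℝ ∞ (L j) B := fun j =>
    contDiffOn_curryPath hBo fun p hp t => contDiffAt_radialCoeff hBo hB h₀ (hA j) hp t
  set F : E → ℂ → 𝔸 := fun x z => transport (∑ j, c j z • L j x) 1 with hF
  have hcA : ∀ j, ContDiffOn ℂ ∞ (c j) Z := fun j => (hc j).contDiffOn hZ
  refine ⟨F, ?_, ?_, ?_, ?_⟩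
  · have h1 : ContDiffOn ℝ ∞ (fun q : E × ℂ => ∑ j, c j q.2 • L j q.1) (B ×ˢ Z) := by
      refine ContDiffOn.sum fun j _ => ?_
      have h2 : ContDiffOn ℝ ∞ (fun q : E × ℂ => c j q.2) (B ×ˢ Z) :=
        ((hcA j).restrict_scalars ℝ).comp contDiff_snd.contDiffOn fun q hq => hq.2
      have h3 : ContDiffOn ℝ ∞ (fun q : E × ℂ => L j q.1) (B ×ˢ Z) :=
        (hLs j).comp contDiff_fst.contDiffOn fun q hq => hq.1
      exact h2.smul h3
    have h4 : ContDiffOn ℝ ∞ (fun q : E × ℂ => transport (∑ j, c j q.2 • L j q.1)) (B ×ˢ Z) :=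
      ((contDiff_transport (𝔸 := 𝔸)).restrict_scalars ℝ).comp_contDiffOn h1
    exact (ContinuousLinearMap.contDiff (𝕜 := ℝ)
      (ContinuousMap.evalCLM ℝ (1 : I) : C(I, 𝔸) →L[ℝ] 𝔸)).comp_contDiffOn h4
  · intro x _
    have h1 : DifferentiableOn ℂ (fun z => ∑ j, c j z • L j x) Z :=
      DifferentiableOn.fun_sum fun j _ => (hc j).smul_const (L j x)
    have h4 : DifferentiableOn ℂ (fun z => transport (∑ j, c j z • L j x)) Z :=
      ((contDiff_transport (𝔸 := 𝔸)).differentiable (by simp)).comp_differentiableOn h1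
    exact (ContinuousMap.evalCLM ℂ (1 : I) : C(I, 𝔸) →L[ℂ] 𝔸).differentiable.comp_differentiableOn
      h4
  · intro z
    have h1 : ∀ j, L j u₀ = 0 := fun j => by
      have h : (fun t : I => radialCoeff (A j) u₀ (u₀, (t : ℝ))) = fun _ => 0 := by
        funext t; simp [radialCoeff]
      rw [hL]
      simp only [curryPath, h]
      rw [ContinuousMap.mkD_of_continuous continuous_const]
      rfl
    have h2 : ∑ j, c j z • L j u₀ = 0 :=
      Finset.sum_eq_zero fun j _ => by rw [h1]; exact ContinuousMap.ext fun t =>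
        (smul_zero (c j z) : c j z • (0 : 𝔸) = 0)
    simp only [hF, h2, transport_zero, ContinuousMap.one_apply]
  · intro z hz x hx
    set Az : E → E →L[ℝ] 𝔸 := fun u => ∑ j, c j z • A j u with hAz
    have hAzs : ContDiffOn ℝ ∞ Az B := ContDiffOn.sum fun j _ => (hA j).const_smul (c j z)
    have hder : ∀ u ∈ B, fderiv ℝ Az u = ∑ j, c j z • fderiv ℝ (A j) u := fun u hu => by
      refine HasFDerivAt.fderiv (HasFDerivAt.fun_sum fun j _ => ?_)
      refine HasFDerivAt.fun_const_smul (F := E →L[ℝ] 𝔸) (f := A j) (f' := fderiv ℝ (A j) u) ?_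
        (c j z)
      exact (((hA j).contDiffAt (hBo.mem_nhds hu)).differentiableAt (by simp)).hasFDerivAt
    have hfl : ∀ u ∈ B, ∀ v w, fderiv ℝ Az u v w - fderiv ℝ Az u w v + Az u v * Az u w -
        Az u w * Az u v = 0 := fun u hu v w => by
      have h := hflat z hz u hu v w
      rw [hder u hu]
      simp only [hAz, sum_apply, smul_apply]
      rw [← h]
      simp only [smul_sub, Finset.sum_sub_distrib]
    have hmain := hasFDerivAt_radialTransport hBo hB h₀ hAzs hfl hx
    have e : ∀ y ∈ B, radialTransport Az u₀ y 1 = F y z := fun y hy => by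
      have h : curryPath (radialCoeff Az u₀) y = ∑ j, c j z • L j y := by
        ext t
        rw [curryPath_apply fun t => (contDiffAt_radialCoeff hBo hB h₀ hAzs hy t).continuousAt,
          ContinuousMap.sum_apply]
        simp only [ContinuousMap.smul_apply, hL]
        simp only [radialCoeff, hAz, sum_apply,
          smul_apply]
        refine Finset.sum_congr rfl fun j _ => ?_
        rw [curryPath_apply
          fun t => (contDiffAt_radialCoeff hBo hB h₀ (hA j) hy t).continuousAt]
        rfl
      simp only [radialTransport, hF, h]
    have he : (fun x => F x z) =ᶠ[nhds x] fun x => radialTransport Az u₀ x 1 := by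
      filter_upwards [hBo.mem_nhds hx] with y hy using (e y hy).symm
    rw [e x hx] at hmain
    exact hmain.congr_of_eventuallyEq he

end Frobenius

/-! ### Locally constant cocycles -/

section Cocycle

variable {X : Type*} [TopologicalSpace X] [SimplyConnectedSpace X] [LocallyPathConnectedSpace X]
  {J Γ : Type*} [Group Γ]

/-- On a simply connected space every locally constant cocycle is a coboundary. The proof glues
the trivial bundles with discrete fibre `Γ` to a covering space, which has a section. -/
theorem exists_locally_constant_coboundary (V : J → Set X) (hV : ∀ i, IsOpen (V i)) (idx : X → J)
    (hidx : ∀ x, x ∈ V (idx x)) (g : J → J → X → Γ)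
    (hg : ∀ i j, ∀ x ∈ V i ∩ V j, ∀ᶠ y in nhds x, g i j y = g i j x)
    (hself : ∀ i, ∀ x ∈ V i, g i i x = 1)
    (hcomp : ∀ i j l, ∀ x ∈ V i ∩ V j ∩ V l, g i j x * g j l x = g i l x) :
    ∃ h : J → X → Γ, (∀ i, ∀ x ∈ V i, ∀ᶠ y in nhds x, h i y = h i x) ∧
      ∀ i j, ∀ x ∈ V i ∩ V j, h i x * g i j x = h j x := by
  let _ : TopologicalSpace Γ := ⊥
  have : DiscreteTopology Γ := ⟨rfl⟩
  let Z : FiberBundleCore J X Γ :=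
    { baseSet := V
      isOpen_baseSet := hV
      indexAt := idx
      mem_baseSet_at := hidx
      coordChange := fun i j x v => v * g i j x
      coordChange_self := fun i x hx v => by rw [hself i x hx, mul_one]
      continuousOn_coordChange := fun i j => by
        rintro ⟨x, v⟩ ⟨hx, -⟩
        refine ContinuousAt.continuousWithinAt ?_
        have h : (fun p : X × Γ => p.2 * g i j p.1) =ᶠ[nhds (x, v)] fun _ => v * g i j x := by
          rw [nhds_prod_eq, show nhds v = pure v from congrFun (nhds_discrete Γ) v]
          refine (Filter.Eventually.prod_mk (hg i j x hx)
            (Filter.eventually_pure.2 (rfl : v = v))).mono ?_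
          rintro ⟨y, w⟩ ⟨h1, h2⟩
          have h2' : v = w := h2
          have h1' : g i j y = g i j x := h1
          change w * g i j y = _
          rw [h1', ← h2']
        exact (continuousAt_const (y := v * g i j x)).congr h.symm
      coordChange_comp := fun i j l x hx v => by rw [mul_assoc, hcomp i j l x hx] }
  have hcov : IsCoveringMap (Z.proj) := FiberBundle.isCoveringMap (F := Γ) (E := Z.Fiber)
  obtain ⟨x₀⟩ : Nonempty X := inferInstance
  obtain ⟨F, ⟨-, hF⟩, -⟩ := hcov.existsUnique_continuousMap_lifts (ContinuousMap.id X) x₀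
    (⟨x₀, (1 : Γ)⟩ : Z.TotalSpace) rfl
  have hp : ∀ x, (F x).1 = x := fun x => congrFun hF x
  refine ⟨fun i x => (Z.localTriv i (F x)).2, fun i x hx => ?_, fun i j x hx => ?_⟩
  · have hc : ContinuousAt (fun y => (Z.localTriv i (F y)).2) x := by
      have h1 : ContinuousAt (Z.localTriv i) (F x) := by
        refine (Z.localTriv i).continuousAt ?_
        rw [Bundle.Trivialization.mem_source]
        change (F x).1 ∈ V i
        rw [hp]; exact hx
      exact (continuous_snd.continuousAt.comp h1).comp F.continuous.continuousAt
    have h2 := hc.tendsto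
    rw [show ∀ v : Γ, nhds v = pure v from fun v => congrFun (nhds_discrete Γ) v,
      Filter.tendsto_pure] at h2
    exact h2
  · have e : ∀ i, (Z.localTriv i (F x)).2 = (show Γ from (F x).2) * g (idx (F x).1) i (F x).1 := fun i => rfl
    change (Z.localTriv i (F x)).2 * g i j x = (Z.localTriv j (F x)).2
    rw [e, e, mul_assoc]
    congr 1
    have h2 := hcomp (idx (F x).1) i j (F x).1 ⟨⟨hidx _, by rw [hp]; exact hx.1⟩,
      by rw [hp]; exact hx.2⟩
    rw [← h2, hp]

end Cocycle

attribute [local instance] Matrix.linftyOpNormedRing Matrix.linftyOpNormedAlgebra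

/-! ### Calculus of matrix-valued maps -/

section MatrixCalculus

variable {ι : Type} [Fintype ι] [DecidableEq ι] {K : Type} [RCLike K]

/-- The entry of a matrix as a bounded real-linear map. -/
def entryCLM (K : Type) [RCLike K] (i j : ι) : Matrix ι ι K →L[ℝ] K :=
  LinearMap.toContinuousLinearMap (Matrix.entryLinearMap ℝ K i j)

/-- The matrix with given entries, as a bounded real-linear map. -/
def ofEntriesCLM (ι : Type) [Fintype ι] [DecidableEq ι] (K : Type) [RCLike K] :
    (ι → ι → K) →L[ℝ] Matrix ι ι K :=
  LinearMap.toContinuousLinearMap (Matrix.ofLinearEquiv ℝ).toLinearMap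

variable {P : Type*} [NormedAddCommGroup P] [NormedSpace ℝ P]

theorem contDiffOn_matrix {n : WithTop ℕ∞} {S : P → Matrix ι ι K} {V : Set P}
    (h : ∀ i j, ContDiffOn ℝ n (fun u => S u i j) V) : ContDiffOn ℝ n S V :=
  (ofEntriesCLM ι K).contDiff.comp_contDiffOn
    (contDiffOn_pi.2 fun i => contDiffOn_pi.2 fun j => h i j)

theorem contDiffAt_matrix {n : WithTop ℕ∞} {S : P → Matrix ι ι K} {u : P}
    (h : ∀ i j, ContDiffAt ℝ n (fun u => S u i j) u) : ContDiffAt ℝ n S u :=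
  (ofEntriesCLM ι K).contDiff.contDiffAt.comp u
    (contDiffAt_pi.2 fun i => contDiffAt_pi.2 fun j => h i j)

theorem contDiffAt_entry {n : WithTop ℕ∞} {S : P → Matrix ι ι K} {u : P}
    (h : ContDiffAt ℝ n S u) (i j : ι) : ContDiffAt ℝ n (fun u => S u i j) u :=
  (entryCLM K i j).contDiff.contDiffAt.comp u h

theorem contDiffOn_entry {n : WithTop ℕ∞} {S : P → Matrix ι ι K} {V : Set P}
    (h : ContDiffOn ℝ n S V) (i j : ι) : ContDiffOn ℝ n (fun u => S u i j) V :=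
  (entryCLM K i j).contDiff.comp_contDiffOn h

theorem contDiffAt_matrix_inv {n : WithTop ℕ∞} {S : P → Matrix ι ι K} {u : P}
    (h : ContDiffAt ℝ n S u) (hu : IsUnit (S u)) : ContDiffAt ℝ n (fun u => (S u)⁻¹) u := by
  obtain ⟨x, hx⟩ := hu
  have h1 : ContDiffAt ℝ n (Ring.inverse : Matrix ι ι K → Matrix ι ι K) (S u) := by
    rw [← hx]; exact contDiffAt_ringInverse ℝ x
  have h2 : (fun u => (S u)⁻¹) = Ring.inverse ∘ S := by
    funext w; exact Matrix.nonsing_inv_eq_ringInverse _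
  rw [h2]
  exact h1.comp u h

end MatrixCalculus

/-! ### Partial derivatives -/

section PartialDerivatives

variable {m : ℕ} {W : Type*} [NormedAddCommGroup W] [NormedSpace ℝ W]
  {u : EuclideanSpace ℝ (Fin m)}

theorem pd_congr {f g : EuclideanSpace ℝ (Fin m) → W} (h : f =ᶠ[nhds u] g) (i : Fin m) :
    pd i f u = pd i g u := by
  rw [pd, pd, h.fderiv_eq]

theorem pd_const (c : W) (i : Fin m) : pd i (fun _ => c) u = 0 := by
  rw [pd, fderiv_fun_const]; rfl

theorem pd_add {f g : EuclideanSpace ℝ (Fin m) → W} (hf : DifferentiableAt ℝ f u)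
    (hg : DifferentiableAt ℝ g u) (i : Fin m) :
    pd i (fun w => f w + g w) u = pd i f u + pd i g u := by
  rw [pd, fderiv_fun_add hf hg]; rfl

theorem pd_sum {κ : Type*} (s : Finset κ) {f : κ → EuclideanSpace ℝ (Fin m) → W}
    (hf : ∀ j, DifferentiableAt ℝ (f j) u) (i : Fin m) :
    pd i (fun w => ∑ j ∈ s, f j w) u = ∑ j ∈ s, pd i (f j) u := by
  rw [pd, fderiv_fun_sum fun j _ => hf j, sum_apply]; rfl

theorem pd_clm {W' : Type*} [NormedAddCommGroup W'] [NormedSpace ℝ W'] (L : W →L[ℝ] W')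
    {f : EuclideanSpace ℝ (Fin m) → W} (hf : DifferentiableAt ℝ f u) (i : Fin m) :
    pd i (fun w => L (f w)) u = L (pd i f u) := by
  have h := (L.hasFDerivAt (x := f u)).comp u hf.hasFDerivAt
  have h' : fderiv ℝ (fun w => L (f w)) u = L.comp (fderiv ℝ f u) := h.fderiv
  rw [pd, h']; rfl

theorem pd_mul {A : Type*} [NormedRing A] [NormedAlgebra ℝ A] {f g : EuclideanSpace ℝ (Fin m) → A}
    (hf : DifferentiableAt ℝ f u) (hg : DifferentiableAt ℝ g u) (i : Fin m) :
    pd i (fun w => f w * g w) u = f u * pd i g u + pd i f u * g u := by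
  rw [pd, fderiv_fun_mul' hf hg]; rfl

theorem contDiffAt_pd {f : EuclideanSpace ℝ (Fin m) → W} (hf : ContDiffAt ℝ ∞ f u) (i : Fin m) :
    ContDiffAt ℝ ∞ (pd i f) u :=
  (hf.fderiv_right (m := ∞) (by simp)).clm_apply contDiffAt_const

theorem pd_comm {f : EuclideanSpace ℝ (Fin m) → W} (hf : ContDiffAt ℝ ∞ f u) (i j : Fin m) :
    pd i (pd j f) u = pd j (pd i f) u := by
  have hd : DifferentiableAt ℝ (fderiv ℝ f) u :=
    (hf.fderiv_right (m := ∞) (by simp)).differentiableAt (by simp)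
  have e : ∀ a b : Fin m, pd a (pd b f) u =
      fderiv ℝ (fderiv ℝ f) u (EuclideanSpace.single a 1) (EuclideanSpace.single b 1) := by
    intro a b
    have h := hd.hasFDerivAt.clm_apply
      (hasFDerivAt_const (EuclideanSpace.single b (1 : ℝ)) u)
    have h' : fderiv ℝ (pd b f) u = _ := h.fderiv
    rw [pd, h']
    simp
  have hs : IsSymmSndFDerivAt ℝ f u := hf.isSymmSndFDerivAt (by
    rw [minSmoothness_of_isRCLikeNormedField]; exact ENat.LEInfty.out)
  rw [e, e, hs.eq]

theorem pd_entry {ι : Type} [Fintype ι] [DecidableEq ι] {K : Type} [RCLike K]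
    {S : EuclideanSpace ℝ (Fin m) → Matrix ι ι K} (hS : DifferentiableAt ℝ S u) (i : Fin m)
    (a b : ι) : pd i (fun w => S w a b) u = pd i S u a b :=
  pd_clm (entryCLM K a b) hS i

theorem pd_pi {ι : Type} [Fintype ι] {f : EuclideanSpace ℝ (Fin m) → ι → ℝ}
    (hf : DifferentiableAt ℝ f u) (i : Fin m) (a : ι) :
    pd i (fun w => f w a) u = pd i f u a :=
  pd_clm (ContinuousLinearMap.proj (R := ℝ) (φ := fun _ : ι => ℝ) a) hf i

theorem pd_matrix_mulVec {ι : Type} [Fintype ι] [DecidableEq ι]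
    {S : EuclideanSpace ℝ (Fin m) → Matrix ι ι ℝ} {x : EuclideanSpace ℝ (Fin m) → ι → ℝ}
    (hd : DifferentiableAt ℝ S u) (hx : DifferentiableAt ℝ x u) (i : Fin m) :
    pd i (fun w => (S w).mulVec (x w)) u =
      (S u).mulVec (pd i x u) + (pd i S u).mulVec (x u) := by
  have hxd : ∀ b, DifferentiableAt ℝ (fun w => x w b) u := fun b => differentiableAt_pi.1 hx b
  have hSd : ∀ a b, DifferentiableAt ℝ (fun w => S w a b) u := fun a b =>
    ((entryCLM ℝ a b).differentiableAt).comp u hd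
  have hsum : ∀ a, DifferentiableAt ℝ (fun w => ∑ b, S w a b * x w b) u := fun a =>
    DifferentiableAt.fun_sum fun b _ => (hSd a b).mul (hxd b)
  have hF : DifferentiableAt ℝ (fun w => (S w).mulVec (x w)) u :=
    differentiableAt_pi.2 fun a => hsum a
  funext a
  rw [← pd_pi hF i a]
  change pd i (fun w => ∑ b, S w a b * x w b) u = _
  rw [pd_sum _ (fun b => (hSd a b).fun_mul (hxd b)), Pi.add_apply]
  simp only [Matrix.mulVec, dotProduct]
  rw [← Finset.sum_add_distrib]
  refine Finset.sum_congr rfl fun b _ => ?_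
  rw [pd_mul (hSd a b) (hxd b), pd_entry hd, pd_pi hx]

theorem contDiffAt_matrix_mulVec {ι : Type} [Fintype ι] [DecidableEq ι] {P : Type*}
    [NormedAddCommGroup P] [NormedSpace ℝ P]
    {S : P → Matrix ι ι ℝ} {x : P → ι → ℝ} {p : P}
    (hS : ContDiffAt ℝ ∞ S p) (hx : ContDiffAt ℝ ∞ x p) :
    ContDiffAt ℝ ∞ (fun w => (S w).mulVec (x w)) p := by
  refine contDiffAt_pi.2 fun a => ?_
  change ContDiffAt ℝ ∞ (fun w => ∑ b, S w a b * x w b) p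
  exact ContDiffAt.sum fun b _ => (contDiffAt_entry hS a b).mul (contDiffAt_pi.1 hx b)

theorem fderiv_apply_eq_sum_pd {f : EuclideanSpace ℝ (Fin m) → W} (v : EuclideanSpace ℝ (Fin m)) :
    fderiv ℝ f u v = ∑ i, v i • pd i f u := by
  have hv : v = ∑ i, v i • EuclideanSpace.single i (1 : ℝ) := by
    ext j
    simp [Finset.sum_apply, Pi.single_apply]
  conv_lhs => rw [hv]
  simp [pd, map_sum]

/-- The Maurer–Cartan equation of `Ω = S⁻¹ dS`. -/
theorem maurer_cartan {A : Type*} [NormedRing A] [NormedAlgebra ℝ A]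
    {S : EuclideanSpace ℝ (Fin m) → A} {Ω : Fin m → EuclideanSpace ℝ (Fin m) → A}
    (hS : ContDiffAt ℝ ∞ S u) (hu : IsUnit (S u)) (hΩ : ∀ i, DifferentiableAt ℝ (Ω i) u)
    (h : ∀ i, ∀ᶠ w in nhds u, pd i S w = S w * Ω i w) (i j : Fin m) :
    pd i (Ω j) u - pd j (Ω i) u + Ω i u * Ω j u - Ω j u * Ω i u = 0 := by
  have hd := hS.differentiableAt (by simp)
  have e : ∀ a b, pd a (pd b S) u = S u * (pd a (Ω b) u + Ω a u * Ω b u) := fun a b => by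
    rw [pd_congr (h b) a, pd_mul hd (hΩ b), (h a).self_of_nhds, mul_add, mul_assoc]
  have h1 := pd_comm hS i j
  rw [e, e] at h1
  have h2 := hu.mul_left_cancel h1
  have h3 := sub_eq_zero.2 h2
  rw [← h3]; abel

end PartialDerivatives

/-! ### Adapted frames -/

section Form

variable {m k : ℕ} (N : Target)

theorem Target.curv_mul_self : N.curv * N.curv = 1 := by cases N <;> simp [Target.curv]

theorem Target.normalSign_mul_self : N.normalSign * N.normalSign = 1 := by
  cases N <;> simp [Target.normalSign]

theorem Target.signs_mul_self (i : Idx m k) : N.signs m k i * N.signs m k i = 1 := by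
  rcases i with i | i | i <;>
    simp [Target.signs, diag3, N.curv_mul_self, N.normalSign_mul_self]

@[simp] theorem Target.signs_tangent (a : Fin m) : N.signs m k (Sum.inl a) = 1 := rfl

@[simp] theorem Target.signs_mid : N.signs m k (mid m k) = N.curv := rfl

@[simp] theorem Target.signs_normal (a : Fin k) :
    N.signs m k (Sum.inr (Sum.inr a)) = N.normalSign := rfl

theorem sum_idx {R : Type*} [AddCommMonoid R] (f : Idx m k → R) :
    ∑ i, f i = ∑ a, f (Sum.inl a) + (f (mid m k) + ∑ α, f (Sum.inr (Sum.inr α))) := by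
  simp [Fintype.sum_sum_type, mid]

theorem Target.form_eq (v w : Idx m k → ℝ) : N.form v w = ∑ a, v (Sum.inl a) * w (Sum.inl a) +
    (N.curv * v (mid m k) * w (mid m k) +
      N.normalSign * ∑ α, v (Sum.inr (Sum.inr α)) * w (Sum.inr (Sum.inr α))) := by
  rw [Target.form, sum_idx, Finset.mul_sum]
  simp [mul_assoc]

theorem Target.form_comm (v w : Idx m k → ℝ) : N.form v w = N.form w v := by
  simp only [Target.form]
  exact Finset.sum_congr rfl fun i _ => by ring

/-- The ambient form as a bilinear map. -/
def Target.formBilin (m k : ℕ) : (Idx m k → ℝ) →ₗ[ℝ] (Idx m k → ℝ) →ₗ[ℝ] ℝ :=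
  LinearMap.mk₂ ℝ (fun v w => N.form v w)
    (fun v v' w => by simp [Target.form, mul_add, add_mul, Finset.sum_add_distrib])
    (fun c v w => by
      simp only [Target.form, Pi.smul_apply, smul_eq_mul, Finset.mul_sum]
      exact Finset.sum_congr rfl fun i _ => by ring)
    (fun v w w' => by simp [Target.form, mul_add, Finset.sum_add_distrib])
    (fun c v w => by
      simp only [Target.form, Pi.smul_apply, smul_eq_mul, Finset.mul_sum]
      exact Finset.sum_congr rfl fun i _ => by ring)

theorem Target.formBilin_apply (v w : Idx m k → ℝ) : N.formBilin m k v w = N.form v w := rfl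

theorem Target.form_sub_left (v v' w : Idx m k → ℝ) :
    N.form (v - v') w = N.form v w - N.form v' w := by
  simp only [← N.formBilin_apply, map_sub, LinearMap.sub_apply]

theorem Target.form_sum_smul_left {κ : Type*} (s : Finset κ) (c : κ → ℝ) (v : κ → Idx m k → ℝ)
    (w : Idx m k → ℝ) : N.form (∑ j ∈ s, c j • v j) w = ∑ j ∈ s, c j * N.form (v j) w := by
  simp only [← N.formBilin_apply, map_sum, map_smul, LinearMap.sum_apply, LinearMap.smul_apply,
    smul_eq_mul]

/-- A matrix with `Sᵗ Ĵ S = Ĵ` is an isometry of the ambient form. -/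
theorem Target.form_mulVec {S : Matrix (Idx m k) (Idx m k) ℝ}
    (hS : S.transpose * Matrix.diagonal (N.signs m k) * S = Matrix.diagonal (N.signs m k))
    (x y : Idx m k → ℝ) : N.form (S.mulVec x) (S.mulVec y) = N.form x y := by
  have e : ∀ x y : Idx m k → ℝ, N.form x y =
      x ⬝ᵥ (Matrix.diagonal (N.signs m k)).mulVec y := fun x y => by
    simp only [Target.form, dotProduct, Matrix.mulVec_diagonal]
    exact Finset.sum_congr rfl fun i _ => by ring
  rw [e, e]
  conv_rhs => rw [← hS]
  rw [← Matrix.mulVec_mulVec, ← Matrix.mulVec_mulVec, Matrix.dotProduct_mulVec x,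
    Matrix.vecMul_transpose]

theorem mul_diagonal_transpose {ι : Type} [Fintype ι] [DecidableEq ι] {R : Type} [CommRing R]
    {d : ι → R} (hd : ∀ i, d i * d i = 1) {S : Matrix ι ι R}
    (hS : S.transpose * Matrix.diagonal d * S = Matrix.diagonal d) :
    S * (Matrix.diagonal d * S.transpose * Matrix.diagonal d) = 1 := by
  have h1 : (Matrix.diagonal d * S.transpose * Matrix.diagonal d) * S = 1 := by
    rw [Matrix.mul_assoc, Matrix.mul_assoc, ← Matrix.mul_assoc S.transpose, hS]
    simp [hd]
  exact mul_eq_one_comm.1 h1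

theorem inv_eq_of_orthogonal {ι : Type} [Fintype ι] [DecidableEq ι] {R : Type} [CommRing R]
    {d : ι → R} (hd : ∀ i, d i * d i = 1) {S : Matrix ι ι R}
    (hS : S.transpose * Matrix.diagonal d * S = Matrix.diagonal d) :
    S⁻¹ = Matrix.diagonal d * S.transpose * Matrix.diagonal d :=
  Matrix.inv_eq_right_inv (mul_diagonal_transpose hd hS)

theorem isUnit_of_orthogonal {ι : Type} [Fintype ι] [DecidableEq ι] {R : Type} [CommRing R]
    {d : ι → R} (hd : ∀ i, d i * d i = 1) {S : Matrix ι ι R}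
    (hS : S.transpose * Matrix.diagonal d * S = Matrix.diagonal d) : IsUnit S :=
  IsUnit.of_mul_eq_one _ (mul_diagonal_transpose hd hS)

theorem mul_transpose_of_orthogonal {ι : Type} [Fintype ι] [DecidableEq ι] {R : Type} [CommRing R]
    {d : ι → R} (hd : ∀ i, d i * d i = 1) {S : Matrix ι ι R}
    (hS : S.transpose * Matrix.diagonal d * S = Matrix.diagonal d) :
    S * Matrix.diagonal d * S.transpose = Matrix.diagonal d := by
  have h := mul_diagonal_transpose hd hS
  have hD : Matrix.diagonal d * Matrix.diagonal d = 1 := by simp [hd]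
  calc S * Matrix.diagonal d * S.transpose
      = S * (Matrix.diagonal d * S.transpose * Matrix.diagonal d) * Matrix.diagonal d := by
        simp only [Matrix.mul_assoc, hD, Matrix.mul_one]
    _ = _ := by rw [h, Matrix.one_mul]

end Form

section Frames

variable {m k : ℕ}

/-- The connection coefficients `S⁻¹ ∂ᵢ S` of a moving frame `S`. -/
def conn (S : EuclideanSpace ℝ (Fin m) → Matrix (Idx m k) (Idx m k) ℝ) (i : Fin m)
    (u : EuclideanSpace ℝ (Fin m)) : Matrix (Idx m k) (Idx m k) ℝ := (S u)⁻¹ * pd i S u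

/-- The matrix of the tangential coframe of a moving frame: its `i`-th row holds the components of
the `i`-th coordinate vector. -/
def coframe (S : EuclideanSpace ℝ (Fin m) → Matrix (Idx m k) (Idx m k) ℝ)
    (u : EuclideanSpace ℝ (Fin m)) : Matrix (Fin m) (Fin m) ℝ :=
  Matrix.of fun i a => conn S i u (Sum.inl a) (mid m k)

/-- The connection coefficients of a pseudo-orthonormal frame lie in the Lie algebra of the form. -/
theorem conn_skew_of_orthogonal {N : Target}
    {S : EuclideanSpace ℝ (Fin m) → Matrix (Idx m k) (Idx m k) ℝ} {u : EuclideanSpace ℝ (Fin m)}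
    (hS : ContDiffAt ℝ ∞ S u)
    (horth : ∀ᶠ w in nhds u, (S w).transpose * Matrix.diagonal (N.signs m k) * S w =
      Matrix.diagonal (N.signs m k)) (i : Fin m) (a b : Idx m k) :
    conn S i u b a * N.signs m k b + N.signs m k a * conn S i u a b = 0 := by
  set D := Matrix.diagonal (N.signs m k) with hD
  have hd := hS.differentiableAt (by simp)
  have horthu := horth.self_of_nhds
  have hmul : S u * conn S i u = pd i S u := by
    rw [conn, ← Matrix.mul_assoc, Matrix.mul_nonsing_inv _
      ((Matrix.isUnit_iff_isUnit_det _).1 (isUnit_of_orthogonal N.signs_mul_self horthu)),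
      Matrix.one_mul]
  set L : Matrix (Idx m k) (Idx m k) ℝ →L[ℝ] Matrix (Idx m k) (Idx m k) ℝ :=
    LinearMap.toContinuousLinearMap (Matrix.transposeLinearEquiv _ _ ℝ ℝ).toLinearMap
  have hL : ∀ X, L X = X.transpose := fun X => rfl
  have hT : pd i (fun w => L (S w)) u = (pd i S u).transpose := pd_clm L hd i
  have h1 : pd i (fun w => L (S w) * D * S w) u = 0 := by
    have h2 : (fun w => L (S w) * D * S w) =ᶠ[nhds u] fun _ => D := by
      filter_upwards [horth] with w hw using hw
    rw [pd_congr h2, pd_const]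
  have hLd : DifferentiableAt ℝ (fun w => L (S w)) u := L.differentiableAt.comp u hd
  rw [pd_mul (hLd.fun_mul (differentiableAt_const D)) hd, pd_mul hLd (differentiableAt_const D),
    pd_const, Matrix.mul_zero, zero_add, hT, hL, ← hmul,
    Matrix.transpose_mul] at h1
  have h3 : (conn S i u).transpose * D + D * conn S i u = 0 := by
    have e1 : (S u).transpose * D * (S u * conn S i u) = D * conn S i u := by
      rw [← Matrix.mul_assoc, horthu]
    have e2 : (conn S i u).transpose * (S u).transpose * D * S u =
        (conn S i u).transpose * D := by
      rw [Matrix.mul_assoc, Matrix.mul_assoc, ← Matrix.mul_assoc (S u).transpose, horthu]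
    rw [e1, e2, add_comm] at h1
    exact h1
  have h4 := congrFun (congrFun h3 a) b
  simpa [hD, Matrix.mul_diagonal, Matrix.diagonal_mul] using h4

/-- `S` is a smooth pseudo-orthonormal moving frame along the immersion `h` on the open set `V`:
the first `m` columns are tangent to `h`, the middle column is `h`, the others are normal. The
tangency is expressed by the vanishing of the components of `dh` along the last `k` columns, the
immersion property by the invertibility of the coframe. -/
structure IsAdaptedFrame (N : Target) (h : EuclideanSpace ℝ (Fin m) → Idx m k → ℝ)
    (S : EuclideanSpace ℝ (Fin m) → Matrix (Idx m k) (Idx m k) ℝ)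
    (V : Set (EuclideanSpace ℝ (Fin m))) : Prop where
  isOpen : IsOpen V
  smooth : ContDiffOn ℝ ∞ S V
  orth : ∀ u ∈ V, (S u).transpose * Matrix.diagonal (N.signs m k) * S u =
    Matrix.diagonal (N.signs m k)
  mid : ∀ u ∈ V, ∀ i, h u i = S u i (mid m k)
  normal : ∀ u ∈ V, ∀ i α, conn S i u (Sum.inr (Sum.inr α)) (FerusPedit.mid m k) = 0
  indep : ∀ u ∈ V, IsUnit (coframe S u)

namespace IsAdaptedFrame

variable {N : Target} {h : EuclideanSpace ℝ (Fin m) → Idx m k → ℝ}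
  {S : EuclideanSpace ℝ (Fin m) → Matrix (Idx m k) (Idx m k) ℝ}
  {V : Set (EuclideanSpace ℝ (Fin m))} (H : IsAdaptedFrame N h S V)
  {u : EuclideanSpace ℝ (Fin m)}

include H

theorem mono {V' : Set (EuclideanSpace ℝ (Fin m))} (hV' : IsOpen V') (hsub : V' ⊆ V) :
    IsAdaptedFrame N h S V' :=
  ⟨hV', H.smooth.mono hsub, fun u hu => H.orth u (hsub hu), fun u hu => H.mid u (hsub hu),
    fun u hu => H.normal u (hsub hu), fun u hu => H.indep u (hsub hu)⟩

theorem contDiffAt (hu : u ∈ V) : ContDiffAt ℝ ∞ S u :=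
  H.smooth.contDiffAt (H.isOpen.mem_nhds hu)

theorem isUnit (hu : u ∈ V) : IsUnit (S u) :=
  isUnit_of_orthogonal N.signs_mul_self (H.orth u hu)

theorem mul_conn (hu : u ∈ V) (i : Fin m) : S u * conn S i u = pd i S u := by
  rw [conn, ← Matrix.mul_assoc, Matrix.mul_nonsing_inv _
    ((Matrix.isUnit_iff_isUnit_det _).1 (H.isUnit hu)), Matrix.one_mul]

theorem contDiffAt_conn (hu : u ∈ V) (i : Fin m) : ContDiffAt ℝ ∞ (conn S i) u :=
  (contDiffAt_matrix_inv (H.contDiffAt hu) (H.isUnit hu)).mul (contDiffAt_pd (H.contDiffAt hu) i)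

theorem conn_skew (hu : u ∈ V) (i : Fin m) (a b : Idx m k) :
    conn S i u b a * N.signs m k b + N.signs m k a * conn S i u a b = 0 := by
  refine conn_skew_of_orthogonal (H.contDiffAt hu) ?_ i a b
  filter_upwards [H.isOpen.mem_nhds hu] with w hw using H.orth w hw

theorem conn_mid_mid (hu : u ∈ V) (i : Fin m) :
    conn S i u (FerusPedit.mid m k) (FerusPedit.mid m k) = 0 := by
  have h1 := H.conn_skew hu i (FerusPedit.mid m k) (FerusPedit.mid m k)
  have h2 := N.curv_mul_self
  simp only [Target.signs_mid] at h1
  have : N.curv * conn S i u (FerusPedit.mid m k) (FerusPedit.mid m k) = 0 := by linarith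
  calc _ = N.curv * N.curv * conn S i u (FerusPedit.mid m k) (FerusPedit.mid m k) := by
        rw [h2, one_mul]
    _ = 0 := by rw [mul_assoc, this, mul_zero]

theorem conn_mid_tangent (hu : u ∈ V) (i a : Fin m) :
    conn S i u (FerusPedit.mid m k) (Sum.inl a) = -(N.curv * coframe S u i a) := by
  have h1 := H.conn_skew hu i (Sum.inl a) (FerusPedit.mid m k)
  have h2 := N.curv_mul_self
  simp only [Target.signs_mid, Target.signs_tangent] at h1
  change _ = -(N.curv * conn S i u (Sum.inl a) (FerusPedit.mid m k))
  linear_combination N.curv * h1 - h2 * conn S i u (FerusPedit.mid m k) (Sum.inl a)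

theorem conn_mid_normal (hu : u ∈ V) (i : Fin m) (α : Fin k) :
    conn S i u (FerusPedit.mid m k) (Sum.inr (Sum.inr α)) = 0 := by
  have h1 := H.conn_skew hu i (Sum.inr (Sum.inr α)) (FerusPedit.mid m k)
  have h2 := N.curv_mul_self
  rw [H.normal u hu i α] at h1
  simp only [Target.signs_mid, Target.signs_normal] at h1
  linear_combination N.curv * h1 - h2 * conn S i u (FerusPedit.mid m k) (Sum.inr (Sum.inr α))

theorem conn_normal_tangent (hu : u ∈ V) (i a : Fin m) (α : Fin k) :
    conn S i u (Sum.inr (Sum.inr α)) (Sum.inl a) =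
      -(N.normalSign * conn S i u (Sum.inl a) (Sum.inr (Sum.inr α))) := by
  have h1 := H.conn_skew hu i (Sum.inl a) (Sum.inr (Sum.inr α))
  have h2 := N.normalSign_mul_self
  simp only [Target.signs_normal, Target.signs_tangent] at h1
  linear_combination N.normalSign * h1 - h2 * conn S i u (Sum.inr (Sum.inr α)) (Sum.inl a)

theorem maurer_cartan (hu : u ∈ V) (i j : Fin m) :
    pd i (conn S j) u - pd j (conn S i) u + conn S i u * conn S j u -
      conn S j u * conn S i u = 0 := by
  refine FerusPedit.maurer_cartan (H.contDiffAt hu) (H.isUnit hu)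
    (fun i => (H.contDiffAt_conn hu i).differentiableAt (by simp)) (fun i => ?_) i j
  filter_upwards [H.isOpen.mem_nhds hu] with w hw using (H.mul_conn hw i).symm

/-- Applying a moving frame to a vector of components. -/
theorem pd_mulVec {x : EuclideanSpace ℝ (Fin m) → Idx m k → ℝ} (hu : u ∈ V)
    (hx : DifferentiableAt ℝ x u) (i : Fin m) :
    pd i (fun w => (S w).mulVec (x w)) u =
      (S u).mulVec (pd i x u + (conn S i u).mulVec (x u)) := by
  rw [pd_matrix_mulVec ((H.contDiffAt hu).differentiableAt (by simp)) hx, Matrix.mulVec_add,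
    Matrix.mulVec_mulVec, H.mul_conn hu i]

theorem eq_mulVec (hu : u ∈ V) : h u = (S u).mulVec (Pi.single (FerusPedit.mid m k) 1) := by
  funext a
  rw [H.mid u hu a]
  simp [Matrix.mulVec_single]

theorem eventuallyEq (hu : u ∈ V) :
    h =ᶠ[nhds u] fun w => (S w).mulVec (Pi.single (FerusPedit.mid m k) 1) := by
  filter_upwards [H.isOpen.mem_nhds hu] with w hw using H.eq_mulVec hw

theorem contDiffAt_mulVec {x : EuclideanSpace ℝ (Fin m) → Idx m k → ℝ} (hu : u ∈ V)
    (hx : ContDiffAt ℝ ∞ x u) : ContDiffAt ℝ ∞ (fun w => (S w).mulVec (x w)) u := 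
  contDiffAt_matrix_mulVec (H.contDiffAt hu) hx

theorem contDiffAt_immersion (hu : u ∈ V) : ContDiffAt ℝ ∞ h u :=
  (H.contDiffAt_mulVec hu contDiffAt_const).congr_of_eventuallyEq (H.eventuallyEq hu)

/-- The components of the coordinate vectors. -/
theorem pd_eq (hu : u ∈ V) (i : Fin m) :
    pd i h u = (S u).mulVec (fun a => conn S i u a (FerusPedit.mid m k)) := by
  rw [pd_congr (H.eventuallyEq hu), H.pd_mulVec hu (differentiableAt_const _), pd_const, zero_add]
  congr 1
  funext a
  simp [Matrix.mulVec_single]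

/-- The scalar product of a vector with a coordinate vector sees only the tangential components. -/
theorem form_pd (hu : u ∈ V) (i : Fin m) (x : Idx m k → ℝ) :
    N.form ((S u).mulVec x) (pd i h u) = ∑ a, coframe S u i a * x (Sum.inl a) := by
  rw [H.pd_eq hu, N.form_mulVec (H.orth u hu), N.form_eq, H.conn_mid_mid hu]
  simp only [H.normal u hu, mul_zero, Finset.sum_const_zero, add_zero]
  exact Finset.sum_congr rfl fun a _ => mul_comm _ _

/-- The induced metric is `θ θᵗ` for the coframe `θ`. -/
theorem inducedMetric_eq (hu : u ∈ V) :
    inducedMetric N h u = coframe S u * (coframe S u).transpose := by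
  ext i j
  rw [inducedMetric, Matrix.of_apply, H.pd_eq hu i, H.form_pd hu j, Matrix.mul_apply]
  exact Finset.sum_congr rfl fun a _ => mul_comm _ _

theorem isUnit_inducedMetric (hu : u ∈ V) : IsUnit (inducedMetric N h u) := by
  rw [H.inducedMetric_eq hu]
  exact (H.indep u hu).mul ((Matrix.isUnit_transpose _).2 (H.indep u hu))

theorem form_self (hu : u ∈ V) (x : Idx m k → ℝ) :
    N.form ((S u).mulVec x) (h u) = N.curv * x (FerusPedit.mid m k) := by
  rw [H.eq_mulVec hu, N.form_mulVec (H.orth u hu), N.form_eq]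
  simp [FerusPedit.mid]

theorem eq_zero_of_coframe (hu : u ∈ V) {x : Fin m → ℝ}
    (hx : ∀ i, ∑ a, coframe S u i a * x a = 0) : x = 0 := by
  have h1 : (coframe S u).mulVec x = 0 := funext fun i => hx i
  have h2 := congrArg (coframe S u)⁻¹.mulVec h1
  rwa [Matrix.mulVec_mulVec, Matrix.nonsing_inv_mul _
    ((Matrix.isUnit_iff_isUnit_det _).1 (H.indep u hu)), Matrix.one_mulVec,
    Matrix.mulVec_zero] at h2

end IsAdaptedFrame

end Frames

/-! ### The Gauss equation -/

section Polarization

/-- An algebraic curvature tensor whose sectional curvatures vanish is zero. -/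
theorem curvatureTensor_eq_zero {V : Type*} [AddCommGroup V] (F : V → V → V → V → ℝ)
    (h1 : ∀ X X' Y Z W, F (X + X') Y Z W = F X Y Z W + F X' Y Z W)
    (h2 : ∀ X Y Y' Z W, F X (Y + Y') Z W = F X Y Z W + F X Y' Z W)
    (h3 : ∀ X Y Z Z' W, F X Y (Z + Z') W = F X Y Z W + F X Y Z' W)
    (h4 : ∀ X Y Z W W', F X Y Z (W + W') = F X Y Z W + F X Y Z W')
    (hskew : ∀ X Y Z W, F X Y Z W = -F Y X Z W) (hpair : ∀ X Y Z W, F X Y Z W = F W Z Y X)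
    (hbianchi : ∀ X Y Z W, F X Y Z W + F Y Z X W + F Z X Y W = 0)
    (hsec : ∀ X Y, F X Y Y X = 0) (X Y Z W : V) : F X Y Z W = 0 := by
  have s1 : ∀ X Y W, F X Y Y W = 0 := fun X Y W => by
    have e := hsec (X + W) Y
    rw [h1, h4, h4, hsec, hsec, hpair W Y Y X] at e
    linarith
  have s2 : ∀ X Y Z W, F X Y Z W = -F X Z Y W := fun X Y Z W => by
    have e := s1 X (Y + Z) W
    rw [h2, h3, h3, s1, s1] at e
    linarith
  have e1 := hbianchi X Y Z W
  have e2 : F Y Z X W = F X Y Z W := by rw [s2, hskew Y X]; ring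
  have e3 : F Z X Y W = F X Y Z W := by rw [s2, hskew Z Y, e2]; ring
  linarith

variable {m : ℕ} {κ : Type*} [Fintype κ]

theorem sum_four (q : Matrix (Fin m) (Fin m) ℝ) (X Y : Fin m → ℝ) :
    ∑ i, ∑ j, ∑ k, ∑ s, X i * Y j * Y k * X s * (q j k * q i s - q i k * q j s) =
      (Y ⬝ᵥ q.mulVec Y) * (X ⬝ᵥ q.mulVec X) - (X ⬝ᵥ q.mulVec Y) * (Y ⬝ᵥ q.mulVec X) := by
  have e : ∀ i j, ∑ k, ∑ s, X i * Y j * Y k * X s * (q j k * q i s - q i k * q j s) =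
      (X i * q.mulVec X i) * (Y j * q.mulVec Y j) - (X i * q.mulVec Y i) * (Y j * q.mulVec X j) := by
    intro i j
    have h1 : ∀ a b : Fin m, q.mulVec Y a * q.mulVec X b =
        ∑ k, ∑ s, (q a k * Y k) * (q b s * X s) := fun a b => by
      simp only [Matrix.mulVec, dotProduct]
      exact Finset.sum_mul_sum _ _ _ _
    calc _ = X i * Y j * (∑ k, ∑ s, (q j k * Y k) * (q i s * X s)) -
        X i * Y j * (∑ k, ∑ s, (q i k * Y k) * (q j s * X s)) := by
          simp only [Finset.mul_sum, ← Finset.sum_sub_distrib]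
          refine Finset.sum_congr rfl fun k _ => Finset.sum_congr rfl fun s _ => ?_
          ring
      _ = _ := by rw [← h1, ← h1]; ring
  simp only [e, Finset.sum_sub_distrib, dotProduct]
  rw [← Finset.sum_mul_sum, ← Finset.sum_mul_sum]
  ring

/-- The sum that defines the sectional curvature, for a curvature tensor with lowered index that is a
combination of the tensors `q ∧ q` of matrices `q t`. -/
theorem sum_sectional (r : Fin m → Fin m → Fin m → Fin m → ℝ) (g : Matrix (Fin m) (Fin m) ℝ)
    (w : κ → ℝ) (q : κ → Matrix (Fin m) (Fin m) ℝ)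
    (hr : ∀ i j k s, ∑ l, r l i j k * g l s =
      ∑ t, w t * (q t j k * q t i s - q t i k * q t j s)) (X Y : Fin m → ℝ) :
    ∑ i, ∑ j, ∑ k, ∑ l, ∑ s, X i * Y j * Y k * r l i j k * g l s * X s =
      ∑ t, w t * ((Y ⬝ᵥ (q t).mulVec Y) * (X ⬝ᵥ (q t).mulVec X) -
        (X ⬝ᵥ (q t).mulVec Y) * (Y ⬝ᵥ (q t).mulVec X)) := by
  have e : ∀ i j k, ∑ l, ∑ s, X i * Y j * Y k * r l i j k * g l s * X s =
      ∑ s, ∑ t, w t * (X i * Y j * Y k * X s * (q t j k * q t i s - q t i k * q t j s)) := by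
    intro i j k
    rw [Finset.sum_comm]
    refine Finset.sum_congr rfl fun s _ => ?_
    calc _ = X i * Y j * Y k * X s * ∑ l, r l i j k * g l s := by
          rw [Finset.mul_sum]
          exact Finset.sum_congr rfl fun l _ => by ring
      _ = _ := by
          rw [hr, Finset.mul_sum]
          exact Finset.sum_congr rfl fun l _ => by ring
  simp only [e, ← sum_four, Finset.mul_sum]
  rw [Finset.sum_comm' (t' := Finset.univ) (s' := fun _ => Finset.univ) (by simp)]
  rw [Finset.sum_comm]
  simp only [Finset.sum_comm (s := (Finset.univ : Finset κ))]

/-- A combination of the curvature tensors `q ∧ q` of symmetric matrices `q t` vanishes if its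
sectional curvatures do. -/
theorem sectional_polarization (w : κ → ℝ) (q : κ → Matrix (Fin m) (Fin m) ℝ)
    (hq : ∀ t, (q t).transpose = q t)
    (hsec : ∀ X Y : Fin m → ℝ, ∑ t, w t * ((Y ⬝ᵥ (q t).mulVec Y) * (X ⬝ᵥ (q t).mulVec X) -
        (X ⬝ᵥ (q t).mulVec Y) * (Y ⬝ᵥ (q t).mulVec X)) = 0) (i j k s : Fin m) :
    ∑ t, w t * (q t j k * q t i s - q t i k * q t j s) = 0 := by
  have hsymm : ∀ t (X Y : Fin m → ℝ), X ⬝ᵥ (q t).mulVec Y = Y ⬝ᵥ (q t).mulVec X := fun t X Y => by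
    rw [Matrix.dotProduct_mulVec, ← Matrix.mulVec_transpose, hq, dotProduct_comm]
  have h := curvatureTensor_eq_zero (V := Fin m → ℝ)
    (fun X Y Z W => ∑ t, w t * ((Y ⬝ᵥ (q t).mulVec Z) * (X ⬝ᵥ (q t).mulVec W) -
        (X ⬝ᵥ (q t).mulVec Z) * (Y ⬝ᵥ (q t).mulVec W)))
    (fun X X' Y Z W => by
      simp only [add_dotProduct, ← Finset.sum_add_distrib]
      exact Finset.sum_congr rfl fun t _ => by ring)
    (fun X Y Y' Z W => by
      simp only [add_dotProduct, ← Finset.sum_add_distrib]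
      exact Finset.sum_congr rfl fun t _ => by ring)
    (fun X Y Z Z' W => by
      simp only [Matrix.mulVec_add, dotProduct_add, ← Finset.sum_add_distrib]
      exact Finset.sum_congr rfl fun t _ => by ring)
    (fun X Y Z W W' => by
      simp only [Matrix.mulVec_add, dotProduct_add, ← Finset.sum_add_distrib]
      exact Finset.sum_congr rfl fun t _ => by ring)
    (fun X Y Z W => by
      simp only [← Finset.sum_neg_distrib]
      exact Finset.sum_congr rfl fun t _ => by ring)
    (fun X Y Z W => by
      refine Finset.sum_congr rfl fun t _ => ?_
      rw [hsymm t Z Y, hsymm t W X, hsymm t W Y, hsymm t Z X]; ring)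
    (fun X Y Z W => by
      simp only [← Finset.sum_add_distrib]
      refine Finset.sum_eq_zero fun t _ => ?_
      rw [hsymm t Y X, hsymm t Z X, hsymm t Z Y]; ring)
    hsec (Pi.single i 1) (Pi.single j 1) (Pi.single k 1) (Pi.single s 1)
  simpa using h

end Polarization

section Gauss

variable {m k : ℕ}

theorem pd_form (N : Target) {f g : EuclideanSpace ℝ (Fin m) → Idx m k → ℝ}
    {u : EuclideanSpace ℝ (Fin m)} (hf : DifferentiableAt ℝ f u) (hg : DifferentiableAt ℝ g u)
    (i : Fin m) : pd i (fun w => N.form (f w) (g w)) u =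
      N.form (pd i f u) (g u) + N.form (f u) (pd i g u) := by
  have hfd : ∀ b, DifferentiableAt ℝ (fun w => f w b) u := fun b => differentiableAt_pi.1 hf b
  have hgd : ∀ b, DifferentiableAt ℝ (fun w => g w b) u := fun b => differentiableAt_pi.1 hg b
  have hfs : ∀ b, DifferentiableAt ℝ (fun w => N.signs m k b * f w b) u := fun b =>
    (hfd b).const_mul _
  simp only [Target.form]
  rw [pd_sum _ (fun b => (hfs b).fun_mul (hgd b)), ← Finset.sum_add_distrib]
  refine Finset.sum_congr rfl fun b _ => ?_
  rw [pd_mul (hfs b) (hgd b), pd_mul (differentiableAt_const _) (hfd b), pd_const, pd_pi hf,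
    pd_pi hg]
  ring

theorem contDiffAt_form (N : Target) {f g : EuclideanSpace ℝ (Fin m) → Idx m k → ℝ}
    {u : EuclideanSpace ℝ (Fin m)} (hf : ContDiffAt ℝ ∞ f u) (hg : ContDiffAt ℝ ∞ g u) :
    ContDiffAt ℝ ∞ (fun w => N.form (f w) (g w)) u := by
  simp only [Target.form]
  exact ContDiffAt.sum fun b _ =>
    (contDiffAt_const.mul (contDiffAt_pi.1 hf b)).mul (contDiffAt_pi.1 hg b)

namespace IsAdaptedFrame

variable {N : Target} {h : EuclideanSpace ℝ (Fin m) → Idx m k → ℝ}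
  {S : EuclideanSpace ℝ (Fin m) → Matrix (Idx m k) (Idx m k) ℝ}
  {V : Set (EuclideanSpace ℝ (Fin m))} (H : IsAdaptedFrame N h S V)
  {u : EuclideanSpace ℝ (Fin m)}

include H

theorem pd_metric (hu : u ∈ V) (i j s : Fin m) :
    pd i (fun w => inducedMetric N h w j s) u =
      N.form (pd i (pd j h) u) (pd s h u) + N.form (pd j h u) (pd i (pd s h) u) := by
  have hh := H.contDiffAt_immersion hu
  exact pd_form N ((contDiffAt_pd hh j).differentiableAt (by simp))
    ((contDiffAt_pd hh s).differentiableAt (by simp)) i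

theorem contDiffAt_metric (hu : u ∈ V) : ContDiffAt ℝ ∞ (inducedMetric N h) u :=
  contDiffAt_matrix fun i j =>
    contDiffAt_form N (contDiffAt_pd (H.contDiffAt_immersion hu) i)
      (contDiffAt_pd (H.contDiffAt_immersion hu) j)

theorem contDiffAt_christoffel (hu : u ∈ V) (l i j : Fin m) :
    ContDiffAt ℝ ∞ (christoffel (inducedMetric N h) l i j) u := by
  have hg := H.contDiffAt_metric hu
  have hinv := contDiffAt_matrix_inv hg (H.isUnit_inducedMetric hu)
  have hp : ∀ a b c, ContDiffAt ℝ ∞ (pd a (fun w => inducedMetric N h w b c)) u := fun a b c =>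
    contDiffAt_pd (contDiffAt_entry hg b c) a
  unfold christoffel
  exact contDiffAt_const.mul (ContDiffAt.sum fun s _ => (contDiffAt_entry hinv l s).mul
    (((hp i j s).add (hp j i s)).sub (hp s i j)))

/-- The Christoffel symbols with lowered index are the tangential components of the second
derivatives of the immersion. -/
theorem christoffel_lower (hu : u ∈ V) (i j s : Fin m) :
    ∑ l, christoffel (inducedMetric N h) l i j u * inducedMetric N h u l s =
      N.form (pd i (pd j h) u) (pd s h u) := by
  have hh := H.contDiffAt_immersion hu
  have e : ∀ l, christoffel (inducedMetric N h) l i j u =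
      ∑ t, (inducedMetric N h u)⁻¹ l t * N.form (pd i (pd j h) u) (pd t h u) := by
    intro l
    rw [christoffel, Finset.mul_sum]
    refine Finset.sum_congr rfl fun t _ => ?_
    rw [H.pd_metric hu, H.pd_metric hu, H.pd_metric hu, pd_comm hh j i, pd_comm hh t i,
      pd_comm hh t j, N.form_comm (pd j h u) (pd i (pd t h) u)]
    rw [N.form_comm (pd i h u) (pd j (pd t h) u)]
    ring
  have hsymm : ∀ a b, inducedMetric N h u a b = inducedMetric N h u b a := fun a b =>
    N.form_comm _ _
  have hinv : inducedMetric N h u * (inducedMetric N h u)⁻¹ = 1 :=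
    Matrix.mul_nonsing_inv _ ((Matrix.isUnit_iff_isUnit_det _).1 (H.isUnit_inducedMetric hu))
  simp only [e, Finset.sum_mul]
  rw [Finset.sum_comm]
  have e2 : ∀ t, ∑ l, (inducedMetric N h u)⁻¹ l t * N.form (pd i (pd j h) u) (pd t h u) *
      inducedMetric N h u l s = N.form (pd i (pd j h) u) (pd t h u) *
        (1 : Matrix (Fin m) (Fin m) ℝ) s t := by
    intro t
    rw [← hinv, Matrix.mul_apply, Finset.mul_sum]
    refine Finset.sum_congr rfl fun l _ => ?_
    rw [hsymm l s]; ring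
  simp only [e2, Matrix.one_apply, mul_ite, mul_one, mul_zero, Finset.sum_ite_eq,
    Finset.mem_univ, if_true]

/-- The curvature tensor with lowered index is expressed by the second derivatives of the immersion
and their components normal to the submanifold in the ambient space. -/
theorem riemann_lower_form (hu : u ∈ V) (i j l s : Fin m) :
    ∑ t, riemann (inducedMetric N h) t i j l u * inducedMetric N h u t s =
      N.form (pd j (pd l h) u - ∑ t, christoffel (inducedMetric N h) t j l u • pd t h u)
        (pd i (pd s h) u) -
      N.form (pd i (pd l h) u - ∑ t, christoffel (inducedMetric N h) t i l u • pd t h u)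
        (pd j (pd s h) u) := by
  have hh := H.contDiffAt_immersion hu
  set Γ := christoffel (inducedMetric N h) with hΓ
  set g := inducedMetric N h with hg
  have hdg : ∀ a b, DifferentiableAt ℝ (fun w => g w a b) u := fun a b =>
    (contDiffAt_entry (H.contDiffAt_metric hu) a b).differentiableAt (by simp)
  have hdΓ : ∀ a b c, DifferentiableAt ℝ (Γ a b c) u := fun a b c =>
    (H.contDiffAt_christoffel hu a b c).differentiableAt (by simp)
  have key : ∀ a b, ∑ t, pd a (Γ t b l) u * g u t s = N.form (pd a (pd b (pd l h)) u) (pd s h u) +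
      N.form (pd b (pd l h) u) (pd a (pd s h) u) -
      ∑ t, Γ t b l u * (N.form (pd a (pd t h) u) (pd s h u) +
        N.form (pd t h u) (pd a (pd s h) u)) := by
    intro a b
    have e1 : (fun w => ∑ t, Γ t b l w * g w t s) =ᶠ[nhds u]
        fun w => N.form (pd b (pd l h) w) (pd s h w) := by
      filter_upwards [H.isOpen.mem_nhds hu] with w hw using H.christoffel_lower hw b l s
    have e2 := pd_congr e1 a
    rw [pd_sum _ (fun t => (hdΓ t b l).fun_mul (hdg t s)),
      pd_form N ((contDiffAt_pd (contDiffAt_pd hh l) b).differentiableAt (by simp))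
        ((contDiffAt_pd hh s).differentiableAt (by simp))] at e2
    rw [← e2, eq_sub_iff_add_eq, ← Finset.sum_add_distrib]
    refine Finset.sum_congr rfl fun t _ => ?_
    rw [pd_mul (hdΓ t b l) (hdg t s), H.pd_metric hu]
    ring
  have quad : ∀ a b, ∑ t, (∑ r, Γ t a r u * Γ r b l u) * g u t s =
      ∑ r, Γ r b l u * N.form (pd a (pd r h) u) (pd s h u) := by
    intro a b
    simp only [Finset.sum_mul]
    rw [Finset.sum_comm]
    refine Finset.sum_congr rfl fun r _ => ?_
    rw [← H.christoffel_lower hu a r s, Finset.mul_sum]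
    exact Finset.sum_congr rfl fun t _ => by ring
  have e0 : ∑ t, riemann g t i j l u * g u t s = ∑ t, pd i (Γ t j l) u * g u t s -
      ∑ t, pd j (Γ t i l) u * g u t s + ∑ t, (∑ r, Γ t i r u * Γ r j l u) * g u t s -
      ∑ t, (∑ r, Γ t j r u * Γ r i l u) * g u t s := by
    rw [← Finset.sum_sub_distrib, ← Finset.sum_add_distrib, ← Finset.sum_sub_distrib]
    refine Finset.sum_congr rfl fun t _ => ?_
    rw [riemann, Finset.sum_sub_distrib]
    ring
  rw [e0, key, key, quad, quad, N.form_sub_left, N.form_sub_left, N.form_sum_smul_left,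
    N.form_sum_smul_left, pd_comm (contDiffAt_pd hh l) j i]
  simp only [mul_add, Finset.sum_add_distrib]
  ring

/-- The components of the second derivatives of the immersion along the position vector and along the
normal vectors. -/
theorem pd_pd_eq (hu : u ∈ V) (i j : Fin m) : ∃ x : Idx m k → ℝ,
    pd i (pd j h) u = (S u).mulVec x ∧ x (FerusPedit.mid m k) =
      -(N.curv * inducedMetric N h u i j) ∧
    ∀ α, x (Sum.inr (Sum.inr α)) =
      ∑ a, conn S i u (Sum.inr (Sum.inr α)) (Sum.inl a) * coframe S u j a := by
  set y : EuclideanSpace ℝ (Fin m) → Idx m k → ℝ := fun w a => conn S j w a (FerusPedit.mid m k)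
    with hy
  have hyd : DifferentiableAt ℝ y u := differentiableAt_pi.2 fun a =>
    (contDiffAt_entry (H.contDiffAt_conn hu j) a (FerusPedit.mid m k)).differentiableAt (by simp)
  have e1 : pd j h =ᶠ[nhds u] fun w => (S w).mulVec (y w) := by
    filter_upwards [H.isOpen.mem_nhds hu] with w hw using H.pd_eq hw j
  have hyu : ∀ b : Idx m k, ∑ a, conn S i u b a * y u a =
      ∑ a, conn S i u b (Sum.inl a) * coframe S u j a := by
    intro b
    rw [sum_idx]
    simp only [hy, H.conn_mid_mid hu, H.normal u hu, mul_zero, Finset.sum_const_zero, add_zero]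
    rfl
  refine ⟨_, (pd_congr e1 i).trans (H.pd_mulVec hu hyd i), ?_, fun α => ?_⟩
  · rw [Pi.add_apply, ← pd_pi hyd i]
    have e2 : (fun w => y w (FerusPedit.mid m k)) =ᶠ[nhds u] fun _ => 0 := by
      filter_upwards [H.isOpen.mem_nhds hu] with w hw using H.conn_mid_mid hw j
    rw [pd_congr e2, pd_const, zero_add]
    refine (hyu (FerusPedit.mid m k)).trans ?_
    rw [H.inducedMetric_eq hu, Matrix.mul_apply, Finset.mul_sum, ← Finset.sum_neg_distrib]
    refine Finset.sum_congr rfl fun a _ => ?_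
    rw [H.conn_mid_tangent hu, Matrix.transpose_apply]
    ring
  · rw [Pi.add_apply, ← pd_pi hyd i]
    have e2 : (fun w => y w (Sum.inr (Sum.inr α))) =ᶠ[nhds u] fun _ => 0 := by
      filter_upwards [H.isOpen.mem_nhds hu] with w hw using H.normal w hw j α
    rw [pd_congr e2, pd_const, zero_add]
    exact hyu _

/-- The second fundamental form in the direction of the normal vector `α`. -/
def _root_.FerusPedit.secondForm
    (S : EuclideanSpace ℝ (Fin m) → Matrix (Idx m k) (Idx m k) ℝ)
    (u : EuclideanSpace ℝ (Fin m)) (α : Fin k) : Matrix (Fin m) (Fin m) ℝ :=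
  Matrix.of fun i j => ∑ a, conn S i u (Sum.inr (Sum.inr α)) (Sum.inl a) * coframe S u j a

theorem secondForm_symm (hu : u ∈ V) (α : Fin k) :
    (secondForm S u α).transpose = secondForm S u α := by
  ext i j
  obtain ⟨x, hx, -, hxα⟩ := H.pd_pd_eq hu i j
  obtain ⟨y, hy, -, hyα⟩ := H.pd_pd_eq hu j i
  have h1 : (S u).mulVec x = (S u).mulVec y := by
    rw [← hx, ← hy, pd_comm (H.contDiffAt_immersion hu)]
  have h2 : x = y := by
    have h3 := congrArg (S u)⁻¹.mulVec h1
    rwa [Matrix.mulVec_mulVec, Matrix.mulVec_mulVec, Matrix.nonsing_inv_mul _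
      ((Matrix.isUnit_iff_isUnit_det _).1 (H.isUnit hu)), Matrix.one_mulVec,
      Matrix.one_mulVec] at h3
  rw [Matrix.transpose_apply, secondForm, Matrix.of_apply, Matrix.of_apply, ← hxα, ← hyα, h2]

/-- The Gauss equation in the target. -/
theorem gauss (hu : u ∈ V) (i j l s : Fin m) :
    ∑ t, riemann (inducedMetric N h) t i j l u * inducedMetric N h u t s =
      N.curv * (inducedMetric N h u j l * inducedMetric N h u i s -
        inducedMetric N h u i l * inducedMetric N h u j s) +
      ∑ α, N.normalSign * (secondForm S u α j l * secondForm S u α i s -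
        secondForm S u α i l * secondForm S u α j s) := by
  have key : ∀ a b c : Fin m,
      N.form (pd a (pd l h) u - ∑ t, christoffel (inducedMetric N h) t a l u • pd t h u)
        (pd b (pd c h) u) = N.curv * (inducedMetric N h u a l * inducedMetric N h u b c) +
        N.normalSign * ∑ α, secondForm S u α a l * secondForm S u α b c := by
    intro a b c
    obtain ⟨x, hx, hx0, hxα⟩ := H.pd_pd_eq hu a l
    obtain ⟨y, hy, hy0, hyα⟩ := H.pd_pd_eq hu b c
    set z : Idx m k → ℝ := x - ∑ t, christoffel (inducedMetric N h) t a l u •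
      (fun a => conn S t u a (FerusPedit.mid m k)) with hz
    have e : pd a (pd l h) u - ∑ t, christoffel (inducedMetric N h) t a l u • pd t h u =
        (S u).mulVec z := by
      rw [hx, hz, Matrix.mulVec_sub, Matrix.mulVec_sum]
      congr 1
      exact Finset.sum_congr rfl fun t _ => by rw [H.pd_eq hu, Matrix.mulVec_smul]
    have hz0 : z (FerusPedit.mid m k) = x (FerusPedit.mid m k) := by
      simp [hz, H.conn_mid_mid hu]
    have hzα : ∀ α, z (Sum.inr (Sum.inr α)) = x (Sum.inr (Sum.inr α)) := fun α => by
      simp [hz, H.normal u hu]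
    have hzt : (fun a => z (Sum.inl a)) = 0 := by
      refine H.eq_zero_of_coframe hu fun r => ?_
      rw [← H.form_pd hu, ← e, N.form_sub_left, N.form_sum_smul_left, sub_eq_zero,
        ← H.christoffel_lower hu a l r]
      rfl
    have hzt' : ∀ a, z (Sum.inl a) = 0 := fun a => congrFun hzt a
    rw [e, hy, N.form_mulVec (H.orth u hu), N.form_eq]
    simp only [hzt', zero_mul, Finset.sum_const_zero, zero_add, hz0, hx0, hy0, hzα, hxα, hyα]
    have hc := N.curv_mul_self
    congr 1
    linear_combination (N.curv * inducedMetric N h u a l * inducedMetric N h u b c) * hc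
  rw [H.riemann_lower_form hu, key, key, ← Finset.mul_sum, Finset.sum_sub_distrib]
  ring

/-- The tangential part of `ωᵢ ∧ ωⱼ` that goes through the normal directions. -/
def _root_.FerusPedit.shapeComm
    (S : EuclideanSpace ℝ (Fin m) → Matrix (Idx m k) (Idx m k) ℝ)
    (u : EuclideanSpace ℝ (Fin m)) (i j a b : Fin m) : ℝ :=
  ∑ α, (conn S i u (Sum.inl a) (Sum.inr (Sum.inr α)) * conn S j u (Sum.inr (Sum.inr α))
      (Sum.inl b) -
    conn S j u (Sum.inl a) (Sum.inr (Sum.inr α)) * conn S i u (Sum.inr (Sum.inr α)) (Sum.inl b))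

/-- The contribution of the second fundamental form to the Gauss equation, in terms of the connection
coefficients of the frame. -/
theorem sum_secondForm (hu : u ∈ V) (i j l s : Fin m) :
    ∑ α, N.normalSign * (secondForm S u α j l * secondForm S u α i s -
        secondForm S u α i l * secondForm S u α j s) =
      ∑ a, ∑ b, coframe S u l a * coframe S u s b * shapeComm S u i j a b := by
  have e : ∀ α, N.normalSign * (secondForm S u α j l * secondForm S u α i s -
        secondForm S u α i l * secondForm S u α j s) = ∑ a, ∑ b, coframe S u l a *
      coframe S u s b * (conn S i u (Sum.inl a) (Sum.inr (Sum.inr α)) *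
        conn S j u (Sum.inr (Sum.inr α)) (Sum.inl b) -
      conn S j u (Sum.inl a) (Sum.inr (Sum.inr α)) *
        conn S i u (Sum.inr (Sum.inr α)) (Sum.inl b)) := by
    intro α
    have hn := N.normalSign_mul_self
    simp only [secondForm, Matrix.of_apply, Finset.sum_mul_sum]
    simp only [← Finset.sum_sub_distrib, Finset.mul_sum]
    refine Finset.sum_congr rfl fun a _ => Finset.sum_congr rfl fun b _ => ?_
    simp only [H.conn_normal_tangent hu]
    linear_combination (coframe S u l a * coframe S u s b * N.normalSign *
      (conn S j u (Sum.inl a) (Sum.inr (Sum.inr α)) *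
        conn S i u (Sum.inl b) (Sum.inr (Sum.inr α)) -
      conn S i u (Sum.inl a) (Sum.inr (Sum.inr α)) *
        conn S j u (Sum.inl b) (Sum.inr (Sum.inr α)))) * hn
  simp only [e, shapeComm, Finset.mul_sum]
  rw [Finset.sum_comm]
  refine Finset.sum_congr rfl fun a _ => ?_
  rw [Finset.sum_comm]

/-- The Gauss equation in its algebraic form implies constant sectional curvature. -/
theorem sectionalCurvatureEq_of_shapeComm {c : ℝ} (hu : u ∈ V)
    (hC : ∀ i j a b, shapeComm S u i j a b = -(c - N.curv) *
      (coframe S u i a * coframe S u j b - coframe S u j a * coframe S u i b)) :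
    SectionalCurvatureEq (inducedMetric N h) c u := by
  intro X Y
  have hg : ∀ i j, inducedMetric N h u i j = ∑ a, coframe S u i a * coframe S u j a := by
    intro i j; rw [H.inducedMetric_eq hu, Matrix.mul_apply]; rfl
  have hR : ∀ i j l s, ∑ t, riemann (inducedMetric N h) t i j l u * inducedMetric N h u t s =
      ∑ t : Unit, c * (inducedMetric N h u j l * inducedMetric N h u i s -
        inducedMetric N h u i l * inducedMetric N h u j s) := by
    intro i j l s
    rw [H.gauss hu, H.sum_secondForm hu]
    have e : ∑ a, ∑ b, coframe S u l a * coframe S u s b * shapeComm S u i j a b =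
        -(c - N.curv) * (inducedMetric N h u i l * inducedMetric N h u j s -
          inducedMetric N h u j l * inducedMetric N h u i s) := by
      simp only [hC, hg, Finset.sum_mul_sum]
      simp only [← Finset.sum_sub_distrib, Finset.mul_sum]
      exact Finset.sum_congr rfl fun a _ => Finset.sum_congr rfl fun b _ => by ring
    rw [e]
    simp
    ring
  rw [sum_sectional (κ := Unit) (fun l i j k => riemann (inducedMetric N h) l i j k u)
    (inducedMetric N h u) (fun _ => c) (fun _ => inducedMetric N h u) hR X Y]
  have hsymm : (inducedMetric N h u).transpose = inducedMetric N h u := by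
    ext a b; exact N.form_comm _ _
  have hs : Y ⬝ᵥ (inducedMetric N h u).mulVec X = X ⬝ᵥ (inducedMetric N h u).mulVec Y := by
    rw [Matrix.dotProduct_mulVec, ← Matrix.mulVec_transpose, hsymm, dotProduct_comm]
  rw [hs]
  simp
  left
  ring

/-- Constant sectional curvature determines the tangential part of `ω ∧ ω` through the normal
directions: after subtracting the curvature tensor of constant curvature `c`, the Gauss equation
exhibits an algebraic curvature tensor without sectional curvatures. -/
theorem shapeComm_of_sectionalCurvatureEq {c : ℝ} (hu : u ∈ V)
    (hc : SectionalCurvatureEq (inducedMetric N h) c u) (i j a b : Fin m) :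
    shapeComm S u i j a b = -(c - N.curv) *
      (coframe S u i a * coframe S u j b - coframe S u j a * coframe S u i b) := by
  have hg : ∀ i j, inducedMetric N h u i j = ∑ a, coframe S u i a * coframe S u j a := by
    intro i j; rw [H.inducedMetric_eq hu, Matrix.mul_apply]; rfl
  have hsymm : (inducedMetric N h u).transpose = inducedMetric N h u := by
    ext a b; exact N.form_comm _ _
  set q : Option (Fin k) → Matrix (Fin m) (Fin m) ℝ := fun t =>
    t.elim (inducedMetric N h u) (secondForm S u) with hq
  have hR : ∀ i j l s, ∑ t, riemann (inducedMetric N h) t i j l u * inducedMetric N h u t s =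
      ∑ t : Option (Fin k), (t.elim N.curv fun _ => N.normalSign) *
        (q t j l * q t i s - q t i l * q t j s) := by
    intro i j l s
    rw [H.gauss hu, Fintype.sum_option]
    rfl
  have hpol := sectional_polarization (κ := Option (Fin k))
    (fun t => t.elim (N.curv - c) fun _ => N.normalSign) q
    (fun t => by cases t with
      | none => exact hsymm
      | some α => exact H.secondForm_symm hu α) (fun X Y => by
    have h1 := hc X Y
    rw [sum_sectional (κ := Option (Fin k)) (fun l i j k => riemann (inducedMetric N h) l i j k u)
      (inducedMetric N h u) _ q hR X Y] at h1
    have hs : Y ⬝ᵥ (inducedMetric N h u).mulVec X = X ⬝ᵥ (inducedMetric N h u).mulVec Y := by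
      rw [Matrix.dotProduct_mulVec, ← Matrix.mulVec_transpose, hsymm, dotProduct_comm]
    rw [Fintype.sum_option] at h1 ⊢
    simp only [hq, Option.elim] at h1 ⊢
    rw [hs] at h1 ⊢
    linear_combination h1)
  -- the difference `D` of both sides vanishes, since the coframe carries it to zero
  set D : Matrix (Fin m) (Fin m) ℝ := Matrix.of fun a b => shapeComm S u i j a b + (c - N.curv) *
      (coframe S u i a * coframe S u j b - coframe S u j a * coframe S u i b) with hD
  have hzero : coframe S u * D * (coframe S u).transpose = 0 := by
    ext l s
    have h1 := hpol i j l s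
    rw [Fintype.sum_option] at h1
    simp only [hq, Option.elim] at h1
    rw [H.sum_secondForm hu] at h1
    rw [Matrix.zero_apply, ← h1, Matrix.mul_apply]
    simp only [Matrix.mul_apply, Finset.sum_mul]
    rw [Finset.sum_comm]
    simp only [hD, Matrix.of_apply, Matrix.transpose_apply, hg, Finset.sum_mul_sum]
    simp only [← Finset.sum_sub_distrib, Finset.mul_sum, ← Finset.sum_add_distrib]
    exact Finset.sum_congr rfl fun a _ => Finset.sum_congr rfl fun b _ => by ring
  have hD0 : D = 0 := by
    have hu1 := H.indep u hu
    have hu2 : IsUnit (coframe S u).transpose := (Matrix.isUnit_transpose _).2 hu1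
    rw [Matrix.mul_assoc] at hzero
    have h2 : D * (coframe S u).transpose = 0 :=
      hu1.mul_left_cancel (hzero.trans (Matrix.mul_zero _).symm)
    exact hu2.mul_right_cancel (h2.trans (Matrix.zero_mul _).symm)
  have h3 := congrFun (congrFun hD0 a) b
  rw [hD, Matrix.of_apply, Matrix.zero_apply] at h3
  linarith

end IsAdaptedFrame

end Gauss

/-! ### The curvature of the normal bundle -/

section NormalCurvature

variable {m k : ℕ}

/-- The projection of component vectors to the last `k` coordinates. -/
def normalPart (m k : ℕ) : Matrix (Idx m k) (Idx m k) ℝ := Matrix.diagonal (diag3 m k 0 0 1)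

theorem normalPart_mulVec_tangent (x : Idx m k → ℝ) (a : Fin m) :
    (normalPart m k).mulVec x (Sum.inl a) = 0 := by
  simp [normalPart, Matrix.mulVec_diagonal, diag3]

theorem normalPart_mulVec_mid (x : Idx m k → ℝ) :
    (normalPart m k).mulVec x (mid m k) = 0 := by
  simp [normalPart, Matrix.mulVec_diagonal, diag3, mid]

theorem normalPart_mulVec_normal (x : Idx m k → ℝ) (α : Fin k) :
    (normalPart m k).mulVec x (Sum.inr (Sum.inr α)) = x (Sum.inr (Sum.inr α)) := by
  simp [normalPart, Matrix.mulVec_diagonal, diag3]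

theorem normalPart_mul_self : normalPart m k * normalPart m k = normalPart m k := by
  rw [normalPart, Matrix.diagonal_mul_diagonal]
  congr 1
  funext i
  rcases i with i | i | i <;> simp [diag3]

theorem idx_ext {R : Type*} {x y : Idx m k → R} (h1 : ∀ a, x (Sum.inl a) = y (Sum.inl a))
    (h2 : x (mid m k) = y (mid m k))
    (h3 : ∀ α, x (Sum.inr (Sum.inr α)) = y (Sum.inr (Sum.inr α))) : x = y := by
  funext i
  rcases i with i | i | i
  · exact h1 i
  · exact h2
  · exact h3 i

/-- The components of the curvature of the normal connection, expressed by the second fundamental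
form. -/
def normalComm (S : EuclideanSpace ℝ (Fin m) → Matrix (Idx m k) (Idx m k) ℝ)
    (u : EuclideanSpace ℝ (Fin m)) (i j : Fin m) (α γ : Fin k) : ℝ :=
  ∑ a, (conn S i u (Sum.inr (Sum.inr α)) (Sum.inl a) *
      conn S j u (Sum.inl a) (Sum.inr (Sum.inr γ)) -
    conn S j u (Sum.inr (Sum.inr α)) (Sum.inl a) * conn S i u (Sum.inl a) (Sum.inr (Sum.inr γ)))

namespace IsAdaptedFrame

variable {N : Target} {h : EuclideanSpace ℝ (Fin m) → Idx m k → ℝ}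
  {S : EuclideanSpace ℝ (Fin m) → Matrix (Idx m k) (Idx m k) ℝ}
  {V : Set (EuclideanSpace ℝ (Fin m))} (H : IsAdaptedFrame N h S V)
  {u : EuclideanSpace ℝ (Fin m)}

include H

theorem normalProj_mulVec (hu : u ∈ V) (x : Idx m k → ℝ) :
    normalProj N h u ((S u).mulVec x) = (S u).mulVec ((normalPart m k).mulVec x) := by
  set g := inducedMetric N h u with hg
  set θ := coframe S u with hθ
  have hgθ : g = θ * θ.transpose := H.inducedMetric_eq hu
  have hθu : IsUnit θ.det := (Matrix.isUnit_iff_isUnit_det _).1 (H.indep u hu)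
  have hθt : IsUnit θ.transpose.det := by rwa [Matrix.det_transpose]
  have hproj : θ.transpose * g⁻¹ * θ = 1 := by
    rw [hgθ, Matrix.mul_inv_rev, ← Matrix.mul_assoc, Matrix.mul_nonsing_inv _ hθt, Matrix.one_mul,
      Matrix.nonsing_inv_mul _ hθu]
  set z : Idx m k → ℝ := x - x (FerusPedit.mid m k) • Pi.single (FerusPedit.mid m k) 1 -
    ∑ i, ∑ j, (g⁻¹ i j * ∑ a, θ i a * x (Sum.inl a)) •
      (fun a => conn S j u a (FerusPedit.mid m k)) with hz
  have e1 : normalProj N h u ((S u).mulVec x) = (S u).mulVec z := by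
    rw [normalProj, H.form_self hu, ← mul_assoc, N.curv_mul_self, one_mul, hz, Matrix.mulVec_sub,
      Matrix.mulVec_sub, Matrix.mulVec_smul, ← H.eq_mulVec hu, Matrix.mulVec_sum]
    congr 1
    refine Finset.sum_congr rfl fun i _ => ?_
    rw [Matrix.mulVec_sum]
    refine Finset.sum_congr rfl fun j _ => ?_
    rw [Matrix.mulVec_smul, ← H.pd_eq hu, H.form_pd hu]
  rw [e1]
  congr 1
  refine idx_ext (fun a => ?_) ?_ (fun α => ?_)
  · rw [normalPart_mulVec_tangent]
    have h1 : ∑ i, ∑ j, g⁻¹ i j * (∑ b, θ i b * x (Sum.inl b)) * θ j a = x (Sum.inl a) := by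
      have hsymm : g⁻¹.transpose = g⁻¹ := by
        rw [Matrix.transpose_nonsing_inv]
        congr 1
        rw [hgθ, Matrix.transpose_mul, Matrix.transpose_transpose]
      have h3 := congrFun (congrArg (fun X : Matrix (Fin m) (Fin m) ℝ =>
        X.mulVec fun b => x (Sum.inl b)) hproj) a
      simp only [Matrix.one_mulVec] at h3
      rw [← h3, ← Matrix.mulVec_mulVec, ← Matrix.mulVec_mulVec]
      conv_rhs => rw [← hsymm]
      change _ = ∑ j, θ j a * ∑ i, g⁻¹ i j * ∑ b, θ i b * x (Sum.inl b)
      simp only [Finset.mul_sum (s := Finset.univ) (f := fun i => g⁻¹ i _ * _)]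
      rw [Finset.sum_comm]
      exact Finset.sum_congr rfl fun i _ => Finset.sum_congr rfl fun j _ => by ring
    have h2 : (∑ i, ∑ j, (g⁻¹ i j * ∑ b, θ i b * x (Sum.inl b)) •
        (fun a => conn S j u a (FerusPedit.mid m k)) : Idx m k → ℝ) (Sum.inl a) = x (Sum.inl a) := by
      simp only [Finset.sum_apply, Pi.smul_apply, smul_eq_mul]
      exact h1
    rw [hz, Pi.sub_apply, h2]
    simp [FerusPedit.mid]
  · rw [normalPart_mulVec_mid]
    simp [hz, H.conn_mid_mid hu]
  · rw [normalPart_mulVec_normal]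
    simp only [hz, Pi.sub_apply, Finset.sum_apply, Pi.smul_apply, smul_eq_mul, H.normal u hu]
    simp [FerusPedit.mid]

theorem normalDeriv_eq {x : EuclideanSpace ℝ (Fin m) → Idx m k → ℝ}
    {ξ : EuclideanSpace ℝ (Fin m) → Idx m k → ℝ} (hu : u ∈ V) (hx : DifferentiableAt ℝ x u)
    (hξ : ξ =ᶠ[nhds u] fun w => (S w).mulVec (x w)) (i : Fin m) :
    normalDeriv N h i ξ u =
      (S u).mulVec ((normalPart m k).mulVec (pd i x u + (conn S i u).mulVec (x u))) := by
  rw [normalDeriv, pd_congr hξ, H.pd_mulVec hu hx, H.normalProj_mulVec hu]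

theorem normalDeriv_normalDeriv {x : EuclideanSpace ℝ (Fin m) → Idx m k → ℝ}
    {ξ : EuclideanSpace ℝ (Fin m) → Idx m k → ℝ} (hu : u ∈ V) (hxe : ∀ᶠ w in nhds u, ContDiffAt ℝ ∞ x w)
    (hξ : ξ =ᶠ[nhds u] fun w => (S w).mulVec (x w)) (i j : Fin m) :
    normalDeriv N h i (normalDeriv N h j ξ) u =
      (S u).mulVec ((normalPart m k).mulVec (pd i (pd j x) u + (pd i (conn S j) u).mulVec (x u) +
        (conn S j u).mulVec (pd i x u) + (conn S i u).mulVec ((normalPart m k).mulVec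
          (pd j x u + (conn S j u).mulVec (x u))))) := by
  have hx := hxe.self_of_nhds
  have h1 : normalDeriv N h j ξ =ᶠ[nhds u] fun w =>
      (S w).mulVec ((normalPart m k).mulVec (pd j x w + (conn S j w).mulVec (x w))) := by
    filter_upwards [H.isOpen.mem_nhds hu, hξ.eventually_nhds, hxe]
      with w hw hw2 hw3
    exact H.normalDeriv_eq hw (hw3.differentiableAt (by simp)) hw2 j
  have hc := contDiffAt_matrix_mulVec (H.contDiffAt_conn hu j) hx
  have hy : ContDiffAt ℝ ∞ (fun w => pd j x w + (conn S j w).mulVec (x w)) u :=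
    (contDiffAt_pd hx j).add hc
  have hP : ContDiffAt ℝ ∞ (fun _ : EuclideanSpace ℝ (Fin m) => normalPart m k) u :=
    contDiffAt_const
  have hd := hy.differentiableAt (by simp)
  have hz := contDiffAt_matrix_mulVec hP hy
  rw [H.normalDeriv_eq hu (hz.differentiableAt (by simp)) h1 i,
    pd_matrix_mulVec (differentiableAt_const _) hd, pd_const, Matrix.zero_mulVec, add_zero,
    pd_add ((contDiffAt_pd hx j).differentiableAt (by simp)) (hc.differentiableAt (by simp)),
    pd_matrix_mulVec ((H.contDiffAt_conn hu j).differentiableAt (by simp))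
      (hx.differentiableAt (by simp))]
  congr 1
  rw [Matrix.mulVec_add, Matrix.mulVec_add (normalPart m k) _ ((conn S i u).mulVec _),
    Matrix.mulVec_mulVec (pd i (pd j x) u + _) (normalPart m k), normalPart_mul_self,
    Matrix.mulVec_add]
  simp only [Matrix.mulVec_add]
  abel

/-- The Ricci equation. -/
theorem normalDeriv_comm {x : EuclideanSpace ℝ (Fin m) → Idx m k → ℝ}
    {ξ : EuclideanSpace ℝ (Fin m) → Idx m k → ℝ} (hu : u ∈ V) (hxe : ∀ᶠ w in nhds u, ContDiffAt ℝ ∞ x w)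
    (hn : ∀ᶠ w in nhds u, (normalPart m k).mulVec (x w) = x w)
    (hξ : ξ =ᶠ[nhds u] fun w => (S w).mulVec (x w)) (i j : Fin m) :
    ∃ y : Idx m k → ℝ, normalDeriv N h i (normalDeriv N h j ξ) u -
      normalDeriv N h j (normalDeriv N h i ξ) u = (S u).mulVec ((normalPart m k).mulVec y) ∧
      ∀ α, y (Sum.inr (Sum.inr α)) =
        -∑ γ, normalComm S u i j α γ * x u (Sum.inr (Sum.inr γ)) := by
  have hx := hxe.self_of_nhds
  have hpd : ∀ a, (normalPart m k).mulVec (pd a x u) = pd a x u := fun a => by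
    have e := pd_congr hn a
    rw [pd_matrix_mulVec (differentiableAt_const _) (hx.differentiableAt (by simp)), pd_const,
      Matrix.zero_mulVec, add_zero] at e
    exact e
  have hxu := hn.self_of_nhds
  refine ⟨_, by rw [H.normalDeriv_normalDeriv hu hxe hξ, H.normalDeriv_normalDeriv hu hxe hξ,
      ← Matrix.mulVec_sub, ← Matrix.mulVec_sub], ?_⟩
  · intro α
    have hMC := H.maurer_cartan hu i j
    have hMC' : pd i (conn S j) u - pd j (conn S i) u =
        conn S j u * conn S i u - conn S i u * conn S j u := by
      rw [← sub_eq_zero, ← hMC]; abel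
    have e1 : pd i (pd j x) u + (pd i (conn S j) u).mulVec (x u) +
        (conn S j u).mulVec (pd i x u) + (conn S i u).mulVec ((normalPart m k).mulVec
          (pd j x u + (conn S j u).mulVec (x u))) -
        (pd j (pd i x) u + (pd j (conn S i) u).mulVec (x u) +
        (conn S i u).mulVec (pd j x u) + (conn S j u).mulVec ((normalPart m k).mulVec
          (pd i x u + (conn S i u).mulVec (x u)))) =
        (conn S j u).mulVec ((conn S i u).mulVec (x u)) -
        (conn S i u).mulVec ((conn S j u).mulVec (x u)) +
        (conn S i u).mulVec ((normalPart m k).mulVec ((conn S j u).mulVec (x u))) -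
        (conn S j u).mulVec ((normalPart m k).mulVec ((conn S i u).mulVec (x u))) := by
      have e2 : (pd i (conn S j) u).mulVec (x u) - (pd j (conn S i) u).mulVec (x u) =
          (conn S j u).mulVec ((conn S i u).mulVec (x u)) -
          (conn S i u).mulVec ((conn S j u).mulVec (x u)) := by
        rw [← Matrix.sub_mulVec, hMC', Matrix.sub_mulVec, Matrix.mulVec_mulVec,
          Matrix.mulVec_mulVec]
      simp only [Matrix.mulVec_add, hpd, pd_comm hx i j]
      rw [sub_eq_sub_iff_add_eq_add] at e2
      rw [← sub_eq_zero]
      have e3 := sub_eq_zero.2 e2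
      rw [← e3]
      abel
    rw [e1]
    have hx1 : ∀ a, x u (Sum.inl a) = 0 := fun a => by
      rw [← hxu, normalPart_mulVec_tangent]
    have hx2 : x u (FerusPedit.mid m k) = 0 := by rw [← hxu, normalPart_mulVec_mid]
    have hωx : ∀ b a, (conn S b u).mulVec (x u) (Sum.inl a) =
        ∑ γ, conn S b u (Sum.inl a) (Sum.inr (Sum.inr γ)) * x u (Sum.inr (Sum.inr γ)) := by
      intro b a
      rw [Matrix.mulVec, dotProduct, sum_idx]
      simp [hx1, hx2]
    have e4 : ∀ b c, ((conn S b u).mulVec ((conn S c u).mulVec (x u)) -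
        (conn S b u).mulVec ((normalPart m k).mulVec ((conn S c u).mulVec (x u))))
          (Sum.inr (Sum.inr α)) = ∑ γ, (∑ a, conn S b u (Sum.inr (Sum.inr α)) (Sum.inl a) *
            conn S c u (Sum.inl a) (Sum.inr (Sum.inr γ))) * x u (Sum.inr (Sum.inr γ)) := by
      intro b c
      rw [← Matrix.mulVec_sub, Matrix.mulVec, dotProduct, sum_idx]
      simp only [Pi.sub_apply, normalPart_mulVec_tangent, normalPart_mulVec_mid,
        normalPart_mulVec_normal, H.normal u hu, sub_self, sub_zero, zero_mul, mul_zero,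
        Finset.sum_const_zero, add_zero, hωx, Finset.mul_sum, Finset.sum_mul]
      rw [Finset.sum_comm]
      exact Finset.sum_congr rfl fun γ _ => Finset.sum_congr rfl fun a _ => by ring
    have e5 := e4 i j
    have e6 := e4 j i
    simp only [Pi.sub_apply, Pi.add_apply] at e5 e6 ⊢
    have e7 : ∑ γ, normalComm S u i j α γ * x u (Sum.inr (Sum.inr γ)) =
        (∑ γ, (∑ a, conn S i u (Sum.inr (Sum.inr α)) (Sum.inl a) *
            conn S j u (Sum.inl a) (Sum.inr (Sum.inr γ))) * x u (Sum.inr (Sum.inr γ))) -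
        ∑ γ, (∑ a, conn S j u (Sum.inr (Sum.inr α)) (Sum.inl a) *
            conn S i u (Sum.inl a) (Sum.inr (Sum.inr γ))) * x u (Sum.inr (Sum.inr γ)) := by
      rw [← Finset.sum_sub_distrib]
      refine Finset.sum_congr rfl fun γ _ => ?_
      rw [normalComm, Finset.sum_sub_distrib, sub_mul]
    rw [e7, ← e5, ← e6]
    ring

/-- Flatness of the normal bundle is applied to the normal vectors of the frame. -/
theorem normalComm_eq_zero {D : Set (EuclideanSpace ℝ (Fin m))} (hVD : V ⊆ D)
    (hflat : NormalFlatOn N h D) (hu : u ∈ V) (i j : Fin m) (α γ : Fin k) :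
    normalComm S u i j α γ = 0 := by
  set e : Idx m k → ℝ := Pi.single (Sum.inr (Sum.inr γ)) 1 with he
  have hne : (normalPart m k).mulVec e = e := by
    refine idx_ext (fun a => ?_) ?_ (fun α => ?_)
    · rw [normalPart_mulVec_tangent]; simp [he]
    · rw [normalPart_mulVec_mid]; simp [he, FerusPedit.mid]
    · rw [normalPart_mulVec_normal]
  have h1 := hflat V hVD H.isOpen (fun w => (S w).mulVec e)
    (fun w hw => (H.contDiffAt_mulVec hw contDiffAt_const).contDiffWithinAt)
    (fun w hw => ⟨by rw [H.form_self hw]; simp [he, FerusPedit.mid],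
      fun i => by rw [H.form_pd hw]; simp [he]⟩) u hu i j
  obtain ⟨y, hy, hyα⟩ := H.normalDeriv_comm (x := fun _ => e) hu
    (Filter.Eventually.of_forall fun _ => contDiffAt_const)
    (Filter.Eventually.of_forall fun _ => hne) Filter.EventuallyEq.rfl i j
  rw [h1, sub_self] at hy
  have h2 : (normalPart m k).mulVec y = 0 := by
    have h3 := congrArg (S u)⁻¹.mulVec hy.symm
    rwa [Matrix.mulVec_mulVec, Matrix.nonsing_inv_mul _
      ((Matrix.isUnit_iff_isUnit_det _).1 (H.isUnit hu)), Matrix.one_mulVec,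
      Matrix.mulVec_zero] at h3
  have h3 : y (Sum.inr (Sum.inr α)) = 0 := by
    rw [← normalPart_mulVec_normal y, h2]; rfl
  rw [hyα] at h3
  have h4 : ∑ γ', normalComm S u i j α γ' * e (Sum.inr (Sum.inr γ')) = normalComm S u i j α γ := by
    simp [he, Pi.single_apply]
  linarith

end IsAdaptedFrame

/-- If the commutators of the shape operators vanish, then so does the normal curvature on every
section, by tensoriality. -/
theorem normalFlatOn_of_normalComm {N : Target} {h : EuclideanSpace ℝ (Fin m) → Idx m k → ℝ}
    {D : Set (EuclideanSpace ℝ (Fin m))}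
    (hD : ∀ u ∈ D, ∃ S V, u ∈ V ∧ IsAdaptedFrame N h S V ∧
      ∀ i j α γ, normalComm S u i j α γ = 0) : NormalFlatOn N h D := by
  intro O hOD hO ξ hξ hn u hu i j
  obtain ⟨S, V, huV, H, hzero⟩ := hD u (hOD hu)
  have hx : ∀ᶠ w in nhds u, ContDiffAt ℝ ∞ (fun w => (S w)⁻¹.mulVec (ξ w)) w := by
    filter_upwards [H.isOpen.mem_nhds huV, hO.mem_nhds hu] with w hw hwO
    exact contDiffAt_matrix_mulVec (contDiffAt_matrix_inv (H.contDiffAt hw) (H.isUnit hw))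
      (hξ.contDiffAt (hO.mem_nhds hwO))
  have hmul : ∀ w ∈ V, (S w).mulVec ((S w)⁻¹.mulVec (ξ w)) = ξ w := fun w hw => by
    rw [Matrix.mulVec_mulVec, Matrix.mul_nonsing_inv _
      ((Matrix.isUnit_iff_isUnit_det _).1 (H.isUnit hw)), Matrix.one_mulVec]
  have hxn : ∀ᶠ w in nhds u, (normalPart m k).mulVec ((S w)⁻¹.mulVec (ξ w)) =
      (S w)⁻¹.mulVec (ξ w) := by
    filter_upwards [H.isOpen.mem_nhds huV, hO.mem_nhds hu] with w hw hwO
    obtain ⟨h1, h2⟩ := hn w hwO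
    refine idx_ext (fun a => ?_) ?_ (fun α => ?_)
    · rw [normalPart_mulVec_tangent]
      refine (congrFun (H.eq_zero_of_coframe hw (x := fun a => (S w)⁻¹.mulVec (ξ w) (Sum.inl a))
        fun i => ?_) a).symm
      rw [← H.form_pd hw, hmul w hw, h2 i]
    · rw [normalPart_mulVec_mid]
      rw [← hmul w hw, H.form_self hw] at h1
      have hc := N.curv_mul_self
      linear_combination (-N.curv) * h1 + (S w)⁻¹.mulVec (ξ w) (mid m k) * hc
    · rw [normalPart_mulVec_normal]
  obtain ⟨y, hy, hyα⟩ := H.normalDeriv_comm huV hx hxn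
    (by filter_upwards [H.isOpen.mem_nhds huV] with w hw using (hmul w hw).symm) i j
  rw [← sub_eq_zero, hy]
  have h2 : (normalPart m k).mulVec y = 0 := by
    refine idx_ext (fun a => ?_) ?_ (fun α => ?_)
    · rw [normalPart_mulVec_tangent]; rfl
    · rw [normalPart_mulVec_mid]; rfl
    · rw [normalPart_mulVec_normal, hyα]
      simp [hzero]
  rw [h2, Matrix.mulVec_zero]

end NormalCurvature

/-! ### Existence of adapted frames -/

section Reflections

variable {ι : Type} [Fintype ι] [DecidableEq ι] {d : ι → ℝ}

/-- The reflection in the hyperplane orthogonal to `n` with respect to the form with diagonal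
`d`. -/
def reflection (d n : ι → ℝ) : Matrix ι ι ℝ :=
  1 - (2 / (n ⬝ᵥ (d * n))) • Matrix.vecMulVec n (d * n)

theorem reflection_orthogonal {n : ι → ℝ} (hn : n ⬝ᵥ (d * n) ≠ 0) :
    (reflection d n).transpose * Matrix.diagonal d * reflection d n = Matrix.diagonal d := by
  set c := 2 / (n ⬝ᵥ (d * n)) with hc
  set P := Matrix.vecMulVec (d * n) (d * n) with hP
  have e1 : Matrix.diagonal d * Matrix.vecMulVec n (d * n) = P := by
    rw [Matrix.mul_vecMulVec]
    congr 1
    funext i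
    rw [Matrix.mulVec_diagonal]; rfl
  have e2 : (Matrix.vecMulVec n (d * n)).transpose * P = (n ⬝ᵥ (d * n)) • P := by
    rw [Matrix.transpose_vecMulVec, hP, Matrix.vecMulVec_mul_vecMulVec]
    ext i j
    simp [Matrix.vecMulVec_apply]
    ring
  have e3 : (Matrix.vecMulVec n (d * n)).transpose * Matrix.diagonal d = P := by
    have h := congrArg Matrix.transpose e1
    rwa [Matrix.transpose_mul, Matrix.diagonal_transpose, hP, Matrix.transpose_vecMulVec (d * n) (d * n)] at h
  have hcq : c * (n ⬝ᵥ (d * n)) = 2 := by rw [hc]; field_simp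
  rw [reflection, Matrix.transpose_sub, Matrix.transpose_smul, Matrix.transpose_one, sub_mul,
    Matrix.one_mul, Matrix.smul_mul, e3, mul_sub, Matrix.mul_one, Matrix.mul_smul, sub_mul, e1,
    Matrix.smul_mul]
  have e4 : P * Matrix.vecMulVec n (d * n) = (n ⬝ᵥ (d * n)) • P := by
    have h := congrArg Matrix.transpose e2
    rwa [Matrix.transpose_mul, Matrix.transpose_transpose, Matrix.transpose_smul, hP,
      Matrix.transpose_vecMulVec] at h
  rw [e4, ← sub_eq_zero]
  have e5 : (Matrix.diagonal d - c • P - c • (P - c • (n ⬝ᵥ (d * n)) • P) - Matrix.diagonal d) =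
      (c * (c * (n ⬝ᵥ (d * n)) - 2)) • P := by module
  rw [← hc]
  refine Eq.trans ?_ (e5.trans (by rw [hcq]; simp))
  module

theorem reflection_mulVec_single (n : ι → ℝ) (i : ι) :
    (reflection d n).mulVec (Pi.single i 1) =
      Pi.single i 1 - (2 / (n ⬝ᵥ (d * n)) * (d i * n i)) • n := by
  rw [reflection, Matrix.sub_mulVec, Matrix.one_mulVec, Matrix.smul_mulVec]
  congr 1
  funext a
  simp [Matrix.mulVec_single, Matrix.vecMulVec_apply]
  ring

variable {P : Type*} [NormedAddCommGroup P] [NormedSpace ℝ P]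

theorem contDiffAt_reflection {n : P → ι → ℝ} {u : P} (hn : ContDiffAt ℝ ∞ n u)
    (hu : n u ⬝ᵥ (d * n u) ≠ 0) : ContDiffAt ℝ ∞ (fun w => reflection d (n w)) u := by
  have hni : ∀ i, ContDiffAt ℝ ∞ (fun w => n w i) u := fun i => contDiffAt_pi.1 hn i
  have hq : ContDiffAt ℝ ∞ (fun w => n w ⬝ᵥ (d * n w)) u := by
    simp only [dotProduct, Pi.mul_apply]
    exact ContDiffAt.sum fun i _ => (hni i).mul (contDiffAt_const.mul (hni i))
  refine contDiffAt_matrix fun i j => ?_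
  simp only [reflection, Matrix.sub_apply, Matrix.smul_apply, Matrix.vecMulVec_apply, smul_eq_mul,
    Pi.mul_apply]
  exact contDiffAt_const.sub ((contDiffAt_const.div hq hu).mul
    ((hni i).mul (contDiffAt_const.mul (hni j))))

/-- A smooth family of vectors `w` of the same square length as the basis vector `e_j` is the image
of `e_j` under a smooth family of pseudo-orthogonal matrices fixing each `e_i` with `w_i = 0`. -/
theorem exists_smooth_rotation (hd : ∀ i, d i * d i = 1) {w : P → ι → ℝ} {u₀ : P} (j : ι)
    (hw : ∀ᶠ u in nhds u₀, ContDiffAt ℝ ∞ w u) (hq : ∀ᶠ u in nhds u₀, w u ⬝ᵥ (d * w u) = d j) :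
    ∃ ρ : P → Matrix ι ι ℝ, ∀ᶠ u in nhds u₀, ContDiffAt ℝ ∞ ρ u ∧
      (ρ u).transpose * Matrix.diagonal d * ρ u = Matrix.diagonal d ∧
      (ρ u).mulVec (Pi.single j 1) = w u ∧
      ∀ i, i ≠ j → w u i = 0 → (ρ u).mulVec (Pi.single i 1) = Pi.single i 1 := by
  have hdj : d j ≠ 0 := fun h => by simpa [h] using hd j
  have hcont : ContinuousAt (fun u => w u j) u₀ :=
    (contDiffAt_pi.1 hw.self_of_nhds j).continuousAt
  -- the square length of `w + c e_j`
  have hlen : ∀ (c : ℝ) (x : ι → ℝ), x ⬝ᵥ (d * x) = d j → c * c = 1 →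
      (x + c • Pi.single j 1) ⬝ᵥ (d * (x + c • Pi.single j 1)) = 2 * d j * (1 + c * x j) := by
    intro c x hx hc
    have e : (x + c • Pi.single j 1) ⬝ᵥ (d * (x + c • Pi.single j 1)) =
        x ⬝ᵥ (d * x) + 2 * c * d j * x j + c * c * d j := by
      simp only [dotProduct, Pi.mul_apply, Pi.add_apply, Pi.smul_apply, smul_eq_mul]
      have e1 : ∀ i, (x i + c * (Pi.single j 1 : ι → ℝ) i) *
          (d i * (x i + c * (Pi.single j 1 : ι → ℝ) i)) =
          x i * (d i * x i) + (Pi.single j (2 * c * d j * x j + c * c * d j) : ι → ℝ) i := by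
        intro i
        by_cases hi : i = j
        · subst hi; simp; ring
        · simp [hi]
      simp only [e1, Finset.sum_add_distrib, Finset.sum_pi_single']
      simp
      ring
    rw [e, hx, hc]; ring
  -- the reflection in `w - e_j` maps `e_j` to `w`; where `w = e_j` it is undefined, and the reflection
  -- in `w + e_j` is composed with that in `e_j`
  by_cases h1 : w u₀ j = 1
  · set n : P → ι → ℝ := fun u => w u + (1 : ℝ) • Pi.single j 1 with hn
    have hne : ∀ᶠ u in nhds u₀, 1 + 1 * w u j ≠ 0 := by
      have h2 : ContinuousAt (fun u => 1 + 1 * w u j) u₀ :=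
        continuousAt_const.add (continuousAt_const.mul hcont)
      exact h2.eventually_ne (by rw [h1]; norm_num)
    have h3 : Pi.single j 1 ⬝ᵥ (d * Pi.single j 1) ≠ 0 := by simpa using hdj
    have hej : (reflection d (Pi.single j 1)).mulVec (Pi.single j 1) = -Pi.single j 1 := by
      rw [reflection_mulVec_single]
      funext a
      by_cases ha : a = j
      · subst ha; simp; field_simp; norm_num
      · simp [ha]
    refine ⟨fun u => reflection d (n u) * reflection d (Pi.single j 1), ?_⟩
    filter_upwards [hw, hq, hne] with u hu hqu hneu
    have hnq : n u ⬝ᵥ (d * n u) = 2 * d j * (1 + 1 * w u j) := hlen 1 (w u) hqu (by norm_num)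
    have hn0 : n u ⬝ᵥ (d * n u) ≠ 0 := by
      rw [hnq]; exact mul_ne_zero (mul_ne_zero two_ne_zero hdj) hneu
    refine ⟨(contDiffAt_reflection (hu.add contDiffAt_const) hn0).mul contDiffAt_const, ?_, ?_,
      fun i hij hi => ?_⟩
    · rw [Matrix.transpose_mul]
      conv_rhs => rw [← reflection_orthogonal h3, ← reflection_orthogonal hn0]
      simp only [Matrix.mul_assoc]
    · rw [← Matrix.mulVec_mulVec, hej, Matrix.mulVec_neg, reflection_mulVec_single, hnq]
      have e : 2 / (2 * d j * (1 + 1 * w u j)) * (d j * n u j) = 1 := by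
        have : n u j = 1 + 1 * w u j := by simp [hn]; ring
        rw [this, div_mul_eq_mul_div, mul_assoc 2, div_self
          (mul_ne_zero two_ne_zero (mul_ne_zero hdj hneu))]
      rw [e, hn]; simp
    · have e1 : (reflection d (Pi.single j 1)).mulVec (Pi.single i 1) = Pi.single i 1 := by
        rw [reflection_mulVec_single]; simp [hij]
      rw [← Matrix.mulVec_mulVec, e1, reflection_mulVec_single]
      simp [hn, hi, hij]
  · set n : P → ι → ℝ := fun u => w u + (-1 : ℝ) • Pi.single j 1 with hn
    have hne : ∀ᶠ u in nhds u₀, 1 + (-1) * w u j ≠ 0 := by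
      have h2 : ContinuousAt (fun u => 1 + (-1) * w u j) u₀ :=
        continuousAt_const.add (continuousAt_const.mul hcont)
      exact h2.eventually_ne (by intro h3; apply h1; linarith)
    refine ⟨fun u => reflection d (n u), ?_⟩
    filter_upwards [hw, hq, hne] with u hu hqu hneu
    have hnq : n u ⬝ᵥ (d * n u) = 2 * d j * (1 + (-1) * w u j) :=
      hlen (-1) (w u) hqu (by norm_num)
    have hn0 : n u ⬝ᵥ (d * n u) ≠ 0 := by
      rw [hnq]; exact mul_ne_zero (mul_ne_zero two_ne_zero hdj) hneu
    refine ⟨contDiffAt_reflection (hu.add contDiffAt_const) hn0, reflection_orthogonal hn0, ?_,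
      fun i hij hi => ?_⟩
    · rw [reflection_mulVec_single, hnq]
      have e : 2 / (2 * d j * (1 + (-1) * w u j)) * (d j * n u j) = -1 := by
        have : n u j = -(1 + (-1) * w u j) := by simp [hn]
        rw [this, div_mul_eq_mul_div, mul_neg, mul_neg, neg_div, mul_assoc 2, div_self
          (mul_ne_zero two_ne_zero (mul_ne_zero hdj hneu))]
      rw [e, hn]; simp
    · rw [reflection_mulVec_single]
      simp [hn, hi, hij]

end Reflections

section Existence

variable {m k : ℕ} {N : Target}

theorem Target.form_eq_dotProduct (x : Idx m k → ℝ) :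
    x ⬝ᵥ (N.signs m k * x) = N.form x x := by
  simp only [Target.form, dotProduct, Pi.mul_apply]
  exact Finset.sum_congr rfl fun i _ => by ring

theorem mul_orthogonal {ι : Type} [Fintype ι] [DecidableEq ι] {R : Type} [CommRing R]
    {J S T : Matrix ι ι R} (hS : S.transpose * J * S = J) (hT : T.transpose * J * T = J) :
    (S * T).transpose * J * (S * T) = J := by
  rw [Matrix.transpose_mul]
  conv_rhs => rw [← hT, ← hS]
  simp only [Matrix.mul_assoc]

theorem pd_form_self {h : EuclideanSpace ℝ (Fin m) → Idx m k → ℝ} {u : EuclideanSpace ℝ (Fin m)}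
    (hh : DifferentiableAt ℝ h u) (hq : ∀ᶠ w in nhds u, N.form (h w) (h w) = N.curv) (i : Fin m) :
    N.form (pd i h u) (h u) = 0 := by
  have h1 := pd_form N hh hh i
  have h2 : pd i (fun w => N.form (h w) (h w)) u = 0 := by
    have h3 : (fun w => N.form (h w) (h w)) =ᶠ[nhds u] fun _ => N.curv := hq
    rw [pd_congr h3, pd_const]
  rw [h2, N.form_comm (h u)] at h1
  linarith

/-- The Gram–Schmidt process: a moving frame whose vectors `S e_a`, for `a` in a finite set `s`,
span the same space as the coordinate vectors `∂ᵢ h` with `i ∈ s`. -/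
theorem exists_partial_frame {h : EuclideanSpace ℝ (Fin m) → Idx m k → ℝ}
    {u₀ : EuclideanSpace ℝ (Fin m)} (hh : ∀ᶠ u in nhds u₀, ContDiffAt ℝ ∞ h u)
    (hq : ∀ᶠ u in nhds u₀, N.form (h u) (h u) = N.curv)
    (hpos : ∀ᶠ u in nhds u₀, ∀ v : EuclideanSpace ℝ (Fin m), v ≠ 0 →
      0 < N.form (fderiv ℝ h u v) (fderiv ℝ h u v)) (s : Finset (Fin m)) :
    ∃ S : EuclideanSpace ℝ (Fin m) → Matrix (Idx m k) (Idx m k) ℝ, ∀ᶠ u in nhds u₀,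
      ContDiffAt ℝ ∞ S u ∧
      (S u).transpose * Matrix.diagonal (N.signs m k) * S u = Matrix.diagonal (N.signs m k) ∧
      (S u).mulVec (Pi.single (mid m k) 1) = h u ∧
      (∀ a ∈ s, (S u).mulVec (Pi.single (Sum.inl a) 1) ∈
        Submodule.span ℝ ((fun i => pd i h u) '' s)) ∧
      (∀ i ∈ s, pd i h u ∈
        Submodule.span ℝ ((fun a => (S u).mulVec (Pi.single (Sum.inl a) 1)) '' s)) := by
  induction s using Finset.induction_on with
  | empty =>
    obtain ⟨ρ, hρ⟩ := exists_smooth_rotation (d := N.signs m k) N.signs_mul_self (w := h)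
      (mid m k) hh (by
        filter_upwards [hq] with u hu
        rw [N.form_eq_dotProduct, hu]; rfl)
    refine ⟨ρ, ?_⟩
    filter_upwards [hρ] with u hu
    exact ⟨hu.1, hu.2.1, hu.2.2.1, by simp, by simp⟩
  | insert b s hb ih =>
    obtain ⟨S, hS⟩ := ih
    -- the components of `∂_b h` orthogonal to the vectors already constructed
    set keep : Idx m k → ℝ := fun i => if i = mid m k ∨ ∃ a ∈ s, i = Sum.inl a then 0 else 1
      with hkeep
    set x : EuclideanSpace ℝ (Fin m) → Idx m k → ℝ := fun u => (S u)⁻¹.mulVec (pd b h u) with hx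
    set y : EuclideanSpace ℝ (Fin m) → Idx m k → ℝ := fun u => keep * x u with hy
    have hSy : ∀ᶠ u in nhds u₀, (S u).mulVec (x u) = pd b h u ∧ (S u).mulVec (y u) = pd b h u -
        ∑ a ∈ s, x u (Sum.inl a) • (S u).mulVec (Pi.single (Sum.inl a) 1) := by
      filter_upwards [hS, hh, hq.eventually_nhds] with u hu hhu hqu
      obtain ⟨hu1, hu2, hu3, hu4, hu5⟩ := hu
      have hunit := isUnit_of_orthogonal N.signs_mul_self hu2
      have hSx : (S u).mulVec (x u) = pd b h u := by
        rw [hx, Matrix.mulVec_mulVec, Matrix.mul_nonsing_inv _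
          ((Matrix.isUnit_iff_isUnit_det _).1 hunit), Matrix.one_mulVec]
      have hmid : x u (mid m k) = 0 := by
        have h1 := pd_form_self (hhu.differentiableAt (by simp)) hqu b
        rw [← hSx, ← hu3, N.form_mulVec hu2, N.form_eq] at h1
        simp [mid] at h1
        have hc := N.curv_mul_self
        have : N.curv * (N.curv * x u (mid m k)) = 0 := by
          rcases h1 with h1 | h1
          · simp [h1]
          · change x u (mid m k) = 0 at h1
            simp [h1]
        rwa [← mul_assoc, hc, one_mul] at this
      refine ⟨hSx, ?_⟩
      have e : y u = x u - ∑ a ∈ s, x u (Sum.inl a) • (Pi.single (Sum.inl a) 1 : Idx m k → ℝ) := by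
        refine idx_ext (fun a => ?_) ?_ (fun α => ?_)
        · simp only [hy, hkeep, Pi.mul_apply, Pi.sub_apply, Finset.sum_apply, Pi.smul_apply,
            smul_eq_mul, Pi.single_apply, Sum.inl.injEq, mul_ite, mul_one, mul_zero]
          by_cases ha : a ∈ s
          · simp [ha]
          · simp [ha, mid]
        · simp only [mid] at hmid
          simp [hy, hkeep, hmid, mid]
        · simp [hy, hkeep, mid]
      rw [e, Matrix.mulVec_sub, hSx, Matrix.mulVec_sum]
      simp only [Matrix.mulVec_smul]
    have hyq : ∀ᶠ u in nhds u₀, 0 < N.form (y u) (y u) := by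
      filter_upwards [hS, hSy, hpos] with u hu hyu hpu
      obtain ⟨hu1, hu2, hu3, hu4, hu5⟩ := hu
      have h1 : ∑ a ∈ s, x u (Sum.inl a) • (S u).mulVec (Pi.single (Sum.inl a) 1) ∈
          Submodule.span ℝ ((fun i => pd i h u) '' s) :=
        Submodule.sum_mem _ fun a ha => Submodule.smul_mem _ _ (hu4 a ha)
      have h2 : (fun i => pd i h u) '' (s : Set (Fin m)) = (fderiv ℝ h u).toLinearMap ''
          ((fun i => EuclideanSpace.single i (1 : ℝ)) '' (s : Set (Fin m))) := by
        rw [Set.image_image]; rfl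
      rw [h2, Submodule.span_image] at h1
      obtain ⟨v, hv, hvu⟩ := h1
      have hvb : v b = 0 := by
        have h3 : Submodule.span ℝ ((fun i => EuclideanSpace.single i (1 : ℝ)) ''
            (s : Set (Fin m))) ≤ LinearMap.ker (EuclideanSpace.proj b :
              EuclideanSpace ℝ (Fin m) →L[ℝ] ℝ).toLinearMap := by
          rw [Submodule.span_le]
          rintro _ ⟨i, hi, rfl⟩
          have hib : b ≠ i := fun h => hb (h ▸ hi)
          simp [hib]
        exact h3 hv
      have h4 : (S u).mulVec (y u) = fderiv ℝ h u (EuclideanSpace.single b 1 - v) := by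
        rw [hyu.2, ← hvu, map_sub]; rfl
      rw [← N.form_mulVec hu2, h4]
      refine hpu _ fun h5 => ?_
      have h6 := congrArg (fun z : EuclideanSpace ℝ (Fin m) => z b) h5
      simp [hvb] at h6
    have hyd : ∀ᶠ u in nhds u₀, ContDiffAt ℝ ∞ y u := by
      filter_upwards [hS, hh] with u hu hhu
      have h1 : ContDiffAt ℝ ∞ x u := contDiffAt_matrix_mulVec
        (contDiffAt_matrix_inv hu.1 (isUnit_of_orthogonal N.signs_mul_self hu.2.1))
        (contDiffAt_pd hhu b)
      exact contDiffAt_pi.2 fun i => contDiffAt_const.mul (contDiffAt_pi.1 h1 i)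
    set w : EuclideanSpace ℝ (Fin m) → Idx m k → ℝ := fun u =>
      (Real.sqrt (N.form (y u) (y u)))⁻¹ • y u with hw
    have hwd : ∀ᶠ u in nhds u₀, ContDiffAt ℝ ∞ w u := by
      filter_upwards [hyd, hyq] with u hu hqu
      exact (((contDiffAt_form N hu hu).sqrt hqu.ne').inv (Real.sqrt_pos.2 hqu).ne').smul hu
    obtain ⟨ρ, hρ⟩ := exists_smooth_rotation (d := N.signs m k) N.signs_mul_self
      (Sum.inl b) hwd (by
        filter_upwards [hyq] with u hqu
        rw [N.form_eq_dotProduct, ← N.formBilin_apply, hw]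
        simp only [map_smul, LinearMap.smul_apply, smul_eq_mul, N.formBilin_apply]
        have h1 := Real.mul_self_sqrt hqu.le
        have h2 := (Real.sqrt_pos.2 hqu).ne'
        rw [Target.signs_tangent]
        field_simp
        nlinarith)
    refine ⟨fun u => S u * ρ u, ?_⟩
    filter_upwards [hS, hρ, hSy, hyq] with u hu hρu hSyu hqu
    obtain ⟨hu1, hu2, hu3, hu4, hu5⟩ := hu
    obtain ⟨hρ1, hρ2, hρ3, hρ4⟩ := hρu
    have hq0 := (Real.sqrt_pos.2 hqu).ne'
    have hfix : ∀ i, (i = mid m k ∨ ∃ a ∈ s, i = Sum.inl a) →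
        (S u * ρ u).mulVec (Pi.single i 1) = (S u).mulVec (Pi.single i 1) := by
      intro i hi
      rw [← Matrix.mulVec_mulVec, hρ4 i]
      · rintro rfl
        rcases hi with hi | ⟨a, ha, hi⟩
        · simp [mid] at hi
        · exact hb (Sum.inl.inj hi ▸ ha)
      · simp [hw, hy, hkeep, hi]
    have hnew : (S u * ρ u).mulVec (Pi.single (Sum.inl b) 1) =
        (Real.sqrt (N.form (y u) (y u)))⁻¹ • (S u).mulVec (y u) := by
      rw [← Matrix.mulVec_mulVec, hρ3, hw, Matrix.mulVec_smul]
    have hmono : Submodule.span ℝ ((fun i => pd i h u) '' (s : Set (Fin m))) ≤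
        Submodule.span ℝ ((fun i => pd i h u) '' (insert b s : Finset (Fin m))) :=
      Submodule.span_mono (Set.image_mono (by simp))
    have hspan : ∀ a ∈ s, (S u).mulVec (Pi.single (Sum.inl a) 1) ∈ Submodule.span ℝ
        ((fun a => (S u * ρ u).mulVec (Pi.single (Sum.inl a) 1)) ''
          (insert b s : Finset (Fin m))) := fun a ha => by
      rw [← hfix _ (Or.inr ⟨a, ha, rfl⟩)]
      exact Submodule.subset_span ⟨a, by simp [ha], rfl⟩
    refine ⟨hu1.mul hρ1, mul_orthogonal hu2 hρ2, (hfix _ (Or.inl rfl)).trans hu3, ?_, ?_⟩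
    · intro a ha
      rcases Finset.mem_insert.1 ha with rfl | ha
      · rw [hnew, hSyu.2]
        refine Submodule.smul_mem _ _ (Submodule.sub_mem _
          (Submodule.subset_span ⟨a, by simp, rfl⟩) (Submodule.sum_mem _ fun c hc => ?_))
        exact Submodule.smul_mem _ _ (hmono (hu4 c hc))
      · rw [hfix _ (Or.inr ⟨a, ha, rfl⟩)]
        exact hmono (hu4 a ha)
    · intro i hi
      rcases Finset.mem_insert.1 hi with rfl | hi
      · have e : pd i h u = Real.sqrt (N.form (y u) (y u)) •
            (S u * ρ u).mulVec (Pi.single (Sum.inl i) 1) +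
            ∑ a ∈ s, x u (Sum.inl a) • (S u).mulVec (Pi.single (Sum.inl a) 1) := by
          rw [hnew, smul_smul, mul_inv_cancel₀ hq0, one_smul, hSyu.2]; abel
        rw [e]
        exact Submodule.add_mem _ (Submodule.smul_mem _ _ (Submodule.subset_span ⟨i, by simp, rfl⟩))
          (Submodule.sum_mem _ fun a ha => Submodule.smul_mem _ _ (hspan a ha))
      · refine (Submodule.span_le.2 ?_) (hu5 i hi)
        rintro _ ⟨a, ha, rfl⟩
        exact hspan a ha

/-- Around each point there is an adapted frame: the Gram–Schmidt process is applied to all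
coordinate vectors. -/
theorem exists_adaptedFrame {h : EuclideanSpace ℝ (Fin m) → Idx m k → ℝ}
    {D : Set (EuclideanSpace ℝ (Fin m))} (hD : IsOpen D) (hh : ContDiffOn ℝ ∞ h D)
    (hq : ∀ u ∈ D, N.form (h u) (h u) = N.curv)
    (hpos : ∀ u ∈ D, ∀ v : EuclideanSpace ℝ (Fin m), v ≠ 0 →
      0 < N.form (fderiv ℝ h u v) (fderiv ℝ h u v))
    {u₀ : EuclideanSpace ℝ (Fin m)} (hu₀ : u₀ ∈ D) :
    ∃ S V, u₀ ∈ V ∧ V ⊆ D ∧ IsAdaptedFrame N h S V := by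
  have hDn := hD.mem_nhds hu₀
  obtain ⟨S, hS⟩ := exists_partial_frame (N := N) (h := h) (u₀ := u₀)
    (by filter_upwards [hDn] with u hu using hh.contDiffAt (hD.mem_nhds hu))
    (by filter_upwards [hDn] with u hu using hq u hu)
    (by filter_upwards [hDn] with u hu using hpos u hu) Finset.univ
  obtain ⟨V, hVS, hVo, hV0⟩ := eventually_nhds_iff.1 (hS.and hDn)
  have hcol : ∀ u ∈ V, ∀ i, S u i (mid m k) = h u i := fun u hu i => by
    rw [← (hVS u hu).1.2.2.1]; simp [Matrix.mulVec_single]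
  have hunit : ∀ u ∈ V, IsUnit (S u) := fun u hu =>
    isUnit_of_orthogonal N.signs_mul_self (hVS u hu).1.2.1
  have hcomp : ∀ u ∈ V, ∀ i, (fun a => conn S i u a (mid m k)) = (S u)⁻¹.mulVec (pd i h u) := by
    intro u hu i
    have hd := (hVS u hu).1.1.differentiableAt (n := ∞) (by simp)
    have e : (fun a => pd i S u a (mid m k)) = pd i h u := by
      have hhd : DifferentiableAt ℝ h u := (hh.contDiffAt (hD.mem_nhds (hVS u hu).2)).differentiableAt
        (by simp)
      funext a
      rw [← pd_entry hd, ← pd_pi hhd]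
      refine pd_congr ?_ i
      filter_upwards [hVo.mem_nhds hu] with w hw using hcol w hw a
    rw [← e]
    funext a
    simp [conn, Matrix.mul_apply, Matrix.mulVec, dotProduct]
  have hnormal : ∀ u ∈ V, ∀ i (b : Idx m k), (∀ a, b ≠ Sum.inl a) → conn S i u b (mid m k) = 0 := by
    intro u hu i b hb
    have h1 := congrFun (hcomp u hu i) b
    rw [h1]
    have h2 : Submodule.span ℝ ((fun a => (S u).mulVec (Pi.single (Sum.inl a) 1)) ''
        ((Finset.univ : Finset (Fin m)) : Set (Fin m))) ≤ LinearMap.ker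
          ((LinearMap.proj b : (Idx m k → ℝ) →ₗ[ℝ] ℝ).comp (Matrix.mulVecLin (S u)⁻¹)) := by
      rw [Submodule.span_le]
      rintro _ ⟨a, -, rfl⟩
      simp only [SetLike.mem_coe, LinearMap.mem_ker, LinearMap.comp_apply, Matrix.mulVecLin_apply,
        LinearMap.proj_apply]
      rw [Matrix.mulVec_mulVec, Matrix.nonsing_inv_mul _
        ((Matrix.isUnit_iff_isUnit_det _).1 (hunit u hu)), Matrix.one_mulVec]
      simp [hb a]
    exact h2 ((hVS u hu).1.2.2.2.2 i (Finset.mem_univ i))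
  refine ⟨S, V, hV0, fun u hu => (hVS u hu).2, hVo,
    fun u hu => (hVS u hu).1.1.contDiffWithinAt, fun u hu => (hVS u hu).1.2.1,
    fun u hu i => (hcol u hu i).symm, fun u hu i α => hnormal u hu i _ (by simp),
    fun u hu => ?_⟩
  rw [← Matrix.vecMul_injective_iff_isUnit]
  refine (injective_iff_map_eq_zero (Matrix.vecMulLinear (coframe S u))).2 fun c hc => ?_
  by_contra hc0
  have hv : (WithLp.toLp 2 c : EuclideanSpace ℝ (Fin m)) ≠ 0 := fun h0 => hc0 (by
    funext i; exact congrArg (fun z : EuclideanSpace ℝ (Fin m) => z i) h0)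
  have h1 := hpos u (hVS u hu).2 _ hv
  have h2 : fderiv ℝ h u (WithLp.toLp 2 c) = 0 := by
    rw [fderiv_apply_eq_sum_pd]
    have h3 : ∀ i, pd i h u = (S u).mulVec (fun a => conn S i u a (mid m k)) := fun i => by
      rw [hcomp u hu i, Matrix.mulVec_mulVec, Matrix.mul_nonsing_inv _
        ((Matrix.isUnit_iff_isUnit_det _).1 (hunit u hu)), Matrix.one_mulVec]
    have h4 : ∑ i, c i • (fun a => conn S i u a (mid m k)) = 0 := by
      refine idx_ext (fun a => ?_) ?_ (fun α => ?_)
      · have h5 := congrFun hc a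
        simpa [Matrix.vecMul, dotProduct, coframe] using h5
      · simp [hnormal u hu _ (mid m k) (by simp [mid])]
      · simp [hnormal u hu _ (Sum.inr (Sum.inr α)) (by simp)]
    simp only [h3, ← Matrix.mulVec_smul, ← Matrix.mulVec_sum]
    exact (congrArg (S u).mulVec h4).trans (Matrix.mulVec_zero _)
  rw [h2] at h1
  simp [Target.form] at h1

end Existence

/-! ### The range of the curvature -/

section CurvatureRange

theorem Axis.add_inv_ne_zero {a : Axis} {z : ℂˣ} (hz : z ∈ a.range) : (z : ℂ) + (z : ℂ)⁻¹ ≠ 0 := by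
  intro h
  have hz0 := z.ne_zero
  have h1 : ((z : ℂ) - Complex.I) * ((z : ℂ) + Complex.I) = 0 := by
    field_simp at h
    linear_combination h - Complex.I_mul_I
  have h2 : (z : ℂ) = Complex.I ∨ (z : ℂ) = -Complex.I := by
    rcases mul_eq_zero.1 h1 with h1 | h1
    · exact Or.inl (sub_eq_zero.1 h1)
    · exact Or.inr (eq_neg_of_add_eq_zero_left h1)
  cases a
  · exact h2.elim hz.2.1 hz.2.2
  · have h3 : (z : ℂ).im = 0 := hz
    rcases h2 with h2 | h2 <;> rw [h2] at h3 <;> simp at h3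
  · exact h2.elim hz.2.1 hz.2.2

/-- `4 / (λ + λ⁻¹)²`, the value of the curvature up to the sign of the target. -/
def curvScale (z : ℂˣ) : ℝ := (4 / ((z : ℂ) + (z : ℂ)⁻¹) ^ 2).re

theorem curvAt_eq (N : Target) (z : ℂˣ) : curvAt N z = N.curv * curvScale z := by
  rw [curvAt, curvScale, mul_div_assoc, ← Complex.re_ofReal_mul]

theorem Axis.exists_imag {z : ℂˣ} (hz : z ∈ Axis.imag.range) :
    ∃ y : ℝ, y ≠ 0 ∧ y ^ 2 ≠ 1 ∧ (z : ℂ) = y * Complex.I := by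
  obtain ⟨h1, h2, h3⟩ := hz
  have e : (z : ℂ) = ((z : ℂ).im : ℂ) * Complex.I := by
    apply Complex.ext <;> simp [h1]
  refine ⟨(z : ℂ).im, fun h => z.ne_zero (by rw [e, h]; simp), fun h => ?_, e⟩
  rcases eq_or_eq_neg_of_sq_eq_sq _ 1 (h.trans (one_pow 2).symm) with h | h
  · exact h2 (by rw [e, h]; simp)
  · exact h3 (by rw [e, h]; simp)

theorem Axis.exists_real {z : ℂˣ} (hz : z ∈ Axis.real.range) :
    ∃ x : ℝ, x ≠ 0 ∧ (z : ℂ) = x := by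
  have h : (z : ℂ).im = 0 := hz
  have e : (z : ℂ) = ((z : ℂ).re : ℂ) := by apply Complex.ext <;> simp [h]
  exact ⟨(z : ℂ).re, fun h => z.ne_zero (by rw [e, h]; simp), e⟩

theorem Axis.inv_circle {z : ℂˣ} (hz : z ∈ Axis.circle.range) :
    (z : ℂ)⁻¹ = starRingEnd ℂ (z : ℂ) := by
  have h : ‖(z : ℂ)‖ = 1 := hz.1
  rw [Complex.inv_def, Complex.normSq_eq_norm_sq, h]
  simp

theorem curvScale_image_imag : curvScale '' Axis.imag.range = Set.Iio 0 := by
  have key : ∀ (z : ℂˣ) (y : ℝ), y ≠ 0 → (z : ℂ) = y * Complex.I →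
      curvScale z = -(4 / (y - y⁻¹) ^ 2) := by
    intro z y hy hz
    have e : (z : ℂ) + (z : ℂ)⁻¹ = ((y - y⁻¹ : ℝ) : ℂ) * Complex.I := by
      rw [hz, mul_inv, Complex.inv_I]; push_cast; ring
    have e2 : (4 / ((z : ℂ) + (z : ℂ)⁻¹) ^ 2) = ((-(4 / (y - y⁻¹) ^ 2) : ℝ) : ℂ) := by
      rw [e, mul_pow, Complex.I_sq]; push_cast; rw [mul_neg_one, div_neg]
    rw [curvScale, e2, Complex.ofReal_re]
  ext c
  constructor
  · rintro ⟨z, hz, rfl⟩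
    obtain ⟨y, hy, hy1, hzy⟩ := Axis.exists_imag hz
    rw [key z y hy hzy]
    have h : y - y⁻¹ ≠ 0 := by
      intro h
      field_simp at h
      exact hy1 (by linarith)
    simp only [Set.mem_Iio, neg_lt_zero]
    positivity
  · intro hc
    have hc : c < 0 := hc
    set t := Real.sqrt (-(4 / c)) with ht
    have hpos : 0 < -(4 / c) := by
      rw [← div_neg]; exact div_pos (by norm_num) (by linarith)
    have ht0 : 0 < t := Real.sqrt_pos.2 hpos
    have ht2 : t ^ 2 = -(4 / c) := Real.sq_sqrt hpos.le
    set r := Real.sqrt (t ^ 2 + 4) with hr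
    have hr2 : r ^ 2 = t ^ 2 + 4 := Real.sq_sqrt (by positivity)
    have hr0 : 0 ≤ r := Real.sqrt_nonneg _
    set y := (t + r) / 2 with hy
    have hy0 : 0 < y := by positivity
    have hyt : y - y⁻¹ = t := by
      have h1 : y * (y - t) = 1 := by rw [hy]; nlinarith
      have h2 : y⁻¹ = y - t := (eq_inv_of_mul_eq_one_right h1).symm
      rw [h2]; ring
    have hy1 : y ≠ 1 := fun h => by rw [h] at hyt; norm_num at hyt; linarith
    have hyI : (y : ℂ) * Complex.I ≠ 0 := by simp [hy0.ne']
    refine ⟨Units.mk0 _ hyI, ⟨by simp, fun h => hy1 ?_, fun h => ?_⟩, ?_⟩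
    · have h' := congrArg Complex.im h
      simpa using h'
    · have h' := congrArg Complex.im h
      simp at h'
      linarith
    · rw [key _ y hy0.ne' rfl, hyt, ht2]
      field_simp
  
theorem curvScale_image_real : curvScale '' Axis.real.range = Set.Ioc 0 1 := by
  have key : ∀ (z : ℂˣ) (x : ℝ), (z : ℂ) = x → curvScale z = 4 / (x + x⁻¹) ^ 2 := by
    intro z x hz
    have e2 : (4 / ((z : ℂ) + (z : ℂ)⁻¹) ^ 2) = ((4 / (x + x⁻¹) ^ 2 : ℝ) : ℂ) := by
      rw [hz]; push_cast; rfl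
    rw [curvScale, e2, Complex.ofReal_re]
  ext c
  constructor
  · rintro ⟨z, hz, rfl⟩
    obtain ⟨x, hx, hzx⟩ := Axis.exists_real hz
    rw [key z x hzx]
    have h : 4 ≤ (x + x⁻¹) ^ 2 := by
      have h1 : (x + x⁻¹) ^ 2 = (x - x⁻¹) ^ 2 + 4 := by field_simp; ring
      rw [h1]; nlinarith [sq_nonneg (x - x⁻¹)]
    have h0 : 0 < (x + x⁻¹) ^ 2 := by linarith
    exact ⟨by positivity, (div_le_one h0).2 h⟩
  · rintro ⟨hc, hc1⟩
    set t := Real.sqrt (4 / c) with ht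
    have hpos : 0 < 4 / c := by positivity
    have ht0 : 0 < t := Real.sqrt_pos.2 hpos
    have ht2 : t ^ 2 = 4 / c := Real.sq_sqrt hpos.le
    have ht4 : 4 ≤ t ^ 2 := by rw [ht2, le_div_iff₀ hc]; linarith
    set r := Real.sqrt (t ^ 2 - 4) with hr
    have hr2 : r ^ 2 = t ^ 2 - 4 := Real.sq_sqrt (by linarith)
    have hr0 : 0 ≤ r := Real.sqrt_nonneg _
    set x := (t + r) / 2 with hx
    have hx0 : 0 < x := by positivity
    have hxt : x + x⁻¹ = t := by
      have h1 : x * (t - x) = 1 := by rw [hx]; nlinarith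
      have h2 : x⁻¹ = t - x := (eq_inv_of_mul_eq_one_right h1).symm
      rw [h2]; ring
    have hxC : (x : ℂ) ≠ 0 := by simpa using hx0.ne'
    refine ⟨Units.mk0 _ hxC, by simp [Axis.range], ?_⟩
    rw [key _ x rfl, hxt, ht2]
    field_simp

theorem curvScale_image_circle : curvScale '' Axis.circle.range = Set.Ici 1 := by
  have key : ∀ z : ℂˣ, (z : ℂ)⁻¹ = starRingEnd ℂ (z : ℂ) →
      curvScale z = 1 / (z : ℂ).re ^ 2 := by
    intro z hz
    have e2 : (4 / ((z : ℂ) + (z : ℂ)⁻¹) ^ 2) = ((1 / (z : ℂ).re ^ 2 : ℝ) : ℂ) := by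
      rw [hz, Complex.add_conj]
      push_cast
      rw [mul_pow, div_mul_eq_div_div]
      norm_num
    rw [curvScale, e2, Complex.ofReal_re]
  ext c
  constructor
  · rintro ⟨z, hz, rfl⟩
    rw [key z (Axis.inv_circle hz)]
    have h0 := Axis.add_inv_ne_zero hz
    rw [Axis.inv_circle hz, Complex.add_conj] at h0
    have h1 : (z : ℂ).re ≠ 0 := fun h => h0 (by simp [h])
    have h2 : |(z : ℂ).re| ≤ 1 := by
      have := Complex.abs_re_le_norm (z : ℂ)
      rwa [hz.1] at this
    have h3 : (z : ℂ).re ^ 2 ≤ 1 := (sq_le_one_iff_abs_le_one _).2 h2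
    have h4 : 0 < (z : ℂ).re ^ 2 := by positivity
    exact (one_le_div h4).2 h3
  · intro hc
    have hc : 1 ≤ c := hc
    set t := (Real.sqrt c)⁻¹ with ht
    have hs0 : 0 < Real.sqrt c := Real.sqrt_pos.2 (by linarith)
    have ht2 : t ^ 2 = c⁻¹ := by rw [ht, inv_pow, Real.sq_sqrt (by linarith)]
    have ht0 : 0 < t := inv_pos.2 hs0
    have ht1 : t ^ 2 ≤ 1 := by rw [ht2]; exact inv_le_one_of_one_le₀ hc
    set r := Real.sqrt (1 - t ^ 2) with hr
    have hr2 : r ^ 2 = 1 - t ^ 2 := Real.sq_sqrt (by linarith)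
    have hz0 : (⟨t, r⟩ : ℂ) ≠ 0 := fun h => ht0.ne' (congrArg Complex.re h)
    have hnorm : ‖(⟨t, r⟩ : ℂ)‖ = 1 := by
      rw [← pow_left_inj₀ (norm_nonneg _) zero_le_one two_ne_zero, ← Complex.normSq_eq_norm_sq,
        Complex.normSq_mk]
      linarith
    have hmem : Units.mk0 _ hz0 ∈ Axis.circle.range :=
      ⟨hnorm, fun h => ht0.ne' (by have := congrArg Complex.re h; simpa using this),
        fun h => ht0.ne' (by have := congrArg Complex.re h; simpa using this)⟩
    refine ⟨Units.mk0 _ hz0, hmem, ?_⟩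
    rw [key _ (Axis.inv_circle hmem)]
    change 1 / t ^ 2 = c
    rw [ht2]; simp

/-- The curvatures realised on a parameter range. -/
theorem curvAt_image (C : FPCase) (a : Axis) :
    curvAt (target C a) '' a.range = curvRange C a := by
  have pos : ∀ N : Target, N.curv = 1 → curvAt N '' a.range = curvScale '' a.range := by
    intro N hN
    refine Set.image_congr fun z _ => ?_
    rw [curvAt_eq, hN, one_mul]
  have neg : ∀ N : Target, N.curv = -1 →
      curvAt N '' a.range = (fun x => -x) '' (curvScale '' a.range) := by
    intro N hN
    rw [Set.image_image]
    refine Set.image_congr fun z _ => ?_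
    rw [curvAt_eq, hN, neg_one_mul]
  cases C <;> cases a <;>
    first
      | (rw [pos _ rfl]; simp only [curvScale_image_imag, curvScale_image_real,
          curvScale_image_circle, curvRange])
      | (rw [neg _ rfl]; simp [curvScale_image_imag, curvScale_image_real,
          curvScale_image_circle, curvRange])

/-- On the parameter ranges the curvature formula holds over `ℂ`. -/
theorem ofReal_curvScale {a : Axis} {z : ℂˣ} (hz : z ∈ a.range) :
    (curvScale z : ℂ) = 4 / ((z : ℂ) + (z : ℂ)⁻¹) ^ 2 := by
  have h : starRingEnd ℂ (4 / ((z : ℂ) + (z : ℂ)⁻¹) ^ 2) = 4 / ((z : ℂ) + (z : ℂ)⁻¹) ^ 2 := by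
    have h4 : starRingEnd ℂ 4 = 4 := Complex.conj_ofNat 4
    rw [map_div₀, h4, map_pow, map_add, map_inv₀]
    congr 1
    cases a
    · obtain ⟨y, -, -, hy⟩ := Axis.exists_imag hz
      rw [hy]; simp only [map_mul, Complex.conj_ofReal, Complex.conj_I]; rw [mul_neg, inv_neg]; ring
    · obtain ⟨x, -, hx⟩ := Axis.exists_real hz
      rw [hx]; simp
    · rw [← Axis.inv_circle hz]; simp [add_comm]
  exact Complex.conj_eq_iff_re.1 h

end CurvatureRange

/-! ### Real forms of the loops on the parameter ranges -/

section Signs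

variable (m k : ℕ) (C : FPCase) (a : Axis)

/-- The diagonal of `P`. -/
def signP : Idx m k → ℂ := diag3 m k 1 (-1) (-1)

/-- The diagonal of `Q`. -/
def signQ : Idx m k → ℂ := diag3 m k 1 1 (-1)

/-- The exponents `(e, f)` for which the reality involution of the case `C` acts on the parameter
range `a` as the `e`-th power of `λ ↦ -λ` followed by the `f`-th power of `λ ↦ λ⁻¹`. -/
def axisFlip : FPCase → Axis → ℕ × ℕ
  | .one, .imag => (0, 0)
  | .one, .real => (1, 0)
  | .one, .circle => (1, 1)
  | .two, .imag => (1, 0)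
  | .two, .real => (0, 0)
  | .two, .circle => (0, 1)
  | .three, .imag => (1, 1)
  | .three, .real => (0, 1)
  | .three, .circle => (0, 0)
  | .four, .imag => (1, 0)
  | .four, .real => (0, 0)
  | .four, .circle => (0, 1)

/-- The diagonal of the matrix `R = P^e Q^f` with `conj X(λ) = R X(λ) R` for all loops `X` and all
`λ` in the parameter range. -/
def axisSign (i : Idx m k) : ℂ :=
  signP m k i ^ (axisFlip C a).1 * signQ m k i ^ (axisFlip C a).2

variable {m k}

theorem signP_mul_self (i : Idx m k) : signP m k i * signP m k i = 1 :=
  diag3_mul_self m k i (by norm_num) (by norm_num)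

theorem signQ_mul_self (i : Idx m k) : signQ m k i * signQ m k i = 1 :=
  diag3_mul_self m k i (by norm_num) (by norm_num)

theorem axisSign_mul_self (i : Idx m k) : axisSign m k C a i * axisSign m k C a i = 1 := by
  have h : axisSign m k C a i * axisSign m k C a i =
      (signP m k i * signP m k i) ^ (axisFlip C a).1 *
        (signQ m k i * signQ m k i) ^ (axisFlip C a).2 := by
    rw [axisSign, mul_pow, mul_pow]; ring
  rw [h, signP_mul_self, signQ_mul_self, one_pow, one_pow, one_mul]

theorem conjDiag_ne_zero (i : Idx m k) : conjDiag m k C a i ≠ 0 := by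
  cases C <;> cases a <;> rcases i with i | i | i <;> simp [conjDiag, diag3]

theorem conj_conjDiag : ∃ e : ℂ, e * e = 1 ∧ ∀ i : Idx m k,
    starRingEnd ℂ (conjDiag m k C a i) = e * axisSign m k C a i * conjDiag m k C a i := by
  have h : ∀ e : ℂ, e * e = 1 → (∀ i : Idx m k,
    starRingEnd ℂ (conjDiag m k C a i) = e * axisSign m k C a i * conjDiag m k C a i) →
    ∃ e : ℂ, e * e = 1 ∧ ∀ i : Idx m k,
    starRingEnd ℂ (conjDiag m k C a i) = e * axisSign m k C a i * conjDiag m k C a i :=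
    fun e he h => ⟨e, he, h⟩
  cases C <;> cases a <;>
  first
    | (refine h 1 (by norm_num) fun i => ?_; rcases i with i | i | i <;>
        simp [conjDiag, diag3, axisSign, axisFlip, signP, signQ]; done)
    | (refine h (-1) (by norm_num) fun i => ?_; rcases i with i | i | i <;>
        simp [conjDiag, diag3, axisSign, axisFlip, signP, signQ])

theorem conj_conjDiag_div (i j : Idx m k) :
    starRingEnd ℂ (conjDiag m k C a i * (conjDiag m k C a j)⁻¹) =
      axisSign m k C a i * axisSign m k C a j *
        (conjDiag m k C a i * (conjDiag m k C a j)⁻¹) := by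
  obtain ⟨e, he, h⟩ := conj_conjDiag (m := m) (k := k) C a
  have hr := axisSign_mul_self (m := m) (k := k) C a j
  have h1 : (axisSign m k C a j)⁻¹ = axisSign m k C a j := inv_eq_of_mul_eq_one_right hr
  have h2 : e⁻¹ = e := inv_eq_of_mul_eq_one_right he
  rw [map_mul, map_inv₀, h, h, mul_inv, mul_inv, h1, h2]
  linear_combination (axisSign m k C a i * axisSign m k C a j *
        (conjDiag m k C a i * (conjDiag m k C a j)⁻¹)) * he

/-- The form preserved by the complex group and the ambient form of the target agree after the
conjugation by `T`, up to a common sign. -/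
theorem conjDiag_signs : ∃ e : ℂ, e * e = 1 ∧ ∀ i : Idx m k, diag3 m k 1 C.eps 1 i =
    conjDiag m k C a i * (e * ((target C a).signs m k i : ℂ)) * conjDiag m k C a i := by
  have h : ∀ e : ℂ, e * e = 1 → (∀ i : Idx m k, diag3 m k 1 C.eps 1 i =
    conjDiag m k C a i * (e * ((target C a).signs m k i : ℂ)) * conjDiag m k C a i) →
    ∃ e : ℂ, e * e = 1 ∧ ∀ i : Idx m k, diag3 m k 1 C.eps 1 i =
    conjDiag m k C a i * (e * ((target C a).signs m k i : ℂ)) * conjDiag m k C a i :=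
    fun e he h => ⟨e, he, h⟩
  cases C <;> cases a <;>
  first
    | (refine h 1 (by norm_num) fun i => ?_; rcases i with i | i | i <;>
        simp [conjDiag, diag3, FPCase.eps, target, Target.signs, Target.curv,
          Target.normalSign]; done)
    | (refine h (-1) (by norm_num) fun i => ?_; rcases i with i | i | i <;>
        simp [conjDiag, diag3, FPCase.eps, target, Target.signs, Target.curv,
          Target.normalSign])

theorem star_eq_of_mem {z : ℂˣ} (hz : z ∈ a.range) :
    star z = match a with
      | .imag => -z
      | .real => z
      | .circle => z⁻¹ := by
  apply Units.ext
  cases a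
  · obtain ⟨y, -, -, hy⟩ := Axis.exists_imag hz
    simp [hy]
  · obtain ⟨x, -, hx⟩ := Axis.exists_real hz
    simp [hx]
  · simp only [Units.val_inv_eq_inv_val, Axis.inv_circle hz]
    rfl

/-- How the reality involution acts on functions with the symmetries of matrix entries. -/
theorem refl_apply_of_mem {z : ℂˣ} (hz : z ∈ a.range) (φ : ℂˣ → ℂ) {p q : ℂ}
    (hp : ∀ z, φ (-z) = p * φ z) (hq : ∀ z, φ z⁻¹ = q * φ z) :
    φ (C.refl z) = p ^ (axisFlip C a).1 * q ^ (axisFlip C a).2 * φ z := by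
  have h := star_eq_of_mem a hz
  cases C <;> cases a <;> simp only at h <;>
    simp [FPCase.refl, h, axisFlip, hp, hq, inv_neg]
  all_goals ring

end Signs

section Entries

variable {m k : ℕ} {C : FPCase} {a : Axis}

theorem loop_neg {X : ℂˣ → Matrix.SpecialLinearGroup (Idx m k) ℂ} (hX : X ∈ loopGroup m k C)
    (z : ℂˣ) (i j : Idx m k) :
    (X (-z)).1 i j = signP m k i * signP m k j * (X z).1 i j := by
  have h := congrFun (congrFun (hX.2.2.1 z) i) j
  rw [Matrix.mul_diagonal, Matrix.diagonal_mul] at h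
  have h1 := signP_mul_self i
  have h2 := signP_mul_self j
  simp only [signP] at *
  rw [← h]
  linear_combination (-(X (-z)).1 i j * diag3 m k (1 : ℂ) (-1) (-1) j *
    diag3 m k (1 : ℂ) (-1) (-1) j) * h1 - (X (-z)).1 i j * h2

theorem loop_inv {X : ℂˣ → Matrix.SpecialLinearGroup (Idx m k) ℂ} (hX : X ∈ loopGroup m k C)
    (z : ℂˣ) (i j : Idx m k) :
    (X z⁻¹).1 i j = signQ m k i * signQ m k j * (X z).1 i j := by
  have h := congrFun (congrFun (hX.2.2.2.1 z) i) j
  rw [Matrix.mul_diagonal, Matrix.diagonal_mul] at h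
  have h1 := signQ_mul_self i
  have h2 := signQ_mul_self j
  simp only [signQ] at *
  rw [← h]
  linear_combination (-(X z⁻¹).1 i j * diag3 m k (1 : ℂ) 1 (-1) j *
    diag3 m k (1 : ℂ) 1 (-1) j) * h1 - (X z⁻¹).1 i j * h2

/-- On the parameter range a loop is real up to conjugation by the signs `R`. -/
theorem loop_conj {X : ℂˣ → Matrix.SpecialLinearGroup (Idx m k) ℂ} (hX : X ∈ loopGroup m k C)
    {z : ℂˣ} (hz : z ∈ a.range) (i j : Idx m k) :
    starRingEnd ℂ ((X z).1 i j) = axisSign m k C a i * axisSign m k C a j * (X z).1 i j := by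
  have h1 := refl_apply_of_mem C a hz (fun z => (X z).1 i j) (fun z => loop_neg hX z i j)
    (fun z => loop_inv hX z i j)
  have h2 := congrFun (congrFun (hX.2.2.2.2 z) i) j
  rw [Matrix.map_apply, h1] at h2
  have h3 := congrArg (starRingEnd ℂ) h2
  rw [Complex.conj_conj] at h3
  rw [← h3, axisSign, axisSign, mul_pow, mul_pow]
  ring

/-- The real form `T X(λ) T⁻¹` of a loop at a parameter of the given range. -/
def realForm (C : FPCase) (a : Axis) (X : Matrix (Idx m k) (Idx m k) ℂ) :
    Matrix (Idx m k) (Idx m k) ℝ :=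
  Matrix.of fun i j => (conjDiag m k C a i * X i j * (conjDiag m k C a j)⁻¹).re

/-- The conjugation by `T` makes the values of the loop on the parameter range real. -/
theorem ofReal_realForm {X : Matrix (Idx m k) (Idx m k) ℂ}
    (hX : ∀ i j, starRingEnd ℂ (X i j) = axisSign m k C a i * axisSign m k C a j * X i j)
    (i j : Idx m k) :
    (realForm C a X i j : ℂ) = conjDiag m k C a i * X i j * (conjDiag m k C a j)⁻¹ := by
  refine Complex.conj_eq_iff_re.1 ?_
  have e : conjDiag m k C a i * X i j * (conjDiag m k C a j)⁻¹ =
      conjDiag m k C a i * (conjDiag m k C a j)⁻¹ * X i j := by ring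
  have h1 := axisSign_mul_self (m := m) (k := k) C a i
  have h2 := axisSign_mul_self (m := m) (k := k) C a j
  rw [e, map_mul, conj_conjDiag_div, hX]
  linear_combination (conjDiag m k C a i * (conjDiag m k C a j)⁻¹ * X i j) * h2 +
    (conjDiag m k C a i * (conjDiag m k C a j)⁻¹ * X i j * axisSign m k C a j *
      axisSign m k C a j) * h1

/-- Conjugation by a diagonal matrix carries one diagonal form to another. -/
theorem orthogonal_diagonal_conj {ι : Type} [Fintype ι] [DecidableEq ι] {t d e : ι → ℂ}
    (ht : ∀ i, t i ≠ 0) (hd : ∀ i, d i = t i * e i * t i) {X : Matrix ι ι ℂ}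
    (hX : X.transpose * Matrix.diagonal d * X = Matrix.diagonal d) :
    (Matrix.diagonal t * X * Matrix.diagonal (fun i => (t i)⁻¹)).transpose * Matrix.diagonal e *
      (Matrix.diagonal t * X * Matrix.diagonal (fun i => (t i)⁻¹)) = Matrix.diagonal e := by
  have h1 : Matrix.diagonal t * Matrix.diagonal e * Matrix.diagonal t = Matrix.diagonal d := by
    rw [Matrix.diagonal_mul_diagonal, Matrix.diagonal_mul_diagonal]
    congr 1
    funext i
    rw [hd]
  calc _ = Matrix.diagonal (fun i => (t i)⁻¹) *
        (X.transpose * (Matrix.diagonal t * Matrix.diagonal e * Matrix.diagonal t) * X) *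
        Matrix.diagonal (fun i => (t i)⁻¹) := by
        simp only [Matrix.transpose_mul, Matrix.diagonal_transpose, Matrix.mul_assoc]
    _ = _ := by
        rw [h1, hX, Matrix.diagonal_mul_diagonal, Matrix.diagonal_mul_diagonal]
        congr 1
        funext i
        rw [hd]
        have := ht i
        field_simp

theorem map_ofReal_injective {ι : Type} :
    Function.Injective (fun X : Matrix ι ι ℝ => X.map (fun x : ℝ => (x : ℂ))) :=
  Matrix.map_injective Complex.ofReal_injective

theorem map_ofReal_mul {ι : Type} [Fintype ι] (X Y : Matrix ι ι ℝ) :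
    (X * Y).map (fun x : ℝ => (x : ℂ)) = X.map (fun x : ℝ => (x : ℂ)) *
      Y.map (fun x : ℝ => (x : ℂ)) :=
  Matrix.map_mul (f := Complex.ofRealHom)

theorem map_ofReal_diagonal {ι : Type} [DecidableEq ι] (d : ι → ℝ) :
    (Matrix.diagonal d).map (fun x : ℝ => (x : ℂ)) = Matrix.diagonal (fun i => (d i : ℂ)) :=
  Matrix.diagonal_map Complex.ofReal_zero

theorem orthogonal_iff_map {ι : Type} [Fintype ι] [DecidableEq ι] {d : ι → ℝ} {S : Matrix ι ι ℝ} :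
    S.transpose * Matrix.diagonal d * S = Matrix.diagonal d ↔
    (S.map (fun x : ℝ => (x : ℂ))).transpose * Matrix.diagonal (fun i => (d i : ℂ)) *
      S.map (fun x : ℝ => (x : ℂ)) = Matrix.diagonal (fun i => (d i : ℂ)) := by
  rw [← map_ofReal_diagonal, ← Matrix.transpose_map, ← map_ofReal_mul, ← map_ofReal_mul]
  exact map_ofReal_injective.eq_iff.symm

theorem smul_orthogonal {ι : Type} [Fintype ι] [DecidableEq ι] {d : ι → ℂ} {e : ℂ} (he : e ≠ 0)
    {X : Matrix ι ι ℂ} : X.transpose * Matrix.diagonal (fun i => e * d i) * X =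
      Matrix.diagonal (fun i => e * d i) ↔
      X.transpose * Matrix.diagonal d * X = Matrix.diagonal d := by
  have h : Matrix.diagonal (fun i => e * d i) = e • Matrix.diagonal d := by
    rw [← Matrix.diagonal_smul]; rfl
  rw [h, Matrix.mul_smul, Matrix.smul_mul]
  exact (smul_right_injective _ he).eq_iff

theorem map_realForm {X : Matrix (Idx m k) (Idx m k) ℂ}
    (hX : ∀ i j, starRingEnd ℂ (X i j) = axisSign m k C a i * axisSign m k C a j * X i j) :
    (realForm C a X).map (fun x : ℝ => (x : ℂ)) = Matrix.diagonal (conjDiag m k C a) * X *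
      Matrix.diagonal (fun i => (conjDiag m k C a i)⁻¹) := by
  ext i j
  rw [Matrix.map_apply, ofReal_realForm hX, Matrix.mul_diagonal, Matrix.diagonal_mul]

/-- The real form preserves the ambient form of the target. -/
theorem realForm_orthogonal {X : Matrix (Idx m k) (Idx m k) ℂ}
    (hX : ∀ i j, starRingEnd ℂ (X i j) = axisSign m k C a i * axisSign m k C a j * X i j)
    (hJ : X.transpose * Matrix.diagonal (diag3 m k 1 C.eps 1) * X =
      Matrix.diagonal (diag3 m k 1 C.eps 1)) :
    (realForm C a X).transpose * Matrix.diagonal ((target C a).signs m k) * realForm C a X =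
      Matrix.diagonal ((target C a).signs m k) := by
  obtain ⟨e, he, h⟩ := conjDiag_signs (m := m) (k := k) C a
  have he0 : e ≠ 0 := fun h0 => by simp [h0] at he
  rw [orthogonal_iff_map, map_realForm hX, ← smul_orthogonal he0]
  exact orthogonal_diagonal_conj (conjDiag_ne_zero C a) h hJ

theorem column_mk {t : Idx m k → ℂ} (X : loopGroup m k C) (z : ℂˣ) (i : Idx m k) :
    column t (QuotientGroup.mk X : LoopQuot m k C) z i =
      t i * (X.1 z).1 i (mid m k) * (t (mid m k))⁻¹ := by
  change (Matrix.diagonal t * (X.1 z).1 * Matrix.diagonal (fun j => (t j)⁻¹)) i (mid m k) = _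
  rw [Matrix.mul_diagonal, Matrix.diagonal_mul]

theorem column_noConj_mk (X : loopGroup m k C) (z : ℂˣ) (i : Idx m k) :
    column (noConj m k) (QuotientGroup.mk X : LoopQuot m k C) z i = (X.1 z).1 i (mid m k) := by
  rw [column_mk]
  rcases i with i | i | i <;> simp [noConj, diag3, mid]

end Entries

/-! ### The dependence of the Maurer–Cartan form on the loop parameter -/

section Weights

variable {m k : ℕ} {C : FPCase} {a : Axis}

/-- The factors by which the entries of the Maurer–Cartan form of a loop group map depend on the
parameter: constant on the diagonal blocks, `λ + λ⁻¹` between the tangent directions and the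
position vector, `λ⁻¹ - λ` between the tangent and the normal directions, zero between the position
vector and the normal directions. -/
def weight (z : ℂ) : Idx m k → Idx m k → ℂ
  | .inl _, .inl _ => 1
  | .inl _, .inr (.inl _) => z + z⁻¹
  | .inl _, .inr (.inr _) => z⁻¹ - z
  | .inr (.inl _), .inl _ => z + z⁻¹
  | .inr (.inl _), .inr (.inl _) => 1
  | .inr (.inl _), .inr (.inr _) => 0
  | .inr (.inr _), .inl _ => z⁻¹ - z
  | .inr (.inr _), .inr (.inl _) => 0
  | .inr (.inr _), .inr (.inr _) => 1

theorem weight_symm (z : ℂ) (i j : Idx m k) : weight z i j = weight z j i := by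
  rcases i with i | i | i <;> rcases j with j | j | j <;> rfl

theorem weight_neg (z : ℂ) (i j : Idx m k) :
    weight (-z) i j = signP m k i * signP m k j * weight z i j := by
  rcases i with i | i | i <;> rcases j with j | j | j <;>
    simp [weight, signP, diag3, inv_neg] <;> ring

theorem weight_inv (z : ℂ) (i j : Idx m k) :
    weight z⁻¹ i j = signQ m k i * signQ m k j * weight z i j := by
  rcases i with i | i | i <;> rcases j with j | j | j <;>
    simp [weight, signQ, diag3, add_comm]

theorem weight_refl (i j : Idx m k) : ∃ p : ℝ, ∀ z : ℂˣ,
    starRingEnd ℂ (weight (C.refl z : ℂ) i j) = p * weight (z : ℂ) i j := by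
  have h : ∀ p : ℝ, (∀ z : ℂˣ,
      starRingEnd ℂ (weight (C.refl z : ℂ) i j) = p * weight (z : ℂ) i j) → ∃ p : ℝ, ∀ z : ℂˣ,
      starRingEnd ℂ (weight (C.refl z : ℂ) i j) = p * weight (z : ℂ) i j := fun p hp => ⟨p, hp⟩
  rcases i with i | i | i <;> rcases j with j | j | j <;> cases C <;>
  first
    | (refine h 1 fun z => ?_; simp [weight, FPCase.refl, add_comm]; done)
    | (refine h (-1) fun z => ?_; simp [weight, FPCase.refl, inv_neg, add_comm]; done)
    | (refine h (-1) fun z => ?_; simp [weight, FPCase.refl, inv_neg]; ring)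

theorem weight_conj {z₀ : ℂˣ} (hz₀ : z₀ ∈ a.range) (z : ℂˣ) (i j : Idx m k) :
    starRingEnd ℂ (weight (C.refl z : ℂ) i j) * weight (z₀ : ℂ) i j =
      axisSign m k C a i * axisSign m k C a j * weight (z : ℂ) i j *
        starRingEnd ℂ (weight (z₀ : ℂ) i j) := by
  obtain ⟨p, hp⟩ := weight_refl (C := C) i j
  have h1 := refl_apply_of_mem C a hz₀ (fun z => weight (z : ℂ) i j)
    (fun z => weight_neg (z : ℂ) i j) (fun z => by
      rw [Units.val_inv_eq_inv_val]; exact weight_inv (z : ℂ) i j)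
  have h2 := hp z₀
  have hreal : ∀ i : Idx m k, starRingEnd ℂ (axisSign m k C a i) = axisSign m k C a i := by
    intro i
    rcases i with i | i | i <;> simp [axisSign, signP, signQ, diag3]
  have h3 : weight (C.refl z₀ : ℂ) i j =
      axisSign m k C a i * axisSign m k C a j * weight (z₀ : ℂ) i j := by
    rw [h1, axisSign, axisSign, mul_pow, mul_pow]; ring
  rw [h3, map_mul, map_mul, hreal, hreal] at h2
  rw [hp]
  linear_combination (-weight (z : ℂ) i j) * h2

end Weights

/-! ### From loop group maps to adapted frames -/

section LoopFrames

variable {m k : ℕ} {C : FPCase} {a : Axis}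

/-- The entrywise product of a matrix with the weights. -/
def weighted (z : ℂ) (α : Matrix (Idx m k) (Idx m k) ℂ) : Matrix (Idx m k) (Idx m k) ℂ :=
  Matrix.of fun i j => weight z i j * α i j

/-- A smooth map `G` of an open subset of the coordinate space into the loop group whose
Maurer–Cartan form depends on the parameter through the weights. -/
structure IsLoopFrame (G : EuclideanSpace ℝ (Fin m) → loopGroup m k C)
    (α : Fin m → EuclideanSpace ℝ (Fin m) → Matrix (Idx m k) (Idx m k) ℂ)
    (V : Set (EuclideanSpace ℝ (Fin m))) : Prop where
  isOpen : IsOpen V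
  smooth : ∀ z : ℂˣ, ContDiffOn ℝ ∞ (fun u => ((G u).1 z).1) V
  pd_eq : ∀ u ∈ V, ∀ (z : ℂˣ) (i : Fin m),
    pd i (fun u => ((G u).1 z).1) u = ((G u).1 z).1 * weighted (z : ℂ) (α i u)

/-- The real moving frame given by a loop group map at a parameter of the given range. -/
def realFrame (a : Axis) (G : EuclideanSpace ℝ (Fin m) → loopGroup m k C) (z : ℂˣ)
    (u : EuclideanSpace ℝ (Fin m)) : Matrix (Idx m k) (Idx m k) ℝ :=
  realForm C a ((G u).1 z).1

namespace IsLoopFrame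

variable {G : EuclideanSpace ℝ (Fin m) → loopGroup m k C}
  {α : Fin m → EuclideanSpace ℝ (Fin m) → Matrix (Idx m k) (Idx m k) ℂ}
  {V : Set (EuclideanSpace ℝ (Fin m))} (H : IsLoopFrame G α V)
  {u : EuclideanSpace ℝ (Fin m)} {z : ℂˣ}

include H

theorem contDiffAt (hu : u ∈ V) (z : ℂˣ) : ContDiffAt ℝ ∞ (fun u => ((G u).1 z).1) u :=
  (H.smooth z).contDiffAt (H.isOpen.mem_nhds hu)

theorem coe_isUnit (u : EuclideanSpace ℝ (Fin m)) (z : ℂˣ) : IsUnit ((G u).1 z).1 :=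
  IsUnit.of_mul_eq_one _ (coe_mul_inv ((G u).1 z))

/-- The Maurer–Cartan equations, entry by entry, compared at two values of the parameter. -/
theorem maurer_cartan_sub (hu : u ∈ V) (i j : Fin m) (z z' : ℂˣ) {b c : Idx m k}
    (hbc : weight (z : ℂ) b c = weight (z' : ℂ) b c) :
    ∑ e, (weight (z : ℂ) b e * weight (z : ℂ) e c - weight (z' : ℂ) b e * weight (z' : ℂ) e c) *
      (α i u b e * α j u e c - α j u b e * α i u e c) = 0 := by
  set Ω : ℂˣ → Fin m → EuclideanSpace ℝ (Fin m) → Matrix (Idx m k) (Idx m k) ℂ :=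
    fun z i w => (((G w).1 z).1)⁻¹ * pd i (fun u => ((G u).1 z).1) w with hΩ
  have hdet : ∀ w z, IsUnit (((G w).1 z).1).det := fun w z =>
    (Matrix.isUnit_iff_isUnit_det _).1 (H.coe_isUnit w z)
  have hΩw : ∀ z i, ∀ w ∈ V, Ω z i w = weighted (z : ℂ) (α i w) := by
    intro z i w hw
    simp only [hΩ]
    rw [H.pd_eq w hw, ← Matrix.mul_assoc, Matrix.nonsing_inv_mul _ (hdet w z), Matrix.one_mul]
  have hΩd : ∀ z i, DifferentiableAt ℝ (Ω z i) u := fun z i =>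
    ((contDiffAt_matrix_inv (H.contDiffAt hu z) (H.coe_isUnit u z)).mul
      (contDiffAt_pd (H.contDiffAt hu z) i)).differentiableAt (by simp)
  have hMC : ∀ z, pd i (Ω z j) u - pd j (Ω z i) u + Ω z i u * Ω z j u - Ω z j u * Ω z i u = 0 := by
    intro z
    refine maurer_cartan (H.contDiffAt hu z) (H.coe_isUnit u z) (hΩd z) (fun i => ?_) i j
    refine Filter.Eventually.of_forall fun w => ?_
    simp only [hΩ]
    rw [← Matrix.mul_assoc, Matrix.mul_nonsing_inv _ (hdet w z), Matrix.one_mul]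
  have hpd : ∀ i j, pd i (Ω z j) u b c = pd i (Ω z' j) u b c := by
    intro i j
    rw [← pd_entry (hΩd z j), ← pd_entry (hΩd z' j)]
    refine pd_congr ?_ i
    filter_upwards [H.isOpen.mem_nhds hu] with w hw
    rw [hΩw z j w hw, hΩw z' j w hw, weighted, weighted, Matrix.of_apply, Matrix.of_apply, hbc]
  have h1 := congrFun (congrFun (hMC z) b) c
  have h2 := congrFun (congrFun (hMC z') b) c
  simp only [Matrix.add_apply, Matrix.sub_apply, Matrix.zero_apply] at h1 h2
  rw [hpd, hpd] at h1
  have h3 := sub_eq_zero.2 (h1.trans h2.symm)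
  have e : ∀ z i j, (Ω z i u * Ω z j u) b c =
      ∑ e, weight (z : ℂ) b e * weight (z : ℂ) e c * (α i u b e * α j u e c) := by
    intro z i j
    rw [hΩw z i u hu, hΩw z j u hu, Matrix.mul_apply]
    refine Finset.sum_congr rfl fun e _ => ?_
    simp only [weighted, Matrix.of_apply]
    ring
  rw [e, e, e, e] at h3
  rw [← h3]
  simp only [sub_mul, mul_sub, Finset.sum_sub_distrib]
  ring

/-- The part of the Maurer–Cartan equation in the tangential block that depends on the parameter
vanishes. -/
theorem tangent_relation (hu : u ∈ V) (i j b c : Fin m) :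
    (α i u (Sum.inl b) (mid m k) * α j u (mid m k) (Sum.inl c) -
      α j u (Sum.inl b) (mid m k) * α i u (mid m k) (Sum.inl c)) +
    ∑ γ, (α i u (Sum.inl b) (Sum.inr (Sum.inr γ)) * α j u (Sum.inr (Sum.inr γ)) (Sum.inl c) -
      α j u (Sum.inl b) (Sum.inr (Sum.inr γ)) * α i u (Sum.inr (Sum.inr γ)) (Sum.inl c)) = 0 := by
  have h := H.maurer_cartan_sub hu i j (Units.mk0 2 two_ne_zero) 1 (b := Sum.inl b) (c := Sum.inl c)
    rfl
  rw [sum_idx] at h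
  simp only [weight, mid, Units.val_mk0, Units.val_one, mul_one, sub_self, zero_mul,
    Finset.sum_const_zero, zero_add, ← Finset.mul_sum, inv_one] at h ⊢
  -- the squares of the weights at the parameters `2` and `1` differ by `9 / 4`
  linear_combination (4 / 9) * h

/-- The same for the normal block: the commutators of the shape operators vanish. -/
theorem normal_relation (hu : u ∈ V) (i j : Fin m) (β γ : Fin k) :
    ∑ b, (α i u (Sum.inr (Sum.inr β)) (Sum.inl b) * α j u (Sum.inl b) (Sum.inr (Sum.inr γ)) -
      α j u (Sum.inr (Sum.inr β)) (Sum.inl b) * α i u (Sum.inl b) (Sum.inr (Sum.inr γ))) = 0 := by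
  have h := H.maurer_cartan_sub hu i j (Units.mk0 2 two_ne_zero) 1 (b := Sum.inr (Sum.inr β))
    (c := Sum.inr (Sum.inr γ)) rfl
  rw [sum_idx] at h
  simp only [weight, mid, Units.val_mk0, Units.val_one, mul_one, sub_self, zero_mul, mul_zero,
    Finset.sum_const_zero, add_zero, ← Finset.mul_sum, inv_one] at h ⊢
  linear_combination (4 / 9) * h

theorem map_realFrame (hz : z ∈ a.range) (u : EuclideanSpace ℝ (Fin m)) :
    (realFrame a G z u).map (fun x : ℝ => (x : ℂ)) = Matrix.diagonal (conjDiag m k C a) *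
      ((G u).1 z).1 * Matrix.diagonal (fun i => (conjDiag m k C a i)⁻¹) :=
  map_realForm fun i j => loop_conj (G u).2 hz i j

theorem realFrame_orthogonal (hz : z ∈ a.range) (u : EuclideanSpace ℝ (Fin m)) :
    (realFrame a G z u).transpose * Matrix.diagonal ((target C a).signs m k) *
      realFrame a G z u = Matrix.diagonal ((target C a).signs m k) :=
  realForm_orthogonal (fun i j => loop_conj (G u).2 hz i j) ((G u).2.2.1 z)

theorem contDiffAt_realFrame (hu : u ∈ V) : ContDiffAt ℝ ∞ (realFrame a G z) u := by
  refine contDiffAt_matrix fun i j => ?_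
  exact Complex.reCLM.contDiff.contDiffAt.comp u
    ((contDiffAt_const.mul (contDiffAt_entry (H.contDiffAt hu z) i j)).mul contDiffAt_const)

/-- The connection coefficients of the real moving frame. -/
theorem ofReal_conn_realFrame (hz : z ∈ a.range) (hu : u ∈ V) (i : Fin m) (b c : Idx m k) :
    (conn (realFrame a G z) i u b c : ℂ) =
      conjDiag m k C a b * (weight (z : ℂ) b c * α i u b c) * (conjDiag m k C a c)⁻¹ := by
  set T := Matrix.diagonal (conjDiag m k C a) with hT
  set T' := Matrix.diagonal (fun i => (conjDiag m k C a i)⁻¹) with hT'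
  have hTT : T' * T = 1 := by
    rw [hT, hT', Matrix.diagonal_mul_diagonal]
    simp [conjDiag_ne_zero]
  set S := realFrame a G z with hS
  have hSd := (H.contDiffAt_realFrame (a := a) (z := z) hu).differentiableAt (n := ∞) (by simp)
  have hGd := (H.contDiffAt hu z).differentiableAt (n := ∞) (by simp)
  have hpd : (pd i S u).map (fun x : ℝ => (x : ℂ)) = T * pd i (fun u => ((G u).1 z).1) u * T' := by
    ext b c
    rw [Matrix.map_apply, ← pd_entry hSd]
    have hSbc : DifferentiableAt ℝ (fun w => S w b c) u :=
      ((entryCLM ℝ b c).differentiableAt).comp u hSd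
    have hGbc : DifferentiableAt ℝ (fun w => ((G w).1 z).1 b c) u :=
      ((entryCLM ℂ b c).differentiableAt).comp u hGd
    have h1 := pd_clm Complex.ofRealCLM hSbc i
    simp only [Complex.ofRealCLM_apply] at h1
    rw [← h1]
    have h2 : (fun w => (S w b c : ℂ)) = fun w => conjDiag m k C a b * ((G w).1 z).1 b c *
        (conjDiag m k C a c)⁻¹ := by
      funext w
      exact ofReal_realForm (fun i j => loop_conj (G w).2 hz i j) b c
    rw [h2, pd_mul ((differentiableAt_const _).fun_mul hGbc) (differentiableAt_const _), pd_const,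
      mul_zero, zero_add, pd_mul (differentiableAt_const _) hGbc, pd_const, zero_mul, add_zero,
      pd_entry hGd, hT', Matrix.mul_diagonal, hT, Matrix.diagonal_mul]
  have hunit := isUnit_of_orthogonal (target C a).signs_mul_self (H.realFrame_orthogonal hz u)
  have hmul : S u * conn S i u = pd i S u := by
    rw [conn, ← Matrix.mul_assoc, Matrix.mul_nonsing_inv _
      ((Matrix.isUnit_iff_isUnit_det _).1 hunit), Matrix.one_mul]
  have h3 : (conn S i u).map (fun x : ℝ => (x : ℂ)) = T * weighted (z : ℂ) (α i u) * T' := by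
    have h4 := congrArg (fun X : Matrix (Idx m k) (Idx m k) ℝ => X.map (fun x : ℝ => (x : ℂ))) hmul
    simp only [map_ofReal_mul] at h4
    have h6 : (S u).map (fun x : ℝ => (x : ℂ)) = T * ((G u).1 z).1 * T' := H.map_realFrame hz u
    rw [hpd, H.pd_eq u hu, h6] at h4
    have h5 : T * ((G u).1 z).1 * T' * (conn S i u).map (fun x : ℝ => (x : ℂ)) =
        T * ((G u).1 z).1 * T' * (T * weighted (z : ℂ) (α i u) * T') := by
      rw [h4]
      calc _ = T * ((G u).1 z).1 * 1 * weighted (z : ℂ) (α i u) * T' := by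
            rw [Matrix.mul_one]; simp only [Matrix.mul_assoc]
        _ = _ := by rw [← hTT]; simp only [Matrix.mul_assoc]
    have h7 : IsUnit (T * ((G u).1 z).1 * T') :=
      ((IsUnit.of_mul_eq_one T' (mul_eq_one_comm.1 hTT)).mul (H.coe_isUnit u z)).mul
        (IsUnit.of_mul_eq_one T hTT)
    exact h7.mul_left_cancel h5
  have h8 := congrFun (congrFun h3 b) c
  rw [Matrix.map_apply, hT', Matrix.mul_diagonal, hT, Matrix.diagonal_mul] at h8
  exact h8

/-- The real moving frame is adapted to its middle column if the latter is an immersion. -/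
theorem isAdaptedFrame (hz : z ∈ a.range)
    (himm : ∀ u ∈ V, Function.Injective
      (fderiv ℝ (fun u (i : Idx m k) => ((G u).1 z).1 i (mid m k)) u))
    {h : EuclideanSpace ℝ (Fin m) → Idx m k → ℝ}
    (hh : ∀ u ∈ V, ∀ i, h u i = realFrame a G z u i (mid m k)) :
    IsAdaptedFrame (target C a) h (realFrame a G z) V := by
  have hconn := fun u hu i b c => H.ofReal_conn_realFrame (u := u) hz hu i b c
  have hnormal : ∀ u ∈ V, ∀ i γ,
      conn (realFrame a G z) i u (Sum.inr (Sum.inr γ)) (mid m k) = 0 := by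
    intro u hu i γ
    have h1 := hconn u hu i (Sum.inr (Sum.inr γ)) (mid m k)
    simpa [weight, mid] using h1
  refine ⟨H.isOpen, fun u hu => (H.contDiffAt_realFrame hu).contDiffWithinAt,
    fun u _ => H.realFrame_orthogonal hz u, hh, hnormal, fun u hu => ?_⟩
  have hmm : ∀ i, conn (realFrame a G z) i u (mid m k) (mid m k) = 0 := by
    intro i
    have h1 := conn_skew_of_orthogonal (N := target C a) (H.contDiffAt_realFrame hu)
      (Filter.Eventually.of_forall fun w => H.realFrame_orthogonal hz w) i (mid m k) (mid m k)
    have h2 := (target C a).curv_mul_self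
    simp only [Target.signs_mid] at h1
    linear_combination ((target C a).curv / 2) * h1 -
      conn (realFrame a G z) i u (mid m k) (mid m k) * h2
  rw [← Matrix.vecMul_injective_iff_isUnit]
  refine (injective_iff_map_eq_zero (Matrix.vecMulLinear (coframe (realFrame a G z) u))).2
    fun c hc => ?_
  have hsum : ∀ b, ∑ i, c i * conn (realFrame a G z) i u b (mid m k) = 0 := by
    intro b
    rcases b with b | b | b
    · have h5 := congrFun hc b
      simpa [Matrix.vecMul, dotProduct, coframe] using h5
    · exact Finset.sum_eq_zero fun i _ => by rw [show Sum.inr (Sum.inl b) = mid m k from rfl, hmm,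
        mul_zero]
    · exact Finset.sum_eq_zero fun i _ => by rw [hnormal u hu, mul_zero]
  have hsumα : ∀ b, ∑ i, (c i : ℂ) * weighted (z : ℂ) (α i u) b (mid m k) = 0 := by
    intro b
    have h1 := congrArg (fun x : ℝ => (x : ℂ)) (hsum b)
    simp only [Complex.ofReal_sum, Complex.ofReal_mul, hconn u hu, Complex.ofReal_zero] at h1
    have h2 : conjDiag m k C a b * (conjDiag m k C a (mid m k))⁻¹ *
        ∑ i, (c i : ℂ) * weighted (z : ℂ) (α i u) b (mid m k) = 0 := by
      rw [← h1, Finset.mul_sum]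
      refine Finset.sum_congr rfl fun i _ => ?_
      rw [weighted, Matrix.of_apply]
      ring
    exact (mul_eq_zero.1 h2).resolve_left
      (mul_ne_zero (conjDiag_ne_zero C a b) (inv_ne_zero (conjDiag_ne_zero C a _)))
  have hGd := (H.contDiffAt hu z).differentiableAt (n := ∞) (by simp)
  have hcd : DifferentiableAt ℝ (fun u (i : Idx m k) => ((G u).1 z).1 i (mid m k)) u :=
    differentiableAt_pi.2 fun i => ((entryCLM ℂ i (mid m k)).differentiableAt).comp u hGd
  have h2 : fderiv ℝ (fun u (i : Idx m k) => ((G u).1 z).1 i (mid m k)) u (WithLp.toLp 2 c) =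
      0 := by
    rw [fderiv_apply_eq_sum_pd]
    funext b
    have h3 : ∀ i, pd i (fun u (i : Idx m k) => ((G u).1 z).1 i (mid m k)) u b =
        ∑ e, ((G u).1 z).1 b e * weighted (z : ℂ) (α i u) e (mid m k) := by
      intro i
      have h4 : pd i (fun w => (fun u (i : Idx m k) => ((G u).1 z).1 i (mid m k)) w b) u = _ :=
        pd_clm (ContinuousLinearMap.proj (R := ℝ) (φ := fun _ : Idx m k => ℂ) b) hcd i
      have h5 := pd_entry hGd i b (mid m k)
      rw [H.pd_eq u hu, Matrix.mul_apply] at h5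
      rw [← h5]
      exact h4.symm
    simp only [Finset.sum_apply, Pi.smul_apply, h3, Pi.zero_apply, Complex.real_smul,
      Finset.mul_sum]
    rw [Finset.sum_comm]
    refine Finset.sum_eq_zero fun e _ => ?_
    calc _ = ((G u).1 z).1 b e * ∑ i, (c i : ℂ) * weighted (z : ℂ) (α i u) e (mid m k) := by
          rw [Finset.mul_sum]
          exact Finset.sum_congr rfl fun i _ => by ring
      _ = 0 := by rw [hsumα, mul_zero]
  have h3 := himm u hu (h2.trans (map_zero _).symm)
  funext i
  exact congrArg (fun z : EuclideanSpace ℝ (Fin m) => z i) h3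

/-- The curvature of the immersion given by a loop group map. -/
theorem shapeComm_realFrame (hz : z ∈ a.range) {h : EuclideanSpace ℝ (Fin m) → Idx m k → ℝ}
    (hS : IsAdaptedFrame (target C a) h (realFrame a G z) V) (hu : u ∈ V) (i j b c : Fin m) :
    shapeComm (realFrame a G z) u i j b c = -(curvAt (target C a) z - (target C a).curv) *
      (coframe (realFrame a G z) u i b * coframe (realFrame a G z) u j c -
        coframe (realFrame a G z) u j b * coframe (realFrame a G z) u i c) := by
  set S := realFrame a G z with hSdef
  set s := (z : ℂ) + (z : ℂ)⁻¹ with hs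
  set d := (z : ℂ)⁻¹ - (z : ℂ) with hd
  have hsd : s ^ 2 - d ^ 2 = 4 := by
    have hz0 := z.ne_zero
    rw [hs, hd]; field_simp; ring
  have hs0 : s ≠ 0 := Axis.add_inv_ne_zero hz
  have hconn := fun i b c => H.ofReal_conn_realFrame (a := a) (u := u) hz hu i b c
  set t := conjDiag m k C a with ht
  have ht0 : ∀ i, t i ≠ 0 := conjDiag_ne_zero C a
  have hrel := H.tangent_relation hu i j b c
  -- the two products of connection coefficients through the middle and the normal directions
  have e1 : ∀ i j, (conn S i u (Sum.inl b) (mid m k) : ℂ) * conn S j u (mid m k) (Sum.inl c) =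
      t (Sum.inl b) * (t (Sum.inl c))⁻¹ * s ^ 2 *
        (α i u (Sum.inl b) (mid m k) * α j u (mid m k) (Sum.inl c)) := by
    intro i j
    have h1 := mul_inv_cancel₀ (ht0 (mid m k))
    rw [hconn, hconn]
    simp only [weight, mid] at h1 ⊢
    linear_combination (t (Sum.inl b) * (t (Sum.inl c))⁻¹ * s ^ 2 *
      (α i u (Sum.inl b) (Sum.inr (Sum.inl ())) * α j u (Sum.inr (Sum.inl ())) (Sum.inl c))) * h1
  have e2 : ∀ i j γ, (conn S i u (Sum.inl b) (Sum.inr (Sum.inr γ)) : ℂ) *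
      conn S j u (Sum.inr (Sum.inr γ)) (Sum.inl c) = t (Sum.inl b) * (t (Sum.inl c))⁻¹ * d ^ 2 *
        (α i u (Sum.inl b) (Sum.inr (Sum.inr γ)) * α j u (Sum.inr (Sum.inr γ)) (Sum.inl c)) := by
    intro i j γ
    have h1 := mul_inv_cancel₀ (ht0 (Sum.inr (Sum.inr γ)))
    rw [hconn, hconn]
    simp only [weight]
    linear_combination (t (Sum.inl b) * (t (Sum.inl c))⁻¹ * d ^ 2 *
      (α i u (Sum.inl b) (Sum.inr (Sum.inr γ)) * α j u (Sum.inr (Sum.inr γ)) (Sum.inl c))) * h1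
  have e3 : (shapeComm S u i j b c : ℂ) * s ^ 2 = -d ^ 2 *
      ((conn S i u (Sum.inl b) (mid m k) : ℂ) * conn S j u (mid m k) (Sum.inl c) -
        conn S j u (Sum.inl b) (mid m k) * conn S i u (mid m k) (Sum.inl c)) := by
    rw [e1, e1, shapeComm]
    push_cast
    simp only [e2, ← mul_sub, ← Finset.mul_sum]
    linear_combination (t (Sum.inl b) * (t (Sum.inl c))⁻¹ * d ^ 2 * s ^ 2) * hrel
  rw [hS.conn_mid_tangent hu, hS.conn_mid_tangent hu] at e3
  have e4 : (curvAt (target C a) z : ℂ) * s ^ 2 = 4 * ((target C a).curv : ℂ) := by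
    rw [curvAt_eq, Complex.ofReal_mul, ofReal_curvScale hz, ← hs]
    field_simp
  have e5 : (shapeComm S u i j b c : ℂ) = ((-(curvAt (target C a) z - (target C a).curv) *
      (coframe S u i b * coframe S u j c - coframe S u j b * coframe S u i c) : ℝ) : ℂ) := by
    refine mul_right_cancel₀ (pow_ne_zero 2 hs0) ?_
    rw [e3]
    have e6 : ∀ i, conn S i u (Sum.inl b) (mid m k) = coframe S u i b := fun i => rfl
    rw [e6, e6]
    push_cast
    linear_combination ((coframe S u i b : ℂ) * coframe S u j c -
      coframe S u j b * coframe S u i c) * (e4 - ((target C a).curv : ℂ) * hsd)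
  exact_mod_cast e5

/-- The flatness of the normal bundle of the immersion given by a loop group map. -/
theorem normalComm_realFrame (hz : z ∈ a.range) (hu : u ∈ V) (i j : Fin m) (β γ : Fin k) :
    normalComm (realFrame a G z) u i j β γ = 0 := by
  have hconn := fun i b c => H.ofReal_conn_realFrame (a := a) (u := u) hz hu i b c
  set t := conjDiag m k C a with ht
  set d := (z : ℂ)⁻¹ - (z : ℂ) with hd
  have e2 : ∀ i j b, (conn (realFrame a G z) i u (Sum.inr (Sum.inr β)) (Sum.inl b) : ℂ) *
      conn (realFrame a G z) j u (Sum.inl b) (Sum.inr (Sum.inr γ)) =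
      t (Sum.inr (Sum.inr β)) * (t (Sum.inr (Sum.inr γ)))⁻¹ * d ^ 2 *
        (α i u (Sum.inr (Sum.inr β)) (Sum.inl b) * α j u (Sum.inl b) (Sum.inr (Sum.inr γ))) := by
    intro i j b
    have h1 := mul_inv_cancel₀ (conjDiag_ne_zero C a (Sum.inl b : Idx m k))
    rw [hconn, hconn]
    simp only [weight]
    linear_combination (t (Sum.inr (Sum.inr β)) * (t (Sum.inr (Sum.inr γ)))⁻¹ * d ^ 2 *
      (α i u (Sum.inr (Sum.inr β)) (Sum.inl b) * α j u (Sum.inl b) (Sum.inr (Sum.inr γ)))) * h1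
  have e3 : (normalComm (realFrame a G z) u i j β γ : ℂ) = 0 := by
    rw [normalComm]
    push_cast
    simp only [e2, ← mul_sub, ← Finset.mul_sum]
    rw [H.normal_relation hu, mul_zero]
  exact_mod_cast e3

end IsLoopFrame

end LoopFrames

/-! ### Charts -/

section Charts

variable {m k : ℕ} {M : Type*} [TopologicalSpace M] [ChartedSpace (EuclideanSpace ℝ (Fin m)) M]
  [IsManifold (𝓡 m) ∞ M] {W : Type*} [NormedAddCommGroup W] [NormedSpace ℝ W]

/-- The derivative of the inverse of the chart around `x₀`. -/
def chartDeriv (x₀ : M) (u : EuclideanSpace ℝ (Fin m)) :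
    EuclideanSpace ℝ (Fin m) →L[ℝ]
      TangentSpace (𝓡 m) ((chartAt (EuclideanSpace ℝ (Fin m)) x₀).symm u) :=
  mfderiv (𝓡 m) (𝓡 m) (chartAt (EuclideanSpace ℝ (Fin m)) x₀).symm u

theorem chartDeriv_bijective (x₀ : M) {u : EuclideanSpace ℝ (Fin m)}
    (hu : u ∈ (chartAt (EuclideanSpace ℝ (Fin m)) x₀).target) :
    Function.Bijective (chartDeriv x₀ u) := by
  have : IsManifold (𝓡 m) 1 M := IsManifold.of_le (n := ∞) (by simp)
  exact (mdifferentiable_chart (I := 𝓡 m) x₀).symm.mfderiv_bijective hu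

theorem fderiv_comp_chart (x₀ : M) {u : EuclideanSpace ℝ (Fin m)}
    (hu : u ∈ (chartAt (EuclideanSpace ℝ (Fin m)) x₀).target) {f : M → W}
    (hf : MDifferentiableAt (𝓡 m) 𝓘(ℝ, W) f ((chartAt (EuclideanSpace ℝ (Fin m)) x₀).symm u))
    (v : EuclideanSpace ℝ (Fin m)) :
    fderiv ℝ (fun w => f ((chartAt (EuclideanSpace ℝ (Fin m)) x₀).symm w)) u v =
      mfderiv (𝓡 m) 𝓘(ℝ, W) f ((chartAt (EuclideanSpace ℝ (Fin m)) x₀).symm u)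
        (chartDeriv x₀ u v) := by
  have : IsManifold (𝓡 m) 1 M := IsManifold.of_le (n := ∞) (by simp)
  have h1 := (mdifferentiable_chart (I := 𝓡 m) x₀).mdifferentiableAt_symm hu
  have h2 := mfderiv_comp_apply (I := 𝓡 m) u hf h1 v
  rw [mfderiv_eq_fderiv] at h2
  exact h2

theorem contDiffOn_comp_chart (x₀ : M) {f : M → W} {U : Set M}
    (hf : ContMDiffOn (𝓡 m) 𝓘(ℝ, W) ∞ f U) :
    ContDiffOn ℝ ∞ (fun w => f ((chartAt (EuclideanSpace ℝ (Fin m)) x₀).symm w))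
      ((chartAt (EuclideanSpace ℝ (Fin m)) x₀).target ∩
        (chartAt (EuclideanSpace ℝ (Fin m)) x₀).symm ⁻¹' U) := by
  have h1 : ContMDiffOn (𝓡 m) (𝓡 m) ∞ (chartAt (EuclideanSpace ℝ (Fin m)) x₀).symm
    (chartAt (EuclideanSpace ℝ (Fin m)) x₀).target := contMDiffOn_chart_symm
  have h2 := hf.comp (h1.mono (Set.inter_subset_left (t :=
    (chartAt (EuclideanSpace ℝ (Fin m)) x₀).symm ⁻¹' U))) (fun w hw => hw.2)
  exact contMDiffOn_iff_contDiffOn.1 h2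

theorem isOpen_chart_preimage (x₀ : M) {U : Set M} (hU : IsOpen U) :
    IsOpen ((chartAt (EuclideanSpace ℝ (Fin m)) x₀).target ∩
        (chartAt (EuclideanSpace ℝ (Fin m)) x₀).symm ⁻¹' U) :=
  (chartAt (EuclideanSpace ℝ (Fin m)) x₀).isOpen_inter_preimage_symm hU

end Charts

/-! ### Extended frames in charts -/

section Laurent

variable {m k : ℕ} {C : FPCase} {a : Axis}

/-- A Laurent polynomial with exponents `-1, 0, 1` and the symmetries of the `(i, j)` entry is a
multiple of the weight. -/
theorem exists_eq_weight (i j : Idx m k) (f : ℂˣ → ℂ)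
    (hf : ∃ b c d : ℂ, ∀ z : ℂˣ, f z = (z : ℂ)⁻¹ * b + c + (z : ℂ) * d)
    (hP : ∀ z, f (-z) = signP m k i * signP m k j * f z)
    (hQ : ∀ z, f z⁻¹ = signQ m k i * signQ m k j * f z) :
    ∃ α : ℂ, ∀ z : ℂˣ, f z = weight (z : ℂ) i j * α := by
  obtain ⟨b, c, d, h⟩ := hf
  set two : ℂˣ := Units.mk0 2 two_ne_zero with h2
  have p1 := hP 1
  have p2 := hP two
  have q2 := hQ two
  simp only [h, h2, Units.val_neg, Units.val_one, Units.val_mk0, Units.val_inv_eq_inv_val,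
    inv_neg, inv_one, inv_inv] at p1 p2 q2
  have e1 : signP m k i * signP m k j = 1 → b = 0 ∧ d = 0 := by
    intro hs
    rw [hs] at p1 p2
    constructor
    · linear_combination (-2 / 3) * p1 + (1 / 3) * p2
    · linear_combination (1 / 6) * p1 - (1 / 3) * p2
  have e2 : signP m k i * signP m k j = -1 → c = 0 := by
    intro hs
    rw [hs] at p1
    linear_combination (1 / 2) * p1
  rcases i with i | i | i <;> rcases j with j | j | j <;>
    simp only [signP, signQ, diag3, Sum.elim_inl, Sum.elim_inr] at e1 e2 q2
  · obtain ⟨rfl, rfl⟩ := e1 (by norm_num)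
    exact ⟨c, fun z => by rw [h]; simp [weight]⟩
  · have hc := e2 (by norm_num)
    have : b = d := by rw [hc] at q2; linear_combination (2 / 3) * q2
    exact ⟨d, fun z => by rw [h, hc, this]; simp only [weight]; ring⟩
  · have hc := e2 (by norm_num)
    have : b = -d := by rw [hc] at q2; linear_combination (2 / 5) * q2
    exact ⟨b, fun z => by rw [h, hc, this]; simp only [weight]; ring⟩
  · have hc := e2 (by norm_num)
    have : b = d := by rw [hc] at q2; linear_combination (2 / 3) * q2
    exact ⟨d, fun z => by rw [h, hc, this]; simp only [weight]; ring⟩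
  · obtain ⟨rfl, rfl⟩ := e1 (by norm_num)
    exact ⟨c, fun z => by rw [h]; simp [weight]⟩
  · obtain ⟨rfl, rfl⟩ := e1 (by norm_num)
    have : c = 0 := by linear_combination (1 / 2) * q2
    exact ⟨0, fun z => by rw [h, this]; simp⟩
  · have hc := e2 (by norm_num)
    have : b = -d := by rw [hc] at q2; linear_combination (2 / 5) * q2
    exact ⟨b, fun z => by rw [h, hc, this]; simp only [weight]; ring⟩
  · obtain ⟨rfl, rfl⟩ := e1 (by norm_num)
    have : c = 0 := by linear_combination (1 / 2) * q2
    exact ⟨0, fun z => by rw [h, this]; simp⟩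
  · obtain ⟨rfl, rfl⟩ := e1 (by norm_num)
    exact ⟨c, fun z => by rw [h]; simp [weight]⟩

variable {M : Type*} [TopologicalSpace M] [ChartedSpace (EuclideanSpace ℝ (Fin m)) M]
  [IsManifold (𝓡 m) ∞ M]

/-- For a fixed parameter an extended frame is smooth on the manifold. -/
theorem IsExtendedFrameOn.contMDiffOn {F : M → loopGroup m k C} {U : Set M}
    (hF : IsExtendedFrameOn F U) (z : ℂˣ) (i j : Idx m k) :
    ContMDiffOn (𝓡 m) 𝓘(ℝ, ℂ) ∞ (fun y => ((F y).1 z).1 i j) U := by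
  have h1 : ContMDiff (𝓡 m) ((𝓡 m).prod 𝓘(ℝ, ℂ)) ∞ (fun y : M => (y, z)) :=
    contMDiff_id.prodMk contMDiff_const
  exact (hF.1 i j).comp h1.contMDiffOn fun y hy => ⟨hy, Set.mem_univ _⟩

/-- The expression of an extended frame in a chart. -/
theorem IsExtendedFrameOn.exists_isLoopFrame {F : M → loopGroup m k C} {U : Set M}
    (hU : IsOpen U) (hF : IsExtendedFrameOn F U) (x₀ : M) :
    ∃ α, IsLoopFrame (fun u => F ((chartAt (EuclideanSpace ℝ (Fin m)) x₀).symm u)) α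
      ((chartAt (EuclideanSpace ℝ (Fin m)) x₀).target ∩
        (chartAt (EuclideanSpace ℝ (Fin m)) x₀).symm ⁻¹' U) := by
  set V := (chartAt (EuclideanSpace ℝ (Fin m)) x₀).target ∩
        (chartAt (EuclideanSpace ℝ (Fin m)) x₀).symm ⁻¹' U with hV
  have hVo : IsOpen V := isOpen_chart_preimage x₀ hU
  set G : EuclideanSpace ℝ (Fin m) → loopGroup m k C := fun u =>
    F ((chartAt (EuclideanSpace ℝ (Fin m)) x₀).symm u) with hG
  have hsm : ∀ z : ℂˣ, ContDiffOn ℝ ∞ (fun u => ((G u).1 z).1) V := fun z =>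
    contDiffOn_matrix fun i j => contDiffOn_comp_chart x₀ (hF.contMDiffOn z i j)
  have hdiff : ∀ u ∈ V, ∀ z : ℂˣ, DifferentiableAt ℝ (fun u => ((G u).1 z).1) u := fun u hu z =>
    ((hsm z).contDiffAt (hVo.mem_nhds hu)).differentiableAt (by simp)
  have hpd : ∀ u ∈ V, ∀ z i, pd i (fun u => ((G u).1 z).1) u =
      loopDeriv F z _ (chartDeriv x₀ u (EuclideanSpace.single i 1)) := by
    intro u hu z i
    ext b c
    rw [← pd_entry (hdiff u hu z)]
    exact fderiv_comp_chart x₀ hu.1 (((hF.contMDiffOn z b c).contMDiffAt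
      (hU.mem_nhds hu.2)).mdifferentiableAt (by simp)) _
  have key : ∀ u ∈ V, ∀ i b c, ∃ α : ℂ, ∀ z : ℂˣ,
      (((((G u).1 z)⁻¹).1 * pd i (fun u => ((G u).1 z).1) u) b c) = weight (z : ℂ) b c * α := by
    intro u hu i b c
    have hinv : (fun z => ((G u).1 z)⁻¹) ∈ loopGroup m k C := ((G u)⁻¹).2
    have hsymm : ∀ (w : ℂˣ → ℂˣ) (s : Idx m k → ℂ), (∀ i, s i * s i = 1) →
        (∀ X ∈ loopGroup m k C, ∀ z i j, (X (w z)).1 i j = s i * s j * (X z).1 i j) → ∀ z,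
        (((((G u).1 (w z))⁻¹).1 * pd i (fun u => ((G u).1 (w z)).1) u) b c) =
        s b * s c * ((((G u).1 z)⁻¹).1 * pd i (fun u => ((G u).1 z).1) u) b c := by
      intro w s hs hX z
      rw [Matrix.mul_apply, Matrix.mul_apply, Finset.mul_sum]
      refine Finset.sum_congr rfl fun e _ => ?_
      have h1 := hX _ hinv z b e
      have h2 : pd i (fun u => ((G u).1 (w z)).1) u e c =
          s e * s c * pd i (fun u => ((G u).1 z).1) u e c := by
        rw [← pd_entry (hdiff u hu _), ← pd_entry (hdiff u hu _)]
        have h3 : (fun v => ((G v).1 (w z)).1 e c) = fun v => s e * s c * ((G v).1 z).1 e c :=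
          funext fun v => hX _ (G v).2 z e c
        have h4 : DifferentiableAt ℝ (fun v => ((G v).1 z).1 e c) u :=
          ((entryCLM ℂ e c).differentiableAt).comp u (hdiff u hu z)
        rw [h3, pd_mul (differentiableAt_const _) h4, pd_const, zero_mul, add_zero]
      rw [h1, h2]
      linear_combination (s b * s c * (((G u).1 z)⁻¹).1 b e *
        pd i (fun u => ((G u).1 z).1) u e c) * hs e
    refine exists_eq_weight b c _ ?_
      (hsymm (fun z => -z) (signP m k) signP_mul_self fun X hX z i j => loop_neg hX z i j)
      (hsymm (fun z => z⁻¹) (signQ m k) signQ_mul_self fun X hX z i j => loop_inv hX z i j)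
    obtain ⟨Bm, B0, Bp, hB⟩ := hF.2 _ hu.2
    refine ⟨Bm (chartDeriv x₀ u (EuclideanSpace.single i 1)) b c,
      B0 (chartDeriv x₀ u (EuclideanSpace.single i 1)) b c,
      Bp (chartDeriv x₀ u (EuclideanSpace.single i 1)) b c, fun z => ?_⟩
    rw [hpd u hu, hB]
    rfl
  classical
  choose! α hα using key
  refine ⟨fun i u => Matrix.of fun b c => α u i b c, hVo, hsm, fun u hu z i => ?_⟩
  have h1 : weighted (z : ℂ) (Matrix.of fun b c => α u i b c) =
      (((G u).1 z)⁻¹).1 * pd i (fun u => ((G u).1 z).1) u := by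
    ext b c
    rw [weighted, Matrix.of_apply, Matrix.of_apply, hα u hu]
  rw [h1, ← Matrix.mul_assoc, coe_mul_inv, Matrix.one_mul]

end Laurent

/-! ### The immersions given by a loop group map -/

section Forward

variable {m k : ℕ} {N : Target}

/-- The metric induced on an immersion with an adapted frame is positive definite. -/
theorem IsAdaptedFrame.form_fderiv_pos {h : EuclideanSpace ℝ (Fin m) → Idx m k → ℝ}
    {S : EuclideanSpace ℝ (Fin m) → Matrix (Idx m k) (Idx m k) ℝ}
    {V : Set (EuclideanSpace ℝ (Fin m))} (H : IsAdaptedFrame N h S V)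
    {u : EuclideanSpace ℝ (Fin m)} (hu : u ∈ V) {v : EuclideanSpace ℝ (Fin m)} (hv : v ≠ 0) :
    0 < N.form (fderiv ℝ h u v) (fderiv ℝ h u v) := by
  set y : Idx m k → ℝ := ∑ i, v i • (fun a => conn S i u a (FerusPedit.mid m k)) with hy
  have e : fderiv ℝ h u v = (S u).mulVec y := by
    rw [fderiv_apply_eq_sum_pd, hy, Matrix.mulVec_sum]
    exact Finset.sum_congr rfl fun i _ => by rw [H.pd_eq hu, Matrix.mulVec_smul]
  have h1 : y (FerusPedit.mid m k) = 0 := by simp [hy, H.conn_mid_mid hu]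
  have h2 : ∀ γ, y (Sum.inr (Sum.inr γ)) = 0 := fun γ => by simp [hy, H.normal u hu]
  rw [e, N.form_mulVec (H.orth u hu), N.form_eq]
  simp only [h1, h2, mul_zero, Finset.sum_const_zero, add_zero]
  have h3 : 0 ≤ ∑ a, y (Sum.inl a) * y (Sum.inl a) :=
    Finset.sum_nonneg fun a _ => mul_self_nonneg _
  refine lt_of_le_of_ne h3 fun h4 => hv ?_
  have h5 : ∀ a, y (Sum.inl a) = 0 := fun a =>
    mul_self_eq_zero.1 ((Finset.sum_eq_zero_iff_of_nonneg fun a _ => mul_self_nonneg _).1 h4.symm a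
      (Finset.mem_univ a))
  have h6 : Matrix.vecMul (fun i => v i) (coframe S u) = 0 := by
    funext a
    have := h5 a
    simpa [hy, Matrix.vecMul, dotProduct, coframe] using this
  have h7 := congrArg (fun x => Matrix.vecMul x (coframe S u)⁻¹) h6
  simp only [Matrix.vecMul_vecMul, Matrix.zero_vecMul] at h7
  rw [Matrix.mul_nonsing_inv _ ((Matrix.isUnit_iff_isUnit_det _).1 (H.indep u hu)),
    Matrix.vecMul_one] at h7
  ext i
  exact congrFun h7 i

variable {M : Type*} [TopologicalSpace M] [ChartedSpace (EuclideanSpace ℝ (Fin m)) M]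
  [IsManifold (𝓡 m) ∞ M] {C : FPCase} {a : Axis}

theorem exists_column_eq_realForm {Φ : M → LoopQuot m k C} {z : ℂˣ} (hz : z ∈ a.range) {x : M}
    {X : loopGroup m k C} (hX : Φ x = QuotientGroup.mk X) (i : Idx m k) :
    column (conjDiag m k C a) (Φ x) z i = (realForm C a (X.1 z).1 i (mid m k) : ℂ) := by
  rw [hX, column_mk, ofReal_realForm fun i j => loop_conj X.2 hz i j]

theorem realForm_mid_form {X : loopGroup m k C} {z : ℂˣ} (hz : z ∈ a.range) :
    (target C a).form (fun i => realForm C a (X.1 z).1 i (mid m k))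
      (fun i => realForm C a (X.1 z).1 i (mid m k)) = (target C a).curv := by
  have h1 := realForm_orthogonal (a := a) (fun i j => loop_conj X.2 hz i j) (X.2.2.1 z)
  have h2 := (target C a).form_mulVec h1 (Pi.single (mid m k) 1) (Pi.single (mid m k) 1)
  rw [Matrix.mulVec_single_one] at h2
  refine h2.trans ?_
  rw [Target.form_eq]
  simp [mid]

/-- The columns of an immersive loop group map at the parameters of the range are immersions of
constant curvature with flat normal bundle. -/
theorem isFlatNormalImmersion_of_isLoopMap [ConnectedSpace M] {p : M} {Φ : M → LoopQuot m k C}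
    (hΦ : IsLoopMap p Φ) (himm : IsImmersive Φ) {z : ℂˣ} (hz : z ∈ a.range) :
    ∃ f : M → Idx m k → ℝ,
      (∀ x i, (f x i : ℂ) = column (conjDiag m k C a) (Φ x) z i) ∧
      IsFlatNormalImmersion (target C a) (curvAt (target C a) z) f := by
  set N := target C a with hN
  set f : M → Idx m k → ℝ := fun x i => (column (conjDiag m k C a) (Φ x) z i).re with hf
  have hfX : ∀ x (X : loopGroup m k C), Φ x = QuotientGroup.mk X → ∀ i,
      f x i = realForm C a (X.1 z).1 i (mid m k) := by
    intro x X hX i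
    simp only [hf]
    rw [exists_column_eq_realForm hz hX, Complex.ofReal_re]
  have hform : ∀ x, N.form (f x) (f x) = N.curv := by
    intro x
    obtain ⟨X, hX⟩ := QuotientGroup.mk_surjective (Φ x)
    have h1 : f x = fun i => realForm C a (X.1 z).1 i (mid m k) := funext (hfX x X hX.symm)
    rw [h1]
    exact realForm_mid_form hz
  have hsmooth : ContMDiff (𝓡 m) 𝓘(ℝ, Idx m k → ℝ) ∞ f := by
    intro x
    obtain ⟨U, hU, hxU, F, hFΦ, hF⟩ := hΦ.2 x
    have h1 : ContMDiffOn (𝓡 m) 𝓘(ℝ, Idx m k → ℝ) ∞ f U := by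
      rw [contMDiffOn_pi_space]
      intro i
      have h2 : ContDiff ℝ ∞ (fun w : ℂ =>
          (conjDiag m k C a i * w * (conjDiag m k C a (mid m k))⁻¹).re) :=
        Complex.reCLM.contDiff.comp ((contDiff_const.mul contDiff_id).mul contDiff_const)
      have h3 := h2.contMDiff.comp_contMDiffOn (hF.contMDiffOn z i (mid m k))
      exact h3.congr fun y hy => hfX y _ (hFΦ y hy) i
    exact h1.contMDiffAt (hU.mem_nhds hxU)
  have hzI : (z : ℂ) ≠ Complex.I ∧ (z : ℂ) ≠ -Complex.I := by
    have h1 := Axis.add_inv_ne_zero hz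
    constructor <;> intro h <;> rw [h] at h1 <;> simp [inv_neg] at h1
  -- an adapted frame around each point, in each chart
  have hframe : ∀ x₀ : M, ∀ u ∈ (chartAt (EuclideanSpace ℝ (Fin m)) x₀).target,
      ∃ S V, u ∈ V ∧ IsAdaptedFrame N (inChart f x₀) S V ∧
        (∀ i j b c, shapeComm S u i j b c = -(curvAt N z - N.curv) *
          (coframe S u i b * coframe S u j c - coframe S u j b * coframe S u i c)) ∧
        ∀ i j β γ, normalComm S u i j β γ = 0 := by
    intro x₀ u hu
    obtain ⟨U, hU, hxU, F, hFΦ, hF⟩ := hΦ.2 ((chartAt (EuclideanSpace ℝ (Fin m)) x₀).symm u)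
    obtain ⟨α, H⟩ := hF.exists_isLoopFrame hU x₀
    have HA := H.isAdaptedFrame (a := a) (z := z) hz (fun w hw => ?_) (h := inChart f x₀)
      (fun w hw i => hfX _ _ (hFΦ _ hw.2) i)
    · have huV : u ∈ (chartAt (EuclideanSpace ℝ (Fin m)) x₀).target ∩
        (chartAt (EuclideanSpace ℝ (Fin m)) x₀).symm ⁻¹' U := ⟨hu, hxU⟩
      exact ⟨_, _, huV, HA, H.shapeComm_realFrame hz HA huV, H.normalComm_realFrame hz huV⟩
    · have h1 := himm z hzI.1 hzI.2 ((chartAt (EuclideanSpace ℝ (Fin m)) x₀).symm w)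
      have h2 : ContMDiffOn (𝓡 m) 𝓘(ℝ, Idx m k → ℂ) ∞
          (fun y (i : Idx m k) => ((F y).1 z).1 i (mid m k)) U := by
        rw [contMDiffOn_pi_space]
        exact fun i => hF.contMDiffOn z i (mid m k)
      have h3 : (fun y => column (noConj m k) (Φ y) z) =ᶠ[nhds
          ((chartAt (EuclideanSpace ℝ (Fin m)) x₀).symm w)]
          fun y (i : Idx m k) => ((F y).1 z).1 i (mid m k) := by
        filter_upwards [hU.mem_nhds hw.2] with y hy
        funext i
        rw [hFΦ y hy, column_noConj_mk]
      rw [h3.mfderiv_eq] at h1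
      have h4 := fun v => fderiv_comp_chart x₀ hw.1
        ((h2.contMDiffAt (hU.mem_nhds hw.2)).mdifferentiableAt (by simp)) v
      intro v v' hvv
      rw [h4, h4] at hvv
      exact (chartDeriv_bijective x₀ hw.1).1 (h1 hvv)
  have hpos : ∀ (x : M) (v : TangentSpace (𝓡 m) x), v ≠ 0 →
      0 < N.form (mfderiv (𝓡 m) 𝓘(ℝ, Idx m k → ℝ) f x v : Idx m k → ℝ)
        (mfderiv (𝓡 m) 𝓘(ℝ, Idx m k → ℝ) f x v : Idx m k → ℝ) := by
    intro x
    have hx := mem_chart_target (EuclideanSpace ℝ (Fin m)) x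
    have hsymm := (chartAt (EuclideanSpace ℝ (Fin m)) x).left_inv
      (mem_chart_source (EuclideanSpace ℝ (Fin m)) x)
    obtain ⟨S, V, hu, H, -, -⟩ := hframe x _ hx
    have h1 := fun v => fderiv_comp_chart x hx (hsmooth.mdifferentiableAt (by simp)) v
    have h2 : ∀ v : TangentSpace (𝓡 m) ((chartAt (EuclideanSpace ℝ (Fin m)) x).symm
        (chartAt (EuclideanSpace ℝ (Fin m)) x x)), v ≠ 0 →
        0 < N.form (mfderiv (𝓡 m) 𝓘(ℝ, Idx m k → ℝ) f _ v : Idx m k → ℝ)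
        (mfderiv (𝓡 m) 𝓘(ℝ, Idx m k → ℝ) f _ v : Idx m k → ℝ) := by
      intro v hv
      obtain ⟨w, rfl⟩ := (chartDeriv_bijective x hx).2 v
      rw [← h1]
      exact H.form_fderiv_pos hu fun hw => hv (by rw [hw, map_zero])
    rwa [hsymm] at h2
  refine ⟨f, fun x i => ?_, hsmooth, fun x => ?_, fun x => ?_, hpos, fun x₀ u hu => ?_,
    fun x₀ => ?_⟩
  · obtain ⟨X, hX⟩ := QuotientGroup.mk_surjective (Φ x)
    rw [hfX x X hX.symm, exists_column_eq_realForm hz hX.symm]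
  · have h1 := hform x
    cases hNc : N <;> rw [hNc] at h1
    · exact h1
    · refine ⟨h1, ?_⟩
      -- a change of the sheet along the connected manifold would force a zero of the middle
      -- coordinate
      have hne : ∀ y, f y (mid m k) ≠ 0 := by
        intro y h0
        have h2 := hform y
        rw [hNc, Target.form_eq, h0] at h2
        simp only [Target.curv, Target.normalSign, mul_zero, zero_add, one_mul] at h2
        have h3 : 0 ≤ ∑ b : Fin m, f y (Sum.inl b) * f y (Sum.inl b) :=
          Finset.sum_nonneg fun b _ => mul_self_nonneg _
        have h4 : 0 ≤ ∑ b : Fin k, f y (Sum.inr (Sum.inr b)) * f y (Sum.inr (Sum.inr b)) :=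
          Finset.sum_nonneg fun b _ => mul_self_nonneg _
        linarith
      have hcont : Continuous fun y => f y (mid m k) :=
        (continuous_apply (mid m k)).comp hsmooth.continuous
      have hp : f p (mid m k) = 1 := by
        rw [hfX p 1 hΦ.1]
        change (conjDiag m k C a (mid m k) * (1 : Matrix (Idx m k) (Idx m k) ℂ) (mid m k) (mid m k) *
          (conjDiag m k C a (mid m k))⁻¹).re = 1
        rw [Matrix.one_apply_eq, mul_one, mul_inv_cancel₀ (conjDiag_ne_zero C a _), Complex.one_re]
      by_contra hneg
      obtain ⟨y, hy⟩ := mem_range_of_exists_le_of_exists_ge hcont ⟨x, not_lt.1 hneg⟩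
        ⟨p, by rw [hp]; exact zero_le_one⟩
      exact hne y hy
    · exact h1
    · exact h1
  · rw [injective_iff_map_eq_zero]
    intro v hv
    by_contra hv0
    have h1 := hpos x v hv0
    rw [hv] at h1
    have h2 : N.form (0 : Idx m k → ℝ) 0 = 0 := by simp [Target.form]
    exact lt_irrefl _ (h1.trans_eq h2)
  · obtain ⟨S, V, huV, H, hS, -⟩ := hframe x₀ u hu
    exact H.sectionalCurvatureEq_of_shapeComm huV hS
  · refine normalFlatOn_of_normalComm fun u hu => ?_
    obtain ⟨S, V, huV, H, -, hn⟩ := hframe x₀ u hu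
    exact ⟨S, V, huV, H, hn⟩

end Forward

/-! ### Uniqueness of parallel frames -/

section Parallel

variable {m : ℕ} {ι : Type} [Fintype ι] [DecidableEq ι]
  {B : Set (EuclideanSpace ℝ (Fin m))} {u₀ : EuclideanSpace ℝ (Fin m)}
  {A : Fin m → EuclideanSpace ℝ (Fin m) → Matrix ι ι ℂ} {J : Matrix ι ι ℂ}
  {X Y : EuclideanSpace ℝ (Fin m) → Matrix ι ι ℂ}

/-- The transposition as a bounded real-linear map. -/
def transposeCLM (ι : Type) [Fintype ι] [DecidableEq ι] : Matrix ι ι ℂ →L[ℝ] Matrix ι ι ℂ :=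
  LinearMap.toContinuousLinearMap (Matrix.transposeLinearEquiv ι ι ℝ ℂ).toLinearMap

@[simp] theorem transposeCLM_apply (X : Matrix ι ι ℂ) : transposeCLM ι X = X.transpose := rfl

/-- If `dX = X A` and `dY = Y A` with `A` in the Lie algebra of the form `J⁻¹`, then `X J Yᵗ` is
constant. -/
theorem parallel_const (hB : IsOpen B) (hBc : IsPreconnected B)
    (hX : ∀ u ∈ B, DifferentiableAt ℝ X u) (hXA : ∀ u ∈ B, ∀ i, pd i X u = X u * A i u)
    (hY : ∀ u ∈ B, DifferentiableAt ℝ Y u) (hYA : ∀ u ∈ B, ∀ i, pd i Y u = Y u * A i u)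
    (hA : ∀ u ∈ B, ∀ i, A i u * J + J * (A i u).transpose = 0) (h₀ : u₀ ∈ B)
    {u : EuclideanSpace ℝ (Fin m)} (hu : u ∈ B) :
    X u * J * (Y u).transpose = X u₀ * J * (Y u₀).transpose := by
  have hYt : ∀ u ∈ B, DifferentiableAt ℝ (fun w => transposeCLM ι (Y w)) u := fun u hu =>
    (transposeCLM ι).differentiableAt.comp u (hY u hu)
  have hXJ : ∀ u ∈ B, DifferentiableAt ℝ (fun w => X w * J) u := fun u hu =>
    (hX u hu).fun_mul (differentiableAt_const J)
  have hd : ∀ u ∈ B, DifferentiableAt ℝ (fun w => X w * J * transposeCLM ι (Y w)) u := fun u hu =>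
    (hXJ u hu).fun_mul (hYt u hu)
  have hz : B.EqOn (fderiv ℝ fun w => X w * J * transposeCLM ι (Y w)) 0 := by
    intro u hu
    have h1 : ∀ i, pd i (fun w => X w * J * transposeCLM ι (Y w)) u = 0 := by
      intro i
      have hT : pd i (fun w => transposeCLM ι (Y w)) u = transposeCLM ι (pd i Y u) :=
        pd_clm (transposeCLM ι) (hY u hu) i
      rw [pd_mul (hXJ u hu) (hYt u hu), pd_mul (hX u hu) (differentiableAt_const J), pd_const,
        hT, hXA u hu, hYA u hu, mul_zero, zero_add,
        transposeCLM_apply, transposeCLM_apply, Matrix.transpose_mul]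
      calc _ = X u * (A i u * J + J * (A i u).transpose) * (Y u).transpose := by noncomm_ring
        _ = 0 := by rw [hA u hu, mul_zero, zero_mul]
    ext1 v
    have h2 := fderiv_apply_eq_sum_pd (f := fun w => X w * J * transposeCLM ι (Y w)) (u := u) v
    exact h2.trans (Finset.sum_eq_zero fun i _ => by rw [h1, smul_zero])
  exact hB.is_const_of_fderiv_eq_zero hBc
    (fun u hu => (hd u hu).differentiableWithinAt) hz hu h₀

/-- A parallel frame which starts at `1` preserves the form. -/
theorem parallel_orthogonal (hB : IsOpen B) (hBc : IsPreconnected B)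
    (hY : ∀ u ∈ B, DifferentiableAt ℝ Y u) (hYA : ∀ u ∈ B, ∀ i, pd i Y u = Y u * A i u)
    (hA : ∀ u ∈ B, ∀ i, A i u * J + J * (A i u).transpose = 0) (h₀ : u₀ ∈ B)
    (hY₀ : Y u₀ = 1) {u : EuclideanSpace ℝ (Fin m)} (hu : u ∈ B) :
    Y u * J * (Y u).transpose = J := by
  rw [parallel_const hB hBc hY hYA hY hYA hA h₀ hu, hY₀]
  simp

/-- Two frames with the same Maurer–Cartan form differ by a constant factor on the left. -/
theorem parallel_eq (hB : IsOpen B) (hBc : IsPreconnected B)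
    (hX : ∀ u ∈ B, DifferentiableAt ℝ X u) (hXA : ∀ u ∈ B, ∀ i, pd i X u = X u * A i u)
    (hY : ∀ u ∈ B, DifferentiableAt ℝ Y u) (hYA : ∀ u ∈ B, ∀ i, pd i Y u = Y u * A i u)
    (hJ : IsUnit J)
    (hA : ∀ u ∈ B, ∀ i, A i u * J + J * (A i u).transpose = 0) (h₀ : u₀ ∈ B)
    (hY₀ : Y u₀ = 1) {u : EuclideanSpace ℝ (Fin m)} (hu : u ∈ B) : X u = X u₀ * Y u := by
  have h1 := parallel_const hB hBc hX hXA hY hYA hA h₀ hu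
  have h2 := parallel_orthogonal hB hBc hY hYA hA h₀ hY₀ hu
  have h3 : IsUnit (J * (Y u).transpose) := by
    have h4 : IsUnit (Y u * (J * (Y u).transpose)) := by rwa [← mul_assoc, h2]
    rw [Matrix.isUnit_iff_isUnit_det, Matrix.det_mul] at h4
    rw [Matrix.isUnit_iff_isUnit_det]
    exact isUnit_of_mul_isUnit_right h4
  refine h3.mul_right_cancel ?_
  rw [← mul_assoc, h1, hY₀, Matrix.transpose_one, mul_one, mul_assoc, ← mul_assoc (Y u), h2]

end Parallel

/-! ### The deformation of an adapted frame -/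

section Deformation

variable {m k : ℕ} {C : FPCase} {a : Axis} {z₀ : ℂˣ}

/-- The Maurer–Cartan form of a moving frame, carried into the complex group and divided by the
weights at the parameter `z₀`. The weight between the position vector and the normal directions is
zero; there the form of an adapted frame vanishes, and the quotient is `0` as well. -/
def loopForm (C : FPCase) (a : Axis) (z₀ : ℂˣ)
    (S : EuclideanSpace ℝ (Fin m) → Matrix (Idx m k) (Idx m k) ℝ) (i : Fin m)
    (u : EuclideanSpace ℝ (Fin m)) : Matrix (Idx m k) (Idx m k) ℂ :=
  Matrix.of fun b c => (conjDiag m k C a b)⁻¹ *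
    ((conn S i u b c : ℂ) / weight (z₀ : ℂ) b c) * conjDiag m k C a c

/-- The relation between the two weights that makes the Gauss equation independent of the
parameter. -/
theorem sq_sub_sq_weight (z : ℂ) (hz : z ≠ 0) : (z + z⁻¹) ^ 2 - (z⁻¹ - z) ^ 2 = 4 := by
  field_simp; ring

/-- `S` is an adapted frame for which the deformed Maurer–Cartan form is flat: the Gauss equation
holds for the curvature prescribed by the parameter `z₀`, the shape operators commute, and the
weights of `z₀` do not vanish. -/
structure IsDeformable (C : FPCase) (a : Axis) (z₀ : ℂˣ)
    (h : EuclideanSpace ℝ (Fin m) → Idx m k → ℝ)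
    (S : EuclideanSpace ℝ (Fin m) → Matrix (Idx m k) (Idx m k) ℝ)
    (V : Set (EuclideanSpace ℝ (Fin m))) : Prop where
  frame : IsAdaptedFrame (target C a) h S V
  mem : z₀ ∈ a.range
  ne : (z₀ : ℂ)⁻¹ - (z₀ : ℂ) ≠ 0
  shape : ∀ u ∈ V, ∀ i j b c, shapeComm S u i j b c =
    -(curvAt (target C a) z₀ - (target C a).curv) *
      (coframe S u i b * coframe S u j c - coframe S u j b * coframe S u i c)
  normal : ∀ u ∈ V, ∀ i j β γ, normalComm S u i j β γ = 0

namespace IsDeformable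

variable {h : EuclideanSpace ℝ (Fin m) → Idx m k → ℝ}
  {S : EuclideanSpace ℝ (Fin m) → Matrix (Idx m k) (Idx m k) ℝ}
  {V : Set (EuclideanSpace ℝ (Fin m))} (H : IsDeformable C a z₀ h S V)
  {u : EuclideanSpace ℝ (Fin m)}

include H

/-- The real Maurer–Cartan equation remains valid after multiplication by the quotients of the
weights. -/
theorem flat_entry (hu : u ∈ V) (z : ℂ) (hz : z ≠ 0) (i j : Fin m) (b c : Idx m k) :
    weight z b c / weight (z₀ : ℂ) b c *
      ((pd i (conn S j) u b c : ℂ) - pd j (conn S i) u b c) +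
      ∑ e, weight z b e / weight (z₀ : ℂ) b e * (weight z e c / weight (z₀ : ℂ) e c) *
        ((conn S i u b e : ℂ) * conn S j u e c - conn S j u b e * conn S i u e c) = 0 := by
  have F := H.frame
  have hd : ∀ i, DifferentiableAt ℝ (conn S i) u := fun i =>
    (F.contDiffAt_conn hu i).differentiableAt (by simp)
  have hMC : ((pd i (conn S j) u b c : ℂ) - pd j (conn S i) u b c) +
      ∑ e, ((conn S i u b e : ℂ) * conn S j u e c - conn S j u b e * conn S i u e c) = 0 := by
    have h1 := congrFun (congrFun (F.maurer_cartan hu i j) b) c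
    simp only [Matrix.add_apply, Matrix.sub_apply, Matrix.mul_apply, Matrix.zero_apply] at h1
    have h2 : (pd i (conn S j) u b c - pd j (conn S i) u b c) +
        ∑ e, (conn S i u b e * conn S j u e c - conn S j u b e * conn S i u e c) = 0 := by
      rw [Finset.sum_sub_distrib]; linarith
    exact_mod_cast congrArg (fun x : ℝ => (x : ℂ)) h2
  have hzero : ∀ b c, (∀ i, ∀ w ∈ V, conn S i w b c = 0) → ∀ i j, pd i (conn S j) u b c = 0 := by
    intro b c h0 i j
    rw [← pd_entry (hd j)]
    have h1 : (fun w => conn S j w b c) =ᶠ[nhds u] fun _ => 0 := by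
      filter_upwards [F.isOpen.mem_nhds hu] with w hw using h0 j w hw
    rw [pd_congr h1, pd_const]
  have hs0 := Axis.add_inv_ne_zero H.mem
  have hd0 := H.ne
  set s := z + z⁻¹ with hs
  set d := z⁻¹ - z with hd
  set s₀ := (z₀ : ℂ) + (z₀ : ℂ)⁻¹ with hs₀
  set d₀ := (z₀ : ℂ)⁻¹ - (z₀ : ℂ) with hd₀
  have hsd : s ^ 2 - d ^ 2 = 4 := sq_sub_sq_weight z hz
  have hsd₀ : s₀ ^ 2 - d₀ ^ 2 = 4 := sq_sub_sq_weight z₀ z₀.ne_zero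
  have hmid : ∀ i, conn S i u (Sum.inr (Sum.inl ())) (Sum.inr (Sum.inl ())) = 0 := fun i =>
    F.conn_mid_mid hu i
  have hnm : ∀ i γ, conn S i u (Sum.inr (Sum.inr γ)) (Sum.inr (Sum.inl ())) = 0 := fun i γ =>
    F.normal u hu i γ
  have hmn : ∀ i γ, conn S i u (Sum.inr (Sum.inl ())) (Sum.inr (Sum.inr γ)) = 0 := fun i γ =>
    F.conn_mid_normal hu i γ
  rw [sum_idx] at hMC ⊢
  rcases b with b | b | b <;> rcases c with c | c | c <;>
    simp only [weight, mid, ← hs, ← hd, ← hs₀, ← hd₀, div_one, one_mul, mul_one, zero_div,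
      zero_mul, mul_zero, hmid, hnm, hmn, Complex.ofReal_zero, sub_self, Finset.sum_const_zero,
      add_zero, zero_add, ← Finset.mul_sum] at hMC ⊢
  · have hN : (∑ γ, ((conn S i u (Sum.inl b) (Sum.inr (Sum.inr γ)) : ℂ) *
        conn S j u (Sum.inr (Sum.inr γ)) (Sum.inl c) -
        conn S j u (Sum.inl b) (Sum.inr (Sum.inr γ)) *
        conn S i u (Sum.inr (Sum.inr γ)) (Sum.inl c))) =
        ((shapeComm S u i j b c : ℝ) : ℂ) := by
      rw [shapeComm]; push_cast; rfl
    have h1 : ∀ i, conn S i u (Sum.inr (Sum.inl ())) (Sum.inl c) =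
        -((target C a).curv * coframe S u i c) := fun i => F.conn_mid_tangent hu i c
    have h2 : ∀ i, conn S i u (Sum.inl b) (Sum.inr (Sum.inl ())) = coframe S u i b := fun i => rfl
    have hc : (curvAt (target C a) z₀ : ℂ) * s₀ ^ 2 = 4 * ((target C a).curv : ℂ) := by
      rw [curvAt_eq, Complex.ofReal_mul, ofReal_curvScale H.mem, ← hs₀]
      field_simp
    rw [hN, H.shape u hu, h1, h1, h2, h2] at hMC ⊢
    push_cast at hMC ⊢
    have hscal : ((target C a).curv : ℂ) * (s / s₀ * (s / s₀) - 1) +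
        ((curvAt (target C a) z₀ : ℂ) - (target C a).curv) * (d / d₀ * (d / d₀) - 1) = 0 := by
      have hc' : (curvAt (target C a) z₀ : ℂ) - (target C a).curv =
          -((target C a).curv : ℂ) * d₀ ^ 2 / s₀ ^ 2 := by
        rw [eq_div_iff (pow_ne_zero 2 hs0)]
        linear_combination hc - ((target C a).curv : ℂ) * hsd₀
      rw [hc']
      field_simp
      linear_combination ((target C a).curv : ℂ) * (hsd - hsd₀)
    linear_combination hMC - ((coframe S u i b : ℂ) * coframe S u j c -
      coframe S u j b * coframe S u i c) * hscal
  · linear_combination (s / s₀) * hMC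
  · linear_combination (d / d₀) * hMC
  · linear_combination (s / s₀) * hMC
  · have hD := hzero (mid m k) (mid m k) (fun i w hw => F.conn_mid_mid hw i)
    simp only [mid] at hD
    rw [hD, hD] at hMC ⊢
    linear_combination (s / s₀ * (s / s₀)) * hMC
  · have hD := hzero (mid m k) (Sum.inr (Sum.inr c)) (fun i w hw => F.conn_mid_normal hw i c)
    simp only [mid] at hD
    rw [hD, hD] at hMC
    linear_combination (s / s₀ * (d / d₀)) * hMC
  · linear_combination (d / d₀) * hMC
  · have hD := hzero (Sum.inr (Sum.inr b)) (mid m k) (fun i w hw => F.normal w hw i b)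
    simp only [mid] at hD
    rw [hD, hD] at hMC
    linear_combination (d / d₀ * (s / s₀)) * hMC
  · have hN : (∑ e, ((conn S i u (Sum.inr (Sum.inr b)) (Sum.inl e) : ℂ) *
        conn S j u (Sum.inl e) (Sum.inr (Sum.inr c)) -
        conn S j u (Sum.inr (Sum.inr b)) (Sum.inl e) *
        conn S i u (Sum.inl e) (Sum.inr (Sum.inr c)))) = 0 := by
      have h1 := H.normal u hu i j b c
      rw [normalComm] at h1
      exact_mod_cast congrArg (fun x : ℝ => (x : ℂ)) h1
    rw [hN] at hMC ⊢
    linear_combination hMC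

theorem contDiffAt_loopForm (hu : u ∈ V) (i : Fin m) :
    ContDiffAt ℝ ∞ (loopForm C a z₀ S i) u := by
  refine contDiffAt_matrix fun b c => ?_
  have h1 : ContDiffAt ℝ ∞ (fun w => (conn S i w b c : ℂ)) u :=
    Complex.ofRealCLM.contDiff.contDiffAt.comp u
      (contDiffAt_entry (H.frame.contDiffAt_conn hu i) b c)
  exact (contDiffAt_const.mul (h1.mul contDiffAt_const)).mul contDiffAt_const

theorem pd_loopForm (hu : u ∈ V) (i j : Fin m) (b c : Idx m k) :
    pd i (loopForm C a z₀ S j) u b c = (conjDiag m k C a b)⁻¹ *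
      ((pd i (conn S j) u b c : ℂ) / weight (z₀ : ℂ) b c) * conjDiag m k C a c := by
  have hd := (H.frame.contDiffAt_conn hu j).differentiableAt (n := ∞) (by simp)
  have hbc : DifferentiableAt ℝ (fun w => conn S j w b c) u :=
    ((entryCLM ℝ b c).differentiableAt).comp u hd
  have hbc' : DifferentiableAt ℝ (fun w => (conn S j w b c : ℂ)) u :=
    Complex.ofRealCLM.differentiableAt.comp u hbc
  have h1 : pd i (fun w => (conn S j w b c : ℂ)) u = (pd i (conn S j) u b c : ℂ) := by
    rw [← pd_entry hd]
    exact pd_clm Complex.ofRealCLM hbc i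
  rw [← pd_entry ((H.contDiffAt_loopForm hu j).differentiableAt (n := ∞) (by simp))]
  have h2 : (fun w => loopForm C a z₀ S j w b c) = fun w => ((conjDiag m k C a b)⁻¹ *
      (weight (z₀ : ℂ) b c)⁻¹ * conjDiag m k C a c) * (conn S j w b c : ℂ) := by
    funext w
    simp only [loopForm, Matrix.of_apply]
    ring
  rw [h2, pd_mul (differentiableAt_const _) hbc', pd_const, zero_mul, add_zero, h1]
  ring

/-- The deformed Maurer–Cartan form is flat for every value of the parameter. -/
theorem flat (hu : u ∈ V) (z : ℂ) (hz : z ≠ 0) (i j : Fin m) :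
    weighted z (pd i (loopForm C a z₀ S j) u) - weighted z (pd j (loopForm C a z₀ S i) u) +
      weighted z (loopForm C a z₀ S i u) * weighted z (loopForm C a z₀ S j u) -
      weighted z (loopForm C a z₀ S j u) * weighted z (loopForm C a z₀ S i u) = 0 := by
  ext b c
  have h1 := H.flat_entry hu z hz i j b c
  have ht : ∀ e, conjDiag m k C a e * (conjDiag m k C a e)⁻¹ = 1 := fun e =>
    mul_inv_cancel₀ (conjDiag_ne_zero C a e)
  have hprod : ∀ i j, (weighted z (loopForm C a z₀ S i u) *
      weighted z (loopForm C a z₀ S j u)) b c = (conjDiag m k C a b)⁻¹ * conjDiag m k C a c *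
      ∑ e, weight z b e / weight (z₀ : ℂ) b e * (weight z e c / weight (z₀ : ℂ) e c) *
        ((conn S i u b e : ℂ) * conn S j u e c) := by
    intro i j
    rw [Matrix.mul_apply, Finset.mul_sum]
    refine Finset.sum_congr rfl fun e _ => ?_
    simp only [weighted, loopForm, Matrix.of_apply]
    linear_combination ((conjDiag m k C a b)⁻¹ * conjDiag m k C a c *
      (weight z b e / weight (z₀ : ℂ) b e * (weight z e c / weight (z₀ : ℂ) e c) *
        ((conn S i u b e : ℂ) * conn S j u e c))) * ht e
  rw [Matrix.sub_apply, Matrix.add_apply, Matrix.sub_apply, hprod, hprod, Matrix.zero_apply,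
    weighted, weighted, Matrix.of_apply, Matrix.of_apply, H.pd_loopForm hu, H.pd_loopForm hu]
  simp only [mul_sub, Finset.sum_sub_distrib] at h1
  linear_combination ((conjDiag m k C a b)⁻¹ * conjDiag m k C a c) * h1

end IsDeformable

end Deformation

/-! ### Integration of flat connection forms in coordinates -/

section CoordinateForms

attribute [-instance] NormedSpace.complexToReal Module.complexToReal NormedAlgebra.complexToReal

variable {m : ℕ} {𝔸 : Type} [NormedRing 𝔸] [NormedAlgebra ℝ 𝔸]
  [NormedAlgebra ℂ 𝔸] [IsScalarTower ℝ ℂ 𝔸] [CompleteSpace 𝔸]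

/-- The one-form with given coefficients. -/
def coordForm (α : Fin m → EuclideanSpace ℝ (Fin m) → 𝔸) (u : EuclideanSpace ℝ (Fin m)) :
    EuclideanSpace ℝ (Fin m) →L[ℝ] 𝔸 :=
  ∑ i, ContinuousLinearMap.smulRightL ℝ (EuclideanSpace ℝ (Fin m)) 𝔸
    (EuclideanSpace.proj i) (α i u)

theorem coordForm_apply (α : Fin m → EuclideanSpace ℝ (Fin m) → 𝔸)
    (u v : EuclideanSpace ℝ (Fin m)) : coordForm α u v = ∑ i, v i • α i u := by
  simp [coordForm, sum_apply]

theorem coordForm_single (α : Fin m → EuclideanSpace ℝ (Fin m) → 𝔸)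
    (u : EuclideanSpace ℝ (Fin m)) (i : Fin m) :
    coordForm α u (EuclideanSpace.single i 1) = α i u := by
  rw [coordForm_apply]
  simp [ite_smul]

theorem contDiffAt_coordForm {α : Fin m → EuclideanSpace ℝ (Fin m) → 𝔸}
    {u : EuclideanSpace ℝ (Fin m)} (hα : ∀ i, ContDiffAt ℝ ∞ (α i) u) :
    ContDiffAt ℝ ∞ (coordForm α) u := by
  refine ContDiffAt.sum fun i _ => ?_
  exact (ContinuousLinearMap.smulRightL ℝ (EuclideanSpace ℝ (Fin m)) 𝔸
    (EuclideanSpace.proj i)).contDiff.contDiffAt.comp u (hα i)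

theorem fderiv_coordForm {α : Fin m → EuclideanSpace ℝ (Fin m) → 𝔸}
    {u : EuclideanSpace ℝ (Fin m)} (hα : ∀ i, ContDiffAt ℝ ∞ (α i) u)
    (v w : EuclideanSpace ℝ (Fin m)) :
    fderiv ℝ (coordForm α) u v w = ∑ i, ∑ j, (v i * w j) • pd i (α j) u := by
  have h1 := (contDiffAt_coordForm hα).differentiableAt (by simp)
  have hd : ∀ j, DifferentiableAt ℝ (α j) u := fun j => (hα j).differentiableAt (by simp)
  have h2 : ∀ i, pd i (fun x => coordForm α x w) u = ∑ j, w j • pd i (α j) u := by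
    intro i
    have h3 : (fun x => coordForm α x w) = fun x => ∑ j, w j • α j x :=
      funext fun x => coordForm_apply α x w
    rw [h3, pd_sum (f := fun j x => w j • α j x) Finset.univ (fun j => (hd j).fun_const_smul (w j)) i]
    refine Finset.sum_congr rfl fun j _ => ?_
    rw [pd, fderiv_fun_const_smul (hd j)]
    rfl
  have h5 : fderiv ℝ (coordForm α) u v w = fderiv ℝ (fun x => coordForm α x w) u v := by
    rw [(h1.hasFDerivAt.clm_apply (hasFDerivAt_const w u)).fderiv]
    simp
  rw [h5, fderiv_apply_eq_sum_pd]
  refine Finset.sum_congr rfl fun i _ => ?_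
  rw [h2, Finset.smul_sum]
  exact Finset.sum_congr rfl fun j _ => smul_smul _ _ _

variable {κ : Type} [Fintype κ]

theorem sum_smul_coordForm (c : κ → ℂ) (α : κ → Fin m → EuclideanSpace ℝ (Fin m) → 𝔸)
    (u v : EuclideanSpace ℝ (Fin m)) :
    ∑ l, c l • coordForm (α l) u v = ∑ i, v i • ∑ l, c l • α l i u := by
  simp only [coordForm_apply, Finset.smul_sum]
  rw [Finset.sum_comm]
  exact Finset.sum_congr rfl fun i _ => Finset.sum_congr rfl fun l _ => smul_comm _ _ _

/-- A flat family of connection forms on a convex set, linear combinations of finitely many forms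
with coefficients depending on a complex parameter, integrates to a family of frames. -/
theorem exists_parallel_family_coord {B : Set (EuclideanSpace ℝ (Fin m))} (hBo : IsOpen B)
    (hB : Convex ℝ B) {u₀ : EuclideanSpace ℝ (Fin m)} (h₀ : u₀ ∈ B) (Z : Set ℂ) (hZ : IsOpen Z)
    (c : κ → ℂ → ℂ) (hc : ∀ l, DifferentiableOn ℂ (c l) Z)
    (α : κ → Fin m → EuclideanSpace ℝ (Fin m) → 𝔸)
    (hα : ∀ u ∈ B, ∀ l i, ContDiffAt ℝ ∞ (α l i) u)
    (hflat : ∀ u ∈ B, ∀ z ∈ Z, ∀ i j,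
      ∑ l, c l z • pd i (α l j) u - ∑ l, c l z • pd j (α l i) u +
        (∑ l, c l z • α l i u) * (∑ l, c l z • α l j u) -
        (∑ l, c l z • α l j u) * (∑ l, c l z • α l i u) = 0) :
    ∃ F : EuclideanSpace ℝ (Fin m) → ℂ → 𝔸,
      ContDiffOn ℝ ∞ (fun q : EuclideanSpace ℝ (Fin m) × ℂ => F q.1 q.2) (B ×ˢ Z) ∧
      (∀ u ∈ B, DifferentiableOn ℂ (F u) Z) ∧
      (∀ z, F u₀ z = 1) ∧
      ∀ z ∈ Z, ∀ u ∈ B, DifferentiableAt ℝ (fun w => F w z) u ∧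
        ∀ i, pd i (fun w => F w z) u = F u z * ∑ l, c l z • α l i u := by
  have key := exists_parallel_family hBo hB h₀ Z hZ c hc
    (fun l => coordForm (α l))
    (fun l u hu => (contDiffAt_coordForm (hα u hu l)).contDiffWithinAt) ?_
  · obtain ⟨F, h1, h2, h3, h4⟩ := key
    refine ⟨F, h1, h2, h3, fun z hz u hu => ⟨(h4 z hz u hu).differentiableAt, fun i => ?_⟩⟩
    rw [pd, (h4 z hz u hu).fderiv]
    simp [sum_apply, coordForm_single, Finset.mul_sum]
  · intro z hz u hu v w
    have e1 : ∑ l, c l z • (fderiv ℝ (coordForm (α l)) u v w -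
        fderiv ℝ (coordForm (α l)) u w v) = ∑ i, ∑ j, (v i * w j) •
        (∑ l, c l z • pd i (α l j) u - ∑ l, c l z • pd j (α l i) u) := by
      have e2 : ∀ l, fderiv ℝ (coordForm (α l)) u v w - fderiv ℝ (coordForm (α l)) u w v =
          ∑ i, ∑ j, (v i * w j) • (pd i (α l j) u - pd j (α l i) u) := by
        intro l
        rw [fderiv_coordForm (hα u hu l), fderiv_coordForm (hα u hu l) w v, Finset.sum_comm (f :=
          fun i j => (w i * v j) • pd i (α l j) u), ← Finset.sum_sub_distrib]
        refine Finset.sum_congr rfl fun i _ => ?_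
        rw [← Finset.sum_sub_distrib]
        refine Finset.sum_congr rfl fun j _ => ?_
        rw [smul_sub, mul_comm (w j)]
      simp only [e2, Finset.smul_sum, ← Finset.sum_sub_distrib, ← smul_sub]
      rw [Finset.sum_comm]
      refine Finset.sum_congr rfl fun i _ => ?_
      rw [Finset.sum_comm]
      exact Finset.sum_congr rfl fun j _ => Finset.sum_congr rfl fun l _ => smul_comm _ _ _
    have e3 : ∀ v w : EuclideanSpace ℝ (Fin m), (∑ i, v i • ∑ l, c l z • α l i u) *
        ∑ i, w i • ∑ l, c l z • α l i u =
        ∑ i, ∑ j, (v i * w j) • ((∑ l, c l z • α l i u) * ∑ l, c l z • α l j u) := by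
      intro v w
      rw [Finset.sum_mul_sum]
      exact Finset.sum_congr rfl fun i _ => Finset.sum_congr rfl fun j _ =>
        smul_mul_smul_comm _ _ _ _
    rw [e1, sum_smul_coordForm, sum_smul_coordForm, e3, e3, Finset.sum_comm (f :=
          fun i j => (w i * v j) • ((∑ l, c l z • α l i u) * ∑ l, c l z • α l j u)),
      ← Finset.sum_add_distrib, ← Finset.sum_sub_distrib]
    refine Finset.sum_eq_zero fun i _ => ?_
    rw [← Finset.sum_add_distrib, ← Finset.sum_sub_distrib]
    refine Finset.sum_eq_zero fun j _ => ?_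
    rw [mul_comm (w j), ← smul_add, ← smul_sub, hflat u hu z hz i j, smul_zero]

end CoordinateForms


/-! ### Integration of weighted connection forms -/

section Integration

variable {m k : ℕ}

/-- The three functions of the loop parameter which occur as weights. -/
def weightCoeff : Fin 3 → ℂ → ℂ := ![fun _ => 1, fun z => z + z⁻¹, fun z => z⁻¹ - z]

/-- The positions of a matrix to which each of the functions `weightCoeff` belongs. -/
def weightPart (l : Fin 3) : Idx m k → Idx m k → ℂ
  | .inl _, .inl _ => ![1, 0, 0] l
  | .inl _, .inr (.inl _) => ![0, 1, 0] l
  | .inl _, .inr (.inr _) => ![0, 0, 1] l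
  | .inr (.inl _), .inl _ => ![0, 1, 0] l
  | .inr (.inl _), .inr (.inl _) => ![1, 0, 0] l
  | .inr (.inl _), .inr (.inr _) => 0
  | .inr (.inr _), .inl _ => ![0, 0, 1] l
  | .inr (.inr _), .inr (.inl _) => 0
  | .inr (.inr _), .inr (.inr _) => ![1, 0, 0] l

theorem sum_weightCoeff (z : ℂ) (b c : Idx m k) :
    ∑ l, weightCoeff l z * weightPart l b c = weight z b c := by
  rcases b with b | b | b <;> rcases c with c | c | c <;>
    simp [weightCoeff, weightPart, weight, Fin.sum_univ_three]

theorem differentiableOn_weightCoeff (l : Fin 3) :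
    DifferentiableOn ℂ (weightCoeff l) ({0}ᶜ : Set ℂ) := by
  have h : DifferentiableOn ℂ (fun z : ℂ => z⁻¹) ({0}ᶜ : Set ℂ) := differentiableOn_inv
  fin_cases l
  · exact differentiableOn_const _
  · exact differentiableOn_id.add h
  · exact h.sub differentiableOn_id

/-- The entrywise product with a fixed matrix of coefficients, as a bounded real-linear map. -/
def hadamardCLM (w : Idx m k → Idx m k → ℂ) : Matrix (Idx m k) (Idx m k) ℂ →L[ℝ]
    Matrix (Idx m k) (Idx m k) ℂ :=
  LinearMap.toContinuousLinearMap
    { toFun := fun X => Matrix.of fun b c => w b c * X b c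
      map_add' := fun X Y => by ext b c; simp [mul_add]
      map_smul' := fun r X => by ext b c; simp [mul_left_comm] }

theorem hadamardCLM_apply (w : Idx m k → Idx m k → ℂ) (X : Matrix (Idx m k) (Idx m k) ℂ) :
    hadamardCLM w X = Matrix.of fun b c => w b c * X b c := rfl

theorem sum_hadamardCLM (z : ℂ) (X : Matrix (Idx m k) (Idx m k) ℂ) :
    ∑ l, weightCoeff l z • hadamardCLM (weightPart l) X = weighted z X := by
  ext b c
  rw [weighted, Matrix.of_apply, ← sum_weightCoeff, Finset.sum_mul, Matrix.sum_apply]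
  refine Finset.sum_congr rfl fun l _ => ?_
  rw [Matrix.smul_apply, hadamardCLM_apply, Matrix.of_apply, smul_eq_mul, mul_assoc]

/-- A flat family of weighted connection forms on a convex set integrates to a family of frames. -/
theorem exists_weighted_family {α : Fin m → EuclideanSpace ℝ (Fin m) → Matrix (Idx m k) (Idx m k) ℂ}
    {B : Set (EuclideanSpace ℝ (Fin m))} (hBo : IsOpen B) (hB : Convex ℝ B)
    {u₀ : EuclideanSpace ℝ (Fin m)} (h₀ : u₀ ∈ B) (hα : ∀ u ∈ B, ∀ i, ContDiffAt ℝ ∞ (α i) u)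
    (hflat : ∀ u ∈ B, ∀ z : ℂ, z ≠ 0 → ∀ i j,
      weighted z (pd i (α j) u) - weighted z (pd j (α i) u) +
        weighted z (α i u) * weighted z (α j u) - weighted z (α j u) * weighted z (α i u) = 0) :
    ∃ F : EuclideanSpace ℝ (Fin m) → ℂ → Matrix (Idx m k) (Idx m k) ℂ,
      ContDiffOn ℝ ∞ (fun q : EuclideanSpace ℝ (Fin m) × ℂ => F q.1 q.2) (B ×ˢ ({0}ᶜ : Set ℂ)) ∧
      (∀ u ∈ B, DifferentiableOn ℂ (F u) ({0}ᶜ : Set ℂ)) ∧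
      (∀ z, F u₀ z = 1) ∧
      ∀ z : ℂ, z ≠ 0 → ∀ u ∈ B, DifferentiableAt ℝ (fun w => F w z) u ∧
        ∀ i, pd i (fun w => F w z) u = F u z * weighted z (α i u) := by
  have hpd : ∀ u ∈ B, ∀ l i j, pd i (fun w => hadamardCLM (weightPart l) (α j w)) u =
      hadamardCLM (weightPart l) (pd i (α j) u) := fun u hu l i j =>
    pd_clm (hadamardCLM (weightPart l)) ((hα u hu j).differentiableAt (by simp)) i
  have key := exists_parallel_family_coord hBo hB h₀ ({0}ᶜ : Set ℂ)
    isOpen_compl_singleton weightCoeff differentiableOn_weightCoeff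
    (fun l i u => hadamardCLM (weightPart l) (α i u))
    (fun u hu l i => (hadamardCLM (weightPart l)).contDiff.contDiffAt.comp u (hα u hu i)) ?_
  · obtain ⟨F, h1, h2, h3, h4⟩ := key
    refine ⟨F, h1, h2, h3, fun z hz u hu => ⟨(h4 z hz u hu).1, fun i => ?_⟩⟩
    rw [← sum_hadamardCLM]
    exact (h4 z hz u hu).2 i
  · intro u hu z hz i j
    have h := hflat u hu z hz i j
    simp only [← sum_hadamardCLM] at h
    simp only [hpd u hu]
    exact h

end Integration

/-! ### The loop group map of an adapted frame -/

section LoopFrameOfFrame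

variable {m k : ℕ} {C : FPCase} {a : Axis} {z₀ : ℂˣ}

/-- The entrywise complex conjugation as a bounded real-linear map. -/
def conjCLM (ι : Type) [Fintype ι] [DecidableEq ι] : Matrix ι ι ℂ →L[ℝ] Matrix ι ι ℂ :=
  LinearMap.toContinuousLinearMap
    { toFun := fun X => X.map (starRingEnd ℂ)
      map_add' := fun X Y => by ext b c; simp
      map_smul' := fun r X => by ext b c; simp }

theorem conjCLM_apply {ι : Type} [Fintype ι] [DecidableEq ι] (X : Matrix ι ι ℂ) :
    conjCLM ι X = X.map (starRingEnd ℂ) := rfl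

/-- The conjugation of a real matrix by the diagonal matrix with entries `t`. -/
def conjDiagCLM (t : Idx m k → ℂ) :
    Matrix (Idx m k) (Idx m k) ℝ →L[ℝ] Matrix (Idx m k) (Idx m k) ℂ :=
  LinearMap.toContinuousLinearMap
    { toFun := fun X => Matrix.of fun b c => (t b)⁻¹ * (X b c : ℂ) * t c
      map_add' := fun X Y => by ext b c; simp; ring
      map_smul' := fun r X => by ext b c; simp; ring }

theorem conjDiagCLM_apply (t : Idx m k → ℂ) (X : Matrix (Idx m k) (Idx m k) ℝ) :
    conjDiagCLM t X = Matrix.of fun b c => (t b)⁻¹ * (X b c : ℂ) * t c := rfl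

theorem conjDiagCLM_mul {t : Idx m k → ℂ} (ht : ∀ i, t i ≠ 0)
    (X Y : Matrix (Idx m k) (Idx m k) ℝ) :
    conjDiagCLM t (X * Y) = conjDiagCLM t X * conjDiagCLM t Y := by
  ext b c
  simp only [conjDiagCLM_apply, Matrix.of_apply, Matrix.mul_apply, Complex.ofReal_sum,
    Finset.mul_sum, Finset.sum_mul]
  refine Finset.sum_congr rfl fun e _ => ?_
  have := ht e
  push_cast
  field_simp

theorem conjDiagCLM_one {t : Idx m k → ℂ} (ht : ∀ i, t i ≠ 0) :
    conjDiagCLM t (1 : Matrix (Idx m k) (Idx m k) ℝ) = 1 := by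
  ext b c
  rw [conjDiagCLM_apply, Matrix.of_apply]
  by_cases hbc : b = c
  · subst hbc
    simp [ht b]
  · simp [Matrix.one_apply_ne hbc]

theorem realForm_conjDiagCLM (X : Matrix (Idx m k) (Idx m k) ℝ) :
    realForm C a (conjDiagCLM (conjDiag m k C a) X) = X := by
  ext b c
  have h1 := conjDiag_ne_zero C a b
  have h2 := conjDiag_ne_zero C a c
  have e : conjDiag m k C a b * conjDiagCLM (conjDiag m k C a) X b c * (conjDiag m k C a c)⁻¹ =
      (X b c : ℂ) := by
    rw [conjDiagCLM_apply, Matrix.of_apply]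
    field_simp
  rw [realForm, Matrix.of_apply, e, Complex.ofReal_re]

namespace IsDeformable

variable {h : EuclideanSpace ℝ (Fin m) → Idx m k → ℝ}
  {S : EuclideanSpace ℝ (Fin m) → Matrix (Idx m k) (Idx m k) ℝ}
  {V : Set (EuclideanSpace ℝ (Fin m))} (H : IsDeformable C a z₀ h S V)
  {u : EuclideanSpace ℝ (Fin m)}

include H

theorem conn_eq_zero_of_weight (hu : u ∈ V) (i : Fin m) {b c : Idx m k}
    (h0 : weight (z₀ : ℂ) b c = 0) : conn S i u b c = 0 := by
  have hs := Axis.add_inv_ne_zero H.mem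
  have hd := H.ne
  have F := H.frame
  rcases b with b | b | b <;> rcases c with c | c | c <;> simp only [weight] at h0
  · exact absurd h0 one_ne_zero
  · exact absurd h0 hs
  · exact absurd h0 hd
  · exact absurd h0 hs
  · exact absurd h0 one_ne_zero
  · exact F.conn_mid_normal hu i c
  · exact absurd h0 hd
  · exact F.normal u hu i b
  · exact absurd h0 one_ne_zero

/-- At the parameter `z₀` the deformation gives back the given frame. -/
theorem weighted_loopForm (hu : u ∈ V) (i : Fin m) :
    weighted (z₀ : ℂ) (loopForm C a z₀ S i u) = conjDiagCLM (conjDiag m k C a) (conn S i u) := by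
  ext b c
  rw [weighted, Matrix.of_apply, loopForm, Matrix.of_apply, conjDiagCLM_apply, Matrix.of_apply]
  by_cases h0 : weight (z₀ : ℂ) b c = 0
  · rw [h0, H.conn_eq_zero_of_weight hu i h0]; simp
  · field_simp

/-- The deformed Maurer–Cartan form takes values in the Lie algebra of the complex group. -/
theorem skew_loopForm (hu : u ∈ V) (i : Fin m) (z : ℂ) :
    weighted z (loopForm C a z₀ S i u) * Matrix.diagonal (diag3 m k 1 C.eps 1) +
      Matrix.diagonal (diag3 m k 1 C.eps 1) *
        (weighted z (loopForm C a z₀ S i u)).transpose = 0 := by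
  obtain ⟨e, he, hsig⟩ := conjDiag_signs (m := m) (k := k) C a
  have hC : C.eps * C.eps = 1 := by cases C <;> simp [FPCase.eps]
  set A := weighted z (loopForm C a z₀ S i u) with hA
  set D := Matrix.diagonal (diag3 m k 1 C.eps 1) with hD
  have hDD : D * D = 1 := diagonal_mul_self fun i => diag3_mul_self m k i hC (by norm_num)
  have h1 : A.transpose * D + D * A = 0 := by
    ext b c
    rw [Matrix.add_apply, hD, Matrix.mul_diagonal, Matrix.diagonal_mul, Matrix.transpose_apply,
      hsig, hsig, Matrix.zero_apply, hA, weighted, Matrix.of_apply, Matrix.of_apply, loopForm,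
      Matrix.of_apply, Matrix.of_apply, weight_symm z c b, weight_symm (z₀ : ℂ) c b]
    have h2 := congrArg (fun x : ℝ => (x : ℂ)) (H.frame.conn_skew hu i b c)
    simp only [Complex.ofReal_add, Complex.ofReal_mul, Complex.ofReal_zero] at h2
    have hb := mul_inv_cancel₀ (conjDiag_ne_zero (m := m) (k := k) C a b)
    have hc := mul_inv_cancel₀ (conjDiag_ne_zero (m := m) (k := k) C a c)
    set tb := conjDiag m k C a b
    set tc := conjDiag m k C a c
    set sb : ℂ := ((target C a).signs m k b : ℂ)
    set sc : ℂ := ((target C a).signs m k c : ℂ)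
    set w := weight z b c / weight (z₀ : ℂ) b c with hw
    calc _ = e * w * tb * tc * ((conn S i u c b : ℂ) * sc * (tc * tc⁻¹) +
          sb * (conn S i u b c : ℂ) * (tb * tb⁻¹)) := by rw [hw]; ring
      _ = 0 := by rw [hb, hc, mul_one, mul_one, h2, mul_zero]
  calc A * D + D * A.transpose = (D * D) * A * D + D * A.transpose * (D * D) := by
        rw [hDD, Matrix.one_mul, Matrix.mul_one]
    _ = D * (A.transpose * D + D * A) * D := by noncomm_ring
    _ = 0 := by rw [h1, Matrix.mul_zero, Matrix.zero_mul]

/-- The deformed Maurer–Cartan form satisfies the reality condition. -/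
theorem conj_loopForm (i : Fin m) (z : ℂˣ) :
    (weighted (C.refl z : ℂ) (loopForm C a z₀ S i u)).map (starRingEnd ℂ) =
      weighted (z : ℂ) (loopForm C a z₀ S i u) := by
  ext b c
  rw [Matrix.map_apply, weighted, weighted, Matrix.of_apply, Matrix.of_apply, loopForm,
    Matrix.of_apply]
  have h1 := conj_conjDiag_div (m := m) (k := k) C a c b
  have h2 := weight_conj (C := C) H.mem z b c
  have hb := axisSign_mul_self (m := m) (k := k) C a b
  have hc := axisSign_mul_self (m := m) (k := k) C a c
  set w := weight (z₀ : ℂ) b c with hw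
  set rb := axisSign m k C a b
  set rc := axisSign m k C a c
  by_cases h0 : w = 0
  · simp [h0]
  have h0' : starRingEnd ℂ w ≠ 0 := (map_ne_zero _).2 h0
  have e1 : ∀ x : ℂ, x * ((conjDiag m k C a b)⁻¹ * ((conn S i u b c : ℂ) / w) *
      conjDiag m k C a c) = conjDiag m k C a c * (conjDiag m k C a b)⁻¹ *
        (conn S i u b c : ℂ) * (x / w) := fun x => by ring
  have e2 : starRingEnd ℂ (weight (C.refl z : ℂ) b c) / starRingEnd ℂ w =
      rb * rc * (weight (z : ℂ) b c / w) := by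
    rw [div_eq_iff h0', mul_div_assoc', div_mul_eq_mul_div, eq_div_iff h0]
    exact h2
  rw [e1, e1, map_mul, map_mul, map_div₀, Complex.conj_ofReal, h1, e2]
  linear_combination (conjDiag m k C a c * (conjDiag m k C a b)⁻¹ * (conn S i u b c : ℂ) *
    (weight (z : ℂ) b c / w)) * (rc * rc * hb + hc)

end IsDeformable

theorem mdifferentiable_units {f : ℂ → ℂ} (hf : DifferentiableOn ℂ f ({0}ᶜ : Set ℂ)) :
    MDifferentiable 𝓘(ℂ, ℂ) 𝓘(ℂ, ℂ) (fun z : ℂˣ => f z) := by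
  intro z
  have h1 : MDifferentiableAt 𝓘(ℂ, ℂ) 𝓘(ℂ, ℂ) f (z : ℂ) :=
    (hf.differentiableAt (isOpen_compl_singleton.mem_nhds z.ne_zero)).mdifferentiableAt
  have h2 : ContMDiff 𝓘(ℂ, ℂ) 𝓘(ℂ, ℂ) ∞ (fun z : ℂˣ => (z : ℂ)) := Units.contMDiff_val
  exact h1.comp z (h2.mdifferentiableAt (by simp))

end LoopFrameOfFrame

section LoopFrameOfFrame

variable {m k : ℕ} {C : FPCase} {a : Axis} {z₀ : ℂˣ}

theorem conj_weighted_of_signs {r : Idx m k → ℂ} {w z : ℂ}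
    (hw : ∀ b c : Idx m k, weight w b c = r b * r c * weight z b c) (hr : ∀ b, r b * r b = 1)
    (X : Matrix (Idx m k) (Idx m k) ℂ) :
    Matrix.diagonal r * weighted w X * Matrix.diagonal r = weighted z X := by
  ext b c
  rw [Matrix.mul_diagonal, Matrix.diagonal_mul, weighted, weighted, Matrix.of_apply,
    Matrix.of_apply, hw]
  linear_combination (weight z b c * X b c) * (r c * r c * hr b + hr c)

namespace IsDeformable

variable {h : EuclideanSpace ℝ (Fin m) → Idx m k → ℝ}
  {S : EuclideanSpace ℝ (Fin m) → Matrix (Idx m k) (Idx m k) ℝ}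
  {V : Set (EuclideanSpace ℝ (Fin m))} (H : IsDeformable C a z₀ h S V)

include H

/-- The deformed Maurer–Cartan form integrates to a map into the loop group, which gives back the
original frame at the parameter `z₀`. -/
theorem exists_isLoopFrame {B : Set (EuclideanSpace ℝ (Fin m))} (hBo : IsOpen B)
    (hB : Convex ℝ B) (hBV : B ⊆ V) {u₀ : EuclideanSpace ℝ (Fin m)} (h₀ : u₀ ∈ B) :
    ∃ (G : EuclideanSpace ℝ (Fin m) → loopGroup m k C)
      (F : EuclideanSpace ℝ (Fin m) → ℂ → Matrix (Idx m k) (Idx m k) ℂ),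
      IsLoopFrame G (loopForm C a z₀ S) B ∧
      ContDiffOn ℝ ∞ (fun q : EuclideanSpace ℝ (Fin m) × ℂ => F q.1 q.2)
        (B ×ˢ ({0}ᶜ : Set ℂ)) ∧
      (∀ u ∈ B, ∀ z : ℂˣ, ((G u).1 z).1 = F u z) ∧ G u₀ = 1 ∧
      ∀ u ∈ B, realFrame a G z₀ u = (S u₀)⁻¹ * S u := by
  obtain ⟨F, hF, hFz, hF₀, hFpd⟩ := exists_weighted_family (α := loopForm C a z₀ S) hBo hB h₀
    (fun u hu i => H.contDiffAt_loopForm (hBV hu) i) (fun u hu z hz i j => H.flat (hBV hu) z hz i j)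
  have hBc : IsPreconnected B := hB.isPreconnected
  have hd : ∀ z : ℂˣ, ∀ u ∈ B, DifferentiableAt ℝ (fun w => F w z) u := fun z u hu =>
    (hFpd z z.ne_zero u hu).1
  have hp : ∀ z : ℂˣ, ∀ u ∈ B, ∀ i, pd i (fun w => F w z) u =
      F u z * weighted (z : ℂ) (loopForm C a z₀ S i u) := fun z u hu => (hFpd z z.ne_zero u hu).2
  set J := Matrix.diagonal (diag3 m k 1 C.eps 1) with hJ
  have hC : C.eps * C.eps = 1 := by cases C <;> simp [FPCase.eps]
  have hJs : ∀ i, diag3 m k 1 C.eps 1 i * diag3 m k 1 C.eps 1 i = 1 := fun i =>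
    diag3_mul_self m k i hC (by norm_num)
  have hJu : IsUnit J := IsUnit.of_mul_eq_one _ (diagonal_mul_self hJs)
  have hsk : ∀ z : ℂˣ, ∀ u ∈ B, ∀ i, weighted (z : ℂ) (loopForm C a z₀ S i u) * J + J *
      (weighted (z : ℂ) (loopForm C a z₀ S i u)).transpose = 0 := fun z u hu i =>
    H.skew_loopForm (hBV hu) i z
  -- a frame with the same Maurer–Cartan form and the same initial value agrees with `F`
  have huniq : ∀ (z : ℂˣ) (X : EuclideanSpace ℝ (Fin m) → Matrix (Idx m k) (Idx m k) ℂ),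
      (∀ u ∈ B, DifferentiableAt ℝ X u) →
      (∀ u ∈ B, ∀ i, pd i X u = X u * weighted (z : ℂ) (loopForm C a z₀ S i u)) →
      X u₀ = 1 → ∀ u ∈ B, X u = F u z := by
    intro z X hX hXp hX₀ u hu
    have h1 := parallel_eq (J := J) (A := fun i u => weighted (z : ℂ) (loopForm C a z₀ S i u))
      (Y := fun w => F w z) hBo hBc hX hXp (hd z) (hp z) hJu (hsk z) h₀ (hF₀ z) hu
    rw [h1, hX₀, Matrix.one_mul]
  -- hence `F` inherits the symmetries of its Maurer–Cartan form
  have horth : ∀ z : ℂˣ, ∀ u ∈ B, (F u z).transpose * J * F u z = J := by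
    intro z u hu
    have h1 := parallel_orthogonal (J := J)
      (A := fun i u => weighted (z : ℂ) (loopForm C a z₀ S i u))
      (Y := fun w => F w z) hBo hBc (hd z) (hp z) (hsk z) h₀ (hF₀ z) hu
    have h2 := mul_transpose_of_orthogonal (S := (F u z).transpose) hJs
      (by rw [Matrix.transpose_transpose]; exact h1)
    rwa [Matrix.transpose_transpose] at h2
  have hdet : ∀ z : ℂˣ, ∀ u ∈ B, (F u z).det = 1 := by
    intro z
    have hcont : ContinuousOn (fun u => (F u z).det) B := fun u hu =>
      (Continuous.matrix_det continuous_id).continuousAt.comp_continuousWithinAt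
        (hd z u hu).continuousAt.continuousWithinAt
    have hsq : Set.EqOn ((fun u => (F u z).det) ^ 2) 1 B := by
      intro u hu
      have h1 := congrArg Matrix.det (horth z u hu)
      rw [Matrix.det_mul, Matrix.det_mul, Matrix.det_transpose] at h1
      have h2 : J.det ≠ 0 := ((Matrix.isUnit_iff_isUnit_det _).1 hJu).ne_zero
      simp only [Pi.pow_apply, Pi.one_apply]
      refine mul_right_cancel₀ h2 ?_
      linear_combination h1
    rcases hBc.eq_one_or_eq_neg_one_of_sq_eq hcont hsq with h1 | h1
    · exact h1
    · have h2 := h1 h₀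
      simp only [hF₀, Matrix.det_one, Pi.neg_apply, Pi.one_apply] at h2
      norm_num at h2
  have hconj : ∀ (r : Idx m k → ℂ) (z w : ℂˣ), (∀ b, r b * r b = 1) →
      (∀ b c : Idx m k, weight (w : ℂ) b c = r b * r c * weight (z : ℂ) b c) →
      ∀ u ∈ B, Matrix.diagonal r * F u w * Matrix.diagonal r = F u z := by
    intro r z w hr hw
    have hdr : ∀ u ∈ B, DifferentiableAt ℝ (fun u => Matrix.diagonal r * F u w) u := fun u hu =>
      (differentiableAt_const _).fun_mul (hd w u hu)
    refine huniq z _ (fun u hu => (hdr u hu).fun_mul (differentiableAt_const _))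
      (fun u hu i => ?_) ?_
    · rw [pd_mul (hdr u hu) (differentiableAt_const _), pd_const, mul_zero, zero_add,
        pd_mul (differentiableAt_const _) (hd w u hu), pd_const, zero_mul, add_zero, hp w u hu,
        ← conj_weighted_of_signs hw hr]
      have hR := diagonal_mul_self hr
      set R := Matrix.diagonal r
      calc _ = R * F u w * 1 * weighted (w : ℂ) (loopForm C a z₀ S i u) * R := by noncomm_ring
        _ = _ := by rw [← hR]; noncomm_ring
    · rw [hF₀, Matrix.mul_one, diagonal_mul_self hr]
  have hmem : ∀ u : B, (fun z : ℂˣ => (⟨F u z, hdet z u u.2⟩ : Matrix.SpecialLinearGroup (Idx m k) ℂ)) ∈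
      loopGroup m k C := by
    rintro ⟨u, hu⟩
    refine ⟨fun i j => ?_, fun z => horth z u hu, fun z => ?_, fun z => ?_, fun z => ?_⟩
    · refine mdifferentiable_units (f := fun z => F u z i j) fun z hz => ?_
      exact ((LinearMap.toContinuousLinearMap
        (Matrix.entryLinearMap ℂ ℂ i j)).differentiableAt).comp_differentiableWithinAt z
          (hFz u hu z hz)
    · exact hconj (signP m k) z (-z) signP_mul_self
        (fun b c => by rw [Units.val_neg]; exact weight_neg (z : ℂ) b c) u hu
    · exact hconj (signQ m k) z z⁻¹ signQ_mul_self
        (fun b c => by rw [Units.val_inv_eq_inv_val]; exact weight_inv (z : ℂ) b c) u hu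
    · refine huniq z (fun w => conjCLM (Idx m k) (F w (C.refl z)))
        (fun u hu => (conjCLM (Idx m k)).differentiableAt.comp u (hd _ u hu))
        (fun u hu i => ?_) ?_ u hu
      · have h1 : pd i (fun w => conjCLM (Idx m k) (F w (C.refl z))) u =
            conjCLM (Idx m k) (pd i (fun w => F w (C.refl z)) u) :=
          pd_clm (conjCLM (Idx m k)) (hd _ u hu) i
        rw [h1, hp _ u hu, conjCLM_apply, conjCLM_apply, Matrix.map_mul, H.conj_loopForm]
      · rw [conjCLM_apply, hF₀]
        simp
  classical
  set G : EuclideanSpace ℝ (Fin m) → loopGroup m k C := fun u =>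
    if hu : u ∈ B then ⟨_, hmem ⟨u, hu⟩⟩ else 1 with hG
  have hGF : ∀ u ∈ B, ∀ z : ℂˣ, ((G u).1 z).1 = F u z := by
    intro u hu z
    simp only [hG, dif_pos hu]
  have hGev : ∀ u ∈ B, ∀ z : ℂˣ, (fun w => ((G w).1 z).1) =ᶠ[nhds u] fun w => F w z :=
    fun u hu z => by filter_upwards [hBo.mem_nhds hu] with w hw using hGF w hw z
  refine ⟨G, F, ⟨hBo, fun z => ?_, fun u hu z i => ?_⟩, hF, hGF, ?_, fun u hu => ?_⟩
  · have h1 : ContDiffOn ℝ ∞ (fun u => F u z) B :=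
      hF.comp (g := fun q : EuclideanSpace ℝ (Fin m) × ℂ => F q.1 q.2) (f := fun u => (u, (z : ℂ)))
        (contDiff_id.prodMk contDiff_const).contDiffOn
        fun u hu => ⟨hu, z.ne_zero⟩
    exact h1.congr fun u hu => hGF u hu z
  · rw [pd_congr (hGev u hu z), hp z u hu, hGF u hu]
  · refine Subtype.ext (funext fun z => Subtype.ext ?_)
    rw [hGF u₀ h₀, hF₀]
    rfl
  · set L := conjDiagCLM (conjDiag m k C a) with hL
    have hcd := conjDiag_ne_zero (m := m) (k := k) C a
    have hSd : ∀ u ∈ B, DifferentiableAt ℝ S u := fun u hu =>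
      (H.frame.contDiffAt (hBV hu)).differentiableAt (by simp)
    have hSd' : ∀ u ∈ B, DifferentiableAt ℝ (fun w => (S u₀)⁻¹ * S w) u := fun u hu =>
      (differentiableAt_const _).fun_mul (hSd u hu)
    have h1 := huniq z₀ (fun w => L ((S u₀)⁻¹ * S w))
      (fun u hu => L.differentiableAt.comp u (hSd' u hu)) (fun u hu i => ?_) ?_ u hu
    · rw [realFrame, hGF u hu, ← h1, hL, realForm_conjDiagCLM]
    · have h2 : pd i (fun w => L ((S u₀)⁻¹ * S w)) u = L (pd i (fun w => (S u₀)⁻¹ * S w) u) :=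
        pd_clm L (hSd' u hu) i
      rw [h2, pd_mul (differentiableAt_const _) (hSd u hu), pd_const, zero_mul, add_zero,
        H.weighted_loopForm (hBV hu), hL, ← conjDiagCLM_mul hcd, ← H.frame.mul_conn (hBV hu),
        Matrix.mul_assoc]
    · have h2 : (S u₀)⁻¹ * S u₀ = 1 := Matrix.nonsing_inv_mul _
        ((Matrix.isUnit_iff_isUnit_det _).1 (H.frame.isUnit (hBV h₀)))
      simp only [h2]
      exact conjDiagCLM_one hcd

end IsDeformable

end LoopFrameOfFrame

/-! ### Block orthogonal matrices -/

section BlockOrthogonal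

variable {m k : ℕ}

/-- The block of an index: tangential, position vector or normal. -/
def blockKind : Idx m k → Fin 3
  | .inl _ => 0
  | .inr (.inl _) => 1
  | .inr (.inr _) => 2

theorem weight_congr (z : ℂ) {b b' c c' : Idx m k} (hb : blockKind b = blockKind b')
    (hc : blockKind c = blockKind c') : weight z b c = weight z b' c' := by
  rcases b with b | b | b <;> rcases b' with b' | b' | b' <;> simp [blockKind] at hb <;>
    rcases c with c | c | c <;> rcases c' with c' | c' | c' <;> simp [blockKind] at hc <;> rfl

theorem conjDiag_congr {C : FPCase} {a : Axis} {b c : Idx m k} (h : blockKind b = blockKind c) :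
    conjDiag m k C a b = conjDiag m k C a c := by
  rcases b with b | b | b <;> rcases c with c | c | c <;> simp [blockKind] at h <;>
    cases C <;> cases a <;> rfl

theorem weight_of_blockKind_eq (z : ℂ) {b c : Idx m k} (h : blockKind b = blockKind c) :
    weight z b c = 1 := by
  rcases b with b | b | b <;> rcases c with c | c | c <;> simp [blockKind] at h <;> rfl

/-- The elements of `O(m) × {1} × O(k)`. -/
structure IsBlockOrthogonal (K : Matrix (Idx m k) (Idx m k) ℝ) : Prop where
  block : ∀ b c, blockKind b ≠ blockKind c → K b c = 0
  mid : K (mid m k) (mid m k) = 1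
  orth : K.transpose * K = 1

/-- The tangential block. -/
def tangentBlock (K : Matrix (Idx m k) (Idx m k) ℝ) : Matrix (Fin m) (Fin m) ℝ :=
  K.submatrix Sum.inl Sum.inl

/-- The normal block. -/
def normalBlock (K : Matrix (Idx m k) (Idx m k) ℝ) : Matrix (Fin k) (Fin k) ℝ :=
  K.submatrix (fun b => Sum.inr (Sum.inr b)) fun b => Sum.inr (Sum.inr b)

namespace IsBlockOrthogonal

variable {K L : Matrix (Idx m k) (Idx m k) ℝ}

theorem mul (hK : IsBlockOrthogonal K) (hL : IsBlockOrthogonal L) : IsBlockOrthogonal (K * L) := by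
  refine ⟨fun b c hbc => ?_, ?_, ?_⟩
  · rw [Matrix.mul_apply]
    refine Finset.sum_eq_zero fun e _ => ?_
    by_cases he : blockKind b = blockKind e
    · rw [hL.block e c (fun h => hbc (he.trans h)), mul_zero]
    · rw [hK.block b e he, zero_mul]
  · rw [Matrix.mul_apply, Finset.sum_eq_single (FerusPedit.mid m k), hK.mid, hL.mid, mul_one]
    · intro e _ he
      rw [hK.block _ e (fun h => he ?_), zero_mul]
      rcases e with e | e | e <;> simp [blockKind, FerusPedit.mid] at h ⊢
    · simp
  · rw [Matrix.transpose_mul, Matrix.mul_assoc, ← Matrix.mul_assoc K.transpose, hK.orth,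
      Matrix.one_mul, hL.orth]

theorem tangentBlock_mul (hK : IsBlockOrthogonal K) :
    tangentBlock (K * L) = tangentBlock K * tangentBlock L := by
  ext b c
  rw [tangentBlock, Matrix.submatrix_apply, Matrix.mul_apply, sum_idx, Matrix.mul_apply,
    hK.block _ (FerusPedit.mid m k) (by simp [blockKind, FerusPedit.mid]), zero_mul,
    Finset.sum_eq_zero (s := (Finset.univ : Finset (Fin k))), add_zero, add_zero]
  · rfl
  · intro γ _
    rw [hK.block _ _ (by simp [blockKind]), zero_mul]

theorem normalBlock_mul (hK : IsBlockOrthogonal K) :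
    normalBlock (K * L) = normalBlock K * normalBlock L := by
  ext b c
  rw [normalBlock, Matrix.submatrix_apply, Matrix.mul_apply, sum_idx, Matrix.mul_apply,
    hK.block _ (FerusPedit.mid m k) (by simp [blockKind, FerusPedit.mid]), zero_mul,
    Finset.sum_eq_zero (s := (Finset.univ : Finset (Fin m))), zero_add, zero_add]
  · rfl
  · intro γ _
    rw [hK.block _ _ (by simp [blockKind]), zero_mul]

theorem transpose (hK : IsBlockOrthogonal K) : IsBlockOrthogonal K.transpose :=
  ⟨fun b c hbc => hK.block c b hbc.symm, hK.mid, by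
    rw [Matrix.transpose_transpose]; exact mul_eq_one_comm.1 hK.orth⟩

theorem tangentBlock_orth (hK : IsBlockOrthogonal K) :
    (tangentBlock K).transpose * tangentBlock K = 1 := by
  have h1 := hK.transpose.tangentBlock_mul (L := K)
  rw [hK.orth] at h1
  refine Eq.trans h1.symm ?_
  ext b c
  simp [tangentBlock, Matrix.one_apply]

theorem normalBlock_orth (hK : IsBlockOrthogonal K) :
    (normalBlock K).transpose * normalBlock K = 1 := by
  have h1 := hK.transpose.normalBlock_mul (L := K)
  rw [hK.orth] at h1
  refine Eq.trans h1.symm ?_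
  ext b c
  simp [normalBlock, Matrix.one_apply]

end IsBlockOrthogonal

theorem det_eq_one_or_of_orth {ι : Type} [Fintype ι] [DecidableEq ι] {A : Matrix ι ι ℝ}
    (hA : A.transpose * A = 1) : A.det = 1 ∨ A.det = -1 := by
  have h1 := congrArg Matrix.det hA
  rw [Matrix.det_mul, Matrix.det_transpose, Matrix.det_one] at h1
  exact mul_self_eq_one_iff.1 h1

theorem mem_specialOrthogonal_of_orth {n : ℕ} {A : Matrix (Fin n) (Fin n) ℝ}
    (hA : A.transpose * A = 1) (hd : A.det = 1) : A ∈ Matrix.specialOrthogonalGroup (Fin n) ℝ := by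
  rw [Matrix.mem_specialOrthogonalGroup_iff]
  exact ⟨(Matrix.mem_orthogonalGroup_iff' _ _).2 hA, hd⟩

theorem IsBlockOrthogonal.eq_blockMat {K : Matrix (Idx m k) (Idx m k) ℝ}
    (hK : IsBlockOrthogonal K) :
    K.map (fun x : ℝ => (x : ℂ)) = blockMat m k (tangentBlock K) (normalBlock K) := by
  rw [blockMat]
  congr 1
  ext b c
  rcases b with b | b | b <;> rcases c with c | c | c
  · rfl
  · exact hK.block _ _ (by simp [blockKind])
  · exact hK.block _ _ (by simp [blockKind])
  · exact hK.block _ _ (by simp [blockKind])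
  · exact hK.mid
  · exact hK.block _ _ (by simp [blockKind])
  · exact hK.block _ _ (by simp [blockKind])
  · exact hK.block _ _ (by simp [blockKind])
  · rfl

/-- A matrix with constant diagonal blocks commutes with block orthogonal matrices. -/
theorem conjDiagCLM_of_block {C : FPCase} {a : Axis} {K : Matrix (Idx m k) (Idx m k) ℝ}
    (hK : ∀ b c, blockKind b ≠ blockKind c → K b c = 0) :
    conjDiagCLM (conjDiag m k C a) K = K.map (fun x : ℝ => (x : ℂ)) := by
  ext b c
  rw [conjDiagCLM_apply, Matrix.of_apply, Matrix.map_apply]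
  by_cases h : blockKind b = blockKind c
  · rw [conjDiag_congr h, mul_right_comm, inv_mul_cancel₀ (conjDiag_ne_zero C a c), one_mul]
  · rw [hK b c h]; simp

theorem diagonal_mul_map_mul_diagonal {K : Matrix (Idx m k) (Idx m k) ℝ}
    (hK : ∀ b c, blockKind b ≠ blockKind c → K b c = 0) {d : Idx m k → ℂ}
    (hd : ∀ b, d b * d b = 1) (hd' : ∀ b c, blockKind b = blockKind c → d b = d c) :
    Matrix.diagonal d * K.map (fun x : ℝ => (x : ℂ)) * Matrix.diagonal d =
      K.map (fun x : ℝ => (x : ℂ)) := by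
  ext b c
  rw [Matrix.mul_diagonal, Matrix.diagonal_mul, Matrix.map_apply]
  by_cases h : blockKind b = blockKind c
  · rw [hd' b c h]
    linear_combination (K b c : ℂ) * hd c
  · rw [hK b c h]; simp

theorem diag3_congr {b' c' : ℂ} {b c : Idx m k} (h : blockKind b = blockKind c) :
    diag3 m k 1 b' c' b = diag3 m k 1 b' c' c := by
  rcases b with b | b | b <;> rcases c with c | c | c <;> simp [blockKind] at h <;> rfl

/-- The constant loops given by block orthogonal matrices with special orthogonal blocks. -/
theorem IsBlockOrthogonal.exists_constLoop (C : FPCase) {K : Matrix (Idx m k) (Idx m k) ℝ}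
    (hK : IsBlockOrthogonal K) (ht : (tangentBlock K).det = 1) (hn : (normalBlock K).det = 1) :
    ∃ X : loopGroup m k C, X ∈ constLoops m k C ∧
      ∀ z, (X.1 z).1 = K.map (fun x : ℝ => (x : ℂ)) := by
  have hdet : (K.map (fun x : ℝ => (x : ℂ))).det = 1 := by
    rw [hK.eq_blockMat, blockMat]
    have h1 : (Matrix.fromBlocks (tangentBlock K) 0 0
        (Matrix.fromBlocks (1 : Matrix Unit Unit ℝ) 0 0 (normalBlock K))).det = 1 := by
      rw [Matrix.det_fromBlocks_zero₂₁, Matrix.det_fromBlocks_zero₂₁, ht, hn, Matrix.det_one,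
        mul_one, mul_one]
    have h2 := congrArg (fun x : ℝ => (x : ℂ)) h1
    have h3 := RingHom.map_det Complex.ofRealHom (Matrix.fromBlocks (tangentBlock K) 0 0
        (Matrix.fromBlocks (1 : Matrix Unit Unit ℝ) 0 0 (normalBlock K)))
    refine h3.symm.trans ?_
    simpa using h2
  have hC : C.eps * C.eps = 1 := by cases C <;> simp [FPCase.eps]
  have hmem : (fun _ : ℂˣ => (⟨_, hdet⟩ : Matrix.SpecialLinearGroup (Idx m k) ℂ)) ∈
      loopGroup m k C := by
    refine ⟨fun i j => mdifferentiable_const, fun z => ?_, fun z => ?_, fun z => ?_, fun z => ?_⟩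
    · have hJ : ∀ i, diag3 m k 1 C.eps 1 i * diag3 m k 1 C.eps 1 i = 1 := fun i =>
        diag3_mul_self m k i hC (by norm_num)
      have h1 := diagonal_mul_map_mul_diagonal hK.block hJ fun b c => diag3_congr
      have h2 : (K.map (fun x : ℝ => (x : ℂ))).transpose * K.map (fun x : ℝ => (x : ℂ)) = 1 := by
        rw [← Matrix.transpose_map, ← map_ofReal_mul, hK.orth, Matrix.map_one _ Complex.ofReal_zero
          Complex.ofReal_one]
      set X := K.map (fun x : ℝ => (x : ℂ))
      set D := Matrix.diagonal (diag3 m k 1 C.eps 1)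
      have h3 : D * X = X * D := by
        calc D * X = D * X * (D * D) := by rw [diagonal_mul_self hJ, Matrix.mul_one]
          _ = D * X * D * D := by noncomm_ring
          _ = _ := by rw [h1]
      change X.transpose * D * X = D
      rw [Matrix.mul_assoc, h3, ← Matrix.mul_assoc, h2, Matrix.one_mul]
    · exact diagonal_mul_map_mul_diagonal hK.block signP_mul_self fun b c => diag3_congr
    · exact diagonal_mul_map_mul_diagonal hK.block signQ_mul_self fun b c => diag3_congr
    · ext b c
      simp
  exact ⟨⟨_, hmem⟩, ⟨_, mem_specialOrthogonal_of_orth hK.tangentBlock_orth ht, _,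
    mem_specialOrthogonal_of_orth hK.normalBlock_orth hn, fun z => hK.eq_blockMat⟩, fun z => rfl⟩

end BlockOrthogonal

/-! ### Transitions between adapted frames -/

section Transitions

variable {m k : ℕ} {N : Target}

/-- A matrix which preserves the ambient form, fixes the middle basis vector and has no entries that
lead from tangential to normal directions is block orthogonal. -/
theorem isBlockOrthogonal_of_orth {K : Matrix (Idx m k) (Idx m k) ℝ}
    (horth : K.transpose * Matrix.diagonal (N.signs m k) * K = Matrix.diagonal (N.signs m k))
    (hmid : ∀ b, K b (mid m k) = (Pi.single (mid m k) 1 : Idx m k → ℝ) b)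
    (hnt : ∀ (γ : Fin k) (b : Fin m), K (Sum.inr (Sum.inr γ)) (Sum.inl b) = 0) :
    IsBlockOrthogonal K := by
  have hcurv := N.curv_mul_self
  have hns := N.normalSign_mul_self
  have hN0 : N.curv ≠ 0 := fun h => by simp [h] at hcurv
  have hδ0 : N.normalSign ≠ 0 := fun h => by simp [h] at hns
  have hE : ∀ b c, ∑ e, K e b * N.signs m k e * K e c =
      (Matrix.diagonal (N.signs m k) : Matrix (Idx m k) (Idx m k) ℝ) b c := by
    intro b c
    rw [← horth, Matrix.mul_apply]
    refine Finset.sum_congr rfl fun e _ => ?_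
    rw [Matrix.mul_diagonal, Matrix.transpose_apply]
  have hTm : ∀ b : Fin m, K (Sum.inl b) (mid m k) = 0 := fun b => by rw [hmid]; simp [mid]
  have hNm : ∀ b : Fin k, K (Sum.inr (Sum.inr b)) (mid m k) = 0 := fun b => by
    rw [hmid]; simp [mid]
  have hmm : K (mid m k) (mid m k) = 1 := by rw [hmid]; simp
  have hmc : ∀ c, c ≠ mid m k → K (mid m k) c = 0 := by
    intro c hc
    have h1 := hE (mid m k) c
    rw [Finset.sum_eq_single (mid m k), hmm, one_mul, Matrix.diagonal_apply_ne _ hc.symm] at h1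
    · refine (mul_eq_zero.1 h1).resolve_left ?_
      simpa [Target.signs, diag3, mid] using hN0
    · intro e _ he
      rw [hmid, Pi.single_eq_of_ne he, zero_mul, zero_mul]
    · simp
  have hmT : ∀ b : Fin m, K (Sum.inr (Sum.inl ())) (Sum.inl b) = 0 := fun b =>
    hmc _ (by simp [mid])
  have hmN : ∀ b : Fin k, K (Sum.inr (Sum.inl ())) (Sum.inr (Sum.inr b)) = 0 := fun b =>
    hmc _ (by simp [mid])
  have hTT : (tangentBlock K).transpose * tangentBlock K = 1 := by
    ext b c
    have h1 := hE (Sum.inl b) (Sum.inl c)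
    rw [sum_idx] at h1
    simp only [hnt, hmT, mid, mul_zero, Finset.sum_const_zero, add_zero] at h1
    rw [Matrix.mul_apply]
    refine Eq.trans (Finset.sum_congr rfl fun e _ => ?_) (h1.trans ?_)
    · simp [tangentBlock, Target.signs, diag3]
    · simp [Matrix.diagonal_apply, Matrix.one_apply, Target.signs, diag3]
  have hTN : ∀ (b : Fin m) (γ : Fin k), K (Sum.inl b) (Sum.inr (Sum.inr γ)) = 0 := by
    intro b γ
    have h1 : (tangentBlock K).transpose.mulVec (fun b => K (Sum.inl b) (Sum.inr (Sum.inr γ))) =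
        0 := by
      funext c
      have h1 := hE (Sum.inl c) (Sum.inr (Sum.inr γ))
      rw [sum_idx, Matrix.diagonal_apply_ne _ (by simp)] at h1
      simp only [hnt, hmT, mid, zero_mul, Finset.sum_const_zero, add_zero] at h1
      rw [Matrix.mulVec, dotProduct, Pi.zero_apply, ← h1]
      exact Finset.sum_congr rfl fun e _ => by simp [tangentBlock, Target.signs, diag3]
    have h2 := congrArg (fun x => (tangentBlock K).mulVec x) h1
    simp only [Matrix.mulVec_mulVec, Matrix.mulVec_zero, mul_eq_one_comm.1 hTT,
      Matrix.one_mulVec] at h2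
    exact congrFun h2 b
  have hblock : ∀ b c, blockKind b ≠ blockKind c → K b c = 0 := by
    intro b c hbc
    rcases b with b | b | b <;> rcases c with c | c | c
    · exact absurd rfl hbc
    · exact hTm b
    · exact hTN b c
    · exact hmT c
    · exact absurd rfl hbc
    · exact hmN c
    · exact hnt b c
    · exact hNm b
    · exact absurd rfl hbc
  refine ⟨hblock, hmm, ?_⟩
  -- the signs are constant on each block
  have hsig : ∀ b c : Idx m k, blockKind b = blockKind c → N.signs m k b = N.signs m k c := by
    intro b c h
    rcases b with b | b | b <;> rcases c with c | c | c <;> simp [blockKind] at h <;> rfl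
  ext b c
  have h1 := hE b c
  have h2 := N.signs_mul_self b
  have h3 : (∑ e, K e b * K e c) = N.signs m k b * ∑ e, K e b * N.signs m k e * K e c := by
    rw [Finset.mul_sum]
    refine Finset.sum_congr rfl fun e _ => ?_
    by_cases he : blockKind e = blockKind b
    · rw [hsig e b he]
      linear_combination (-K e b * K e c) * h2
    · rw [hblock e b he]; ring
  rw [Matrix.mul_apply]
  simp only [Matrix.transpose_apply]
  rw [h3, h1, Matrix.diagonal_apply, Matrix.one_apply]
  split_ifs
  · exact h2
  · exact mul_zero _

theorem isBlockOrthogonal_diagonal {r : Idx m k → ℝ} (hr : ∀ b, r b * r b = 1)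
    (hmid : r (mid m k) = 1) : IsBlockOrthogonal (Matrix.diagonal r) := by
  refine ⟨fun b c hbc => Matrix.diagonal_apply_ne _ fun h => hbc (by rw [h]), by
    rw [Matrix.diagonal_apply_eq, hmid], ?_⟩
  rw [Matrix.diagonal_transpose, Matrix.diagonal_mul_diagonal]
  simp [hr]

namespace IsAdaptedFrame

variable {h : EuclideanSpace ℝ (Fin m) → Idx m k → ℝ}
  {S : EuclideanSpace ℝ (Fin m) → Matrix (Idx m k) (Idx m k) ℝ}
  {V : Set (EuclideanSpace ℝ (Fin m))} (H : IsAdaptedFrame N h S V)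
  {u : EuclideanSpace ℝ (Fin m)}

include H

/-- The columns of an adapted frame other than the middle one may change their signs. -/
theorem mul_diagonal {r : Idx m k → ℝ} (hr : ∀ b, r b * r b = 1)
    (hmid : r (FerusPedit.mid m k) = 1) :
    IsAdaptedFrame N h (fun u => S u * Matrix.diagonal r) V := by
  have hrr : Matrix.diagonal r * Matrix.diagonal r = 1 := by
    rw [Matrix.diagonal_mul_diagonal]; simp [hr]
  have hconn : ∀ u ∈ V, ∀ i b c, conn (fun u => S u * Matrix.diagonal r) i u b c =
      r b * conn S i u b c * r c := by
    intro u hu i b c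
    have h1 : conn (fun u => S u * Matrix.diagonal r) i u =
        Matrix.diagonal r * conn S i u * Matrix.diagonal r := by
      have hd := (H.contDiffAt hu).differentiableAt (n := ∞) (by simp)
      rw [conn, pd_mul hd (differentiableAt_const _), pd_const, mul_zero, zero_add,
        Matrix.mul_inv_rev, Matrix.inv_eq_left_inv hrr, conn]
      noncomm_ring
    rw [h1, Matrix.mul_diagonal, Matrix.diagonal_mul]
  refine ⟨H.isOpen, fun u hu => ?_, fun u hu => ?_, fun u hu i => ?_, fun u hu i γ => ?_,
    fun u hu => ?_⟩
  · exact ((H.contDiffAt hu).mul contDiffAt_const).contDiffWithinAt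
  · have h1 := H.orth u hu
    rw [Matrix.transpose_mul, Matrix.diagonal_transpose]
    calc _ = Matrix.diagonal r * ((S u).transpose * Matrix.diagonal (N.signs m k) * S u) *
          Matrix.diagonal r := by noncomm_ring
      _ = _ := by
        rw [h1, Matrix.diagonal_mul_diagonal, Matrix.diagonal_mul_diagonal]
        congr 1
        funext b
        linear_combination (N.signs m k b) * hr b
  · rw [Matrix.mul_diagonal, hmid, mul_one, H.mid u hu]
  · rw [hconn u hu, H.normal u hu, mul_zero, zero_mul]
  · have h1 : coframe (fun u => S u * Matrix.diagonal r) u =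
        coframe S u * Matrix.diagonal (fun b => r (Sum.inl b)) := by
      ext i b
      rw [coframe, Matrix.of_apply, hconn u hu, hmid, Matrix.mul_diagonal, coframe, Matrix.of_apply]
      ring
    rw [h1]
    refine (H.indep u hu).mul (IsUnit.of_mul_eq_one (Matrix.diagonal fun b => r (Sum.inl b)) ?_)
    rw [Matrix.diagonal_mul_diagonal]
    simp [hr]

theorem fderiv_eq_mulVec (hu : u ∈ V) (v : EuclideanSpace ℝ (Fin m)) :
    fderiv ℝ h u v =
      (S u).mulVec (∑ i, v i • fun b => conn S i u b (FerusPedit.mid m k)) := by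
  rw [fderiv_apply_eq_sum_pd, Matrix.mulVec_sum]
  exact Finset.sum_congr rfl fun i _ => by rw [H.pd_eq hu, Matrix.mulVec_smul]

/-- Each tangential column of an adapted frame is a derivative of the immersion. -/
theorem exists_fderiv_eq (hu : u ∈ V) (b : Fin m) : ∃ v,
    fderiv ℝ h u v = (S u).mulVec (Pi.single (Sum.inl b) 1) := by
  have hθ := (Matrix.isUnit_iff_isUnit_det _).1 (H.indep u hu)
  set v : Fin m → ℝ := Matrix.vecMul (Pi.single b 1) (coframe S u)⁻¹ with hv
  have hvθ : Matrix.vecMul v (coframe S u) = Pi.single b 1 := by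
    rw [hv, Matrix.vecMul_vecMul, Matrix.nonsing_inv_mul _ hθ, Matrix.vecMul_one]
  refine ⟨WithLp.toLp 2 v, ?_⟩
  rw [H.fderiv_eq_mulVec hu]
  congr 1
  refine idx_ext (fun c => ?_) ?_ (fun γ => ?_)
  · have h1 := congrFun hvθ c
    simp only [Matrix.vecMul, dotProduct, coframe, Matrix.of_apply] at h1
    simp only [Finset.sum_apply, Pi.smul_apply, smul_eq_mul]
    refine h1.trans ?_
    simp [Pi.single_apply]
  · simp [H.conn_mid_mid hu]
    simp [FerusPedit.mid]
  · simp [H.normal u hu]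

/-- Two frames adapted to parametrisations of the same immersion differ by block orthogonal
matrices. -/
theorem isBlockOrthogonal_transition {h' : EuclideanSpace ℝ (Fin m) → Idx m k → ℝ}
    {S' : EuclideanSpace ℝ (Fin m) → Matrix (Idx m k) (Idx m k) ℝ}
    {V' : Set (EuclideanSpace ℝ (Fin m))} (H' : IsAdaptedFrame N h' S' V')
    {u' : EuclideanSpace ℝ (Fin m)} (hu : u ∈ V) (hu' : u' ∈ V')
    (hval : h' u' = h u) (hder : ∀ v', ∃ v, fderiv ℝ h u v = fderiv ℝ h' u' v') :
    IsBlockOrthogonal ((S u)⁻¹ * S' u') := by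
  have hSu := (Matrix.isUnit_iff_isUnit_det _).1 (H.isUnit hu)
  have hinv : (S u)⁻¹ * S u = 1 := Matrix.nonsing_inv_mul _ hSu
  have hcol : ∀ x, ((S u)⁻¹ * S' u').mulVec x = (S u)⁻¹.mulVec ((S' u').mulVec x) := fun x =>
    (Matrix.mulVec_mulVec _ _ _).symm
  refine isBlockOrthogonal_of_orth (N := N) ?_ (fun b => ?_) (fun γ b => ?_)
  · have h1 := H.orth u hu
    have h2 := H'.orth u' hu'
    have h3 : S u * ((S u)⁻¹ * S' u') = S' u' := by
      rw [← Matrix.mul_assoc, Matrix.mul_nonsing_inv _ hSu, Matrix.one_mul]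
    calc _ = ((S u)⁻¹ * S' u').transpose *
          ((S u).transpose * Matrix.diagonal (N.signs m k) * S u) * ((S u)⁻¹ * S' u') := by rw [h1]
      _ = (S u * ((S u)⁻¹ * S' u')).transpose * Matrix.diagonal (N.signs m k) *
          (S u * ((S u)⁻¹ * S' u')) := by
        rw [Matrix.transpose_mul (S u)]
        simp only [Matrix.mul_assoc]
      _ = _ := by rw [h3, h2]
  · have h1 := congrFun (hcol (Pi.single (FerusPedit.mid m k) 1)) b
    rw [← H'.eq_mulVec hu', hval, H.eq_mulVec hu, Matrix.mulVec_mulVec, hinv, Matrix.one_mulVec,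
      Matrix.mulVec_single_one] at h1
    exact h1
  · obtain ⟨v', hv'⟩ := H'.exists_fderiv_eq hu' b
    obtain ⟨v, hv⟩ := hder v'
    have h1 := congrFun (hcol (Pi.single (Sum.inl b) 1)) (Sum.inr (Sum.inr γ))
    rw [← hv', ← hv, H.fderiv_eq_mulVec hu, Matrix.mulVec_mulVec, hinv, Matrix.one_mulVec,
      Matrix.mulVec_single_one] at h1
    refine Eq.trans h1 ?_
    simp [H.normal u hu]

end IsAdaptedFrame

end Transitions

/-! ### Oriented adapted frames on a simply connected manifold -/

section OrientedFrames

variable {m k : ℕ} {M : Type*} [TopologicalSpace M] [ChartedSpace (EuclideanSpace ℝ (Fin m)) M]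
  {N : Target} {f : M → Idx m k → ℝ} {c : ℝ}

/-- The part of the domain of the chart around `x` that is mapped into `V`. -/
def chartDomain (x : M) (V : Set (EuclideanSpace ℝ (Fin m))) : Set M :=
  (chartAt (EuclideanSpace ℝ (Fin m)) x).source ∩ chartAt (EuclideanSpace ℝ (Fin m)) x ⁻¹' V

theorem isOpen_chartDomain (x : M) {V : Set (EuclideanSpace ℝ (Fin m))} (hV : IsOpen V) :
    IsOpen (chartDomain x V) :=
  (chartAt (EuclideanSpace ℝ (Fin m)) x).isOpen_inter_preimage hV

theorem mem_chartDomain_self {x : M} {V : Set (EuclideanSpace ℝ (Fin m))}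
    (hV : chartAt (EuclideanSpace ℝ (Fin m)) x x ∈ V) : x ∈ chartDomain x V :=
  ⟨mem_chart_source _ x, hV⟩

/-- A smooth moving frame along `f` in the chart around `x`, adapted to `f`. -/
structure IsFrameAt (N : Target) (f : M → Idx m k → ℝ) (x : M)
    (S : EuclideanSpace ℝ (Fin m) → Matrix (Idx m k) (Idx m k) ℝ)
    (V : Set (EuclideanSpace ℝ (Fin m))) : Prop where
  mem : chartAt (EuclideanSpace ℝ (Fin m)) x x ∈ V
  subset : V ⊆ (chartAt (EuclideanSpace ℝ (Fin m)) x).target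
  adapted : IsAdaptedFrame N (inChart f x) S V

/-- The moving frame on the manifold. -/
def liftFrame (x : M) (S : EuclideanSpace ℝ (Fin m) → Matrix (Idx m k) (Idx m k) ℝ) (q : M) :
    Matrix (Idx m k) (Idx m k) ℝ := S (chartAt (EuclideanSpace ℝ (Fin m)) x q)

namespace IsFrameAt

variable {x y : M} {S S' : EuclideanSpace ℝ (Fin m) → Matrix (Idx m k) (Idx m k) ℝ}
  {V V' : Set (EuclideanSpace ℝ (Fin m))} (H : IsFrameAt N f x S V) {q : M}

include H

theorem isOpen : IsOpen (chartDomain x V) := isOpen_chartDomain x H.adapted.isOpen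

theorem mono (hV' : IsOpen V') (hsub : V' ⊆ V)
    (hmem : chartAt (EuclideanSpace ℝ (Fin m)) x x ∈ V') : IsFrameAt N f x S V' :=
  ⟨hmem, hsub.trans H.subset, H.adapted.mono hV' hsub⟩

theorem orth (hq : q ∈ chartDomain x V) :
    (liftFrame x S q).transpose * Matrix.diagonal (N.signs m k) * liftFrame x S q =
      Matrix.diagonal (N.signs m k) :=
  H.adapted.orth _ hq.2

theorem mid (hq : q ∈ chartDomain x V) (b : Idx m k) :
    f q b = liftFrame x S q b (FerusPedit.mid m k) := by
  have h1 := H.adapted.mid _ hq.2 b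
  rwa [inChart, (chartAt (EuclideanSpace ℝ (Fin m)) x).left_inv hq.1] at h1

theorem isUnit (hq : q ∈ chartDomain x V) : IsUnit (liftFrame x S q) := H.adapted.isUnit hq.2

theorem mul_inv (hq : q ∈ chartDomain x V) : liftFrame x S q * (liftFrame x S q)⁻¹ = 1 :=
  Matrix.mul_nonsing_inv _ ((Matrix.isUnit_iff_isUnit_det _).1 (H.isUnit hq))

theorem inv_mul (hq : q ∈ chartDomain x V) : (liftFrame x S q)⁻¹ * liftFrame x S q = 1 :=
  Matrix.nonsing_inv_mul _ ((Matrix.isUnit_iff_isUnit_det _).1 (H.isUnit hq))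

theorem continuousAt (hq : q ∈ chartDomain x V) : ContinuousAt (liftFrame x S) q :=
  (H.adapted.contDiffAt hq.2).continuousAt.comp
    ((chartAt (EuclideanSpace ℝ (Fin m)) x).continuousAt hq.1)

theorem isBlockOrthogonal [IsManifold (𝓡 m) ∞ M] (hf : MDifferentiableAt (𝓡 m) 𝓘(ℝ, Idx m k → ℝ) f q)
    (H' : IsFrameAt N f y S' V') (hq : q ∈ chartDomain x V) (hq' : q ∈ chartDomain y V') :
    IsBlockOrthogonal ((liftFrame x S q)⁻¹ * liftFrame y S' q) := by
  have hx := (chartAt (EuclideanSpace ℝ (Fin m)) x).left_inv hq.1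
  have hy := (chartAt (EuclideanSpace ℝ (Fin m)) y).left_inv hq'.1
  -- the derivatives of `f` in a chart have the same range as those on the manifold
  have h1 : ∀ (x : M) (u : EuclideanSpace ℝ (Fin m)),
      u ∈ (chartAt (EuclideanSpace ℝ (Fin m)) x).target →
      (chartAt (EuclideanSpace ℝ (Fin m)) x).symm u = q →
      (∀ v, ∃ w : TangentSpace (𝓡 m) q, fderiv ℝ (inChart f x) u v =
        mfderiv (𝓡 m) 𝓘(ℝ, Idx m k → ℝ) f q w) ∧
      ∀ w : TangentSpace (𝓡 m) q, ∃ v, fderiv ℝ (inChart f x) u v =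
        mfderiv (𝓡 m) 𝓘(ℝ, Idx m k → ℝ) f q w := by
    rintro x u hu rfl
    refine ⟨fun v => ⟨_, fderiv_comp_chart x hu hf v⟩, fun w => ?_⟩
    obtain ⟨v, rfl⟩ := (chartDeriv_bijective x hu).2 w
    exact ⟨v, fderiv_comp_chart x hu hf v⟩
  refine H.adapted.isBlockOrthogonal_transition H'.adapted hq.2 hq'.2 ?_ fun v' => ?_
  · rw [inChart, inChart, hx, hy]
  · obtain ⟨w, hw⟩ := (h1 y _ (H'.subset hq'.2) hy).1 v'
    obtain ⟨v, hv⟩ := (h1 x _ (H.subset hq.2) hx).2 w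
    exact ⟨v, hv.trans hw.symm⟩

theorem continuousAt_transition (H' : IsFrameAt N f y S' V') (hq : q ∈ chartDomain x V)
    (hq' : q ∈ chartDomain y V') :
    ContinuousAt (fun q => (liftFrame x S q)⁻¹ * liftFrame y S' q) q := by
  have h1 : (fun q => (liftFrame x S q)⁻¹) =ᶠ[nhds q] fun q => Matrix.diagonal (N.signs m k) *
      (liftFrame x S q).transpose * Matrix.diagonal (N.signs m k) := by
    filter_upwards [H.isOpen.mem_nhds hq] with w hw
    exact inv_eq_of_orthogonal N.signs_mul_self (H.orth hw)
  have h2 : ContinuousAt (fun q => Matrix.diagonal (N.signs m k) *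
      (liftFrame x S q).transpose * Matrix.diagonal (N.signs m k)) q := by
    have h3 : Continuous fun X : Matrix (Idx m k) (Idx m k) ℝ => Matrix.diagonal (N.signs m k) *
      X.transpose * Matrix.diagonal (N.signs m k) := by fun_prop
    exact h3.continuousAt.comp (H.continuousAt hq)
  exact (h2.congr h1.symm).mul (H'.continuousAt hq')

end IsFrameAt

/-- Adapted frames exist in the chart around each point. -/
theorem IsFlatNormalImmersion.exists_isFrameAt [IsManifold (𝓡 m) ∞ M]
    (hf : IsFlatNormalImmersion N c f) (x : M) : ∃ S V, IsFrameAt N f x S V := by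
  have hform : ∀ q, N.form (f q) (f q) = N.curv := by
    intro q
    have h1 := hf.mem q
    cases N
    · exact h1
    · exact h1.1
    · exact h1
    · exact h1
  set e := chartAt (EuclideanSpace ℝ (Fin m)) x
  have hsm : ContDiffOn ℝ ∞ (inChart f x) e.target := by
    have h1 := contDiffOn_comp_chart x (hf.smooth.contMDiffOn (s := Set.univ))
    rwa [Set.preimage_univ, Set.inter_univ] at h1
  obtain ⟨S, V, h0, hV, hS⟩ := exists_adaptedFrame (N := N) (h := inChart f x) e.open_target hsm
    (fun u _ => hform _) (fun u hu v hv => by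
      have h1 := fderiv_comp_chart x hu (hf.smooth.mdifferentiableAt (by simp)) v
      change fderiv ℝ (inChart f x) u v = _ at h1
      rw [h1]
      refine hf.posDef _ _ fun h0 => hv ?_
      exact (chartDeriv_bijective x hu).1 (h0.trans (map_zero _).symm)) (mem_chart_target _ x)
  exact ⟨S, V, h0, hV, hS⟩

/-- The Gauss and Ricci equations of the immersion are the conditions for the deformation. -/
theorem IsFrameAt.isDeformable {C : FPCase} {a : Axis} {z₀ : ℂˣ}
    (hf : IsFlatNormalImmersion (target C a) c f) (hz₀ : z₀ ∈ a.range)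
    (hc : curvAt (target C a) z₀ = c) (hne : (z₀ : ℂ)⁻¹ - (z₀ : ℂ) ≠ 0) {x : M}
    {S : EuclideanSpace ℝ (Fin m) → Matrix (Idx m k) (Idx m k) ℝ}
    {V : Set (EuclideanSpace ℝ (Fin m))} (H : IsFrameAt (target C a) f x S V) :
    IsDeformable C a z₀ (inChart f x) S V :=
  ⟨H.adapted, hz₀, hne, fun u hu i j b d => by
    rw [hc]
    exact H.adapted.shapeComm_of_sectionalCurvatureEq hu (hf.curvature x u (H.subset hu)) i j b d,
    fun u hu i j β γ => H.adapted.normalComm_eq_zero H.subset (hf.flatNormal x) hu i j β γ⟩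

/-- The sign of a determinant `±1`. -/
def unitSign (r : ℝ) : ℤˣ := if r = 1 then 1 else -1

theorem coe_unitSign {r : ℝ} (hr : r = 1 ∨ r = -1) : (((unitSign r : ℤˣ) : ℤ) : ℝ) = r := by
  rcases hr with rfl | rfl
  · simp [unitSign]
  · norm_num [unitSign]

theorem unitSign_mul {r s : ℝ} (hr : r = 1 ∨ r = -1) (hs : s = 1 ∨ s = -1) :
    unitSign (r * s) = unitSign r * unitSign s := by
  rcases hr with rfl | rfl <;> rcases hs with rfl | rfl <;> norm_num [unitSign]

theorem eventually_unitSign_eq {X : Type*} [TopologicalSpace X] {d : X → ℝ} {q : X}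
    (hd : ContinuousAt d q) (h1 : ∀ᶠ w in nhds q, d w = 1 ∨ d w = -1) :
    ∀ᶠ w in nhds q, unitSign (d w) = unitSign (d q) := by
  filter_upwards [h1, Metric.continuousAt_iff'.1 hd 1 one_pos] with w hw hw'
  congr 1
  rw [Real.dist_eq] at hw'
  rcases hw with hw | hw <;> rcases h1.self_of_nhds with hq | hq <;> rw [hw, hq] at hw' ⊢ <;>
    norm_num at hw'

/-- The diagonal matrix which changes the orientations of the tangential and the normal block
according to two signs. An empty block stays as it is. -/
def orientDiag (m k : ℕ) (s : ℤˣ × ℤˣ) : Idx m k → ℝ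
  | .inl b => if (b : ℕ) = 0 then ((s.1 : ℤ) : ℝ) else 1
  | .inr (.inl _) => 1
  | .inr (.inr b) => if (b : ℕ) = 0 then ((s.2 : ℤ) : ℝ) else 1

theorem coe_units_mul_self (s : ℤˣ) : ((s : ℤ) : ℝ) * ((s : ℤ) : ℝ) = 1 := by
  rcases Int.units_eq_one_or s with rfl | rfl <;> norm_num

theorem orientDiag_mul_self (s : ℤˣ × ℤˣ) (b : Idx m k) :
    orientDiag m k s b * orientDiag m k s b = 1 := by
  rcases b with b | b | b <;> simp only [orientDiag]
  · split_ifs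
    · exact coe_units_mul_self _
    · exact one_mul 1
  · exact one_mul 1
  · split_ifs
    · exact coe_units_mul_self _
    · exact one_mul 1

theorem prod_ite_zero (n : ℕ) (r : ℝ) :
    ∏ b : Fin n, (if (b : ℕ) = 0 then r else 1) = if n = 0 then 1 else r := by
  cases n with
  | zero => simp
  | succ n => simp

theorem det_tangentBlock_orientDiag (s : ℤˣ × ℤˣ) :
    (tangentBlock (Matrix.diagonal (orientDiag m k s))).det =
      if m = 0 then 1 else ((s.1 : ℤ) : ℝ) := by
  have h1 : tangentBlock (Matrix.diagonal (orientDiag m k s)) =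
      Matrix.diagonal fun b => orientDiag m k s (Sum.inl b) := by
    ext b c
    simp [tangentBlock, Matrix.diagonal_apply]
  rw [h1, Matrix.det_diagonal]
  exact prod_ite_zero m _

theorem det_normalBlock_orientDiag (s : ℤˣ × ℤˣ) :
    (normalBlock (Matrix.diagonal (orientDiag m k s))).det =
      if k = 0 then 1 else ((s.2 : ℤ) : ℝ) := by
  have h1 : normalBlock (Matrix.diagonal (orientDiag m k s)) =
      Matrix.diagonal fun b => orientDiag m k s (Sum.inr (Sum.inr b)) := by
    ext b c
    simp [normalBlock, Matrix.diagonal_apply]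
  rw [h1, Matrix.det_diagonal]
  exact prod_ite_zero k _

theorem det_of_size_zero {n : ℕ} (hn : n = 0) (A : Matrix (Fin n) (Fin n) ℝ) : A.det = 1 := by
  subst hn
  exact Matrix.det_isEmpty

/-- On a simply connected manifold the adapted frames can be chosen with consistent orientations
of the tangent and the normal spaces. -/
theorem IsFlatNormalImmersion.exists_oriented_frames [IsManifold (𝓡 m) ∞ M]
    [SimplyConnectedSpace M] (hf : IsFlatNormalImmersion N c f) :
    ∃ (S : M → EuclideanSpace ℝ (Fin m) → Matrix (Idx m k) (Idx m k) ℝ)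
      (V : M → Set (EuclideanSpace ℝ (Fin m))),
      (∀ x, IsFrameAt N f x (S x) (V x)) ∧
      ∀ x y, ∀ q ∈ chartDomain x (V x) ∩ chartDomain y (V y),
        (tangentBlock ((liftFrame x (S x) q)⁻¹ * liftFrame y (S y) q)).det = 1 ∧
        (normalBlock ((liftFrame x (S x) q)⁻¹ * liftFrame y (S y) q)).det = 1 := by
  have : LocallyPathConnectedSpace M :=
    ChartedSpace.locallyPathConnectedSpace (EuclideanSpace ℝ (Fin m)) M
  choose S V H using fun x => hf.exists_isFrameAt x
  set K : M → M → M → Matrix (Idx m k) (Idx m k) ℝ := fun x y q =>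
    (liftFrame x (S x) q)⁻¹ * liftFrame y (S y) q with hK
  have hKb : ∀ x y, ∀ q ∈ chartDomain x (V x) ∩ chartDomain y (V y),
      IsBlockOrthogonal (K x y q) := fun x y q hq =>
    (H x).isBlockOrthogonal (hf.smooth.mdifferentiableAt (by simp)) (H y) hq.1 hq.2
  have hdt : ∀ x y, ∀ q ∈ chartDomain x (V x) ∩ chartDomain y (V y),
      (tangentBlock (K x y q)).det = 1 ∨ (tangentBlock (K x y q)).det = -1 := fun x y q hq =>
    det_eq_one_or_of_orth (hKb x y q hq).tangentBlock_orth
  have hdn : ∀ x y, ∀ q ∈ chartDomain x (V x) ∩ chartDomain y (V y),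
      (normalBlock (K x y q)).det = 1 ∨ (normalBlock (K x y q)).det = -1 := fun x y q hq =>
    det_eq_one_or_of_orth (hKb x y q hq).normalBlock_orth
  have hopen : ∀ x y, IsOpen (chartDomain x (V x) ∩ chartDomain y (V y)) := fun x y =>
    (H x).isOpen.inter (H y).isOpen
  -- the signs of the two determinants form a locally constant cocycle; the signs `s` that trivialise
  -- it tell which frames have to change orientation
  obtain ⟨s, hs, hsg⟩ := exists_locally_constant_coboundary (Γ := ℤˣ × ℤˣ)
    (fun x => chartDomain x (V x)) (fun x => (H x).isOpen) (fun x => x)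
    (fun x => mem_chartDomain_self (H x).mem)
    (fun x y q => (unitSign (tangentBlock (K x y q)).det, unitSign (normalBlock (K x y q)).det))
    (fun x y q hq => by
      have hc := (H x).continuousAt_transition (H y) hq.1 hq.2
      have h1 : Continuous fun X : Matrix (Idx m k) (Idx m k) ℝ => (tangentBlock X).det :=
        (continuous_id.matrix_submatrix _ _).matrix_det
      have h2 : Continuous fun X : Matrix (Idx m k) (Idx m k) ℝ => (normalBlock X).det :=
        (continuous_id.matrix_submatrix _ _).matrix_det
      filter_upwards [eventually_unitSign_eq (h1.continuousAt.comp hc)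
          (Filter.eventually_of_mem ((hopen x y).mem_nhds hq) fun w hw => hdt x y w hw),
        eventually_unitSign_eq (h2.continuousAt.comp hc)
          (Filter.eventually_of_mem ((hopen x y).mem_nhds hq) fun w hw => hdn x y w hw)]
        with w h3 h4
      exact Prod.ext h3 h4)
    (fun x q hq => by
      have h1 : K x x q = 1 := (H x).inv_mul hq
      have h2 : tangentBlock (1 : Matrix (Idx m k) (Idx m k) ℝ) = 1 := by
        ext b c; simp [tangentBlock, Matrix.one_apply]
      have h3 : normalBlock (1 : Matrix (Idx m k) (Idx m k) ℝ) = 1 := by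
        ext b c; simp [normalBlock, Matrix.one_apply]
      simp [h1, h2, h3, unitSign])
    (fun x y l q hq => by
      have h1 : K x y q * K y l q = K x l q := by
        simp only [hK]
        rw [Matrix.mul_assoc, ← Matrix.mul_assoc (liftFrame y (S y) q), (H y).mul_inv hq.1.2,
          Matrix.one_mul]
      have hxy := hKb x y q hq.1
      rw [Prod.mk_mul_mk, ← unitSign_mul (hdt x y q hq.1) (hdt y l q ⟨hq.1.2, hq.2⟩),
        ← unitSign_mul (hdn x y q hq.1) (hdn y l q ⟨hq.1.2, hq.2⟩), ← Matrix.det_mul,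
        ← Matrix.det_mul, ← hxy.tangentBlock_mul, ← hxy.normalBlock_mul, h1])
  choose O hO hOo hOx using fun x =>
    eventually_nhds_iff.1 (hs x x (mem_chartDomain_self (H x).mem))
  set V' : M → Set (EuclideanSpace ℝ (Fin m)) := fun x =>
    V x ∩ ((chartAt (EuclideanSpace ℝ (Fin m)) x).target ∩
      (chartAt (EuclideanSpace ℝ (Fin m)) x).symm ⁻¹' O x) with hV'
  have hsub : ∀ x, V' x ⊆ V x := fun x => Set.inter_subset_left
  have hmemO : ∀ x, ∀ q ∈ chartDomain x (V' x), q ∈ O x := by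
    intro x q hq
    have h1 := hq.2.2.2
    rwa [Set.mem_preimage, (chartAt (EuclideanSpace ℝ (Fin m)) x).left_inv hq.1] at h1
  have hdom : ∀ x, chartDomain x (V' x) ⊆ chartDomain x (V x) := fun x q hq =>
    ⟨hq.1, hsub x hq.2⟩
  refine ⟨fun x u => S x u * Matrix.diagonal (orientDiag m k (s x x)), V', fun x => ?_,
    fun x y q hq => ?_⟩
  · have hx : (chartAt (EuclideanSpace ℝ (Fin m)) x).symm (chartAt (EuclideanSpace ℝ (Fin m)) x x) ∈
        O x := by
      rw [(chartAt (EuclideanSpace ℝ (Fin m)) x).left_inv (mem_chart_source _ x)]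
      exact hOx x
    have h1 := (H x).mono ((H x).adapted.isOpen.inter (isOpen_chart_preimage x (hOo x))) (hsub x)
      ⟨(H x).mem, mem_chart_target _ x, hx⟩
    exact ⟨h1.mem, h1.subset, h1.adapted.mul_diagonal (orientDiag_mul_self _) rfl⟩
  · have hq1 : q ∈ chartDomain x (V x) ∩ chartDomain y (V y) := ⟨hdom x hq.1, hdom y hq.2⟩
    set Dx := Matrix.diagonal (orientDiag m k (s x x)) with hDx
    set Dy := Matrix.diagonal (orientDiag m k (s y y)) with hDy
    have hDD : Dx * Dx = 1 := by
      rw [hDx, Matrix.diagonal_mul_diagonal]; simp [orientDiag_mul_self]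
    have e1 : (liftFrame x (fun u => S x u * Dx) q)⁻¹ * liftFrame y (fun u => S y u * Dy) q =
        Dx * K x y q * Dy := by
      simp only [liftFrame, hK, Matrix.mul_inv_rev, Matrix.inv_eq_left_inv hDD, Matrix.mul_assoc]
    have hDxb : IsBlockOrthogonal Dx := isBlockOrthogonal_diagonal (orientDiag_mul_self _) rfl
    have hb := hKb x y q hq1
    have hrel := hsg x y q hq1
    rw [hO x q (hmemO x q hq.1), hO y q (hmemO y q hq.2)] at hrel
    rw [e1, (hDxb.mul hb).tangentBlock_mul, hDxb.tangentBlock_mul, (hDxb.mul hb).normalBlock_mul,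
      hDxb.normalBlock_mul, Matrix.det_mul, Matrix.det_mul, Matrix.det_mul, Matrix.det_mul,
      det_tangentBlock_orientDiag, det_tangentBlock_orientDiag, det_normalBlock_orientDiag,
      det_normalBlock_orientDiag]
    have key : ∀ {s₁ s₂ : ℤˣ} {r : ℝ}, (r = 1 ∨ r = -1) → s₁ * unitSign r = s₂ →
        ((s₁ : ℤ) : ℝ) * r * ((s₂ : ℤ) : ℝ) = 1 := by
      intro s₁ s₂ r hr h
      rw [← h, Units.val_mul, Int.cast_mul, coe_unitSign hr]
      have h1 := coe_units_mul_self s₁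
      have h2 : r * r = 1 := by rcases hr with rfl | rfl <;> norm_num
      linear_combination (r * r) * h1 + h2
    constructor
    -- an empty block has determinant one without any correction
    · split_ifs with hm
      · rw [det_of_size_zero hm, one_mul, mul_one]
      · exact key (hdt x y q hq1) (congrArg Prod.fst hrel)
    · split_ifs with hm
      · rw [det_of_size_zero hm, one_mul, mul_one]
      · exact key (hdn x y q hq1) (congrArg Prod.snd hrel)

end OrientedFrames

/-! ### Comparison of the deformations of two frames -/

section Comparison

variable {m k : ℕ} {C : FPCase} {a : Axis} {z₀ : ℂˣ}

theorem pd_comp {W : Type*} [NormedAddCommGroup W] [NormedSpace ℝ W]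
    {g : EuclideanSpace ℝ (Fin m) → W} {φ : EuclideanSpace ℝ (Fin m) → EuclideanSpace ℝ (Fin m)}
    {u : EuclideanSpace ℝ (Fin m)} (hg : DifferentiableAt ℝ g (φ u)) (hφ : DifferentiableAt ℝ φ u)
    (i : Fin m) : pd i (fun w => g (φ w)) u = ∑ j, (pd i φ u) j • pd j g (φ u) := by
  have h1 : fderiv ℝ (fun w => g (φ w)) u = (fderiv ℝ g (φ u)).comp (fderiv ℝ φ u) :=
    fderiv_comp u hg hφ
  rw [pd, h1, ContinuousLinearMap.comp_apply]
  exact fderiv_apply_eq_sum_pd _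

/-- The linear map that carries the Maurer–Cartan form of a frame to its deformation at the
parameter `z`. -/
def deformCLM (m k : ℕ) (C : FPCase) (a : Axis) (z₀ : ℂˣ) (z : ℂ) :
    Matrix (Idx m k) (Idx m k) ℝ →L[ℝ] Matrix (Idx m k) (Idx m k) ℂ :=
  LinearMap.toContinuousLinearMap
    { toFun := fun X => Matrix.of fun b c => weight z b c * ((conjDiag m k C a b)⁻¹ *
        ((X b c : ℂ) / weight (z₀ : ℂ) b c) * conjDiag m k C a c)
      map_add' := fun X Y => by ext b c; simp; ring
      map_smul' := fun r X => by ext b c; simp; ring }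

theorem deformCLM_apply (z : ℂ) (X : Matrix (Idx m k) (Idx m k) ℝ) (b c : Idx m k) :
    deformCLM m k C a z₀ z X b c = weight z b c * ((conjDiag m k C a b)⁻¹ *
        ((X b c : ℂ) / weight (z₀ : ℂ) b c) * conjDiag m k C a c) := rfl

theorem weighted_loopForm_eq (S : EuclideanSpace ℝ (Fin m) → Matrix (Idx m k) (Idx m k) ℝ)
    (i : Fin m) (u : EuclideanSpace ℝ (Fin m)) (z : ℂ) :
    weighted z (loopForm C a z₀ S i u) = deformCLM m k C a z₀ z (conn S i u) := rfl

/-- A block diagonal matrix is not affected by the weights. -/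
theorem deformCLM_of_block (z : ℂ) {X : Matrix (Idx m k) (Idx m k) ℝ}
    (hX : ∀ b c, blockKind b ≠ blockKind c → X b c = 0) :
    deformCLM m k C a z₀ z X = conjDiagCLM (conjDiag m k C a) X := by
  ext b c
  rw [deformCLM_apply, conjDiagCLM_apply, Matrix.of_apply]
  by_cases h : blockKind b = blockKind c
  · rw [weight_of_blockKind_eq z h, weight_of_blockKind_eq (z₀ : ℂ) h, one_mul, div_one]
  · rw [hX b c h]; simp

theorem deformCLM_mul_block (z : ℂ) (X : Matrix (Idx m k) (Idx m k) ℝ)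
    {K : Matrix (Idx m k) (Idx m k) ℝ} (hK : ∀ b c, blockKind b ≠ blockKind c → K b c = 0) :
    deformCLM m k C a z₀ z (X * K) =
      deformCLM m k C a z₀ z X * conjDiagCLM (conjDiag m k C a) K := by
  ext b c
  rw [deformCLM_apply, Matrix.mul_apply, Matrix.mul_apply, Complex.ofReal_sum, Finset.sum_div,
    Finset.mul_sum, Finset.sum_mul, Finset.mul_sum]
  refine Finset.sum_congr rfl fun e _ => ?_
  rw [deformCLM_apply, conjDiagCLM_apply, Matrix.of_apply]
  by_cases h : blockKind e = blockKind c
  · rw [weight_congr z rfl h (b := b), weight_congr (z₀ : ℂ) rfl h (b := b)]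
    have h1 := mul_inv_cancel₀ (conjDiag_ne_zero (m := m) (k := k) C a e)
    push_cast
    linear_combination (-weight z b c * ((conjDiag m k C a b)⁻¹ *
        ((X b e : ℂ) * K e c / weight (z₀ : ℂ) b c) * conjDiag m k C a c)) * h1
  · rw [hK e c h]; simp

theorem deformCLM_block_mul (z : ℂ) (X : Matrix (Idx m k) (Idx m k) ℝ)
    {K : Matrix (Idx m k) (Idx m k) ℝ} (hK : ∀ b c, blockKind b ≠ blockKind c → K b c = 0) :
    deformCLM m k C a z₀ z (K * X) =
      conjDiagCLM (conjDiag m k C a) K * deformCLM m k C a z₀ z X := by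
  ext b c
  rw [deformCLM_apply, Matrix.mul_apply, Matrix.mul_apply, Complex.ofReal_sum, Finset.sum_div,
    Finset.mul_sum, Finset.sum_mul, Finset.mul_sum]
  refine Finset.sum_congr rfl fun e _ => ?_
  rw [deformCLM_apply, conjDiagCLM_apply, Matrix.of_apply]
  by_cases h : blockKind b = blockKind e
  · rw [← weight_congr z h rfl (c := c), ← weight_congr (z₀ : ℂ) h rfl (c := c)]
    have h1 := mul_inv_cancel₀ (conjDiag_ne_zero (m := m) (k := k) C a e)
    push_cast
    linear_combination (-weight z b c * ((conjDiag m k C a b)⁻¹ *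
        ((K b e : ℂ) * X e c / weight (z₀ : ℂ) b c) * conjDiag m k C a c)) * h1
  · rw [hK b e h]; simp

variable {h h' : EuclideanSpace ℝ (Fin m) → Idx m k → ℝ}
  {S S' : EuclideanSpace ℝ (Fin m) → Matrix (Idx m k) (Idx m k) ℝ}
  {V V' : Set (EuclideanSpace ℝ (Fin m))} {G G' : EuclideanSpace ℝ (Fin m) → loopGroup m k C}

/-- The deformations of two frames along the same immersion have gauge equivalent Maurer–Cartan forms,
because the weights are constant on the blocks of the transition between the frames. So after this
transition they differ by a constant factor on the left, for each value of the parameter. -/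
theorem IsDeformable.transition_const (H : IsDeformable C a z₀ h S V)
    (H' : IsDeformable C a z₀ h' S' V') (L : IsLoopFrame G (loopForm C a z₀ S) V)
    (L' : IsLoopFrame G' (loopForm C a z₀ S') V')
    {φ : EuclideanSpace ℝ (Fin m) → EuclideanSpace ℝ (Fin m)}
    {B : Set (EuclideanSpace ℝ (Fin m))} (hB : IsOpen B) (hBc : IsPreconnected B) (hBV : B ⊆ V)
    (hφV : ∀ u ∈ B, φ u ∈ V') (hφ : ∀ u ∈ B, DifferentiableAt ℝ φ u)
    (hK : ∀ u ∈ B, IsBlockOrthogonal ((S u)⁻¹ * S' (φ u)))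
    {u₀ u : EuclideanSpace ℝ (Fin m)} (h₀ : u₀ ∈ B) (hu : u ∈ B) (z : ℂˣ) :
    ((G u).1 z).1 * ((S u)⁻¹ * S' (φ u)).map (fun x : ℝ => (x : ℂ)) *
        (((G' (φ u)).1 z)⁻¹).1 =
      ((G u₀).1 z).1 * ((S u₀)⁻¹ * S' (φ u₀)).map (fun x : ℝ => (x : ℂ)) *
        (((G' (φ u₀)).1 z)⁻¹).1 := by
  set K : EuclideanSpace ℝ (Fin m) → Matrix (Idx m k) (Idx m k) ℝ := fun u => (S u)⁻¹ * S' (φ u)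
    with hKdef
  set T := conjDiagCLM (conjDiag m k C a) with hT
  set Ω : Fin m → EuclideanSpace ℝ (Fin m) → Matrix (Idx m k) (Idx m k) ℝ := fun i u =>
    ∑ j, (pd i φ u) j • conn S' j (φ u) with hΩ
  have hSd : ∀ u ∈ B, DifferentiableAt ℝ S u := fun u hu =>
    (H.frame.contDiffAt (hBV hu)).differentiableAt (by simp)
  have hSd' : ∀ u ∈ B, DifferentiableAt ℝ S' (φ u) := fun u hu =>
    (H'.frame.contDiffAt (hφV u hu)).differentiableAt (by simp)
  have hSφ : ∀ u ∈ B, DifferentiableAt ℝ (fun w => S' (φ w)) u := fun u hu =>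
    (hSd' u hu).comp u (hφ u hu)
  have hKd : ∀ u ∈ B, DifferentiableAt ℝ K u := fun u hu =>
    ((contDiffAt_matrix_inv (H.frame.contDiffAt (hBV hu))
      (H.frame.isUnit (hBV hu))).differentiableAt (n := ∞) (by simp)).fun_mul (hSφ u hu)
  have hSK : ∀ u ∈ B, S u * K u = S' (φ u) := fun u hu => by
    rw [hKdef, ← Matrix.mul_assoc, Matrix.mul_nonsing_inv _
      ((Matrix.isUnit_iff_isUnit_det _).1 (H.frame.isUnit (hBV hu))), Matrix.one_mul]
  -- the gauge transformation of the Maurer–Cartan form by the transition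
  have hgauge : ∀ u ∈ B, ∀ i, conn S i u * K u + pd i K u = K u * Ω i u := by
    intro u hu i
    have h1 : pd i (fun w => S w * K w) u = pd i (fun w => S' (φ w)) u := by
      refine pd_congr ?_ i
      filter_upwards [hB.mem_nhds hu] with w hw using hSK w hw
    rw [pd_mul (hSd u hu) (hKd u hu), pd_comp (hSd' u hu) (hφ u hu)] at h1
    have h2 : ∑ j, (pd i φ u) j • pd j S' (φ u) = S' (φ u) * Ω i u := by
      rw [hΩ, Finset.mul_sum]
      refine Finset.sum_congr rfl fun j _ => ?_
      rw [Matrix.mul_smul, H'.frame.mul_conn (hφV u hu)]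
    rw [h2, ← H.frame.mul_conn (hBV hu), ← hSK u hu] at h1
    refine (H.frame.isUnit (hBV hu)).mul_left_cancel ?_
    rw [Matrix.mul_add, add_comm, ← Matrix.mul_assoc (S u) (conn S i u) (K u), h1,
      Matrix.mul_assoc (S u) (K u)]
  have hpdK : ∀ u ∈ B, ∀ i b c, blockKind b ≠ blockKind c → pd i K u b c = 0 := by
    intro u hu i b c hbc
    rw [← pd_entry (hKd u hu)]
    have h1 : (fun w => K w b c) =ᶠ[nhds u] fun _ => 0 := by
      filter_upwards [hB.mem_nhds hu] with w hw using (hK w hw).block b c hbc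
    rw [pd_congr h1, pd_const]
  have hGd : ∀ u ∈ B, DifferentiableAt ℝ (fun w => ((G w).1 z).1) u := fun u hu =>
    (L.contDiffAt (hBV hu) z).differentiableAt (by simp)
  have hGd' : ∀ u ∈ B, DifferentiableAt ℝ (fun w => ((G' w).1 z).1) (φ u) := fun u hu =>
    (L'.contDiffAt (hφV u hu) z).differentiableAt (by simp)
  have hTK : ∀ u ∈ B, DifferentiableAt ℝ (fun w => T (K w)) u := fun u hu =>
    T.differentiableAt.comp u (hKd u hu)
  have hC : C.eps * C.eps = 1 := by cases C <;> simp [FPCase.eps]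
  have hJs : ∀ i : Idx m k, diag3 m k 1 C.eps 1 i * diag3 m k 1 C.eps 1 i = 1 := fun i =>
    diag3_mul_self m k i hC (by norm_num)
  have key := parallel_const (J := Matrix.diagonal (diag3 m k 1 C.eps 1))
    (A := fun i u => ∑ j, (pd i φ u) j • weighted (z : ℂ) (loopForm C a z₀ S' j (φ u)))
    (X := fun w => ((G w).1 z).1 * T (K w)) (Y := fun w => ((G' (φ w)).1 z).1) hB hBc
    (fun u hu => (hGd u hu).fun_mul (hTK u hu)) (fun u hu i => ?_)
    (fun u hu => (hGd' u hu).comp u (hφ u hu)) (fun u hu i => ?_) (fun u hu i => ?_) h₀ hu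
  · have hTb : ∀ u ∈ B, T (K u) = (K u).map (fun x : ℝ => (x : ℂ)) := fun u hu =>
      conjDiagCLM_of_block (hK u hu).block
    simp only [hTb u hu, hTb u₀ h₀] at key
    rw [coe_inv_eq _ hJs ((G' (φ u)).2.2.1 z), coe_inv_eq _ hJs ((G' (φ u₀)).2.2.1 z)]
    simp only [← Matrix.mul_assoc]
    rw [key]
  · have hT' : pd i (fun w => T (K w)) u = T (pd i K u) := pd_clm T (hKd u hu) i
    rw [pd_mul (hGd u hu) (hTK u hu), hT', L.pd_eq u (hBV hu), weighted_loopForm_eq]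
    simp only [weighted_loopForm_eq]
    have h1 := congrArg (deformCLM m k C a z₀ z) (hgauge u hu i)
    rw [map_add, deformCLM_mul_block _ _ (hK u hu).block, deformCLM_block_mul _ _ (hK u hu).block,
      deformCLM_of_block _ (hpdK u hu i), hΩ, map_sum] at h1
    simp only [map_smul] at h1
    rw [Matrix.mul_assoc _ (T (K u)), ← h1, Matrix.mul_add, add_comm, Matrix.mul_assoc]
  · refine (pd_comp (g := fun w => ((G' w).1 z).1) (hGd' u hu) (hφ u hu) i).trans ?_
    rw [Finset.mul_sum]
    refine Finset.sum_congr rfl fun j _ => ?_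
    rw [L'.pd_eq (φ u) (hφV u hu), Matrix.mul_smul]
  · rw [Finset.sum_mul, Matrix.transpose_sum, Finset.mul_sum, ← Finset.sum_add_distrib]
    refine Finset.sum_eq_zero fun j _ => ?_
    rw [Matrix.smul_mul, Matrix.transpose_smul, Matrix.mul_smul, ← smul_add,
      H'.skew_loopForm (hφV u hu), smul_zero]

end Comparison

/-! ### Loop frames on the manifold -/

section Lifting

variable {m k : ℕ} {C : FPCase} {a : Axis} {z₀ : ℂˣ}

/-- A holomorphic function on the group `ℂ*` is smooth. -/
theorem contMDiff_of_mdifferentiable_units {φ : ℂˣ → ℂ}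
    (hφ : MDifferentiable 𝓘(ℂ, ℂ) 𝓘(ℂ, ℂ) φ) : ContMDiff 𝓘(ℝ, ℂ) 𝓘(ℝ, ℂ) ∞ φ := by
  set ψ : ℂ → ℂ := fun w => if hw : w ≠ 0 then φ (Units.mk0 w hw) else 0 with hψ
  have hval : ∀ z : ℂˣ, φ z = ψ z := by
    intro z
    rw [hψ]
    simp
  have hd : DifferentiableOn ℂ ψ ({0}ᶜ : Set ℂ) := by
    set e := Units.isOpenEmbedding_val.toOpenPartialHomeomorph (Units.val : ℂˣ → ℂ) with he
    have hrange : Set.range (Units.val : ℂˣ → ℂ) = {0}ᶜ := by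
      ext w
      constructor
      · rintro ⟨z, rfl⟩
        exact z.ne_zero
      · intro hw
        exact ⟨Units.mk0 w hw, rfl⟩
    have h1 : ContMDiffOn 𝓘(ℂ, ℂ) 𝓘(ℂ, ℂ) ∞ e.symm (Set.range (Units.val : ℂˣ → ℂ)) :=
      contMDiffOn_isOpenEmbedding_symm Units.isOpenEmbedding_val
    rw [hrange] at h1
    have h2 : MDifferentiableOn 𝓘(ℂ, ℂ) 𝓘(ℂ, ℂ) (φ ∘ e.symm) ({0}ᶜ : Set ℂ) :=
      hφ.comp_mdifferentiableOn (h1.mdifferentiableOn (by simp))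
    refine (mdifferentiableOn_iff_differentiableOn.1 h2).congr fun w hw => ?_
    have h3 : e.symm w = Units.mk0 w hw := by
      have h4 : e (Units.mk0 w hw) = w := rfl
      conv_lhs => rw [← h4]
      exact e.left_inv (Set.mem_univ _)
    rw [Function.comp_apply, h3]
    simp [hψ, show w ≠ 0 from hw]
  have hs : ContDiffOn ℝ ∞ ψ ({0}ᶜ : Set ℂ) :=
    (hd.contDiffOn isOpen_compl_singleton).restrict_scalars ℝ
  have h5 : ContMDiff 𝓘(ℝ, ℂ) 𝓘(ℝ, ℂ) ∞ (fun z : ℂˣ => (z : ℂ)) := Units.contMDiff_val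
  have h6 := hs.contMDiffOn.comp_contMDiff h5 fun z => z.ne_zero
  exact h6.congr hval

theorem IsLoopFrame.const_mul {G : EuclideanSpace ℝ (Fin m) → loopGroup m k C}
    {α : Fin m → EuclideanSpace ℝ (Fin m) → Matrix (Idx m k) (Idx m k) ℂ}
    {V : Set (EuclideanSpace ℝ (Fin m))} (L : IsLoopFrame G α V) (X : loopGroup m k C) :
    IsLoopFrame (fun u => X * G u) α V := by
  have hX : ∀ u z, ((X * G u).1 z).1 = (X.1 z).1 * ((G u).1 z).1 := fun _ _ => rfl
  refine ⟨L.isOpen, fun z => ?_, fun u hu z i => ?_⟩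
  · simp only [hX]
    exact contDiffOn_const.mul (L.smooth z)
  · simp only [hX]
    rw [pd_mul (differentiableAt_const _) ((L.contDiffAt hu z).differentiableAt (by simp)),
      pd_const, zero_mul, add_zero, L.pd_eq u hu, Matrix.mul_assoc]

variable {M : Type*} [TopologicalSpace M] [ChartedSpace (EuclideanSpace ℝ (Fin m)) M]

/-- The derivative of the chart around `x`. -/
def chartFwd (x q : M) : TangentSpace (𝓡 m) q →L[ℝ] EuclideanSpace ℝ (Fin m) :=
  mfderiv (𝓡 m) (𝓡 m) (chartAt (EuclideanSpace ℝ (Fin m)) x) q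

variable [IsManifold (𝓡 m) ∞ M] {W : Type*} [NormedAddCommGroup W] [NormedSpace ℝ W]

theorem chartFwd_injective (x : M) {q : M}
    (hq : q ∈ (chartAt (EuclideanSpace ℝ (Fin m)) x).source) :
    Function.Injective (chartFwd (m := m) x q) := by
  have : IsManifold (𝓡 m) 1 M := IsManifold.of_le (n := ∞) (by simp)
  exact ((mdifferentiable_chart (I := 𝓡 m) x).mfderiv_bijective hq).1

theorem mfderiv_comp_chartAt (x : M) {q : M}
    (hq : q ∈ (chartAt (EuclideanSpace ℝ (Fin m)) x).source) {g : EuclideanSpace ℝ (Fin m) → W}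
    (hg : DifferentiableAt ℝ g (chartAt (EuclideanSpace ℝ (Fin m)) x q))
    (v : TangentSpace (𝓡 m) q) :
    mfderiv (𝓡 m) 𝓘(ℝ, W) (fun q => g (chartAt (EuclideanSpace ℝ (Fin m)) x q)) q v =
      fderiv ℝ g (chartAt (EuclideanSpace ℝ (Fin m)) x q) (chartFwd x q v) := by
  have : IsManifold (𝓡 m) 1 M := IsManifold.of_le (n := ∞) (by simp)
  have h1 := (mdifferentiable_chart (I := 𝓡 m) x).mdifferentiableAt hq
  have h2 := mfderiv_comp_apply (I := 𝓡 m) (I' := 𝓡 m) (I'' := 𝓘(ℝ, W)) q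
    hg.mdifferentiableAt h1 v
  rw [mfderiv_eq_fderiv] at h2
  exact h2

variable {G : EuclideanSpace ℝ (Fin m) → loopGroup m k C}
  {α : Fin m → EuclideanSpace ℝ (Fin m) → Matrix (Idx m k) (Idx m k) ℂ}
  {V : Set (EuclideanSpace ℝ (Fin m))} {x q : M}

theorem IsLoopFrame.fderiv_eq (L : IsLoopFrame G α V) {u : EuclideanSpace ℝ (Fin m)} (hu : u ∈ V)
    (z : ℂˣ) (v : EuclideanSpace ℝ (Fin m)) :
    fderiv ℝ (fun u => ((G u).1 z).1) u v =
      ((G u).1 z).1 * ∑ i, v i • weighted (z : ℂ) (α i u) := by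
  refine (fderiv_apply_eq_sum_pd v).trans ?_
  rw [Finset.mul_sum]
  exact Finset.sum_congr rfl fun i _ => by rw [L.pd_eq u hu, Matrix.mul_smul]

theorem IsLoopFrame.fderiv_entry (L : IsLoopFrame G α V) {u : EuclideanSpace ℝ (Fin m)}
    (hu : u ∈ V) (z : ℂˣ) (v : EuclideanSpace ℝ (Fin m)) (b c : Idx m k) :
    fderiv ℝ (fun u => ((G u).1 z).1 b c) u v =
      (((G u).1 z).1 * ∑ i, v i • weighted (z : ℂ) (α i u)) b c := by
  rw [← L.fderiv_eq hu]
  have hd : DifferentiableAt ℝ (fun u => ((G u).1 z).1) u :=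
    (L.contDiffAt hu z).differentiableAt (by simp)
  have h1 : fderiv ℝ (fun u => entryCLM ℂ b c (((G u).1 z).1)) u =
      (entryCLM ℂ b c).comp (fderiv ℝ (fun u => ((G u).1 z).1) u) :=
    ((entryCLM ℂ b c).hasFDerivAt.comp u hd.hasFDerivAt).fderiv
  exact congrArg (fun L => L v) h1

theorem IsLoopFrame.loopDeriv_lift (L : IsLoopFrame G α V) (hq : q ∈ chartDomain x V) (z : ℂˣ)
    (v : TangentSpace (𝓡 m) q) :
    loopDeriv (fun q => G (chartAt (EuclideanSpace ℝ (Fin m)) x q)) z q v =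
      ((G (chartAt (EuclideanSpace ℝ (Fin m)) x q)).1 z).1 *
        ∑ i, (chartFwd x q v) i • weighted (z : ℂ) (α i (chartAt (EuclideanSpace ℝ (Fin m)) x q)) := by
  ext b c
  have hd : DifferentiableAt ℝ (fun u => ((G u).1 z).1 b c)
      (chartAt (EuclideanSpace ℝ (Fin m)) x q) :=
    (contDiffAt_entry (L.contDiffAt hq.2 z) b c).differentiableAt (by simp)
  exact (mfderiv_comp_chartAt x hq.1 hd v).trans (L.fderiv_entry hq.2 z _ b c)

theorem weighted_eq_add (z : ℂ) (X : Matrix (Idx m k) (Idx m k) ℂ) :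
    weighted z X = z⁻¹ • (hadamardCLM (weightPart 1) X + hadamardCLM (weightPart 2) X) +
      hadamardCLM (weightPart 0) X +
      z • (hadamardCLM (weightPart 1) X - hadamardCLM (weightPart 2) X) := by
  rw [← sum_hadamardCLM, Fin.sum_univ_three]
  ext b c
  simp [weightCoeff]
  ring

/-- The form on the manifold with given coefficients in the chart around `x`. -/
def liftForm (x q : M) (Y : Fin m → Matrix (Idx m k) (Idx m k) ℂ) :
    TangentSpace (𝓡 m) q →ₗ[ℝ] Matrix (Idx m k) (Idx m k) ℂ :=
  ∑ i, ((EuclideanSpace.proj i : EuclideanSpace ℝ (Fin m) →L[ℝ] ℝ).toLinearMap.comp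
    (chartFwd x q).toLinearMap).smulRight (Y i)

theorem liftForm_apply (x q : M) (Y : Fin m → Matrix (Idx m k) (Idx m k) ℂ)
    (v : TangentSpace (𝓡 m) q) : liftForm x q Y v = ∑ i, (chartFwd x q v) i • Y i := by
  rw [liftForm, LinearMap.sum_apply]
  rfl

/-- A loop frame in a chart, multiplied by a fixed loop, defines an extended frame on the
manifold. -/
theorem IsLoopFrame.isExtendedFrameOn (L : IsLoopFrame G α V)
    {F : EuclideanSpace ℝ (Fin m) → ℂ → Matrix (Idx m k) (Idx m k) ℂ}
    (hF : ContDiffOn ℝ ∞ (fun q : EuclideanSpace ℝ (Fin m) × ℂ => F q.1 q.2)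
      (V ×ˢ ({0}ᶜ : Set ℂ)))
    (hGF : ∀ u ∈ V, ∀ z : ℂˣ, ((G u).1 z).1 = F u z) (X : loopGroup m k C) {U : Set M}
    (hU : U ⊆ chartDomain x V) :
    IsExtendedFrameOn (fun q => X * G (chartAt (EuclideanSpace ℝ (Fin m)) x q)) U := by
  refine ⟨fun i j => ?_, fun q hq => ?_⟩
  · have h1 : ContMDiffOn ((𝓡 m).prod 𝓘(ℝ, ℂ)) 𝓘(ℝ, EuclideanSpace ℝ (Fin m) × ℂ) ∞
        (fun q : M × ℂˣ => (chartAt (EuclideanSpace ℝ (Fin m)) x q.1, (q.2 : ℂ)))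
        (U ×ˢ Set.univ) := by
      refine ContMDiffOn.prodMk_space ?_ ?_
      · have h2 : ContMDiffOn (𝓡 m) (𝓡 m) ∞ (chartAt (EuclideanSpace ℝ (Fin m)) x)
            (chartAt (EuclideanSpace ℝ (Fin m)) x).source := contMDiffOn_chart
        exact h2.comp contMDiffOn_fst fun q hq => (hU hq.1).1
      · have h2 : ContMDiff 𝓘(ℝ, ℂ) 𝓘(ℝ, ℂ) ∞ (fun z : ℂˣ => (z : ℂ)) := Units.contMDiff_val
        exact h2.comp_contMDiffOn contMDiffOn_snd
    have h2 : ∀ e, ContMDiffOn ((𝓡 m).prod 𝓘(ℝ, ℂ)) 𝓘(ℝ, ℂ) ∞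
        (fun q : M × ℂˣ => F (chartAt (EuclideanSpace ℝ (Fin m)) x q.1) q.2 e j)
        (U ×ˢ Set.univ) := by
      intro e
      have h3 := (contDiffOn_entry hF e j).contMDiffOn
      exact h3.comp h1 fun q hq => ⟨(hU hq.1).2, q.2.ne_zero⟩
    have h4 : ∀ e, ContMDiffOn ((𝓡 m).prod 𝓘(ℝ, ℂ)) 𝓘(ℝ, ℂ) ∞
        (fun q : M × ℂˣ => (X.1 q.2).1 i e) (U ×ˢ Set.univ) := fun e =>
      (contMDiff_of_mdifferentiable_units (X.2.1 i e)).comp_contMDiffOn contMDiffOn_snd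
    have h5 : ContMDiffOn ((𝓡 m).prod 𝓘(ℝ, ℂ)) 𝓘(ℝ, ℂ) ∞
        (fun q : M × ℂˣ => ∑ e, (X.1 q.2).1 i e *
          F (chartAt (EuclideanSpace ℝ (Fin m)) x q.1) q.2 e j) (U ×ˢ Set.univ) :=
      contMDiffOn_finsetSum fun e _ =>
        (contDiff_mul (𝕜 := ℝ) (𝔸 := ℂ)).contMDiff.comp_contMDiffOn ((h4 e).prodMk_space (h2 e))
    refine h5.congr fun q hq => ?_
    rw [← Matrix.mul_apply, ← hGF _ (hU hq.1).2]
    rfl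
  · set u := chartAt (EuclideanSpace ℝ (Fin m)) x q with hu
    refine ⟨liftForm x q fun i => hadamardCLM (weightPart 1) (α i u) +
        hadamardCLM (weightPart 2) (α i u), liftForm x q fun i => hadamardCLM (weightPart 0) (α i u),
      liftForm x q fun i => hadamardCLM (weightPart 1) (α i u) -
        hadamardCLM (weightPart 2) (α i u), fun z v => ?_⟩
    have h1 := (L.const_mul X).loopDeriv_lift (x := x) (hU hq) z v
    have h2 : ((((X * G u).1 z))⁻¹).1 * ((X * G u).1 z).1 = 1 :=
      congrArg Subtype.val (inv_mul_cancel ((X * G u).1 z))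
    rw [h1, ← Matrix.mul_assoc, h2, Matrix.one_mul, liftForm_apply, liftForm_apply, liftForm_apply,
      Finset.smul_sum, Finset.smul_sum, ← Finset.sum_add_distrib, ← Finset.sum_add_distrib]
    refine Finset.sum_congr rfl fun i _ => ?_
    rw [weighted_eq_add, smul_add, smul_add, smul_comm, smul_comm (z : ℂ)]

/-- The loop frames of adapted frames are immersive. -/
theorem IsLoopFrame.injective_mfderiv_column {h : EuclideanSpace ℝ (Fin m) → Idx m k → ℝ}
    {S : EuclideanSpace ℝ (Fin m) → Matrix (Idx m k) (Idx m k) ℝ}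
    (L : IsLoopFrame G (loopForm C a z₀ S) V) (H : IsDeformable C a z₀ h S V)
    (hq : q ∈ chartDomain x V) {z : ℂˣ} (hz : (z : ℂ) ≠ Complex.I) (hz' : (z : ℂ) ≠ -Complex.I) :
    Function.Injective (mfderiv (𝓡 m) 𝓘(ℝ, Idx m k → ℂ)
      (fun q (b : Idx m k) => ((G (chartAt (EuclideanSpace ℝ (Fin m)) x q)).1 z).1 b (mid m k))
      q) := by
  set u := chartAt (EuclideanSpace ℝ (Fin m)) x q with hu
  rw [injective_iff_map_eq_zero]
  intro v hv
  have hd : ∀ b, DifferentiableAt ℝ (fun u => ((G u).1 z).1 b (mid m k)) u := fun b =>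
    (contDiffAt_entry (L.contDiffAt hq.2 z) b _).differentiableAt (by simp)
  have h1 := mfderiv_comp_chartAt x hq.1
    (g := fun u (b : Idx m k) => ((G u).1 z).1 b (mid m k)) (differentiableAt_pi.2 hd) v
  have h2 : fderiv ℝ (fun u (b : Idx m k) => ((G u).1 z).1 b (mid m k)) u (chartFwd x q v) = 0 :=
    h1.symm.trans hv
  set Y := ∑ i, (chartFwd x q v) i • weighted (z : ℂ) (loopForm C a z₀ S i u) with hY
  have h3 : (((G u).1 z).1).mulVec (fun b => Y b (mid m k)) = 0 := by
    funext b
    have h4 : fderiv ℝ (fun u (b : Idx m k) => ((G u).1 z).1 b (mid m k)) u =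
        ContinuousLinearMap.pi fun b => fderiv ℝ (fun u => ((G u).1 z).1 b (mid m k)) u :=
      fderiv_pi hd
    have h5 := congrFun h2 b
    rw [h4, ContinuousLinearMap.pi_apply, L.fderiv_entry hq.2, Matrix.mul_apply] at h5
    exact h5
  have h4 : (fun b => Y b (mid m k)) = 0 := by
    have h5 := congrArg (fun y => ((((G u).1 z)⁻¹).1).mulVec y) h3
    simp only [Matrix.mulVec_mulVec, Matrix.mulVec_zero] at h5
    have h6 : (((G u).1 z)⁻¹).1 * ((G u).1 z).1 = 1 :=
      congrArg Subtype.val (inv_mul_cancel ((G u).1 z))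
    rwa [h6, Matrix.one_mulVec] at h5
  have hs : (z : ℂ) + (z : ℂ)⁻¹ ≠ 0 := by
    intro h0
    have hz0 := z.ne_zero
    have h5 : ((z : ℂ) - Complex.I) * ((z : ℂ) + Complex.I) = 0 := by
      field_simp at h0
      linear_combination h0 - Complex.I_sq
    rcases mul_eq_zero.1 h5 with h6 | h6
    · exact hz (sub_eq_zero.1 h6)
    · exact hz' (eq_neg_of_add_eq_zero_left h6)
  have h7 : Matrix.vecMul (fun i => (chartFwd x q v) i) (coframe S u) = 0 := by
    funext b
    have h8 := congrFun h4 (Sum.inl b)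
    rw [hY, Matrix.sum_apply] at h8
    have h9 : ∀ i, ((chartFwd x q v) i • weighted (z : ℂ) (loopForm C a z₀ S i u)) (Sum.inl b)
        (mid m k) = (((z : ℂ) + (z : ℂ)⁻¹) * (conjDiag m k C a (Sum.inl b))⁻¹ *
          ((z₀ : ℂ) + (z₀ : ℂ)⁻¹)⁻¹ * conjDiag m k C a (mid m k)) *
          (((chartFwd x q v) i * coframe S u i b : ℝ) : ℂ) := by
      intro i
      have h10 : ((chartFwd x q v) i • weighted (z : ℂ) (loopForm C a z₀ S i u)) (Sum.inl b)
        (mid m k) = ((chartFwd x q v) i : ℂ) * (((z : ℂ) + (z : ℂ)⁻¹) *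
          ((conjDiag m k C a (Sum.inl b))⁻¹ * ((coframe S u i b : ℂ) /
          ((z₀ : ℂ) + (z₀ : ℂ)⁻¹)) * conjDiag m k C a (mid m k))) := rfl
      rw [h10]
      push_cast
      ring
    simp only [h9, ← Finset.mul_sum, ← Complex.ofReal_sum, Pi.zero_apply] at h8
    have h11 := (mul_eq_zero.1 h8).resolve_left (mul_ne_zero (mul_ne_zero (mul_ne_zero hs
      (inv_ne_zero (conjDiag_ne_zero C a _))) (inv_ne_zero (Axis.add_inv_ne_zero H.mem)))
      (conjDiag_ne_zero C a _))
    exact Complex.ofReal_eq_zero.1 h11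
  have h12 : chartFwd x q v = 0 := by
    have h13 := congrArg (fun y => Matrix.vecMul y (coframe S u)⁻¹) h7
    simp only [Matrix.vecMul_vecMul, Matrix.zero_vecMul] at h13
    rw [Matrix.mul_nonsing_inv _ ((Matrix.isUnit_iff_isUnit_det _).1 (H.frame.indep u hq.2)),
      Matrix.vecMul_one] at h13
    ext i
    exact congrFun h13 i
  exact chartFwd_injective x hq.1 (h12.trans (map_zero _).symm)

end Lifting

/-! ### The loop group map of an immersion -/

section Gluing

variable {m k : ℕ} {C : FPCase} {a : Axis} {z₀ : ℂˣ}

theorem realForm_mul (hz : z₀ ∈ a.range) (X Y : loopGroup m k C) :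
    realForm C a (((X * Y).1 z₀).1) = realForm C a ((X.1 z₀).1) * realForm C a ((Y.1 z₀).1) := by
  apply map_ofReal_injective
  have h1 : ∀ X : loopGroup m k C, (realForm C a ((X.1 z₀).1)).map (fun x : ℝ => (x : ℂ)) = _ :=
    fun X => map_realForm (C := C) (a := a) fun i j => loop_conj X.2 hz i j
  have hT : Matrix.diagonal (fun i => (conjDiag m k C a i)⁻¹) *
      Matrix.diagonal (conjDiag m k C a) = 1 := by
    rw [Matrix.diagonal_mul_diagonal]
    simp [conjDiag_ne_zero]
  simp only [map_ofReal_mul, h1]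
  set T := Matrix.diagonal (conjDiag m k C a)
  set T' := Matrix.diagonal (fun i => (conjDiag m k C a i)⁻¹)
  calc T * ((X.1 z₀).1 * (Y.1 z₀).1) * T' = T * (X.1 z₀).1 * 1 * (Y.1 z₀).1 * T' := by
        noncomm_ring
    _ = _ := by rw [← hT]; noncomm_ring

theorem realForm_one : realForm C a (1 : Matrix (Idx m k) (Idx m k) ℂ) = 1 := by
  rw [← conjDiagCLM_one (conjDiag_ne_zero C a), realForm_conjDiagCLM]

theorem realForm_map_of_block {K : Matrix (Idx m k) (Idx m k) ℝ}
    (hK : ∀ b c, blockKind b ≠ blockKind c → K b c = 0) :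
    realForm C a (K.map (fun x : ℝ => (x : ℂ))) = K := by
  rw [← conjDiagCLM_of_block (C := C) (a := a) hK, realForm_conjDiagCLM]

variable {M : Type*} [TopologicalSpace M] [ChartedSpace (EuclideanSpace ℝ (Fin m)) M]
  [IsManifold (𝓡 m) ∞ M] {f : M → Idx m k → ℝ} {c : ℝ}

/-- The loops `G K (G')⁻¹` that compare the deformations of two frames, with transition `K`, are
locally constant on the manifold. -/
theorem eventually_transition_const {x y q : M}
    {S S' : EuclideanSpace ℝ (Fin m) → Matrix (Idx m k) (Idx m k) ℝ}
    {V V' : Set (EuclideanSpace ℝ (Fin m))} {G G' : EuclideanSpace ℝ (Fin m) → loopGroup m k C}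
    (hf : MDifferentiable (𝓡 m) 𝓘(ℝ, Idx m k → ℝ) f)
    (H : IsFrameAt (target C a) f x S V) (H' : IsFrameAt (target C a) f y S' V')
    (D : IsDeformable C a z₀ (inChart f x) S V) (D' : IsDeformable C a z₀ (inChart f y) S' V')
    (L : IsLoopFrame G (loopForm C a z₀ S) V) (L' : IsLoopFrame G' (loopForm C a z₀ S') V')
    (hq : q ∈ chartDomain x V ∩ chartDomain y V') :
    ∀ᶠ w in nhds q, w ∈ chartDomain x V ∩ chartDomain y V' ∧ ∀ z : ℂˣ,
      ((G (chartAt (EuclideanSpace ℝ (Fin m)) x w)).1 z).1 *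
        ((liftFrame x S w)⁻¹ * liftFrame y S' w).map (fun x : ℝ => (x : ℂ)) *
        (((G' (chartAt (EuclideanSpace ℝ (Fin m)) y w)).1 z)⁻¹).1 =
      ((G (chartAt (EuclideanSpace ℝ (Fin m)) x q)).1 z).1 *
        ((liftFrame x S q)⁻¹ * liftFrame y S' q).map (fun x : ℝ => (x : ℂ)) *
        (((G' (chartAt (EuclideanSpace ℝ (Fin m)) y q)).1 z)⁻¹).1 := by
  have : IsManifold (𝓡 m) 1 M := IsManifold.of_le (n := ∞) (by simp)
  set e := chartAt (EuclideanSpace ℝ (Fin m)) x with he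
  set e' := chartAt (EuclideanSpace ℝ (Fin m)) y with he'
  set O := chartDomain x V ∩ chartDomain y V' with hO
  have hOo : IsOpen O := H.isOpen.inter H'.isOpen
  have hEo : IsOpen (e.target ∩ e.symm ⁻¹' O) := isOpen_chart_preimage x hOo
  have hmem : ∀ w ∈ O, e w ∈ e.target ∩ e.symm ⁻¹' O := fun w hw =>
    ⟨e.map_source hw.1.1, by rw [Set.mem_preimage, e.left_inv hw.1.1]; exact hw⟩
  obtain ⟨ε, hε, hball⟩ := Metric.isOpen_iff.1 hEo (e q) (hmem q hq)
  have hB : ∀ u ∈ Metric.ball (e q) ε, u ∈ e.target ∧ e.symm u ∈ O ∧ e (e.symm u) = u := fun u hu =>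
    ⟨(hball hu).1, (hball hu).2, e.right_inv (hball hu).1⟩
  have hev : ∀ᶠ w in nhds q, w ∈ O ∧ e w ∈ Metric.ball (e q) ε :=
    Filter.Eventually.and (hOo.mem_nhds hq)
      ((e.continuousAt hq.1.1).preimage_mem_nhds (Metric.ball_mem_nhds _ hε))
  filter_upwards [hev] with w hw
  refine ⟨hw.1, fun z => ?_⟩
  have key := D.transition_const D' L L' (φ := fun u => e' (e.symm u)) Metric.isOpen_ball
    (convex_ball (e q) ε).isPreconnected
    (fun u hu => by
      have h1 := (hB u hu).2.1.1.2
      rwa [Set.mem_preimage, ← he, (hB u hu).2.2] at h1)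
    (fun u hu => (hB u hu).2.1.2.2)
    (fun u hu => by
      have h1 := (mdifferentiable_chart (I := 𝓡 m) x).mdifferentiableAt_symm (hB u hu).1
      have h2 := (mdifferentiable_chart (I := 𝓡 m) y).mdifferentiableAt (hB u hu).2.1.2.1
      exact (h2.comp u h1).differentiableAt)
    (fun u hu => by
      have h1 := H.isBlockOrthogonal (hf _) H' (hB u hu).2.1.1 (hB u hu).2.1.2
      rw [liftFrame, liftFrame, ← he, (hB u hu).2.2] at h1
      exact h1)
    (Metric.mem_ball_self hε) hw.2 z
  simp only [e.left_inv hw.1.1.1, e.left_inv hq.1.1] at key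
  exact key

set_option maxHeartbeats 1000000 in
/-- Every immersion of constant sectional curvature with flat normal bundle comes from a loop
group map: the deformations of oriented adapted frames are glued, the obstruction being a locally
constant cocycle with values in the loop group. -/
theorem IsFlatNormalImmersion.exists_isLoopMap [SimplyConnectedSpace M]
    (hf : IsFlatNormalImmersion (target C a) c f) (p : M) (hz₀ : z₀ ∈ a.range)
    (hc : curvAt (target C a) z₀ = c) (hne : (z₀ : ℂ)⁻¹ - (z₀ : ℂ) ≠ 0) :
    ∃ S : Matrix (Idx m k) (Idx m k) ℝ,
      S.transpose * Matrix.diagonal ((target C a).signs m k) * S =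
        Matrix.diagonal ((target C a).signs m k) ∧
      ∃ Φ : M → LoopQuot m k C, IsLoopMap p Φ ∧ IsImmersive Φ ∧
        ∀ x i, ((S.mulVec (f x)) i : ℂ) = column (conjDiag m k C a) (Φ x) z₀ i := by
  have : LocallyPathConnectedSpace M :=
    ChartedSpace.locallyPathConnectedSpace (EuclideanSpace ℝ (Fin m)) M
  have hfd : MDifferentiable (𝓡 m) 𝓘(ℝ, Idx m k → ℝ) f := hf.smooth.mdifferentiable (by simp)
  obtain ⟨S, V', H', hor⟩ := hf.exists_oriented_frames
  have hloc : ∀ x, ∃ (V : Set (EuclideanSpace ℝ (Fin m)))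
      (G : EuclideanSpace ℝ (Fin m) → loopGroup m k C)
      (F : EuclideanSpace ℝ (Fin m) → ℂ → Matrix (Idx m k) (Idx m k) ℂ),
      V ⊆ V' x ∧ IsFrameAt (target C a) f x (S x) V ∧ IsLoopFrame G (loopForm C a z₀ (S x)) V ∧
      ContDiffOn ℝ ∞ (fun q : EuclideanSpace ℝ (Fin m) × ℂ => F q.1 q.2)
        (V ×ˢ ({0}ᶜ : Set ℂ)) ∧
      (∀ u ∈ V, ∀ z : ℂˣ, ((G u).1 z).1 = F u z) ∧
      G (chartAt (EuclideanSpace ℝ (Fin m)) x x) = 1 ∧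
      ∀ u ∈ V, realFrame a G z₀ u = (liftFrame x (S x) x)⁻¹ * S x u := by
    intro x
    obtain ⟨ε, hε, hball⟩ := Metric.isOpen_iff.1 (H' x).adapted.isOpen _ (H' x).mem
    have h0 := Metric.mem_ball_self (x := chartAt (EuclideanSpace ℝ (Fin m)) x x) hε
    obtain ⟨G, F, h1, h2, h3, h4, h5⟩ := ((H' x).isDeformable hf hz₀ hc hne).exists_isLoopFrame
      Metric.isOpen_ball (convex_ball _ ε) hball h0
    exact ⟨_, G, F, hball, (H' x).mono Metric.isOpen_ball hball h0, h1, h2, h3, h4, h5⟩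
  choose V G F hVV H L hF hGF hG1 hreal using hloc
  have D : ∀ x, IsDeformable C a z₀ (inChart f x) (S x) (V x) := fun x =>
    (H x).isDeformable hf hz₀ hc hne
  set W : M → Set M := fun x => chartDomain x (V x) with hW
  set R : M → M → Matrix (Idx m k) (Idx m k) ℝ := fun x q => liftFrame x (S x) q with hR
  set Γ : M → M → loopGroup m k C := fun x q => G x (chartAt (EuclideanSpace ℝ (Fin m)) x q) with hΓ
  have hWx : ∀ x, x ∈ W x := fun x => mem_chartDomain_self (H x).mem
  have hblock : ∀ x y q, q ∈ W x ∩ W y → IsBlockOrthogonal ((R x q)⁻¹ * R y q) := fun x y q hq =>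
    (H x).isBlockOrthogonal (hfd q) (H y) hq.1 hq.2
  have hk : ∀ x y q, q ∈ W x ∩ W y → ∃ X : loopGroup m k C, X ∈ constLoops m k C ∧
      ∀ z, (X.1 z).1 = ((R x q)⁻¹ * R y q).map (fun x : ℝ => (x : ℂ)) := by
    intro x y q hq
    have h1 := hor x y q ⟨⟨hq.1.1, hVV x hq.1.2⟩, ⟨hq.2.1, hVV y hq.2.2⟩⟩
    exact (hblock x y q hq).exists_constLoop C h1.1 h1.2
  choose! K hKc hKm using hk
  obtain ⟨h, hhloc, hh⟩ := exists_locally_constant_coboundary (Γ := loopGroup m k C) W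
    (fun x => (H x).isOpen) (fun x => x) hWx (fun x y q => Γ x q * K x y q * (Γ y q)⁻¹)
    (fun x y q hq => by
      filter_upwards [eventually_transition_const hfd (H x) (H y) (D x) (D y) (L x) (L y) hq]
        with w hw
      refine Subtype.ext (funext fun z => Subtype.ext ?_)
      have h1 := hw.2 z
      rw [← hKm x y w hw.1 z, ← hKm x y q hq z] at h1
      exact h1)
    (fun x q hq => by
      have h1 : K x x q = 1 := by
        refine Subtype.ext (funext fun z => Subtype.ext ?_)
        rw [hKm x x q ⟨hq, hq⟩, hR, (H x).inv_mul hq, Matrix.map_one _ Complex.ofReal_zero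
          Complex.ofReal_one]
        rfl
      rw [h1, mul_one, mul_inv_cancel])
    (fun x y l q hq => by
      have h1 : K x y q * K y l q = K x l q := by
        refine Subtype.ext (funext fun z => Subtype.ext ?_)
        have h2 : (R x q)⁻¹ * R y q * ((R y q)⁻¹ * R l q) = (R x q)⁻¹ * R l q := by
          rw [Matrix.mul_assoc, ← Matrix.mul_assoc (R y q), hR, (H y).mul_inv hq.1.2,
            Matrix.one_mul]
        change ((K x y q).1 z).1 * ((K y l q).1 z).1 = _
        rw [hKm x y q hq.1, hKm y l q ⟨hq.1.2, hq.2⟩, hKm x l q ⟨hq.1.1, hq.2⟩, ← map_ofReal_mul,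
          h2]
      rw [← h1]
      group)
  -- `h x q * Γ x q` is independent of `x` modulo the constant loops, and its class at `q` can be
  -- computed with the frame around `q` itself, where `Γ q q = 1`
  have hΓ1 : ∀ q, Γ q q = 1 := hG1
  have hrel : ∀ x, ∀ q ∈ W x, h q q = h x q * Γ x q * K x q q := by
    intro x q hq
    have h1 := hh x q q ⟨hq, hWx q⟩
    rw [← h1, hΓ1, inv_one, mul_one, mul_assoc]
  set Λ := (h p p)⁻¹ with hΛ
  set Φ : M → LoopQuot m k C := fun q => QuotientGroup.mk (Λ * h q q) with hΦ
  have hΦx : ∀ x, ∀ q ∈ W x, Φ q = QuotientGroup.mk (Λ * h x q * Γ x q) := by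
    intro x q hq
    refine (QuotientGroup.eq.2 ?_).symm
    rw [hrel x q hq]
    have h1 : (Λ * h x q * Γ x q)⁻¹ * (Λ * (h x q * Γ x q * K x q q)) = K x q q := by group
    rw [h1]
    exact hKc x q q ⟨hq, hWx q⟩
  choose O hO hOo hOx using fun x => eventually_nhds_iff.1 (hhloc x x (hWx x))
  have hUo : ∀ x, IsOpen (O x ∩ W x) := fun x => (hOo x).inter (H x).isOpen
  have hΦU : ∀ x, ∀ q ∈ O x ∩ W x, Φ q = QuotientGroup.mk (Λ * h x x * Γ x q) := by
    intro x q hq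
    rw [hΦx x q hq.2, hO x q hq.1]
  -- the real matrix relating the frame given by the loop group map to the original one; it is
  -- locally constant, hence constant
  set E : M → M → Matrix (Idx m k) (Idx m k) ℝ := fun x q =>
    realForm C a ((Λ * h x q).1 z₀).1 * (R x x)⁻¹ with hE
  have hER : ∀ x, ∀ q ∈ W x, realForm C a ((Λ * h x q * Γ x q).1 z₀).1 = E x q * R x q := by
    intro x q hq
    rw [realForm_mul hz₀, hE, Matrix.mul_assoc]
    congr 1
    exact hreal x _ hq.2
  have hEE : ∀ x, ∀ q ∈ W x, E q q = E x q := by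
    intro x q hq
    have h1 : realForm C a ((Λ * h q q).1 z₀).1 = E x q * R q q := by
      rw [hrel x q hq, ← mul_assoc, ← mul_assoc, realForm_mul hz₀, hER x q hq,
        hKm x q q ⟨hq, hWx q⟩, realForm_map_of_block (hblock x q q ⟨hq, hWx q⟩).block,
        Matrix.mul_assoc, ← Matrix.mul_assoc (R x q), hR, (H x).mul_inv hq, Matrix.one_mul]
    change realForm C a ((Λ * h q q).1 z₀).1 * (R q q)⁻¹ = _
    rw [h1, Matrix.mul_assoc, hR, (H q).mul_inv (hWx q), Matrix.mul_one]
  have hEconst : ∀ q, E q q = E p p := by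
    have h1 : IsLocallyConstant fun q => E q q := by
      rw [IsLocallyConstant.iff_eventually_eq]
      intro x
      filter_upwards [(hUo x).mem_nhds ⟨hOx x, hWx x⟩] with q hq
      rw [hEE x q hq.2]
      simp only [hE, hO x q hq.1]
    exact fun q => h1.apply_eq_of_preconnectedSpace q p
  have hEp : E p p = (R p p)⁻¹ := by
    simp only [hE]
    rw [hΛ, inv_mul_cancel]
    change realForm C a (1 : Matrix (Idx m k) (Idx m k) ℂ) * _ = _
    rw [realForm_one, Matrix.one_mul]
  refine ⟨(R p p)⁻¹, ?_, Φ, ⟨?_, fun x => ?_⟩, fun z hz hz' x => ?_, fun q i => ?_⟩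
  · have h1 := (H p).orth (hWx p)
    have h2 : R p p * (R p p)⁻¹ = 1 := (H p).mul_inv (hWx p)
    calc _ = ((R p p)⁻¹).transpose * ((R p p).transpose *
          Matrix.diagonal ((target C a).signs m k) * R p p) * (R p p)⁻¹ := by
          rw [hR, h1]
      _ = (R p p * (R p p)⁻¹).transpose * Matrix.diagonal ((target C a).signs m k) *
          (R p p * (R p p)⁻¹) := by
          rw [Matrix.transpose_mul]; simp only [Matrix.mul_assoc]
      _ = _ := by rw [h2, Matrix.transpose_one, Matrix.one_mul, Matrix.mul_one]
  · simp only [hΦ]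
    rw [hΛ, inv_mul_cancel]
  · exact ⟨O x ∩ W x, hUo x, ⟨hOx x, hWx x⟩, fun q => Λ * h x x * Γ x q, hΦU x,
      (L x).isExtendedFrameOn (hF x) (hGF x) _ Set.inter_subset_right⟩
  · have h1 : (fun y => column (noConj m k) (Φ y) z) =ᶠ[nhds x]
        fun y (b : Idx m k) => ((Λ * h x x * Γ x y).1 z).1 b (mid m k) := by
      filter_upwards [(hUo x).mem_nhds ⟨hOx x, hWx x⟩] with y hy
      funext b
      rw [hΦU x y hy, column_noConj_mk]
    rw [h1.mfderiv_eq]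
    exact ((L x).const_mul (Λ * h x x)).injective_mfderiv_column (D x) (hWx x) hz hz'
  · have h1 : f q = fun b => R q q b (mid m k) := funext fun b => (H q).mid (hWx q) b
    rw [exists_column_eq_realForm hz₀ (hΦx q q (hWx q)), hER q q (hWx q), hEconst q, hEp, h1]
    rfl

end Gluing

/-- The parameters `±1`, at which the normal weight `λ⁻¹ - λ` vanishes, are those whose curvature
is that of the target. -/
theorem inv_sub_ne_zero_of_curvAt_ne {N : Target} {z : ℂˣ} (h : curvAt N z ≠ N.curv) :
    (z : ℂ)⁻¹ - (z : ℂ) ≠ 0 := by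
  intro h0
  have h4 := sq_sub_sq_weight (z : ℂ) z.ne_zero
  rw [h0, zero_pow two_ne_zero, sub_zero] at h4
  apply h
  rw [curvAt, h4, mul_div_cancel_right₀ _ (by norm_num : (4 : ℂ) ≠ 0), Complex.ofReal_re]

end FerusPedit

end

theorem theorem3p2 (m k : ℕ) (M : Type*) [TopologicalSpace M] [T2Space M]
    [SecondCountableTopology M] [ConnectedSpace M]
    [ChartedSpace (EuclideanSpace ℝ (Fin m)) M] [IsManifold (𝓡 m) ∞ M]
    (p : M) (C : FerusPedit.FPCase) (a : FerusPedit.Axis) :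
    FerusPedit.curvAt (FerusPedit.target C a) '' a.range = FerusPedit.curvRange C a ∧
    (∀ Φ : M → FerusPedit.LoopQuot m k C,
      FerusPedit.IsLoopMap p Φ → FerusPedit.IsImmersive Φ →
      ∀ z ∈ a.range, ∃ f : M → FerusPedit.Idx m k → ℝ,
        (∀ x i, (f x i : ℂ) = FerusPedit.column (FerusPedit.conjDiag m k C a) (Φ x) z i) ∧
        FerusPedit.IsFlatNormalImmersion (FerusPedit.target C a)
          (FerusPedit.curvAt (FerusPedit.target C a) z) f) ∧
    (SimplyConnectedSpace M →
      ∀ (f : M → FerusPedit.Idx m k → ℝ) (c : ℝ),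
        c ∈ FerusPedit.curvRange C a → c ≠ (FerusPedit.target C a).curv →
        FerusPedit.IsFlatNormalImmersion (FerusPedit.target C a) c f →
        ∃ S : Matrix (FerusPedit.Idx m k) (FerusPedit.Idx m k) ℝ,
          S.transpose * Matrix.diagonal ((FerusPedit.target C a).signs m k) * S =
            Matrix.diagonal ((FerusPedit.target C a).signs m k) ∧
          ∃ Φ : M → FerusPedit.LoopQuot m k C,
            FerusPedit.IsLoopMap p Φ ∧ FerusPedit.IsImmersive Φ ∧
            ∃ z ∈ a.range, FerusPedit.curvAt (FerusPedit.target C a) z = c ∧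
              ∀ x i, ((S.mulVec (f x)) i : ℂ) =
                FerusPedit.column (FerusPedit.conjDiag m k C a) (Φ x) z i) := by
  refine ⟨FerusPedit.curvAt_image C a, fun Φ hΦ himm z hz =>
    FerusPedit.isFlatNormalImmersion_of_isLoopMap hΦ himm hz, fun _ f c hc hne hf => ?_⟩
  rw [← FerusPedit.curvAt_image C a] at hc
  obtain ⟨z, hz, hzc⟩ := hc
  obtain ⟨S, hS, Φ, hΦ, himm, hcol⟩ := hf.exists_isLoopMap p hz hzc
    (FerusPedit.inv_sub_ne_zero_of_curvAt_ne (hzc ▸ hne))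
  exact ⟨S, hS, Φ, hΦ, himm, z, hz, hzc, hcol⟩
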